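/- Let $0<\beta_1\le\beta_2\le\beta_3<1$ with $(1-\beta_2)+(1-\beta_3)<1-\beta_1$, and put $\gamma=\beta_2+\beta_3-1\in(\beta_1,1)$. Let $a_2\neq a_3$ be complex numbers with $(1-\beta_2)a_2+(1-\beta_3)a_3=0$, and let $L_1=\{z=0\}$, $L_j=\{w=a_jz\}$ ($j=2,3$) be the corresponding lines in $\mathbf C^2$. Let $$\phi(w)=|w|^{2\gamma}+\frac{\gamma^2}{\pi}\int_{\mathbf C}\left(|t-a_2|^{2\beta_2-2}|t-a_3|^{2\beta_3-2}-|t|^{2\gamma-2}\right)\log|w-t|\;i\,dt\,d\bar t ,$$ where $i\,dt\,d\bar t$ is twice the area measure; this is the potential, asymptotic to $|w|^{2\gamma}$, of the flat metric $\gamma^2|w-a_2|^{2\beta_2-2}|w-a_3|^{2\beta_3-2}\,i\,dw\,d\bar w$. Write $r=|z|^{\beta_1}$, $R=|w|^\gamma$, $\rho^2=r^2+R^2$, fix $\alpha_0\in(1,\gamma/\beta_1)$ and a smooth cutoff function $\chi_1:\mathbf R\to[0,1]$ with $\chi_1(s)=1$ for $s>2$ and $\chi_1(s)=0$ for $s<1$,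 put $\chi_2=1-\chi_1$, and let $$\omega=i\partial\bar\partial\left(|z|^{2\beta_1}+\chi_1(Rr^{-\alpha_0})|w|^{2\gamma}+\chi_2(Rr^{-\alpha_0})|z|^{2\gamma}\phi(w/z)\right).$$ For $0<\beta\le1$ let $\mathbf C_\beta$ be $\mathbf C$ with the line element $\beta|z|^{\beta-1}|dz|$ (a cone of total angle $2\pi\beta$; $\mathbf C_1=\mathbf C$). Let $\mathcal C$ be the set of the six model cones $$\mathbf C^2,\quad \mathbf C_{\beta_1}\times\mathbf C_\gamma,\quad \mathbf C_{\beta_1}\times\mathbf C,\quad \mathbf C_{\beta_2}\times\mathbf C,\quad \mathbf C_{\beta_3}\times\mathbf C,\quad \mathbf C_\gamma\times\mathbf C,$$ each with its product metric and with the origin as its apex. A form $i\sum g_{j\bar k}\,dz_j\,d\bar z_k$ has line element $\left(\sum g_{j\bar k}\,dz_j\,d\bar z_k\right)^{1/2}$. Then there is $t_0>0$ such that $\omega$ is positive definite on $\{\rho<t_0\}\setminus(L_1\cup L_2\cup L_3)$ and the following holds for all $0<s<t\le t_0$. Equip $\{\rho<t\}$ with the distance induced by $\omega$, the infimum of the $\omega$-lengths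 of piecewise $C^1$ paths in $\{\rho<t\}$ that meet the lines at most finitely often, and let $B(p,\cdot)$ denote its balls. For every $\varepsilon>0$ and $0<\lambda<1$ there is $N\in\mathbf N$ such that for every point $p$ with $\rho(p)<s$, and for all integers $k\ge0$ except at most $N$ of them, the rescaled ball $\lambda^{-k}B(p,\lambda^k)$ has Gromov--Hausdorff distance less than $\varepsilon$ to the unit ball centred at the apex of some model cone in $\mathcal C$. -/

import Mathlib

open MeasureTheory Set
open scoped ENNReal ContDiff

noncomputable section

namespace ConicalLines

/-! ### Length distances of singular Hermitian metrics on `ℂ²` -/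

/-- The Levi form of `f : ℂ² → ℝ` at `x`, that is, the Hermitian form `∑ f_{j k̄}(x) v_j v̄_k`
(with `f_{j k̄} = ∂²f / ∂z_j ∂z̄_k`) of the real (1,1)-form `i ∂∂̄ f`. In terms of the real Hessian
it is `¼ (D²f(v, v) + D²f(iv, iv))`. For `f = |z|² + |w|²` it is `|v₁|² + |v₂|²`. -/
def leviForm (f : ℂ × ℂ → ℝ) (x v : ℂ × ℂ) : ℝ :=
  (fderiv ℝ (fun y => fderiv ℝ f y v) x v
    + fderiv ℝ (fun y => fderiv ℝ f y (Complex.I • v)) x (Complex.I • v)) / 4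

/-- `c : [0,1] → U` is a continuous path from `p` to `q` which, away from finitely many times,
stays in the regular set `S` and is continuously differentiable. -/
structure IsAdmissiblePath (U S : Set (ℂ × ℂ)) (p q : ℂ × ℂ) (c : ℝ → ℂ × ℂ) : Prop where
  source : c 0 = p
  target : c 1 = q
  continuousOn : ContinuousOn c (Icc 0 1)
  mapsTo : MapsTo c (Icc 0 1) U
  regular : ∃ T : Set ℝ, T.Finite ∧ MapsTo c (Ioo 0 1 \ T) S ∧ ContDiffOn ℝ 1 c (Ioo 0 1 \ T)

/-- The length of a path on `[0,1]` for the line element `√(h x v)`. -/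
def pathLength (h : ℂ × ℂ → ℂ × ℂ → ℝ) (c : ℝ → ℂ × ℂ) : ℝ≥0∞ :=
  ∫⁻ τ in Icc (0 : ℝ) 1, ENNReal.ofReal (√(h (c τ) (deriv c τ)))

/-- The distance on `U` induced by a Hermitian metric `h` defined on the regular set `S`: the
infimum of the lengths of the paths in `U` that meet the complement of `S` at most finitely often.
It is `⊤` if `p` or `q` is not in `U`. -/
def lengthDist (U S : Set (ℂ × ℂ)) (h : ℂ × ℂ → ℂ × ℂ → ℝ) (p q : ℂ × ℂ) : ℝ≥0∞ :=
  ⨅ (c : ℝ → ℂ × ℂ) (_ : IsAdmissiblePath U S p q c), pathLength h c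

/-! ### Gromov-Hausdorff distance -/

/-- The Gromov-Hausdorff distance of two (not necessarily compact) spaces with distance functions
`dX` and `dY`: the infimum of the Hausdorff distances of their images under distance preserving
maps into a common metric space. -/
def ghEDist {X Y : Type} (dX : X → X → ℝ≥0∞) (dY : Y → Y → ℝ≥0∞) : ℝ≥0∞ :=
  ⨅ (Z : Type) (_ : MetricSpace Z) (f : X → Z) (g : Y → Z)
    (_ : ∀ x x', edist (f x) (f x') = dX x x') (_ : ∀ y y', edist (g y) (g y') = dY y y'),
    Metric.hausdorffEDist (range f) (range g)

/-- The open ball of centre `p` and radius `r` for the distance function `d`. -/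
def ballOf (d : ℂ × ℂ → ℂ × ℂ → ℝ≥0∞) (p : ℂ × ℂ) (r : ℝ) : Set (ℂ × ℂ) :=
  {q | d p q < ENNReal.ofReal r}

/-- The distance function of the rescaled ball `r⁻¹ B(p, r)`. -/
def rescaledBallDist (d : ℂ × ℂ → ℂ × ℂ → ℝ≥0∞) (p : ℂ × ℂ) (r : ℝ)
    (x y : ballOf d p r) : ℝ≥0∞ :=
  ENNReal.ofReal r⁻¹ * d x y

/-! ### Model cones -/

/-- The Hermitian metric of `C_β × C_γ`, where `C_β` is `ℂ` with the line element
`β |z|^(β-1) |dz|`, a cone of total angle `2πβ`. -/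
def coneForm (β γ : ℝ) (x v : ℂ × ℂ) : ℝ :=
  β ^ 2 * ‖x.1‖ ^ (2 * β - 2) * ‖v.1‖ ^ 2 + γ ^ 2 * ‖x.2‖ ^ (2 * γ - 2) * ‖v.2‖ ^ 2

/-- The complement of the conical lines of `C_β × C_γ`; a factor of angle `2π` is the Euclidean
line `ℂ` and has no singular point. -/
def coneRegular (β γ : ℝ) : Set (ℂ × ℂ) :=
  {x | (β ≠ 1 → x.1 ≠ 0) ∧ (γ ≠ 1 → x.2 ≠ 0)}

/-- The distance of `C_β × C_γ`; its apex is the origin. -/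
def coneDist (β γ : ℝ) : ℂ × ℂ → ℂ × ℂ → ℝ≥0∞ :=
  lengthDist univ (coneRegular β γ) (coneForm β γ)

/-- The pairs of angle parameters of the six model cones `ℂ²`, `C_β₁ × C_γ`, `C_β₁ × ℂ`,
`C_β₂ × ℂ`, `C_β₃ × ℂ` and `C_γ × ℂ`. -/
def modelCones (β₁ β₂ β₃ γ : ℝ) : Set (ℝ × ℝ) :=
  {(1, 1), (β₁, γ), (β₁, 1), (β₂, 1), (β₃, 1), (γ, 1)}

/-! ### The metric with conical singularities along three lines -/

/-- The potential on `ℂ` of the flat metric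
`γ² |w - a₂|^(2β₂-2) |w - a₃|^(2β₃-2) i dw dw̄` with two cone points, as the convolution
`φ(w) = |w|^(2γ) + (γ²/π) ∫ (|t-a₂|^(2β₂-2) |t-a₃|^(2β₃-2) - |t|^(2γ-2)) log|w-t| i dt dt̄`.
The measure `i dt dt̄` is twice the area measure `volume`. -/
def flatPotential (β₂ β₃ γ : ℝ) (a₂ a₃ w : ℂ) : ℝ :=
  ‖w‖ ^ (2 * γ) + 2 * γ ^ 2 / Real.pi *
    ∫ t : ℂ, (‖t - a₂‖ ^ (2 * β₂ - 2) * ‖t - a₃‖ ^ (2 * β₃ - 2) - ‖t‖ ^ (2 * γ - 2)) *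
      Real.log ‖w - t‖

/-- The distance `ρ` to the origin in `C_β₁ × C_γ`: `ρ² = r² + R²`, where `r = |z|^β₁` and
`R = |w|^γ`. -/
def rho (β₁ γ : ℝ) (x : ℂ × ℂ) : ℝ :=
  √((‖x.1‖ ^ β₁) ^ 2 + (‖x.2‖ ^ γ) ^ 2)

/-- The neighbourhood `B_t = {ρ < t}` of the origin. -/
def rhoBall (β₁ γ t : ℝ) : Set (ℂ × ℂ) :=
  {x | rho β₁ γ x < t}

/-- The potential
`ψ = |z|^(2β₁) + χ₁(R r^(-α₀)) |w|^(2γ) + χ₂(R r^(-α₀)) |z|^(2γ) φ(w / z)` with `χ₂ = 1 - χ₁`. -/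
def approxPotential (β₁ β₂ β₃ γ α₀ : ℝ) (a₂ a₃ : ℂ) (χ₁ : ℝ → ℝ) (x : ℂ × ℂ) : ℝ :=
  ‖x.1‖ ^ (2 * β₁)
    + χ₁ (‖x.2‖ ^ γ * (‖x.1‖ ^ β₁) ^ (-α₀)) * ‖x.2‖ ^ (2 * γ)
    + (1 - χ₁ (‖x.2‖ ^ γ * (‖x.1‖ ^ β₁) ^ (-α₀))) *
      (‖x.1‖ ^ (2 * γ) * flatPotential β₂ β₃ γ a₂ a₃ (x.2 / x.1))

/-- The complement of the three lines `{z = 0}`, `{w = a₂ z}` and `{w = a₃ z}`. -/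
def linesCompl (a₂ a₃ : ℂ) : Set (ℂ × ℂ) :=
  {x | x.1 ≠ 0 ∧ x.2 ≠ a₂ * x.1 ∧ x.2 ≠ a₃ * x.1}

/-- The Hermitian metric of the (1,1)-form `ω = i ∂∂̄ ψ`. -/
def approxForm (β₁ β₂ β₃ γ α₀ : ℝ) (a₂ a₃ : ℂ) (χ₁ : ℝ → ℝ) : ℂ × ℂ → ℂ × ℂ → ℝ :=
  leviForm (approxPotential β₁ β₂ β₃ γ α₀ a₂ a₃ χ₁)

/-- The distance of `ω` on the neighbourhood `{ρ < t}` of the origin. -/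
def approxDist (β₁ β₂ β₃ γ α₀ : ℝ) (a₂ a₃ : ℂ) (χ₁ : ℝ → ℝ) (t : ℝ) :
    ℂ × ℂ → ℂ × ℂ → ℝ≥0∞ :=
  lengthDist (rhoBall β₁ γ t) (rhoBall β₁ γ t ∩ linesCompl a₂ a₃)
    (approxForm β₁ β₂ β₃ γ α₀ a₂ a₃ χ₁)

end ConicalLines

end

/-!
Why blow-ups of the metric `ω` at every scale but boundedly many look like model cones.

*Characteristic scales.* For a point `p = (z, w)` close to the origin put `u = w / z`. Five numbers
decide how `ω` looks from `p` at scale `h`: the distances `r = |z|^β₁` and `R = |w|^γ` to the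
coordinate lines, the size `|z|^γ` of the fibre structure over `z`, and the distances
`|z|^γ |u - a_j|^β_j` to the two other lines. If `h` is separated from all five by a large factor
`M` (`IsSeparated`), then the rescaled ball is close to a ball in one of the six cones
(`GluingData.exists_radius`). For each of the five numbers only boundedly many powers `λ^k` are not
separated from it (`exists_encard_not_isSeparated_le`), so the number of exceptions does not depend
on `p`.

*The metric.* Two approximations of `ω` are used. Where `|w|` is large compared with `|z|`, the
asymptotics of the potential `φ` show that `ω` is close to the metric of `C_β₁ × C_γ`
(`exists_cone_close`). Where `u` is bounded, `ω` is close to a fibre metric: a multiple of the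
metric of `C_β₁` in the base plus `|z|^(2γ)` times the flat metric with two cone points in `u`
(`exists_fibre_close`, `exists_fibre_close_near`). Both rest on the analysis of `φ` as a logarithmic
potential: the density minus that of the one-point cone is integrable with decay, hence `φ` and its
gradient approach `|w|^(2γ)` and its gradient at infinity, `φ` is `C²` with the right Laplacian off
the two points, and near `a_j` the squared gradient is small compared with the density. No explicit
formula for `φ` is needed.

*From line elements to Gromov-Hausdorff distance.* Suppose that in a chart, on the box
`‖X‖^b₁ < 8`, `‖Y‖^b₂ < 8` of a product of two cones, the pulled back line element is within a
factor `1 ± δ` of `h` times that of the cone, apart from a thin set that can be collapsed along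
short vertical paths onto the graph of a section. Then paths can be transported in both directions
with almost no loss of length, so the chart is almost an isometry between balls, and the rescaled
ball is `40δ`-close to the unit ball of the cone (`ConeChart.ghEDist_le`). The thin set is needed
when a ball of scale `h ≫ |z|^γ` centred near `w = 0` is compared with a ball in a product with a
factor `C_γ`: the lines `w = a_j z` then lie in a sector of negligible size, in which `ω` is not
close to the cone metric.

*The regimes.* Balls with `h` large compared with `|z|^γ`, or far outside the sector
`|w| ≤ M₁|z|`, belong to `exists_isConical_product`. Inside the sector and for `h` small compared
with `|z|^γ`, the coordinate `u` is rescaled instead: near `a_j` one sees `C_β_j × ℂ` or `ℂ²`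
(`exists_isConical_near`), elsewhere `ℂ²` (`exists_isConical_sector`). Away from all lines and from
`z = 0`, compactness and smoothness suffice (`exists_isConical_compact`).
-/

namespace ConicalLines

open ENNReal (add_iInf add_ne_top lt_add_right lt_ofReal_iff_toReal_lt mul_ne_top ofReal ofReal_add
  ofReal_coe_nnreal ofReal_eq_zero ofReal_le_ofReal ofReal_le_ofReal_iff ofReal_lt_ofReal_iff
  ofReal_lt_top ofReal_mul ofReal_ne_top ofReal_one ofReal_sum_of_nonneg ofReal_toReal toReal_add
  toReal_nonneg)
open Real (cos dist_eq div_rpow le_rpow_inv_iff_of_pos le_sqrt_of_sq_le log log_inv mul_rpow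
  norm_eq_abs norm_of_nonneg pi_pos posLog rpow_add rpow_add_one rpow_le_rpow
  rpow_le_rpow_of_exponent_ge rpow_le_rpow_of_nonpos rpow_mul rpow_mul_natCast rpow_natCast rpow_neg
  rpow_neg_one rpow_nonneg rpow_one rpow_two rpow_zero sin sq_sqrt sqrt_le_left sqrt_pos zero_rpow)
open Complex (I I_im I_re I_sq abs_re_le_norm add_re conj_im conj_re continuous_re div_re exp
  exp_mul_I log_re mul_im mul_re normSq_apply normSq_eq_norm_sq norm_I norm_real ofRealCLM
  ofReal_ne_zero ofReal_neg ofReal_re ofReal_zero re reCLM re_ofReal_mul real_smul sq_norm sub_im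
  sub_re)
open Filter (Eventually Tendsto atTop eventually_all eventually_gt_atTop)
open Metric (ball ball_mem_nhds closedBall continuousAt_iff cthickening isClosed_closedBall
  isOpen_ball mem_ball)
open scoped Real

local notation "ℂ²" => ℂ × ℂ
local notation "𝒟" => fderiv ℝ
local notation "𝕀" => Icc (0 : ℝ) 1

/-! ### Paths on intervals and their lengths -/

/-- An admissible path parametrised by an arbitrary interval `[a, b]`. -/
structure IsPathOn (U S : Set ℂ²) (c : ℝ → ℂ²) (a b : ℝ) : Prop where
  continuousOn : ContinuousOn c (Icc a b)
  mapsTo : MapsTo c (Icc a b) U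
  regular : ∃ T : Set ℝ, T.Finite ∧ ∀ τ ∈ Ioo a b \ T, c τ ∈ S ∧ ContDiffAt ℝ 1 c τ

/-- The speed of a path for the line element `√(h x v)`. -/
noncomputable def speed (h : ℂ² → ℂ² → ℝ) (c : ℝ → ℂ²) (τ : ℝ) : ℝ≥0∞ :=
  ofReal (√(h (c τ) (deriv c τ)))

/-- The length of a path over `[a, b]`. -/
noncomputable def arcLength (h : ℂ² → ℂ² → ℝ) (c : ℝ → ℂ²) (a b : ℝ) : ℝ≥0∞ :=
  ∫⁻ τ in Icc a b, speed h c τ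

/-- `h` is homogeneous of degree two under real scalars; this is what makes lengths independent
of the parametrisation. -/
def IsLineElement (h : ℂ² → ℂ² → ℝ) : Prop := ∀ x (k : ℝ) v, h x (k • v) = k ^ 2 * h x v

/-- Sums of `ofReal` in the direction convenient for estimates, with automatic sign conditions. -/
theorem ofReal_add_ofReal {a b : ℝ} (ha : 0 ≤ a := by positivity) (hb : 0 ≤ b := by positivity) :
    ofReal a + ofReal b = ofReal (a + b) := (ofReal_add ha hb).symm

theorem ofReal_mul_ofReal {a b : ℝ} (ha : 0 ≤ a := by positivity) :
    ofReal a * ofReal b = ofReal (a * b) := (ofReal_mul ha).symm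

section
variable {U S : Set ℂ²} {h : ℂ² → ℂ² → ℝ} {c : ℝ → ℂ²} {a b : ℝ}

theorem IsPathOn.mono (hc : IsPathOn U S c a b) {a' b' : ℝ} (ha : a ≤ a') (hb : b' ≤ b) :
    IsPathOn U S c a' b' := by
  obtain ⟨T, hT, hr⟩ := hc.regular
  exact ⟨hc.continuousOn.mono (Icc_subset_Icc ha hb),
    hc.mapsTo.mono_left (Icc_subset_Icc ha hb), T, hT,
    fun τ hτ => hr τ ⟨⟨ha.trans_lt hτ.1.1, hτ.1.2.trans_le hb⟩, hτ.2⟩⟩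

theorem isOpen_Ioo_diff_finite {T : Set ℝ} (hT : T.Finite) : IsOpen (Ioo a b \ T) :=
  isOpen_Ioo.sdiff hT.isClosed

theorem IsAdmissiblePath.isPathOn {p q : ℂ²} (hc : IsAdmissiblePath U S p q c) :
    IsPathOn U S c 0 1 := by
  obtain ⟨T, hT, hS, hC⟩ := hc.regular
  exact ⟨hc.continuousOn, hc.mapsTo, T, hT, fun τ hτ => ⟨hS hτ,
    hC.contDiffAt ((isOpen_Ioo_diff_finite hT).mem_nhds hτ)⟩⟩

theorem IsPathOn.isAdmissiblePath (hc : IsPathOn U S c 0 1) :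
    IsAdmissiblePath U S (c 0) (c 1) c := by
  obtain ⟨T, hT, hr⟩ := hc.regular
  exact ⟨rfl, rfl, hc.continuousOn, hc.mapsTo, T, hT, fun τ hτ => (hr τ hτ).1,
    fun τ hτ => (hr τ hτ).2.contDiffWithinAt⟩

theorem IsPathOn.comp_affine (hc : IsPathOn U S c a b) {x0 k a' b' : ℝ} (hk : k ≠ 0)
    (himg : (fun τ => x0 + k * τ) '' Icc a' b' = Icc a b)
    (himg' : (fun τ => x0 + k * τ) '' Ioo a' b' = Ioo a b) :
    IsPathOn U S (fun τ => c (x0 + k * τ)) a' b' := by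
  obtain ⟨T, hT, hr⟩ := hc.regular
  have hm : MapsTo (fun τ => x0 + k * τ) (Icc a' b') (Icc a b) := himg ▸ mapsTo_image _ _
  have hm' : MapsTo (fun τ => x0 + k * τ) (Ioo a' b') (Ioo a b) := himg' ▸ mapsTo_image _ _
  refine ⟨hc.continuousOn.comp (by fun_prop) hm, hc.mapsTo.comp hm,
    (fun τ => x0 + k * τ) ⁻¹' T, hT.preimage ?_, fun τ hτ => ?_⟩
  · intro x _ y _ hxy
    simpa [hk] using hxy
  · have := hr (x0 + k * τ) ⟨hm' hτ.1, hτ.2⟩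
    refine ⟨this.1, ?_⟩
    exact ContDiffAt.comp (g := c) τ this.2 (by fun_prop)

theorem arcLength_comp_affine (hh : IsLineElement h) {x0 k a' b' : ℝ} (hk : k ≠ 0)
    (himg : (fun τ => x0 + k * τ) '' Icc a' b' = Icc a b) :
    arcLength h (fun τ => c (x0 + k * τ)) a' b' = arcLength h c a b := by
  unfold arcLength
  rw [← himg, lintegral_image_eq_lintegral_abs_deriv_mul (f' := fun _ => k) measurableSet_Icc]
  · refine setLIntegral_congr_fun measurableSet_Icc fun τ _ => ?_
    have hd : deriv (fun τ => c (x0 + k * τ)) τ = k • deriv c (x0 + k * τ) := by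
      rw [deriv_comp_mul_left k (fun y => c (x0 + y)), deriv_comp_const_add]
    simp only [speed]
    rw [hd, hh, ← ofReal_mul (abs_nonneg _), Real.sqrt_mul (sq_nonneg _), Real.sqrt_sq_eq_abs]
  · intro τ _
    simpa using ((hasDerivAt_id τ).const_mul k).const_add x0 |>.hasDerivWithinAt
  · intro x _ y _ hxy
    simpa [hk] using hxy

theorem lengthDist_le_pathLength (hc : IsPathOn U S c 0 1) :
    lengthDist U S h (c 0) (c 1) ≤ arcLength h c 0 1 :=
  iInf₂_le c hc.isAdmissiblePath

theorem image_affine_Icc_aux (hab : a < b) : (fun τ => a + (b - a) * τ) '' Icc 0 1 = Icc a b ∧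
    (fun τ => a + (b - a) * τ) '' Ioo 0 1 = Ioo a b := by
  have e : (fun τ => a + (b - a) * τ) = fun τ => (b - a) * τ + a := by ext; ring
  rw [e, image_affine_Icc' (sub_pos.2 hab), image_affine_Ioo (sub_pos.2 hab)]
  simp

theorem IsPathOn.lengthDist_le (hh : IsLineElement h) (hab : a < b) (hc : IsPathOn U S c a b) :
    lengthDist U S h (c a) (c b) ≤ arcLength h c a b := by
  obtain ⟨i1, i2⟩ := image_affine_Icc_aux hab
  have := lengthDist_le_pathLength (h := h) (hc.comp_affine (sub_pos.2 hab).ne' i1 i2)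
  rw [arcLength_comp_affine hh (sub_pos.2 hab).ne' i1] at this
  simpa using this

theorem exists_path_of_lengthDist_lt {p q : ℂ²} {L : ℝ≥0∞} (hL : lengthDist U S h p q < L) :
    ∃ c, c 0 = p ∧ c 1 = q ∧ IsPathOn U S c 0 1 ∧ arcLength h c 0 1 < L := by
  simp only [lengthDist, iInf_lt_iff] at hL
  obtain ⟨c, hc, hl⟩ := hL
  exact ⟨c, hc.source, hc.target, hc.isPathOn, hl⟩

theorem lengthDist_comm (hh : IsLineElement h) (p q : ℂ²) :
    lengthDist U S h p q = lengthDist U S h q p := by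
  suffices H : ∀ p q, lengthDist U S h p q ≤ lengthDist U S h q p from le_antisymm (H _ _) (H _ _)
  intro p q
  refine le_of_forall_gt fun L hL => ?_
  obtain ⟨c, rfl, rfl, hc, hl⟩ := exists_path_of_lengthDist_lt hL
  have e : (fun τ : ℝ => 1 + (-1) * τ) = fun τ => 1 - τ := by ext; ring
  have i1 : (fun τ : ℝ => 1 + (-1) * τ) '' Icc 0 1 = Icc 0 1 := by rw [e]; simp
  have i2 : (fun τ : ℝ => 1 + (-1) * τ) '' Ioo 0 1 = Ioo 0 1 := by rw [e]; simp
  have := lengthDist_le_pathLength (h := h) (hc.comp_affine (by norm_num) i1 i2)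
  rw [arcLength_comp_affine hh (by norm_num) i1] at this
  simp only [mul_zero, add_zero, mul_one, add_neg_cancel] at this
  exact this.trans_lt hl

theorem speed_congr {c' : ℝ → ℂ²} {τ : ℝ} (hcc : c =ᶠ[nhds τ] c') : speed h c τ = speed h c' τ := by
  simp only [speed, hcc.eq_of_nhds, hcc.deriv_eq]

theorem arcLength_congr {c' : ℝ → ℂ²} (hcc : EqOn c c' (Ioo a b)) :
    arcLength h c a b = arcLength h c' a b := by
  unfold arcLength
  rw [setLIntegral_congr Ioo_ae_eq_Icc.symm, setLIntegral_congr Ioo_ae_eq_Icc.symm]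
  exact setLIntegral_congr_fun measurableSet_Ioo fun τ hτ =>
    speed_congr (hcc.eventuallyEq_of_mem (isOpen_Ioo.mem_nhds hτ))

theorem arcLength_add {m : ℝ} (ham : a ≤ m) (hmb : m ≤ b) :
    arcLength h c a b = arcLength h c a m + arcLength h c m b := by
  unfold arcLength
  rw [← Icc_union_Icc_eq_Icc ham hmb]
  have : Icc a m ∪ Icc m b = Icc a m ∪ Ioc m b := by
    rw [Icc_union_Icc_eq_Icc ham hmb, Icc_union_Ioc_eq_Icc ham hmb]
  rw [this, lintegral_union measurableSet_Ioc, setLIntegral_congr (Ioc_ae_eq_Icc (a := m) (b := b))]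
  exact disjoint_left.2 fun x hx hx' => absurd hx.2 (not_le.2 hx'.1)

theorem arcLength_mono {a' b' : ℝ} (ha : a ≤ a') (hb : b' ≤ b) :
    arcLength h c a' b' ≤ arcLength h c a b :=
  lintegral_mono_set (Icc_subset_Icc ha hb)

theorem lengthDist_triangle (hh : IsLineElement h) (p q s : ℂ²) :
    lengthDist U S h p s ≤ lengthDist U S h p q + lengthDist U S h q s := by
  by_cases h1 : lengthDist U S h p q = ⊤
  · simp [h1]
  by_cases h2 : lengthDist U S h q s = ⊤
  · simp [h2]
  refine ENNReal.le_of_forall_pos_le_add fun ε hε _ => ?_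
  have hε' : ((ε / 2 : NNReal) : ℝ≥0∞) ≠ 0 := by simpa using hε.ne'
  obtain ⟨c1, rfl, hq, hc1, hl1⟩ := exists_path_of_lengthDist_lt (lt_add_right h1 hε')
  obtain ⟨c2, hq', rfl, hc2, hl2⟩ := exists_path_of_lengthDist_lt (lt_add_right h2 hε')
  have i1 : (fun τ : ℝ => -1 + 1 * τ) '' Icc 1 2 = Icc 0 1 := by
    have e : (fun τ : ℝ => -1 + 1 * τ) = fun τ => 1 * τ + -1 := by ext; ring
    rw [e, image_affine_Icc' one_pos]; norm_num
  have i2 : (fun τ : ℝ => -1 + 1 * τ) '' Ioo 1 2 = Ioo 0 1 := by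
    have e : (fun τ : ℝ => -1 + 1 * τ) = fun τ => 1 * τ + -1 := by ext; ring
    rw [e, image_affine_Ioo one_pos]; norm_num
  have hc3 := hc2.comp_affine one_ne_zero i1 i2
  have hl3 := arcLength_comp_affine (c := c2) hh one_ne_zero i1
  set c3 : ℝ → ℂ² := fun τ => c2 (-1 + 1 * τ) with hc3def
  set c : ℝ → ℂ² := fun τ => if τ ≤ 1 then c1 τ else c3 τ with hcdef
  have e1 : EqOn c c1 (Icc 0 1) := fun τ hτ => if_pos hτ.2
  have e3 : EqOn c c3 (Icc 1 2) := by
    intro τ hτ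
    rcases hτ.1.eq_or_lt with rfl | h'
    · simp only [hcdef, hc3def, le_refl, if_true]; norm_num; rw [hq, hq']
    · exact if_neg (not_le.2 h')
  obtain ⟨T1, hT1, hr1⟩ := hc1.regular
  obtain ⟨T3, hT3, hr3⟩ := hc3.regular
  have hc : IsPathOn U S c 0 2 := by
    refine ⟨?_, ?_, T1 ∪ T3 ∪ {1}, (hT1.union hT3).union (finite_singleton _), ?_⟩
    · rw [← Icc_union_Icc_eq_Icc (zero_le_one' ℝ) one_le_two]
      exact (hc1.continuousOn.congr e1).union_of_isClosed (hc3.continuousOn.congr e3)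
        isClosed_Icc isClosed_Icc
    · rw [← Icc_union_Icc_eq_Icc (zero_le_one' ℝ) one_le_two]
      exact (hc1.mapsTo.congr e1.symm).union (hc3.mapsTo.congr e3.symm)
    · rintro τ ⟨⟨h0, h2⟩, hT⟩
      simp only [mem_union, mem_singleton_iff, not_or] at hT
      rcases lt_or_gt_of_ne hT.2 with h | h
      · obtain ⟨i, j⟩ := hr1 τ ⟨⟨h0, h⟩, hT.1.1⟩
        rw [e1 ⟨h0.le, h.le⟩]
        exact ⟨i, j.congr_of_eventuallyEq
          ((e1.mono Ioo_subset_Icc_self).eventuallyEq_of_mem (isOpen_Ioo.mem_nhds ⟨h0, h⟩))⟩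
      · obtain ⟨i, j⟩ := hr3 τ ⟨⟨h, h2⟩, hT.1.2⟩
        rw [e3 ⟨h.le, h2.le⟩]
        exact ⟨i, j.congr_of_eventuallyEq
          ((e3.mono Ioo_subset_Icc_self).eventuallyEq_of_mem (isOpen_Ioo.mem_nhds ⟨h, h2⟩))⟩
  have key := hc.lengthDist_le hh two_pos
  rw [arcLength_add zero_le_one one_le_two, arcLength_congr (e1.mono Ioo_subset_Icc_self),
    arcLength_congr (e3.mono Ioo_subset_Icc_self), hl3] at key
  have k0 : c 0 = c1 0 := e1 (by simp)
  have k2 : c 2 = c2 1 := by rw [e3 (by simp)]; simp only [hc3def]; norm_num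
  rw [k0, k2] at key
  refine key.trans ((add_le_add hl1.le hl2.le).trans (le_of_eq ?_))
  rw [add_add_add_comm, ← ENNReal.coe_add, add_halves]

/-- A function along a path moves by at most the integral of any bound of its speed. -/
theorem enorm_sub_le_lintegral {E : Type*} [NormedAddCommGroup E] [NormedSpace ℝ E]
    [CompleteSpace E] {g g' : ℝ → E} (hab : a ≤ b) (hg : ContinuousOn g (Icc a b)) {T : Set ℝ}
    (hT : T.Finite) (hd : ∀ τ ∈ Ioo a b \ T, HasDerivAt g (g' τ) τ) {l : ℝ → ℝ≥0∞}
    (hl : ∀ τ ∈ Ioo a b \ T, ‖g' τ‖ₑ ≤ l τ) : ‖g b - g a‖ₑ ≤ ∫⁻ τ in Icc a b, l τ := by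
  by_cases hfin : ∫⁻ τ in Icc a b, l τ = ⊤
  · simp [hfin]
  have hae : ∀ᵐ τ ∂(volume.restrict (Ioo a b)), ‖deriv g τ‖ₑ ≤ l τ := by
    have hTn : ∀ᵐ τ ∂(volume.restrict (Ioo a b)), τ ∉ T :=
      ae_restrict_of_ae (hT.countable.ae_notMem _)
    filter_upwards [hTn, ae_restrict_mem measurableSet_Ioo] with τ h1 h2
    rw [(hd τ ⟨h2, h1⟩).deriv]
    exact hl τ ⟨h2, h1⟩
  have hle : ∫⁻ τ in Ioo a b, ‖deriv g τ‖ₑ ≤ ∫⁻ τ in Icc a b, l τ :=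
    (lintegral_mono_ae hae).trans (lintegral_mono_set Ioo_subset_Icc_self)
  have hint : IntegrableOn (deriv g) (Ioo a b) :=
    ⟨(stronglyMeasurable_deriv g).aestronglyMeasurable, hle.trans_lt (lt_top_iff_ne_top.2 hfin)⟩
  have hint' : IntervalIntegrable (deriv g) volume a b := by
    rw [intervalIntegrable_iff_integrableOn_Ioo_of_le hab]; exact hint
  rw [← integral_eq_of_hasDerivAt_off_countable_of_le g (deriv g) hab hT.countable hg
    (fun x hx => (hd x hx).differentiableAt.hasDerivAt) hint',
    intervalIntegral.integral_of_le hab, integral_Ioc_eq_integral_Ioo]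
  exact (enorm_integral_le_lintegral_enorm _).trans hle

/-- Along a path in `ℂ` whose speed for the line element `β |x|^(β-1) |dx|` is bounded by `l`, the
radius `|x|^β` of the cone grows by at most the integral of `l`. -/
theorem ofReal_norm_rpow_le_add {β : ℝ} (hβ : 0 < β) {x x' : ℝ → ℂ} (hab : a ≤ b)
    (hx : ContinuousOn x (Icc a b)) {T : Set ℝ} (hT : T.Finite)
    (hd : ∀ τ ∈ Ioo a b \ T, HasDerivAt x (x' τ) τ) (h0 : ∀ τ ∈ Ioo a b \ T, β ≠ 1 → x τ ≠ 0)
    {l : ℝ → ℝ≥0∞}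
    (hl : ∀ τ ∈ Ioo a b \ T, ofReal (β * ‖x τ‖ ^ (β - 1) * ‖x' τ‖) ≤ l τ) :
    ofReal (‖x b‖ ^ β) ≤ ofReal (‖x a‖ ^ β) + ∫⁻ τ in Icc a b, l τ := by
  by_cases hβ1 : β = 1
  · subst hβ1
    have := enorm_sub_le_lintegral hab hx hT hd (l := l) (fun τ hτ => by
      have := hl τ hτ
      simp only [sub_self, rpow_zero, one_mul] at this
      rwa [ofReal_norm] at this)
    simp only [rpow_one, ofReal_norm]
    calc ‖x b‖ₑ = ‖x a + (x b - x a)‖ₑ := by congr 1; ring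
      _ ≤ ‖x a‖ₑ + ‖x b - x a‖ₑ := enorm_add_le _ _
      _ ≤ _ := by gcongr
  · have hcont : ContinuousOn (fun τ => ‖x τ‖ ^ β) (Icc a b) :=
      hx.norm.rpow_const fun _ _ => Or.inr hβ.le
    have hder : ∀ τ ∈ Ioo a b \ T, HasDerivAt (fun τ => ‖x τ‖ ^ β)
        ((2 * inner ℝ (x τ) (x' τ)) * (β / 2) * (‖x τ‖ ^ 2) ^ (β / 2 - 1)) τ := by
      intro τ hτ
      have h1 := (hd τ hτ).norm_sq
      have h2 := h1.rpow_const (p := β / 2) (Or.inl (by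
        have := h0 τ hτ hβ1; positivity))
      refine h2.congr_of_eventuallyEq (.of_forall fun s => ?_)
      change ‖x s‖ ^ β = (‖x s‖ ^ 2) ^ (β / 2)
      rw [← rpow_natCast, ← rpow_mul (norm_nonneg _)]
      congr 1; push_cast; ring
    have := enorm_sub_le_lintegral hab hcont hT hder (l := l) (fun τ hτ => by
      refine le_trans ?_ (hl τ hτ)
      have hp : 0 < ‖x τ‖ := norm_pos_iff.2 (h0 τ hτ hβ1)
      rw [← ofReal_norm]
      apply ofReal_le_ofReal
      rw [norm_mul, norm_mul, norm_mul, norm_of_nonneg (by positivity : (0:ℝ) ≤ 2),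
        norm_of_nonneg (by positivity : 0 ≤ β / 2),
        norm_of_nonneg (by positivity : 0 ≤ (‖x τ‖ ^ 2) ^ (β / 2 - 1))]
      have e : (‖x τ‖ ^ 2) ^ (β / 2 - 1) * ‖x τ‖ = ‖x τ‖ ^ (β - 1) := by
        rw [← rpow_natCast, ← rpow_mul hp.le, ← rpow_add_one hp.ne']
        congr 1; push_cast; ring
      have hi : ‖inner ℝ (x τ) (x' τ)‖ ≤ ‖x τ‖ * ‖x' τ‖ := norm_inner_le_norm _ _
      calc 2 * ‖inner ℝ (x τ) (x' τ)‖ * (β / 2) * (‖x τ‖ ^ 2) ^ (β / 2 - 1)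
          ≤ 2 * (‖x τ‖ * ‖x' τ‖) * (β / 2) * (‖x τ‖ ^ 2) ^ (β / 2 - 1) := by gcongr
        _ = β * ((‖x τ‖ ^ 2) ^ (β / 2 - 1) * ‖x τ‖) * ‖x' τ‖ := by ring
        _ = _ := by rw [e])
    have e1 : ‖x b‖ ^ β ≤ ‖x a‖ ^ β + ‖‖x b‖ ^ β - ‖x a‖ ^ β‖ := by
      have := Real.le_norm_self (‖x b‖ ^ β - ‖x a‖ ^ β); linarith
    refine (ofReal_le_ofReal e1).trans ?_
    rw [ofReal_add (by positivity) (by positivity), ofReal_norm]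
    gcongr

theorem continuousOn_arcLength (hfin : arcLength h c a b ≠ ⊤) :
    ContinuousOn (fun τ => (arcLength h c a τ).toReal) (Icc a b) := by
  have hne : ∀ x y, a ≤ x → y ≤ b → arcLength h c x y ≠ ⊤ := fun x y hx hy =>
    ((arcLength_mono hx hy).trans_lt (lt_top_iff_ne_top.2 hfin)).ne
  rw [Metric.continuousOn_iff]
  intro x hx ε hε
  obtain ⟨δ, hδ, H⟩ := exists_pos_setLIntegral_lt_of_measure_lt
    (μ := volume.restrict (Icc a b)) (f := speed h c) hfin (ε := ofReal ε)
    (by simpa using hε)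
  have key : ∀ u v, a ≤ u → u ≤ v → v ≤ b → ofReal (v - u) < δ →
      dist (arcLength h c a u).toReal (arcLength h c a v).toReal < ε := by
    intro u v hu huv hv hd
    rw [arcLength_add hu huv, toReal_add (hne _ _ le_rfl (huv.trans hv)) (hne _ _ hu hv),
      dist_eq, sub_add_cancel_left, abs_neg, abs_of_nonneg toReal_nonneg]
    have := H (Icc u v) (by
      rw [Measure.restrict_apply measurableSet_Icc]
      refine (measure_mono inter_subset_left).trans_lt ?_
      rwa [Real.volume_Icc])
    rw [Measure.restrict_restrict measurableSet_Icc,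
      inter_eq_self_of_subset_left (Icc_subset_Icc hu hv)] at this
    exact (lt_ofReal_iff_toReal_lt (hne _ _ hu hv)).1 this
  obtain ⟨δ', hδ', hδδ⟩ : ∃ δ' : ℝ, 0 < δ' ∧ ofReal δ' ≤ δ := by
    rcases eq_or_ne δ ⊤ with rfl | h
    · exact ⟨1, one_pos, le_top⟩
    · exact ⟨δ.toReal, ENNReal.toReal_pos hδ.ne' h, by rw [ofReal_toReal h]⟩
  refine ⟨δ', hδ', fun y hy hyx => ?_⟩
  rw [dist_eq, abs_lt] at hyx
  rcases le_total y x with h | h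
  · exact key y x hy.1 h hx.2 (((ofReal_lt_ofReal_iff hδ').2 (by linarith)).trans_le hδδ)
  · rw [dist_comm]
    exact key x y hx.1 h hy.2 (((ofReal_lt_ofReal_iff hδ').2 (by linarith)).trans_le hδδ)

/-- A point at distance less than `m + n` can be reached through a point at distance less than
`m` from the first and less than `n` from the second. -/
theorem exists_intermediate (hh : IsLineElement h) {p q : ℂ²} {m n : ℝ} (hm : 0 < m)
    (hn : 0 < n) (hpq : lengthDist U S h p q < ofReal (m + n)) :
    ∃ y, lengthDist U S h p y < ofReal m ∧ lengthDist U S h y q < ofReal n := by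
  obtain ⟨c, rfl, rfl, hc, hl⟩ := exists_path_of_lengthDist_lt hpq
  have hfin : arcLength h c 0 1 ≠ ⊤ := (hl.trans_le le_top).ne
  set L := (arcLength h c 0 1).toReal with hL
  have hL0 : 0 ≤ L := toReal_nonneg
  have hLmn : L < m + n := (lt_ofReal_iff_toReal_lt hfin).1 hl
  have hne : ∀ x y, 0 ≤ x → y ≤ 1 → arcLength h c x y ≠ ⊤ := fun x y hx hy =>
    ((arcLength_mono hx hy).trans_lt (lt_top_iff_ne_top.2 hfin)).ne
  have hA0 : (arcLength h c 0 0).toReal = 0 := by simp [arcLength]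
  obtain ⟨τ, ⟨h0, h1⟩, hτ⟩ : ∃ τ ∈ Ioo (0 : ℝ) 1,
      (arcLength h c 0 τ).toReal = L * (m / (m + n)) := by
    rcases hL0.eq_or_lt with h | h
    · refine ⟨1 / 2, by norm_num, ?_⟩
      have := ENNReal.toReal_mono hfin
        (arcLength_mono (c := c) (le_refl (0 : ℝ)) (by norm_num : (1 / 2 : ℝ) ≤ 1))
      rw [← h, zero_mul]
      exact le_antisymm (by linarith) toReal_nonneg
    · have hlt : m / (m + n) < 1 := by rw [div_lt_one (by positivity)]; linarith
      have := intermediate_value_Ioo (zero_le_one' ℝ) (continuousOn_arcLength hfin)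
      rw [hA0] at this
      obtain ⟨τ, h1, h2⟩ := this ⟨(by positivity : 0 < L * (m / (m + n))), by rw [← hL]; nlinarith⟩
      exact ⟨τ, h1, h2⟩
  have hsum : L = (arcLength h c 0 τ).toReal + (arcLength h c τ 1).toReal := by
    rw [hL, arcLength_add h0.le h1.le, toReal_add (hne _ _ le_rfl h1.le) (hne _ _ h0.le le_rfl)]
  refine ⟨c τ, ?_, ?_⟩
  · refine ((hc.mono le_rfl h1.le).lengthDist_le hh h0).trans_lt ?_
    rw [lt_ofReal_iff_toReal_lt (hne _ _ le_rfl h1.le), hτ, ← mul_div_assoc,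
      div_lt_iff₀ (by positivity)]
    nlinarith
  · refine ((hc.mono h0.le le_rfl).lengthDist_le hh h1).trans_lt ?_
    rw [lt_ofReal_iff_toReal_lt (hne _ _ h0.le le_rfl)]
    have : (arcLength h c τ 1).toReal = L * n / (m + n) := by
      rw [hτ] at hsum
      have : (arcLength h c τ 1).toReal = L - L * (m / (m + n)) := by linarith
      rw [this]; field_simp; ring
    rw [this, div_lt_iff₀ (by positivity)]
    nlinarith

theorem lengthDist_self (hh : IsLineElement h) {p q : ℂ²} (hpq : lengthDist U S h p q ≠ ⊤) :
    lengthDist U S h q q = 0 := by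
  refine le_antisymm (ENNReal.le_of_forall_pos_le_add fun ε hε _ => ?_) zero_le
  have hε2 : 0 < (ε : ℝ) / 2 := by positivity
  obtain ⟨y, -, hy⟩ := exists_intermediate hh (p := p) (q := q)
    (m := (lengthDist U S h p q).toReal + 1) (n := ε / 2) (by positivity) hε2 (by
      rw [lt_ofReal_iff_toReal_lt hpq]; linarith)
  refine (lengthDist_triangle hh q y q).trans ?_
  rw [lengthDist_comm hh q y]
  refine (add_le_add hy.le hy.le).trans ?_
  rw [← ofReal_add hε2.le hε2.le, add_halves, ofReal_coe_nnreal, zero_add]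

/-- If the line element dominates a multiple of the Euclidean one, then so does the distance. -/
theorem enorm_sub_le_lengthDist {k : ℝ} (hk : 0 < k)
    (hlow : ∀ x ∈ S, ∀ v, k ^ 2 * ‖v‖ ^ 2 ≤ h x v) (p q : ℂ²) :
    ofReal k * ‖q - p‖ₑ ≤ lengthDist U S h p q := by
  refine le_of_forall_gt fun L hL => ?_
  obtain ⟨c, rfl, rfl, hc, hl⟩ := exists_path_of_lengthDist_lt hL
  obtain ⟨T, hT, hr⟩ := hc.regular
  refine lt_of_le_of_lt ?_ hl
  have := enorm_sub_le_lintegral (l := fun τ => ofReal k⁻¹ * speed h c τ) zero_le_one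
    hc.continuousOn hT (fun τ hτ => ((hr τ hτ).2.differentiableAt (by norm_num)).hasDerivAt)
    (fun τ hτ => by
      rw [speed, ofReal_mul_ofReal, ← ofReal_norm]
      apply ofReal_le_ofReal
      rw [inv_mul_eq_div, le_div_iff₀ hk]
      apply le_sqrt_of_sq_le
      have := hlow _ (hr τ hτ).1 (deriv c τ)
      nlinarith)
  rw [lintegral_const_mul' _ _ ofReal_ne_top] at this
  calc ofReal k * ‖c 1 - c 0‖ₑ
      ≤ ofReal k * (ofReal k⁻¹ * arcLength h c 0 1) := by gcongr; exact this
    _ = _ := by rw [← mul_assoc, ← ofReal_mul hk.le, mul_inv_cancel₀ hk.ne', ofReal_one, one_mul]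
end

/-! ### Gromov-Hausdorff distance and correspondences -/

/-- A distance function with values in `ℝ≥0∞` that comes from a metric. -/
structure IsMetric {X : Type} (d : X → X → ℝ≥0∞) : Prop where
  ne_top : ∀ x y, d x y ≠ ⊤
  self : ∀ x, d x x = 0
  comm : ∀ x y, d x y = d y x
  triangle : ∀ x y z, d x z ≤ d x y + d y z
  eq_of_zero : ∀ x y, d x y = 0 → x = y

/-- The metric space of a distance function that comes from a metric. -/
@[reducible] noncomputable def IsMetric.metricSpace {X : Type} {d : X → X → ℝ≥0∞} (h : IsMetric d) :
    MetricSpace X :=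
  letI : EMetricSpace X :=
    { edist := d
      edist_self := h.self
      edist_comm := h.comm
      edist_triangle := h.triangle
      eq_of_edist_eq_zero := fun {x y} => h.eq_of_zero x y }
  EMetricSpace.toMetricSpace h.ne_top

theorem IsMetric.edist_eq {X : Type} {d : X → X → ℝ≥0∞} (h : IsMetric d) (x y : X) :
    (letI := h.metricSpace; edist x y) = d x y := rfl

/-- A correspondence between two metric spaces whose distortion is at most `2δ` bounds their
Gromov-Hausdorff distance by `δ`: glue the spaces along the correspondence. -/
theorem ghEDist_le_of_correspondence {X Y : Type} {dX : X → X → ℝ≥0∞} {dY : Y → Y → ℝ≥0∞}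
    (hX : IsMetric dX) (hY : IsMetric dY) [Nonempty X] {δ : ℝ} (hδ : 0 < δ) (R : X → Y → Prop)
    (hRX : ∀ x, ∃ y, R x y) (hRY : ∀ y, ∃ x, R x y)
    (h1 : ∀ x y x' y', R x y → R x' y' → dX x x' ≤ dY y y' + ofReal (2 * δ))
    (h2 : ∀ x y x' y', R x y → R x' y' → dY y y' ≤ dX x x' + ofReal (2 * δ)) :
    ghEDist dX dY ≤ ofReal δ := by
  let _ := hX.metricSpace
  let _ := hY.metricSpace
  let Z := {z : X × Y // R z.1 z.2}
  have : Nonempty Z := by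
    obtain ⟨x⟩ := ‹Nonempty X›
    obtain ⟨y, hy⟩ := hRX x
    exact ⟨⟨(x, y), hy⟩⟩
  have H : ∀ p q : Z, |dist p.1.1 q.1.1 - dist p.1.2 q.1.2| ≤ 2 * δ := by
    intro p q
    have e1 := h1 _ _ _ _ p.2 q.2
    have e2 := h2 _ _ _ _ p.2 q.2
    rw [← hX.edist_eq, ← hY.edist_eq, edist_dist, edist_dist,
      ← ofReal_add dist_nonneg (by positivity),
      ofReal_le_ofReal_iff (by positivity)] at e1 e2
    rw [abs_le]; constructor <;> linarith
  let mZ : MetricSpace (X ⊕ Y) :=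
    Metric.glueMetricApprox (fun z : Z => z.1.1) (fun z : Z => z.1.2) δ hδ H
  refine iInf_le_of_le (X ⊕ Y) (iInf_le_of_le mZ (iInf_le_of_le Sum.inl (iInf_le_of_le Sum.inr
    (iInf_le_of_le ?_ (iInf_le_of_le ?_ ?_)))))
  · intro x x'
    rw [← hX.edist_eq, edist_dist, edist_dist]; rfl
  · intro y y'
    rw [← hY.edist_eq, edist_dist, edist_dist]; rfl
  · have hg : ∀ z : Z, edist (Sum.inl z.1.1 : X ⊕ Y) (Sum.inr z.1.2) = ofReal δ := by
      intro z
      rw [edist_dist]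
      congr 1
      exact Metric.glueDist_glued_points (fun z : Z => z.1.1) (fun z : Z => z.1.2) δ z
    refine Metric.hausdorffEDist_le_of_mem_edist ?_ ?_
    · rintro _ ⟨x, rfl⟩
      obtain ⟨y, hy⟩ := hRX x
      exact ⟨_, ⟨y, rfl⟩, (hg ⟨(x, y), hy⟩).le⟩
    · rintro _ ⟨y, rfl⟩
      obtain ⟨x, hx⟩ := hRY y
      exact ⟨_, ⟨x, rfl⟩, by rw [edist_comm]; exact (hg ⟨(x, y), hx⟩).le⟩

/-! ### The model cones -/

theorem isLineElement_coneForm (β γ : ℝ) : IsLineElement (coneForm β γ) := by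
  intro x k v
  simp only [coneForm, Prod.smul_fst, Prod.smul_snd, norm_smul, norm_eq_abs, mul_pow, sq_abs]
  ring

theorem norm_rpow_two_mul_sub_two (y : ℂ) (β : ℝ) : ‖y‖ ^ (2 * β - 2) = (‖y‖ ^ (β - 1)) ^ 2 := by
  rw [← rpow_mul_natCast (norm_nonneg _)]; congr 1; push_cast; ring

theorem coneForm_eq (β γ : ℝ) (x v : ℂ²) : coneForm β γ x v =
    (β * ‖x.1‖ ^ (β - 1) * ‖v.1‖) ^ 2 + (γ * ‖x.2‖ ^ (γ - 1) * ‖v.2‖) ^ 2 := by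
  rw [coneForm, norm_rpow_two_mul_sub_two, norm_rpow_two_mul_sub_two]; ring

theorem fst_le_sqrt_coneForm {β γ : ℝ} (x v : ℂ²) :
    β * ‖x.1‖ ^ (β - 1) * ‖v.1‖ ≤ √(coneForm β γ x v) := by
  apply le_sqrt_of_sq_le
  rw [coneForm_eq]
  nlinarith [sq_nonneg (γ * ‖x.2‖ ^ (γ - 1) * ‖v.2‖)]

theorem snd_le_sqrt_coneForm {β γ : ℝ} (x v : ℂ²) :
    γ * ‖x.2‖ ^ (γ - 1) * ‖v.2‖ ≤ √(coneForm β γ x v) := by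
  apply le_sqrt_of_sq_le
  rw [coneForm_eq]
  nlinarith [sq_nonneg (β * ‖x.1‖ ^ (β - 1) * ‖v.1‖)]

theorem sqrt_coneForm_le {β γ : ℝ} (hβ : 0 ≤ β) (hγ : 0 ≤ γ) (x v : ℂ²) :
    √(coneForm β γ x v) ≤ β * ‖x.1‖ ^ (β - 1) * ‖v.1‖ + γ * ‖x.2‖ ^ (γ - 1) * ‖v.2‖ := by
  have h1 : 0 ≤ β * ‖x.1‖ ^ (β - 1) * ‖v.1‖ := by positivity
  have h2 : 0 ≤ γ * ‖x.2‖ ^ (γ - 1) * ‖v.2‖ := by positivity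
  rw [coneForm_eq, sqrt_le_left (by positivity)]
  nlinarith

/-- The integral of `|x|^(β-1)` over any interval of length one is bounded. -/
theorem lintegral_abs_rpow_le {β : ℝ} (hβ : 0 < β) (hβ1 : β ≤ 1) (α : ℝ) :
    ∫⁻ τ in 𝕀, ofReal (|α + τ| ^ (β - 1)) ≤ ofReal (3 / β) := by
  set F : ℝ → ℝ≥0∞ := indicator (Ioc 0 1) fun s => ofReal (s ^ (β - 1)) with hF
  have hFm : Measurable F := by
    apply Measurable.indicator _ measurableSet_Ioc
    fun_prop
  have hFi : ∫⁻ s, F s = ofReal (1 / β) := by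
    rw [hF, lintegral_indicator measurableSet_Ioc, ← ofReal_integral_eq_lintegral_ofReal]
    · rw [← intervalIntegral.integral_of_le zero_le_one, integral_rpow (Or.inl (by linarith))]
      congr 1
      simp [hβ.ne']
    · exact ((intervalIntegral.intervalIntegrable_rpow' (by linarith)).1)
    · filter_upwards [ae_restrict_mem measurableSet_Ioc] with s hs
      exact rpow_nonneg hs.1.le _
  have hpt : ∀ s : ℝ, s ≠ 0 → ofReal (|s| ^ (β - 1)) ≤ 1 + (F s + F (-s)) := by
    intro s hs
    rcases le_or_gt |s| 1 with h | h
    · refine le_trans ?_ le_add_self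
      rcases lt_or_gt_of_ne hs with h' | h'
      · refine le_trans ?_ le_add_self
        rw [abs_of_neg h'] at h ⊢
        rw [hF, indicator_of_mem (by constructor <;> linarith)]
      · refine le_trans ?_ le_self_add
        rw [abs_of_pos h'] at h ⊢
        rw [hF, indicator_of_mem (by constructor <;> linarith)]
    · refine le_trans ?_ le_self_add
      rw [← ofReal_one]
      exact ofReal_le_ofReal (Real.rpow_le_one_of_one_le_of_nonpos h.le (by linarith))
  calc ∫⁻ τ in 𝕀, ofReal (|α + τ| ^ (β - 1)) ≤ ∫⁻ τ in 𝕀, (1 + (F (α + τ) + F (-(α + τ)))) := by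
        apply lintegral_mono_ae
        have : ∀ᵐ τ : ℝ, τ ∉ ({-α} : Set ℝ) := (finite_singleton _).countable.ae_notMem _
        filter_upwards [ae_restrict_of_ae this] with τ hτ
        exact hpt _ fun h => hτ (by simp only [mem_singleton_iff]; linarith)
    _ = 1 + ((∫⁻ τ in 𝕀, F (α + τ)) + ∫⁻ τ in 𝕀, F (-(α + τ))) := by
        rw [lintegral_add_left measurable_const, lintegral_add_left (by fun_prop)]
        simp
    _ ≤ 1 + ((∫⁻ τ, F (α + τ)) + ∫⁻ τ, F (-(α + τ))) := by gcongr <;> exact Measure.restrict_le_self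
    _ = 1 + (ofReal (1 / β) + ofReal (1 / β)) := by
        rw [lintegral_add_left_eq_self F α, lintegral_add_left_eq_self (fun s => F (-s)) α,
          lintegral_neg_eq_self, hFi]
    _ ≤ ofReal (3 / β) := by
        rw [← ofReal_one, ofReal_add_ofReal, ofReal_add_ofReal]
        apply ofReal_le_ofReal
        have : 1 ≤ 1 / β := by rw [le_div_iff₀ hβ]; linarith
        calc 1 + (1 / β + 1 / β) ≤ 1 / β + (1 / β + 1 / β) := by gcongr
          _ = 3 / β := by ring

/-- The length of a segment for the line element `|x|^(β-1) |dx|`. -/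
theorem lintegral_segment_le {β : ℝ} (hβ : 0 < β) (hβ1 : β ≤ 1) (a v : ℂ) :
    ∫⁻ τ in 𝕀, ofReal (‖a + τ * v‖ ^ (β - 1) * ‖v‖) ≤ ofReal (3 / β * ‖v‖ ^ β) := by
  rcases eq_or_ne v 0 with rfl | hv
  · simp
  have hv' : 0 < ‖v‖ := norm_pos_iff.2 hv
  set α := (a / v).re
  calc ∫⁻ τ in 𝕀, ofReal (‖a + τ * v‖ ^ (β - 1) * ‖v‖)
      ≤ ∫⁻ τ in 𝕀, ofReal (‖v‖ ^ β) * ofReal (|α + τ| ^ (β - 1)) := by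
        apply lintegral_mono_ae
        have : ∀ᵐ τ : ℝ, τ ∉ ({-α} : Set ℝ) := (finite_singleton _).countable.ae_notMem _
        filter_upwards [ae_restrict_of_ae this] with τ hτ
        rw [ofReal_mul_ofReal]
        apply ofReal_le_ofReal
        have hpos : 0 < |α + τ| := abs_pos.2 fun h => hτ (by
          simp only [mem_singleton_iff]; linarith)
        have hle : ‖v‖ * |α + τ| ≤ ‖a + τ * v‖ := by
          have e : a + τ * v = v * (a / v + τ) := by field_simp
          rw [e, norm_mul]
          gcongr
          simpa using abs_re_le_norm (a / v + τ)
        calc ‖a + τ * v‖ ^ (β - 1) * ‖v‖ ≤ (‖v‖ * |α + τ|) ^ (β - 1) * ‖v‖ := by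
              gcongr ?_ * _
              exact rpow_le_rpow_of_nonpos (by positivity) hle (by linarith)
          _ = (‖v‖ ^ (β - 1) * ‖v‖) * |α + τ| ^ (β - 1) := by rw [mul_rpow hv'.le hpos.le]; ring
          _ = _ := by rw [← rpow_add_one hv'.ne', sub_add_cancel]
    _ = ofReal (‖v‖ ^ β) * ∫⁻ τ in 𝕀, ofReal (|α + τ| ^ (β - 1)) :=
        lintegral_const_mul' _ _ ofReal_ne_top
    _ ≤ ofReal (‖v‖ ^ β) * ofReal (3 / β) := by gcongr; exact lintegral_abs_rpow_le hβ hβ1 α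
    _ = _ := by rw [ofReal_mul_ofReal, mul_comm]

theorem finite_zeros_of_segment {a b : ℂ} (hab : a ≠ 0 ∨ b ≠ 0) :
    {τ : ℝ | a + τ * (b - a) = 0}.Finite := by
  apply Set.Subsingleton.finite
  intro τ hτ σ hσ
  simp only [mem_ofPred_eq] at hτ hσ
  have h : ((τ : ℂ) - σ) * (b - a) = 0 := by linear_combination hτ - hσ
  rcases mul_eq_zero.1 h with h | h
  · exact_mod_cast sub_eq_zero.1 h
  · rw [h] at hτ
    rw [sub_eq_zero] at h
    simp only [mul_zero, add_zero] at hτ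
    rw [h, hτ] at hab
    simp at hab

theorem hasDerivAt_segment (a v : ℂ²) (τ : ℝ) :
    HasDerivAt (fun τ : ℝ => (a.1 + (τ : ℂ) * v.1, a.2 + (τ : ℂ) * v.2)) v τ := by
  have h : ∀ a v : ℂ, HasDerivAt (fun τ : ℝ => a + (τ : ℂ) * v) v τ := fun a v => by
    simpa using ((hasDerivAt_id τ).ofReal_comp.mul_const v).const_add a
  exact (h _ _).prodMk (h _ _)

theorem contDiff_segment (a v : ℂ²) :
    ContDiff ℝ 1 (fun τ : ℝ => (a.1 + (τ : ℂ) * v.1, a.2 + (τ : ℂ) * v.2)) := by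
  have : ContDiff ℝ 1 (fun τ : ℝ => (τ : ℂ)) := ofRealCLM.contDiff
  fun_prop

theorem coneDist_le_of_regular {β γ : ℝ} (hβ : 0 < β) (hβ1 : β ≤ 1) (hγ : 0 < γ)
    (hγ1 : γ ≤ 1) {X Y : ℂ²} (h1 : β ≠ 1 → X.1 ≠ 0 ∨ Y.1 ≠ 0)
    (h2 : γ ≠ 1 → X.2 ≠ 0 ∨ Y.2 ≠ 0) :
    coneDist β γ X Y ≤ ofReal (3 * ‖Y.1 - X.1‖ ^ β + 3 * ‖Y.2 - X.2‖ ^ γ) := by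
  set c : ℝ → ℂ² := fun τ => (X.1 + τ * (Y - X).1, X.2 + τ * (Y - X).2)
  have hc : IsPathOn univ (coneRegular β γ) c 0 1 := by
    refine ⟨(contDiff_segment X (Y - X)).continuous.continuousOn, mapsTo_univ _ _,
      {τ | β ≠ 1 ∧ X.1 + τ * (Y.1 - X.1) = 0} ∪ {τ | γ ≠ 1 ∧ X.2 + τ * (Y.2 - X.2) = 0},
      Finite.union ?_ ?_, fun τ hτ => ⟨?_, (contDiff_segment X (Y - X)).contDiffAt⟩⟩
    · by_cases h : β ≠ 1
      · exact (finite_zeros_of_segment (h1 h)).subset fun τ hτ => hτ.2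
      · simp [h]
    · by_cases h : γ ≠ 1
      · exact (finite_zeros_of_segment (h2 h)).subset fun τ hτ => hτ.2
      · simp [h]
    · have := hτ.2
      simp only [mem_union, mem_ofPred_eq, not_or, not_and] at this
      exact this
  have := hc.lengthDist_le (isLineElement_coneForm β γ) one_pos
  have e0 : c 0 = X := by simp [c]
  have e1 : c 1 = Y := by simp [c]
  rw [e0, e1] at this
  refine this.trans ?_
  calc arcLength (coneForm β γ) c 0 1 ≤ ∫⁻ τ in 𝕀,
        (ofReal β * ofReal (‖X.1 + τ * (Y - X).1‖ ^ (β - 1) * ‖(Y - X).1‖)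
        + ofReal γ * ofReal (‖X.2 + τ * (Y - X).2‖ ^ (γ - 1) * ‖(Y - X).2‖)) := by
        apply lintegral_mono
        intro τ
        have hd : deriv c τ = Y - X := (hasDerivAt_segment X (Y - X) τ).deriv
        simp only [speed, hd]
        rw [← ofReal_mul hβ.le, ← ofReal_mul hγ.le, ofReal_add_ofReal]
        apply ofReal_le_ofReal
        have := sqrt_coneForm_le hβ.le hγ.le (c τ) (Y - X)
        simpa [c, mul_assoc] using this
    _ ≤ ofReal β * ofReal (3 / β * ‖(Y - X).1‖ ^ β)
        + ofReal γ * ofReal (3 / γ * ‖(Y - X).2‖ ^ γ) := by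
        rw [lintegral_add_left (by fun_prop), lintegral_const_mul' _ _ ofReal_ne_top,
          lintegral_const_mul' _ _ ofReal_ne_top]
        gcongr
        · exact lintegral_segment_le hβ hβ1 _ _
        · exact lintegral_segment_le hγ hγ1 _ _
    _ = _ := by
        rw [← ofReal_mul hβ.le, ← ofReal_mul hγ.le, ofReal_add_ofReal]
        congr 1
        simp only [Prod.fst_sub, Prod.snd_sub]
        field_simp

theorem coneDist_le {β γ : ℝ} (hβ : 0 < β) (hβ1 : β ≤ 1) (hγ : 0 < γ) (hγ1 : γ ≤ 1) (X Y : ℂ²) :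
    coneDist β γ X Y ≤ ofReal (3 * ‖Y.1 - X.1‖ ^ β + 3 * ‖Y.2 - X.2‖ ^ γ) := by
  refine ENNReal.le_of_forall_pos_le_add fun ε hε _ => ?_
  have hε' : (0 : ℝ) < ε := hε
  have ht : Tendsto (fun η : ℝ => 6 * η ^ β + 6 * η ^ γ) (nhdsWithin 0 (Ioi 0)) (nhds 0) := by
    have : ContinuousAt (fun η : ℝ => 6 * η ^ β + 6 * η ^ γ) 0 :=
      (continuousAt_const.mul (Real.continuousAt_rpow_const _ _ (Or.inr hβ.le))).add
        (continuousAt_const.mul (Real.continuousAt_rpow_const _ _ (Or.inr hγ.le)))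
    have h := this.tendsto
    simp only [zero_rpow hβ.ne', zero_rpow hγ.ne', mul_zero, add_zero] at h
    exact h.mono_left nhdsWithin_le_nhds
  obtain ⟨η, hη, hη0⟩ := ((ht.eventually (gt_mem_nhds hε')).and self_mem_nhdsWithin).exists
  have hη0' : (0 : ℝ) < η := hη0
  -- a regular point close to `Y`
  let f : ℂ → ℂ := fun y => if y = 0 then (η : ℂ) else y
  have hf0 : ∀ y, f y ≠ 0 := by
    intro y
    by_cases h : y = 0
    · simp [f, h, hη0'.ne']
    · simp [f, h]
  have hfy : ∀ y, ‖y - f y‖ ≤ η := by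
    intro y
    by_cases h : y = 0
    · simp [f, h, abs_of_pos hη0']
    · simp [f, h, hη0'.le]
  let Z : ℂ² := (f Y.1, f Y.2)
  have t1 := coneDist_le_of_regular hβ hβ1 hγ hγ1 (X := X) (Y := Z) (fun _ => Or.inr (hf0 _))
    (fun _ => Or.inr (hf0 _))
  have t2 := coneDist_le_of_regular hβ hβ1 hγ hγ1 (X := Z) (Y := Y) (fun _ => Or.inl (hf0 _))
    (fun _ => Or.inl (hf0 _))
  have hpow : ∀ {δ : ℝ}, 0 < δ → δ ≤ 1 → ∀ x y : ℂ, ‖f y - x‖ ^ δ ≤ ‖y - x‖ ^ δ + η ^ δ := by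
    intro δ hδ hδ1 x y
    calc ‖f y - x‖ ^ δ ≤ (‖y - x‖ + η) ^ δ := by
          gcongr
          calc ‖f y - x‖ = ‖(y - x) - (y - f y)‖ := by congr 1; ring
            _ ≤ _ := (norm_sub_le _ _).trans (by gcongr; exact hfy y)
      _ ≤ _ := Real.rpow_add_le_add_rpow (norm_nonneg _) hη0'.le hδ.le hδ1
  refine (lengthDist_triangle (isLineElement_coneForm β γ) X Z Y).trans ((add_le_add t1 t2).trans ?_)
  rw [← ofReal_coe_nnreal, ofReal_add_ofReal, ofReal_add_ofReal]
  apply ofReal_le_ofReal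
  have a1 := hpow hβ hβ1 X.1 Y.1
  have a2 := hpow hγ hγ1 X.2 Y.2
  have a3 : ‖Y.1 - f Y.1‖ ^ β ≤ η ^ β := by gcongr; exact hfy _
  have a4 : ‖Y.2 - f Y.2‖ ^ γ ≤ η ^ γ := by gcongr; exact hfy _
  simp only [Z]
  linarith

/-- A lower bound for the displacement in one factor of the cone, on bounded pieces. -/
theorem enorm_sub_le_of_cone_speed {β : ℝ} (hβ : 0 < β) (hβ1 : β ≤ 1) {x x' : ℝ → ℂ} {a b : ℝ}
    (hab : a ≤ b) (hx : ContinuousOn x (Icc a b)) {T : Set ℝ} (hT : T.Finite)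
    (hd : ∀ τ ∈ Ioo a b \ T, HasDerivAt x (x' τ) τ) (h0 : ∀ τ ∈ Ioo a b \ T, β ≠ 1 → x τ ≠ 0)
    {l : ℝ → ℝ≥0∞}
    (hl : ∀ τ ∈ Ioo a b \ T, ofReal (β * ‖x τ‖ ^ (β - 1) * ‖x' τ‖) ≤ l τ)
    (hl1 : ∫⁻ τ in Icc a b, l τ ≤ 1) :
    ofReal (β * ((‖x a‖ ^ β + 1) ^ β⁻¹) ^ (β - 1)) * ‖x b - x a‖ₑ ≤ ∫⁻ τ in Icc a b, l τ := by
  set k := β * ((‖x a‖ ^ β + 1) ^ β⁻¹) ^ (β - 1) with hk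
  have hk0 : 0 < k := by positivity
  have hbd : ∀ τ ∈ Ioo a b, ‖x τ‖ ≤ (‖x a‖ ^ β + 1) ^ β⁻¹ := by
    intro τ hτ
    rw [le_rpow_inv_iff_of_pos (norm_nonneg _) (by positivity) hβ]
    have hs : Ioo a τ ⊆ Ioo a b := Ioo_subset_Ioo le_rfl hτ.2.le
    have := ofReal_norm_rpow_le_add hβ hτ.1.le (hx.mono (Icc_subset_Icc le_rfl hτ.2.le)) hT
      (fun s hs' => hd s ⟨hs hs'.1, hs'.2⟩) (fun s hs' => h0 s ⟨hs hs'.1, hs'.2⟩)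
      (fun s hs' => hl s ⟨hs hs'.1, hs'.2⟩)
    have h2 : ofReal (‖x τ‖ ^ β) ≤ ofReal (‖x a‖ ^ β + 1) := by
      rw [ofReal_add (by positivity) zero_le_one, ofReal_one]
      refine this.trans ?_
      gcongr
      exact (lintegral_mono_set (Icc_subset_Icc le_rfl hτ.2.le)).trans hl1
    exact (ofReal_le_ofReal_iff (by positivity)).1 h2
  have := enorm_sub_le_lintegral (l := fun τ => ofReal k⁻¹ * l τ) hab hx hT hd (fun τ hτ => by
      refine le_trans ?_ (mul_le_mul_right (hl τ hτ) _)
      rw [ofReal_mul_ofReal, ← ofReal_norm]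
      apply ofReal_le_ofReal
      rw [inv_mul_eq_div, le_div_iff₀ hk0, mul_comm, hk]
      gcongr ?_ * _
      gcongr ?_ * ?_
      rcases eq_or_ne β 1 with h | h
      · simp [h]
      · exact rpow_le_rpow_of_nonpos (norm_pos_iff.2 (h0 τ hτ h)) (hbd τ hτ.1) (by linarith))
  rw [lintegral_const_mul' _ _ ofReal_ne_top] at this
  calc ofReal k * ‖x b - x a‖ₑ ≤ ofReal k * (ofReal k⁻¹ * ∫⁻ τ in Icc a b, l τ) := by gcongr
    _ = _ := by rw [← mul_assoc, ← ofReal_mul hk0.le, mul_inv_cancel₀ hk0.ne', ofReal_one, one_mul]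

theorem HasDerivAt.fst' {c : ℝ → ℂ²} {c' : ℂ²} {τ : ℝ} (h : HasDerivAt c c' τ) :
    HasDerivAt (fun τ => (c τ).1) c'.1 τ :=
  (ContinuousLinearMap.fst ℝ ℂ ℂ).hasFDerivAt.comp_hasDerivAt τ h

theorem HasDerivAt.snd' {c : ℝ → ℂ²} {c' : ℂ²} {τ : ℝ} (h : HasDerivAt c c' τ) :
    HasDerivAt (fun τ => (c τ).2) c'.2 τ :=
  (ContinuousLinearMap.snd ℝ ℂ ℂ).hasFDerivAt.comp_hasDerivAt τ h

theorem ofReal_le_coneDist {β γ : ℝ} (hβ : 0 < β) (hγ : 0 < γ) (X Y : ℂ²) :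
    ofReal (‖Y.1‖ ^ β) ≤ ofReal (‖X.1‖ ^ β) + coneDist β γ X Y ∧
    ofReal (‖Y.2‖ ^ γ) ≤ ofReal (‖X.2‖ ^ γ) + coneDist β γ X Y := by
  constructor
  · rw [coneDist, lengthDist, add_iInf]
    refine le_iInf fun c => ?_
    by_cases hc : IsAdmissiblePath univ (coneRegular β γ) X Y c
    · simp only [hc, iInf_pos]
      obtain ⟨T, hT, hr⟩ := hc.isPathOn.regular
      have := ofReal_norm_rpow_le_add (l := speed (coneForm β γ) c) hβ zero_le_one
        hc.continuousOn.fst hT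
        (fun τ hτ => HasDerivAt.fst' ((hr τ hτ).2.differentiableAt (by norm_num)).hasDerivAt)
        (fun τ hτ => (hr τ hτ).1.1)
        (fun τ hτ => ofReal_le_ofReal (fst_le_sqrt_coneForm _ _))
      rwa [hc.source, hc.target] at this
    · simp [hc]
  · rw [coneDist, lengthDist, add_iInf]
    refine le_iInf fun c => ?_
    by_cases hc : IsAdmissiblePath univ (coneRegular β γ) X Y c
    · simp only [hc, iInf_pos]
      obtain ⟨T, hT, hr⟩ := hc.isPathOn.regular
      have := ofReal_norm_rpow_le_add (l := speed (coneForm β γ) c) hγ zero_le_one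
        hc.continuousOn.snd hT
        (fun τ hτ => HasDerivAt.snd' ((hr τ hτ).2.differentiableAt (by norm_num)).hasDerivAt)
        (fun τ hτ => (hr τ hτ).1.2)
        (fun τ hτ => ofReal_le_ofReal (snd_le_sqrt_coneForm _ _))
      rwa [hc.source, hc.target] at this
    · simp [hc]

theorem eq_of_coneDist_eq_zero {β γ : ℝ} (hβ : 0 < β) (hβ1 : β ≤ 1) (hγ : 0 < γ) (hγ1 : γ ≤ 1)
    {X Y : ℂ²} (h : coneDist β γ X Y = 0) : X = Y := by
  have aux : ∀ k : ℝ, ∀ y : ℂ, 0 < k →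
      (∀ L : ℝ≥0∞, 0 < L → L ≤ 1 → ofReal k * ‖y‖ₑ ≤ L) → y = 0 := by
    intro k y hk H
    by_contra hy
    have hy' : 0 < ofReal k * ‖y‖ₑ := by
      refine ENNReal.mul_pos (by simpa using hk) (by simpa using hy)
    have hfin : ofReal k * ‖y‖ₑ ≠ ⊤ := by finiteness
    have := H (min 1 (ofReal k * ‖y‖ₑ / 2)) (lt_min one_pos (ENNReal.half_pos hy'.ne'))
      (min_le_left _ _)
    exact absurd (this.trans (min_le_right _ _)) (not_le.2 (ENNReal.half_lt_self hy'.ne' hfin))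
  refine Prod.ext ?_ ?_
  · symm
    rw [← sub_eq_zero]
    refine aux _ _ (by positivity : 0 < β * ((‖X.1‖ ^ β + 1) ^ β⁻¹) ^ (β - 1)) fun L hL hL1 => ?_
    obtain ⟨c, rfl, rfl, hc, hl⟩ := exists_path_of_lengthDist_lt (h.trans_lt hL)
    obtain ⟨T, hT, hr⟩ := hc.regular
    exact (enorm_sub_le_of_cone_speed (l := speed (coneForm β γ) c) hβ hβ1 zero_le_one
        hc.continuousOn.fst hT
        (fun τ hτ => HasDerivAt.fst' ((hr τ hτ).2.differentiableAt (by norm_num)).hasDerivAt)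
        (fun τ hτ => (hr τ hτ).1.1)
        (fun τ hτ => ofReal_le_ofReal (fst_le_sqrt_coneForm _ _))
        (hl.le.trans hL1)).trans hl.le
  · symm
    rw [← sub_eq_zero]
    refine aux _ _ (by positivity : 0 < γ * ((‖X.2‖ ^ γ + 1) ^ γ⁻¹) ^ (γ - 1)) fun L hL hL1 => ?_
    obtain ⟨c, rfl, rfl, hc, hl⟩ := exists_path_of_lengthDist_lt (h.trans_lt hL)
    obtain ⟨T, hT, hr⟩ := hc.regular
    exact (enorm_sub_le_of_cone_speed (l := speed (coneForm β γ) c) hγ hγ1 zero_le_one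
        hc.continuousOn.snd hT
        (fun τ hτ => HasDerivAt.snd' ((hr τ hτ).2.differentiableAt (by norm_num)).hasDerivAt)
        (fun τ hτ => (hr τ hτ).1.2)
        (fun τ hτ => ofReal_le_ofReal (snd_le_sqrt_coneForm _ _))
        (hl.le.trans hL1)).trans hl.le

/-! ### Charts onto model cones and Gromov-Hausdorff closeness -/

/-- A bidisc about the apex of `C_b₁ × C_b₂`, large enough to contain everything that matters for
the unit ball. -/
def coneBox (b1 b2 : ℝ) : Set ℂ² := {X | ‖X.1‖ ^ b1 < 8 ∧ ‖X.2‖ ^ b2 < 8}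

/-- A chart `Φ`, with inverse `Ψ` on the open set `O`, in which the line element `H`, rescaled by
`h`, is `δ`-close to that of the cone `C_b₁ × C_b₂` outside a thin closed set `K` around the first
factor. On `K` the line element is only bounded below by its first factor, and above along the
graph of a section `σ`; distances in the direction of the second factor are small there. -/
structure ConeChart (U S : Set ℂ²) (H : ℂ² → ℂ² → ℝ) (b1 b2 h δ : ℝ)
    (Φ Ψ : ℂ² → ℂ²) (O K : Set ℂ²) (σ : ℂ → ℂ) : Prop where
  contDiff : ContDiff ℝ 1 Φ
  isOpen : IsOpen O
  contDiffOn : ContDiffOn ℝ 1 Ψ O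
  right_inv : ∀ x ∈ O, Φ (Ψ x) = x
  mapsTo : ∀ X ∈ coneBox b1 b2, Φ X ∈ O ∧ Φ X ∈ U
  left_inv : ∀ X ∈ coneBox b1 b2, Ψ (Φ X) = X
  isClosed : IsClosed K
  regular_iff : ∀ X ∈ coneBox b1 b2, X ∉ K → (Φ X ∈ S ↔ X ∈ coneRegular b1 b2)
  regular_fst : ∀ X ∈ coneBox b1 b2, Φ X ∈ S → b1 ≠ 1 → X.1 ≠ 0
  lower : ∀ X ∈ coneBox b1 b2, X ∉ K → Φ X ∈ S → ∀ Y,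
    (1 - δ) * (h ^ 2 * coneForm b1 b2 X Y) ≤ H (Φ X) (𝒟 Φ X Y)
  upper : ∀ X ∈ coneBox b1 b2, X ∉ K → Φ X ∈ S → ∀ Y,
    H (Φ X) (𝒟 Φ X Y) ≤ (1 + δ) * (h ^ 2 * coneForm b1 b2 X Y)
  lower_fst : ∀ X ∈ coneBox b1 b2, Φ X ∈ S → ∀ Y,
    (1 - δ) * (h ^ 2 * (b1 * ‖X.1‖ ^ (b1 - 1) * ‖Y.1‖) ^ 2) ≤ H (Φ X) (𝒟 Φ X Y)
  thin : ∀ X ∈ coneBox b1 b2, X ∈ K → ‖X.2‖ ^ b2 ≤ δ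
  contDiff_sec : ContDiff ℝ 1 σ
  sec_mem : K.Nonempty → ∀ z : ℂ, ‖z‖ ^ b1 < 8 → Φ (z, σ z) ∈ U
  sec_regular : K.Nonempty → ∀ z : ℂ, ‖z‖ ^ b1 < 8 → (b1 ≠ 1 → z ≠ 0) → Φ (z, σ z) ∈ S
  sec_upper : K.Nonempty → ∀ z : ℂ, ‖z‖ ^ b1 < 8 → (b1 ≠ 1 → z ≠ 0) → ∀ y : ℂ,
    H (Φ (z, σ z)) (𝒟 Φ (z, σ z) (y, 𝒟 σ z y)) ≤ (1 + δ) * (h ^ 2 * (b1 * ‖z‖ ^ (b1 - 1) * ‖y‖) ^ 2)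
  vertical : ∀ X ∈ coneBox b1 b2, X ∈ K → X.2 = σ X.1 ∨
    lengthDist U S H (Φ X) (Φ (X.1, σ X.1)) ≤ ofReal (δ * h)

theorem le_mul_sqrt_of_close {δ h B A : ℝ} (hδ : 0 ≤ δ) (hδ1 : δ ≤ 1 / 4) (hh : 0 < h)
    (hA : (1 - δ) * (h ^ 2 * B ^ 2) ≤ A) : B ≤ (1 + 2 * δ) / h * √A := by
  have hA0 : 0 ≤ A := le_trans (by have : 0 ≤ 1 - δ := by linarith
                                   positivity) hA
  have h1 : (h * B) ^ 2 ≤ ((1 + 2 * δ) * √A) ^ 2 := by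
    rw [mul_pow, mul_pow, sq_sqrt hA0]
    have h2 : 1 ≤ (1 - δ) * (1 + 2 * δ) ^ 2 := by nlinarith [mul_nonneg hδ hδ, mul_nonneg (mul_nonneg hδ hδ) hδ]
    calc h ^ 2 * B ^ 2 ≤ ((1 - δ) * (1 + 2 * δ) ^ 2) * (h ^ 2 * B ^ 2) := by
          apply le_mul_of_one_le_left (by positivity) h2
      _ = (1 + 2 * δ) ^ 2 * ((1 - δ) * (h ^ 2 * B ^ 2)) := by ring
      _ ≤ _ := by gcongr
  have h3 := (abs_le_of_sq_le_sq' h1 (by positivity)).2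
  rw [div_mul_eq_mul_div, le_div_iff₀ hh]
  linarith

theorem sqrt_le_mul_of_close {δ h B A : ℝ} (hδ : 0 ≤ δ) (hh : 0 < h) (hB : 0 ≤ B)
    (hA : A ≤ (1 + δ) * (h ^ 2 * B ^ 2)) : √A ≤ (1 + δ) * h * B := by
  rw [sqrt_le_left (by positivity)]
  calc A ≤ (1 + δ) * (h ^ 2 * B ^ 2) := hA
    _ ≤ (1 + δ) ^ 2 * (h ^ 2 * B ^ 2) := by gcongr; nlinarith
    _ = _ := by ring

theorem arcLength_le_mul {h h' : ℂ² → ℂ² → ℝ} {c c' : ℝ → ℂ²} {a b : ℝ} {T : Set ℝ}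
    (hT : T.Finite) {k : ℝ≥0∞} (hk : k ≠ ⊤)
    (hle : ∀ τ ∈ Ioo a b \ T, speed h c τ ≤ k * speed h' c' τ) :
    arcLength h c a b ≤ k * arcLength h' c' a b := by
  unfold arcLength
  rw [← lintegral_const_mul' _ _ hk, setLIntegral_congr Ioo_ae_eq_Icc.symm,
    setLIntegral_congr Ioo_ae_eq_Icc.symm]
  apply lintegral_mono_ae
  filter_upwards [ae_restrict_mem measurableSet_Ioo,
    ae_restrict_of_ae (hT.countable.ae_notMem volume)] with τ h1 h2
  exact hle τ ⟨h1, h2⟩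

/-- A path splits at its first and its last visit to a closed set. If a cost is bounded by the
length as long as the path avoids the set, and by the length up to an error `η` between two
visits, then it is bounded by the length up to `η`. -/
theorem le_of_first_last_visit {E L : ℝ → ℝ → ℝ≥0∞} (htri : ∀ a b c, E a c ≤ E a b + E b c)
    {X : ℝ → ℂ²} (hX : ContinuousOn X (Icc 0 1)) {K : Set ℂ²} (hK : IsClosed K)
    {A η : ℝ≥0∞} (hL : ∀ a m b, a ≤ m → m ≤ b → L a b = L a m + L m b)
    (h1 : ∀ a b, 0 ≤ a → a < b → b ≤ 1 → (∀ τ ∈ Ioo a b, X τ ∉ K) → E a b ≤ A * L a b)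
    (h2 : ∀ a b, 0 ≤ a → a < b → b ≤ 1 → X a ∈ K → X b ∈ K → E a b ≤ A * L a b + η) :
    E 0 1 ≤ A * L 0 1 + η := by
  set J := {τ ∈ 𝕀 | X τ ∈ K} with hJ
  have hJc : IsClosed J := hX.preimage_isClosed_of_isClosed isClosed_Icc hK
  rcases J.eq_empty_or_nonempty with hemp | hne
  · refine (h1 0 1 le_rfl one_pos le_rfl fun τ hτ hτK => ?_).trans le_self_add
    have : τ ∈ J := ⟨⟨hτ.1.le, hτ.2.le⟩, hτK⟩
    rw [hemp] at this; exact this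
  have hbb : BddBelow J := ⟨0, fun τ hτ => hτ.1.1⟩
  have hba : BddAbove J := ⟨1, fun τ hτ => hτ.1.2⟩
  have hs := hJc.csInf_mem hne hbb
  have ht := hJc.csSup_mem hne hba
  set s := sInf J
  set t := sSup J
  have hst : s ≤ t := csInf_le hbb ht
  have step1 : 0 = s ∨ E 0 s ≤ A * L 0 s := by
    rcases hs.1.1.eq_or_lt with h | h
    · exact Or.inl h
    · refine Or.inr (h1 0 s le_rfl h hs.1.2 fun τ hτ hτK => ?_)
      exact absurd (csInf_le hbb ⟨⟨hτ.1.le, hτ.2.le.trans hs.1.2⟩, hτK⟩) (not_le.2 hτ.2)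
  have step2 : s = t ∨ E s t ≤ A * L s t + η := by
    rcases hst.eq_or_lt with h | h
    · exact Or.inl h
    · exact Or.inr (h2 s t hs.1.1 h ht.1.2 hs.2 ht.2)
  have step3 : t = 1 ∨ E t 1 ≤ A * L t 1 := by
    rcases ht.1.2.eq_or_lt with h | h
    · exact Or.inl h
    · refine Or.inr (h1 t 1 ht.1.1 h le_rfl fun τ hτ hτK => ?_)
      exact absurd (le_csSup hba ⟨⟨ht.1.1.trans hτ.1.le, hτ.2.le⟩, hτK⟩) (not_le.2 hτ.1)
  have comb : ∀ a b c P Q, (a = b ∨ E a b ≤ P) → (b = c ∨ E b c ≤ Q) → (a = c ∨ E a c ≤ P + Q) := by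
    rintro a b c P Q (rfl | h) (rfl | h')
    · exact Or.inl rfl
    · exact Or.inr (h'.trans le_add_self)
    · exact Or.inr (h.trans le_self_add)
    · exact Or.inr ((htri a b c).trans (add_le_add h h'))
  rcases comb _ _ _ _ _ (comb _ _ _ _ _ step1 step2) step3 with h | h
  · exact absurd h zero_ne_one
  · refine h.trans (le_of_eq ?_)
    rw [hL 0 s 1 hs.1.1 hs.1.2, hL s t 1 hst ht.1.2]
    ring

namespace ConeChart
variable {U S : Set ℂ²} {H : ℂ² → ℂ² → ℝ} {b1 b2 h δ : ℝ}
  {Φ Ψ : ℂ² → ℂ²} {O K : Set ℂ²} {σ : ℂ → ℂ} {c : ℝ → ℂ²} {a b : ℝ}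

theorem lift_at (C : ConeChart U S H b1 b2 h δ Φ Ψ O K σ) {τ : ℝ} (hO : c τ ∈ O)
    (hc : ContDiffAt ℝ 1 c τ) : ContDiffAt ℝ 1 (Ψ ∘ c) τ ∧
    deriv c τ = 𝒟 Φ (Ψ (c τ)) (deriv (Ψ ∘ c) τ) := by
  have h1 : ContDiffAt ℝ 1 (Ψ ∘ c) τ := (C.contDiffOn.contDiffAt (C.isOpen.mem_nhds hO)).comp τ hc
  refine ⟨h1, ?_⟩
  have h2 : (Φ ∘ (Ψ ∘ c)) =ᶠ[nhds τ] c := by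
    filter_upwards [hc.continuousAt.eventually (C.isOpen.mem_nhds hO)] with s hs
    exact C.right_inv _ hs
  rw [← h2.deriv_eq]
  exact ((C.contDiff.differentiable (by norm_num) _).hasFDerivAt.comp_hasDerivAt τ
    (h1.differentiableAt (by norm_num)).hasDerivAt).deriv

theorem lift_speed_fst (C : ConeChart U S H b1 b2 h δ Φ Ψ O K σ) (hδ : 0 ≤ δ) (hδ1 : δ ≤ 1 / 4)
    (hh : 0 < h) {τ : ℝ} (hO : c τ ∈ O) (hb : Ψ (c τ) ∈ coneBox b1 b2) (hS : c τ ∈ S)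
    (hc : ContDiffAt ℝ 1 c τ) :
    ofReal (b1 * ‖(Ψ (c τ)).1‖ ^ (b1 - 1) * ‖(deriv (Ψ ∘ c) τ).1‖)
      ≤ ofReal ((1 + 2 * δ) / h) * speed H c τ := by
  rw [speed, ofReal_mul_ofReal]
  apply ofReal_le_ofReal
  apply le_mul_sqrt_of_close hδ hδ1 hh
  have := C.lower_fst (Ψ (c τ)) hb (by rwa [C.right_inv _ hO]) (deriv (Ψ ∘ c) τ)
  rwa [C.right_inv _ hO, ← (C.lift_at hO hc).2] at this

theorem lift_speed (C : ConeChart U S H b1 b2 h δ Φ Ψ O K σ) (hδ : 0 ≤ δ) (hδ1 : δ ≤ 1 / 4)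
    (hh : 0 < h) {τ : ℝ} (hO : c τ ∈ O) (hb : Ψ (c τ) ∈ coneBox b1 b2) (hK : Ψ (c τ) ∉ K)
    (hS : c τ ∈ S) (hc : ContDiffAt ℝ 1 c τ) :
    speed (coneForm b1 b2) (Ψ ∘ c) τ ≤ ofReal ((1 + 2 * δ) / h) * speed H c τ := by
  rw [speed, speed, ofReal_mul_ofReal]
  apply ofReal_le_ofReal
  apply le_mul_sqrt_of_close hδ hδ1 hh
  have := C.lower (Ψ (c τ)) hb hK (by rwa [C.right_inv _ hO]) (deriv (Ψ ∘ c) τ)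
  rw [C.right_inv _ hO, ← (C.lift_at hO hc).2] at this
  rw [sq_sqrt]
  · exact this
  · rw [coneForm_eq]; positivity

theorem lift_continuousOn (C : ConeChart U S H b1 b2 h δ Φ Ψ O K σ) (hc : IsPathOn U S c a b)
    (hO : ∀ τ ∈ Icc a b, c τ ∈ O) : ContinuousOn (Ψ ∘ c) (Icc a b) :=
  C.contDiffOn.continuousOn.comp hc.continuousOn hO

theorem lift_bounds (C : ConeChart U S H b1 b2 h δ Φ Ψ O K σ) (hb1 : 0 < b1) (hb2 : 0 < b2)
    (hδ : 0 ≤ δ) (hδ1 : δ ≤ 1 / 4) (hh : 0 < h) (hb : 0 ≤ b) (hc : IsPathOn U S c 0 b)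
    (hO : ∀ τ ∈ Icc 0 b, c τ ∈ O) (hB : ∀ τ ∈ Icc 0 b, Ψ (c τ) ∈ coneBox b1 b2) {m l : ℝ}
    (hm1 : ‖(Ψ (c 0)).1‖ ^ b1 ≤ m) (hm2 : ‖(Ψ (c 0)).2‖ ^ b2 ≤ m) (hδm : δ ≤ m) (hl : 0 ≤ l)
    (hlen : arcLength H c 0 b ≤ ofReal (h * l)) :
    ‖(Ψ (c b)).1‖ ^ b1 ≤ m + (1 + 2 * δ) * l ∧ ‖(Ψ (c b)).2‖ ^ b2 ≤ m + (1 + 2 * δ) * l := by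
  obtain ⟨T, hT, hr⟩ := hc.regular
  have hX := C.lift_continuousOn hc hO
  have hm0 : 0 ≤ m := hδ.trans hδm
  have hint : ∀ s, 0 ≤ s → ∫⁻ τ in Icc s b, ofReal ((1 + 2 * δ) / h) * speed H c τ
      ≤ ofReal ((1 + 2 * δ) * l) := by
    intro s hs
    rw [lintegral_const_mul' _ _ ofReal_ne_top]
    calc ofReal ((1 + 2 * δ) / h) * arcLength H c s b
        ≤ ofReal ((1 + 2 * δ) / h) * ofReal (h * l) := by
          gcongr; exact (arcLength_mono hs le_rfl).trans hlen
      _ = _ := by rw [ofReal_mul_ofReal]; congr 1; field_simp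
  have fin : ∀ x y : ℝ, x ≤ m → ofReal y ≤ ofReal x +
      ofReal ((1 + 2 * δ) * l) → y ≤ m + (1 + 2 * δ) * l := by
    intro x y hx hy
    rw [← ofReal_le_ofReal_iff (by positivity), ofReal_add hm0 (by positivity)]
    exact hy.trans (by gcongr)
  constructor
  · refine fin _ _ hm1 ?_
    refine (ofReal_norm_rpow_le_add (l := fun τ => ofReal ((1 + 2 * δ) / h) * speed H c τ)
      (x := fun τ => (Ψ (c τ)).1) (x' := fun τ => (deriv (Ψ ∘ c) τ).1)
      hb1 hb hX.fst hT (fun τ hτ => ?_) (fun τ hτ => ?_) (fun τ hτ => ?_)).trans ?_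
    · exact HasDerivAt.fst' ((C.lift_at (hO τ (Ioo_subset_Icc_self hτ.1)) (hr τ hτ).2).1.differentiableAt (by norm_num)).hasDerivAt
    · have hτ' := Ioo_subset_Icc_self hτ.1
      exact C.regular_fst _ (hB τ hτ') (by rw [C.right_inv _ (hO τ hτ')]; exact (hr τ hτ).1)
    · have hτ' := Ioo_subset_Icc_self hτ.1
      exact C.lift_speed_fst hδ hδ1 hh (hO τ hτ') (hB τ hτ') (hr τ hτ).1 (hr τ hτ).2
    · gcongr; exact hint 0 le_rfl
  · -- start at the last visit to `K`, where the second coordinate is small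
    obtain ⟨s, hs0, hsb, hsm, hsK⟩ : ∃ s, 0 ≤ s ∧ s ≤ b ∧ ‖(Ψ (c s)).2‖ ^ b2 ≤ m ∧
        ∀ τ ∈ Ioo s b, Ψ (c τ) ∉ K := by
      set J := {τ ∈ Icc (0 : ℝ) b | (Ψ ∘ c) τ ∈ K} with hJ
      have hJc : IsClosed J := hX.preimage_isClosed_of_isClosed isClosed_Icc C.isClosed
      rcases J.eq_empty_or_nonempty with hemp | hne
      · refine ⟨0, le_rfl, hb, hm2, fun τ hτ hK => ?_⟩
        have : τ ∈ J := ⟨Ioo_subset_Icc_self hτ, hK⟩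
        rw [hemp] at this; exact this
      · have hba : BddAbove J := ⟨b, fun τ hτ => hτ.1.2⟩
        have ht := hJc.csSup_mem hne hba
        refine ⟨sSup J, ht.1.1, ht.1.2, (C.thin _ (hB _ ht.1) ht.2).trans hδm, fun τ hτ hK => ?_⟩
        exact absurd (le_csSup hba ⟨⟨ht.1.1.trans hτ.1.le, hτ.2.le⟩, hK⟩) (not_le.2 hτ.1)
    have hsub : Ioo s b ⊆ Icc 0 b := fun τ hτ => ⟨hs0.trans hτ.1.le, hτ.2.le⟩
    have hsub' : Ioo s b ⊆ Ioo 0 b := Ioo_subset_Ioo hs0 le_rfl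
    refine fin _ _ hsm ?_
    refine (ofReal_norm_rpow_le_add (l := fun τ => ofReal ((1 + 2 * δ) / h) * speed H c τ)
      (x := fun τ => (Ψ (c τ)).2) (x' := fun τ => (deriv (Ψ ∘ c) τ).2)
      hb2 hsb (hX.snd.mono (Icc_subset_Icc hs0 le_rfl)) hT (fun τ hτ => ?_) (fun τ hτ => ?_)
      (fun τ hτ => ?_)).trans ?_
    · exact HasDerivAt.snd' ((C.lift_at (hO τ (hsub hτ.1)) (hr τ ⟨hsub' hτ.1, hτ.2⟩).2).1.differentiableAt (by norm_num)).hasDerivAt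
    · have hτ' := hsub hτ.1
      have := (C.regular_iff _ (hB τ hτ') (hsK τ hτ.1)).1 (by
        rw [C.right_inv _ (hO τ hτ')]; exact (hr τ ⟨hsub' hτ.1, hτ.2⟩).1)
      exact this.2
    · have hτ' := hsub hτ.1
      exact (ofReal_le_ofReal (snd_le_sqrt_coneForm _ _)).trans
        (C.lift_speed hδ hδ1 hh (hO τ hτ') (hB τ hτ') (hsK τ hτ.1) (hr τ ⟨hsub' hτ.1, hτ.2⟩).1
          (hr τ ⟨hsub' hτ.1, hτ.2⟩).2)
    · gcongr; exact hint s hs0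

/-- A short path that starts near the apex stays in the chart. -/
theorem stays (C : ConeChart U S H b1 b2 h δ Φ Ψ O K σ) (hb1 : 0 < b1) (hb2 : 0 < b2)
    (hδ : 0 ≤ δ) (hδ1 : δ ≤ 1 / 4) (hh : 0 < h) (hc : IsPathOn U S c 0 1) {X0 : ℂ²}
    (hX0 : c 0 = Φ X0) {m l : ℝ} (hm1 : ‖X0.1‖ ^ b1 ≤ m) (hm2 : ‖X0.2‖ ^ b2 ≤ m) (hδm : δ ≤ m)
    (hl : 0 ≤ l) (hml : m + (1 + 2 * δ) * l < 8)
    (hlen : arcLength H c 0 1 ≤ ofReal (h * l)) :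
    ∀ τ ∈ 𝕀, c τ ∈ O ∧ Ψ (c τ) ∈ coneBox b1 b2 := by
  have hm0 : 0 ≤ m := hδ.trans hδm
  have hl' : 0 ≤ (1 + 2 * δ) * l := by positivity
  have hX0b : X0 ∈ coneBox b1 b2 := ⟨by linarith, by linarith⟩
  have hboxo : IsOpen (coneBox b1 b2) := by
    have i1 : Continuous fun X : ℂ² => ‖X.1‖ ^ b1 :=
      (continuous_norm.comp continuous_fst).rpow_const fun _ => Or.inr hb1.le
    have i2 : Continuous fun X : ℂ² => ‖X.2‖ ^ b2 :=
      (continuous_norm.comp continuous_snd).rpow_const fun _ => Or.inr hb2.le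
    exact (isOpen_lt i1 continuous_const).inter (isOpen_lt i2 continuous_const)
  set W := O ∩ Ψ ⁻¹' coneBox b1 b2 with hW
  have hWo : IsOpen W := C.contDiffOn.continuousOn.isOpen_inter_preimage C.isOpen hboxo
  by_contra hcon
  push Not at hcon
  set J := {τ ∈ 𝕀 | c τ ∈ Wᶜ} with hJ
  have hJc : IsClosed J := hc.continuousOn.preimage_isClosed_of_isClosed isClosed_Icc
    hWo.isClosed_compl
  have hne : J.Nonempty := by
    obtain ⟨τ, hτ, h1⟩ := hcon
    exact ⟨τ, hτ, fun h2 => h1 h2.1 h2.2⟩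
  have hbb : BddBelow J := ⟨0, fun τ hτ => hτ.1.1⟩
  have hs := hJc.csInf_mem hne hbb
  set s := sInf J with hsdef
  have hbefore : ∀ τ, 0 ≤ τ → τ < s → c τ ∈ W := by
    intro τ h0 h1
    by_contra h2
    exact absurd (csInf_le hbb ⟨⟨h0, h1.le.trans hs.1.2⟩, h2⟩) (not_le.2 h1)
  have h0W : c 0 ∈ W := by
    rw [hX0]; exact ⟨(C.mapsTo _ hX0b).1, by rw [mem_preimage, C.left_inv _ hX0b]; exact hX0b⟩
  have hs0 : 0 < s := by
    rcases hs.1.1.eq_or_lt with h | h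
    · exact absurd h0W (by have := hs.2; rwa [← h] at this)
    · exact h
  set B := m + (1 + 2 * δ) * l with hB
  have hB0 : 0 ≤ B := by positivity
  set P : Set ℂ² := closedBall 0 (B ^ b1⁻¹) ×ˢ closedBall 0 (B ^ b2⁻¹) with hP
  have hPbox : P ⊆ coneBox b1 b2 := by
    rintro X ⟨h1, h2⟩
    rw [mem_closedBall_zero_iff, le_rpow_inv_iff_of_pos (norm_nonneg _) hB0 hb1] at h1
    rw [mem_closedBall_zero_iff, le_rpow_inv_iff_of_pos (norm_nonneg _) hB0 hb2] at h2
    exact ⟨h1.trans_lt hml, h2.trans_lt hml⟩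
  have hPc : IsClosed (Φ '' P) :=
    (((isCompact_closedBall _ _).prod (isCompact_closedBall _ _)).image
      C.contDiff.continuous).isClosed
  have hin : ∀ τ ∈ Ico 0 s, c τ ∈ Φ '' P := by
    intro τ hτ
    have hτs : ∀ r ∈ Icc 0 τ, c r ∈ W := fun r hr => hbefore r hr.1 (hr.2.trans_lt hτ.2)
    have hτ1 : τ ≤ 1 := hτ.2.le.trans hs.1.2
    have e0 : Ψ (c 0) = X0 := by rw [hX0, C.left_inv _ hX0b]
    have := C.lift_bounds hb1 hb2 hδ hδ1 hh hτ.1 (hc.mono le_rfl hτ1) (fun r hr => (hτs r hr).1)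
      (fun r hr => (hτs r hr).2) (by rwa [e0]) (by rwa [e0]) hδm hl
      ((arcLength_mono le_rfl hτ1).trans hlen)
    refine ⟨Ψ (c τ), ⟨?_, ?_⟩, C.right_inv _ (hτs τ ⟨hτ.1, le_rfl⟩).1⟩
    · rw [mem_closedBall_zero_iff, le_rpow_inv_iff_of_pos (norm_nonneg _) hB0 hb1]
      exact this.1
    · rw [mem_closedBall_zero_iff, le_rpow_inv_iff_of_pos (norm_nonneg _) hB0 hb2]
      exact this.2
  have hcs : c s ∈ Φ '' P := by
    have hcw : ContinuousWithinAt c (Ico 0 s) s :=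
      (hc.continuousOn s hs.1).mono (Ico_subset_Icc_self.trans (Icc_subset_Icc le_rfl hs.1.2))
    have hcl : s ∈ closure (Ico 0 s) := by rw [closure_Ico hs0.ne]; exact ⟨hs0.le, le_rfl⟩
    have := hcw.mem_closure hcl hin
    rwa [hPc.closure_eq] at this
  obtain ⟨X, hXP, hX⟩ := hcs
  refine hs.2 ?_
  rw [← hX]
  exact ⟨(C.mapsTo _ (hPbox hXP)).1, by
    rw [mem_preimage, C.left_inv _ (hPbox hXP)]; exact hPbox hXP⟩


/-- Every point close to `Φ X` is in the chart. -/
theorem exists_preimage (C : ConeChart U S H b1 b2 h δ Φ Ψ O K σ) (hb1 : 0 < b1) (hb2 : 0 < b2)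
    (hδ : 0 ≤ δ) (hδ1 : δ ≤ 1 / 4) (hh : 0 < h) {X : ℂ²} {q : ℂ²} {m l : ℝ}
    (hm1 : ‖X.1‖ ^ b1 ≤ m) (hm2 : ‖X.2‖ ^ b2 ≤ m) (hδm : δ ≤ m) (hl : 0 ≤ l)
    (hml : m + (1 + 2 * δ) * l < 8) (hd : lengthDist U S H (Φ X) q < ofReal (h * l)) :
    ∃ Y ∈ coneBox b1 b2, Φ Y = q ∧ ‖Y.1‖ ^ b1 ≤ m + (1 + 2 * δ) * l ∧
      ‖Y.2‖ ^ b2 ≤ m + (1 + 2 * δ) * l := by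
  have hl' : 0 ≤ (1 + 2 * δ) * l := by positivity
  have hXb : X ∈ coneBox b1 b2 := ⟨by linarith, by linarith⟩
  obtain ⟨c, hc0, rfl, hc, hlen⟩ := exists_path_of_lengthDist_lt hd
  have hst := C.stays hb1 hb2 hδ hδ1 hh hc hc0 hm1 hm2 hδm hl hml hlen.le
  have e0 : Ψ (c 0) = X := by rw [hc0, C.left_inv _ hXb]
  have := C.lift_bounds hb1 hb2 hδ hδ1 hh zero_le_one hc (fun τ hτ => (hst τ hτ).1)
    (fun τ hτ => (hst τ hτ).2) (by rwa [e0]) (by rwa [e0]) hδm hl hlen.le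
  have h1 : (1 : ℝ) ∈ 𝕀 := by simp
  exact ⟨Ψ (c 1), (hst 1 h1).2, C.right_inv _ (hst 1 h1).1, this.1, this.2⟩

/-- Distances in the cone are at most slightly larger than distances in the chart. -/
theorem coneDist_le_of_dist_lt (C : ConeChart U S H b1 b2 h δ Φ Ψ O K σ) (hb1 : 0 < b1)
    (hb11 : b1 ≤ 1) (hb2 : 0 < b2) (hb21 : b2 ≤ 1) (hδ : 0 < δ) (hδ1 : δ ≤ 1 / 4) (hh : 0 < h)
    {X Y : ℂ²} {l : ℝ} (hX1 : ‖X.1‖ ^ b1 ≤ 3 / 2) (hX2 : ‖X.2‖ ^ b2 ≤ 3 / 2)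
    (hY : Y ∈ coneBox b1 b2)
    (hl : 0 ≤ l) (hl4 : l ≤ 4) (hd : lengthDist U S H (Φ X) (Φ Y) < ofReal (h * l)) :
    coneDist b1 b2 X Y ≤ ofReal ((1 + 2 * δ) * l + 12 * δ) := by
  have hXb : X ∈ coneBox b1 b2 := ⟨by linarith, by linarith⟩
  obtain ⟨c, hc0, hc1, hc, hlen⟩ := exists_path_of_lengthDist_lt hd
  have hst := C.stays hb1 hb2 hδ.le hδ1 hh hc hc0 hX1 hX2 (by linarith) hl (by nlinarith) hlen.le
  have hX : ContinuousOn (Ψ ∘ c) (Icc 0 1) := C.lift_continuousOn hc fun τ hτ => (hst τ hτ).1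
  obtain ⟨T, hT, hr⟩ := hc.regular
  have hsub : ∀ {a b : ℝ}, 0 ≤ a → b ≤ 1 → ∀ τ ∈ Ioo a b \ T, τ ∈ 𝕀 ∧ τ ∈ Ioo (0 : ℝ) 1 \ T :=
    fun ha hb τ hτ => ⟨⟨ha.trans hτ.1.1.le, hτ.1.2.le.trans hb⟩,
      ⟨⟨ha.trans_lt hτ.1.1, hτ.1.2.trans_le hb⟩, hτ.2⟩⟩
  have key := le_of_first_last_visit (E := fun a b => coneDist b1 b2 (Ψ (c a)) (Ψ (c b)))
    (L := fun a b => arcLength H c a b) (A := ofReal ((1 + 2 * δ) / h))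
    (η := ofReal (12 * δ))
    (fun _ _ _ => lengthDist_triangle (isLineElement_coneForm _ _) _ _ _) hX C.isClosed
    (fun a m b => arcLength_add) ?_ ?_
  · have e0 : Ψ (c 0) = X := by rw [hc0, C.left_inv _ hXb]
    have e1 : Ψ (c 1) = Y := by rw [hc1, C.left_inv _ hY]
    simp only [e0, e1] at key
    refine key.trans ?_
    rw [ofReal_add (by positivity) (by positivity)]
    gcongr
    calc ofReal ((1 + 2 * δ) / h) * arcLength H c 0 1
        ≤ ofReal ((1 + 2 * δ) / h) * ofReal (h * l) := by gcongr
      _ = _ := by rw [ofReal_mul_ofReal]; congr 1; field_simp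
  · intro a b ha hab hb hK
    have hp : IsPathOn univ (coneRegular b1 b2) (Ψ ∘ c) a b := by
      refine ⟨hX.mono (Icc_subset_Icc ha hb), mapsTo_univ _ _, T, hT, fun τ hτ => ?_⟩
      obtain ⟨h1, h2⟩ := hsub ha hb τ hτ
      refine ⟨(C.regular_iff _ (hst τ h1).2 (hK τ hτ.1)).1 ?_, (C.lift_at (hst τ h1).1 (hr τ h2).2).1⟩
      rw [C.right_inv _ (hst τ h1).1]; exact (hr τ h2).1
    refine (hp.lengthDist_le (isLineElement_coneForm _ _) hab).trans
      (arcLength_le_mul hT ofReal_ne_top fun τ hτ => ?_)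
    obtain ⟨h1, h2⟩ := hsub ha hb τ hτ
    exact C.lift_speed hδ.le hδ1 hh (hst τ h1).1 (hst τ h1).2 (hK τ hτ.1) (hr τ h2).1 (hr τ h2).2
  · intro a b ha hab hb hKa hKb
    -- move vertically to a fixed small second coordinate, then along the first factor
    have hIa : a ∈ 𝕀 := ⟨ha, hab.le.trans hb⟩
    have hIb : b ∈ 𝕀 := ⟨ha.trans hab.le, hb⟩
    set μ : ℝ := δ ^ b2⁻¹ with hμ
    have hμ0 : 0 < μ := by positivity
    have hμδ : μ ^ b2 = δ := Real.rpow_inv_rpow hδ.le hb2.ne'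
    have hvert : ∀ Z ∈ coneBox b1 b2, Z ∈ K → coneDist b1 b2 Z (Z.1, (μ : ℂ)) ≤ ofReal (6 * δ) := by
      intro Z hZ hZK
      refine (coneDist_le hb1 hb11 hb2 hb21 _ _).trans (ofReal_le_ofReal ?_)
      have : ‖(μ : ℂ) - Z.2‖ ^ b2 ≤ 2 * δ := by
        calc ‖(μ : ℂ) - Z.2‖ ^ b2 ≤ (μ + ‖Z.2‖) ^ b2 := by
              gcongr
              refine (norm_sub_le _ _).trans (le_of_eq ?_)
              simp [abs_of_pos hμ0]
          _ ≤ μ ^ b2 + ‖Z.2‖ ^ b2 := Real.rpow_add_le_add_rpow hμ0.le (norm_nonneg _) hb2.le hb21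
          _ ≤ 2 * δ := by rw [hμδ]; linarith [C.thin Z hZ hZK]
      simp only [sub_self, norm_zero, zero_rpow hb1.ne']
      linarith
    set e : ℝ → ℂ² := fun τ => ((Ψ (c τ)).1, (μ : ℂ)) with he
    have hhor : coneDist b1 b2 (e a) (e b) ≤ ofReal ((1 + 2 * δ) / h) * arcLength H c a b := by
      have hder : ∀ τ ∈ Ioo a b \ T, ContDiffAt ℝ 1 e τ ∧ deriv e τ = ((deriv (Ψ ∘ c) τ).1, 0) := by
        intro τ hτ
        obtain ⟨h1, h2⟩ := hsub ha hb τ hτ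
        have hl := (C.lift_at (hst τ h1).1 (hr τ h2).2).1
        refine ⟨(contDiffAt_fst.comp τ hl).prodMk contDiffAt_const, ?_⟩
        exact (((HasDerivAt.fst' (hl.differentiableAt (by norm_num)).hasDerivAt)).prodMk
          (hasDerivAt_const τ (μ : ℂ))).deriv
      have hp : IsPathOn univ (coneRegular b1 b2) e a b := by
        refine ⟨((hX.fst.mono (Icc_subset_Icc ha hb)).prodMk continuousOn_const),
          mapsTo_univ _ _, T, hT, fun τ hτ => ⟨⟨?_, fun _ => ?_⟩, (hder τ hτ).1⟩⟩
        · obtain ⟨h1, h2⟩ := hsub ha hb τ hτ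
          exact C.regular_fst (Ψ (c τ)) (hst τ h1).2
            (by rw [C.right_inv _ (hst τ h1).1]; exact (hr τ h2).1)
        · simpa [e] using hμ0.ne'
      refine (hp.lengthDist_le (isLineElement_coneForm _ _) hab).trans
        (arcLength_le_mul hT ofReal_ne_top fun τ hτ => ?_)
      obtain ⟨h1, h2⟩ := hsub ha hb τ hτ
      refine le_trans (ofReal_le_ofReal ?_)
        (C.lift_speed_fst hδ.le hδ1 hh (hst τ h1).1 (hst τ h1).2 (hr τ h2).1 (hr τ h2).2)
      rw [(hder τ hτ).2]
      refine (sqrt_coneForm_le hb1.le hb2.le _ _).trans (le_of_eq ?_)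
      simp [e]
    calc coneDist b1 b2 (Ψ (c a)) (Ψ (c b))
        ≤ coneDist b1 b2 (Ψ (c a)) (e a) + (coneDist b1 b2 (e a) (e b)
          + coneDist b1 b2 (e b) (Ψ (c b))) :=
          (lengthDist_triangle (isLineElement_coneForm _ _) _ (e a) _).trans
            (add_le_add le_rfl (lengthDist_triangle (isLineElement_coneForm _ _) _ (e b) _))
      _ ≤ ofReal (6 * δ) + (ofReal ((1 + 2 * δ) / h) * arcLength H c a b + ofReal (6 * δ)) := by
          gcongr
          · exact hvert _ (hst a hIa).2 hKa
          · rw [coneDist, lengthDist_comm (isLineElement_coneForm _ _)]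
            exact hvert _ (hst b hIb).2 hKb
      _ = ofReal ((1 + 2 * δ) / h) * arcLength H c a b
          + (ofReal (6 * δ) + ofReal (6 * δ)) := by ring
      _ = _ := by rw [ofReal_add_ofReal]; congr 2; ring

/-- Distances in the chart are at most slightly larger than distances in the cone. -/
theorem dist_le_of_coneDist_lt (C : ConeChart U S H b1 b2 h δ Φ Ψ O K σ) (hH : IsLineElement H)
    (hb1 : 0 < b1) (hb2 : 0 < b2) (hδ : 0 ≤ δ) (hh : 0 < h)
    {X Y : ℂ²} {l : ℝ} (hX1 : ‖X.1‖ ^ b1 ≤ 3 / 2) (hX2 : ‖X.2‖ ^ b2 ≤ 3 / 2)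
    (hl : 0 ≤ l) (hl4 : l ≤ 4) (hd : coneDist b1 b2 X Y < ofReal l) :
    lengthDist U S H (Φ X) (Φ Y) ≤ ofReal (h * ((1 + δ) * l + 2 * δ)) := by
  obtain ⟨x, hx0, hx1, hx, hlen⟩ := exists_path_of_lengthDist_lt hd
  have hbox : ∀ τ ∈ 𝕀, x τ ∈ coneBox b1 b2 := by
    intro τ hτ
    rcases hτ.1.eq_or_lt with rfl | h0
    · rw [hx0]; exact ⟨by linarith, by linarith⟩
    have h1 : coneDist b1 b2 X (x τ) ≤ ofReal l := by
      rw [← hx0]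
      exact ((hx.mono le_rfl hτ.2).lengthDist_le (isLineElement_coneForm _ _) h0).trans
        ((arcLength_mono le_rfl hτ.2).trans hlen.le)
    have h2 := ofReal_le_coneDist hb1 hb2 X (x τ)
    have fin : ∀ y z : ℝ, y ≤ 3 / 2 → ofReal z ≤ ofReal y + coneDist b1 b2 X (x τ) → z < 8 := by
      intro y z hy hz
      have : ofReal z ≤ ofReal (3 / 2 + l) := by
        rw [ofReal_add (by norm_num) hl]
        exact hz.trans (by gcongr)
      rw [ofReal_le_ofReal_iff (by positivity)] at this
      linarith
    exact ⟨fin _ _ hX1 h2.1, fin _ _ hX2 h2.2⟩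
  obtain ⟨T, hT, hr⟩ := hx.regular
  have hsub : ∀ {a b : ℝ}, 0 ≤ a → b ≤ 1 → ∀ τ ∈ Ioo a b \ T, τ ∈ 𝕀 ∧ τ ∈ Ioo (0 : ℝ) 1 \ T :=
    fun ha hb τ hτ => ⟨⟨ha.trans hτ.1.1.le, hτ.1.2.le.trans hb⟩,
      ⟨⟨ha.trans_lt hτ.1.1, hτ.1.2.trans_le hb⟩, hτ.2⟩⟩
  have key := le_of_first_last_visit (E := fun a b => lengthDist U S H (Φ (x a)) (Φ (x b)))
    (L := fun a b => arcLength (coneForm b1 b2) x a b) (A := ofReal ((1 + δ) * h))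
    (η := ofReal (2 * δ * h))
    (fun _ _ _ => lengthDist_triangle hH _ _ _) hx.continuousOn C.isClosed
    (fun a m b => arcLength_add) ?_ ?_
  · simp only [hx0, hx1] at key
    refine key.trans ?_
    have e : h * ((1 + δ) * l + 2 * δ) = (1 + δ) * h * l + 2 * δ * h := by ring
    rw [e, ofReal_add (by positivity) (by positivity), ofReal_mul (q := l) (by positivity)]
    gcongr
  · intro a b ha hab hb hK
    have hder : ∀ τ ∈ Ioo a b \ T, ContDiffAt ℝ 1 (Φ ∘ x) τ ∧
        deriv (Φ ∘ x) τ = 𝒟 Φ (x τ) (deriv x τ) := by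
      intro τ hτ
      obtain ⟨h1, h2⟩ := hsub ha hb τ hτ
      exact ⟨C.contDiff.contDiffAt.comp τ (hr τ h2).2,
        ((C.contDiff.differentiable (by norm_num) _).hasFDerivAt.comp_hasDerivAt τ
          ((hr τ h2).2.differentiableAt (by norm_num)).hasDerivAt).deriv⟩
    have hS : ∀ τ ∈ Ioo a b \ T, Φ (x τ) ∈ S := fun τ hτ =>
      (C.regular_iff _ (hbox τ (hsub ha hb τ hτ).1) (hK τ hτ.1)).2 (hr τ (hsub ha hb τ hτ).2).1
    have hp : IsPathOn U S (Φ ∘ x) a b := by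
      refine ⟨C.contDiff.continuous.comp_continuousOn (hx.continuousOn.mono (Icc_subset_Icc ha hb)),
        fun τ hτ => (C.mapsTo _ (hbox τ (Icc_subset_Icc ha hb hτ))).2, T, hT, fun τ hτ => ?_⟩
      exact ⟨hS τ hτ, (hder τ hτ).1⟩
    refine (hp.lengthDist_le hH hab).trans (arcLength_le_mul hT ofReal_ne_top fun τ hτ => ?_)
    rw [speed, speed, ofReal_mul_ofReal, (hder τ hτ).2]
    apply ofReal_le_ofReal
    apply sqrt_le_mul_of_close hδ hh (Real.sqrt_nonneg _)
    rw [sq_sqrt (by rw [coneForm_eq]; positivity)]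
    exact C.upper _ (hbox τ (hsub ha hb τ hτ).1) (hK τ hτ.1) (hS τ hτ) _
  · intro a b ha hab hb hKa hKb
    have hKne : K.Nonempty := ⟨_, hKa⟩
    have hIa : a ∈ 𝕀 := ⟨ha, hab.le.trans hb⟩
    have hIb : b ∈ 𝕀 := ⟨ha.trans hab.le, hb⟩
    set e : ℝ → ℂ² := fun τ => Φ ((x τ).1, σ (x τ).1) with he
    have hhor : lengthDist U S H (e a) (e b)
        ≤ ofReal ((1 + δ) * h) * arcLength (coneForm b1 b2) x a b := by
      have hg : ContDiff ℝ 1 fun z : ℂ => (z, σ z) := contDiff_id.prodMk C.contDiff_sec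
      have hder : ∀ τ ∈ Ioo a b \ T, ContDiffAt ℝ 1 e τ ∧ deriv e τ = 𝒟 Φ ((x τ).1, σ (x τ).1)
            ((deriv x τ).1, 𝒟 σ (x τ).1 (deriv x τ).1) := by
        intro τ hτ
        obtain ⟨h1, h2⟩ := hsub ha hb τ hτ
        have hd1 := HasDerivAt.fst' ((hr τ h2).2.differentiableAt (by norm_num)).hasDerivAt
        have hd2 := (C.contDiff_sec.differentiable (by norm_num)
          (x τ).1).hasFDerivAt.comp_hasDerivAt τ hd1
        refine ⟨(C.contDiff.comp hg).contDiffAt.comp τ (contDiffAt_fst.comp τ (hr τ h2).2), ?_⟩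
        exact ((C.contDiff.differentiable (by norm_num) _).hasFDerivAt.comp_hasDerivAt τ
          (hd1.prodMk hd2)).deriv
      have hp : IsPathOn U S e a b := by
        refine ⟨(C.contDiff.comp hg).continuous.comp_continuousOn
          (hx.continuousOn.fst.mono (Icc_subset_Icc ha hb)),
          fun τ hτ => C.sec_mem hKne _ (hbox τ (Icc_subset_Icc ha hb hτ)).1,
          T, hT, fun τ hτ => ⟨?_, (hder τ hτ).1⟩⟩
        exact C.sec_regular hKne _ (hbox τ (hsub ha hb τ hτ).1).1 (hr τ (hsub ha hb τ hτ).2).1.1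
      refine (hp.lengthDist_le hH hab).trans (arcLength_le_mul hT ofReal_ne_top fun τ hτ => ?_)
      rw [speed, speed, ofReal_mul_ofReal, (hder τ hτ).2]
      apply ofReal_le_ofReal
      refine (sqrt_le_mul_of_close hδ hh (by positivity)
        (C.sec_upper hKne _ (hbox τ (hsub ha hb τ hτ).1).1
          (hr τ (hsub ha hb τ hτ).2).1.1 _)).trans ?_
      gcongr
      exact fst_le_sqrt_coneForm _ _
    have hd : ∀ τ ∈ 𝕀, x τ ∈ K → ∀ q, lengthDist U S H (Φ (x τ)) q
        ≤ ofReal (δ * h) + lengthDist U S H (e τ) q := by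
      intro τ hτ hK q
      rcases C.vertical _ (hbox τ hτ) hK with h1 | h1
      · rw [he]; simp only [← h1]; exact le_add_self
      · exact (lengthDist_triangle hH _ (e τ) _).trans (add_le_add h1 le_rfl)
    calc lengthDist U S H (Φ (x a)) (Φ (x b))
        ≤ ofReal (δ * h) + lengthDist U S H (e a) (Φ (x b)) := hd a hIa hKa _
      _ ≤ ofReal (δ * h) + (ofReal (δ * h) + lengthDist U S H (e a) (e b)) := by
          gcongr 1
          rw [lengthDist_comm hH (e a), lengthDist_comm hH (e a)]
          exact hd b hIb hKb _
      _ ≤ ofReal (δ * h) + (ofReal (δ * h) +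
          ofReal ((1 + δ) * h) * arcLength (coneForm b1 b2) x a b) := by gcongr
      _ = ofReal ((1 + δ) * h) * arcLength (coneForm b1 b2) x a b
          + (ofReal (δ * h) + ofReal (δ * h)) := by ring
      _ = _ := by rw [ofReal_add_ofReal]; congr 2; ring

/-- The rescaled ball around a point near the apex of a chart is Gromov-Hausdorff close to the
unit ball of the model cone. -/
theorem ghEDist_le (C : ConeChart U S H b1 b2 h δ Φ Ψ O K σ) (hH : IsLineElement H)
    (hb1 : 0 < b1) (hb11 : b1 ≤ 1) (hb2 : 0 < b2) (hb21 : b2 ≤ 1) (hδ : 0 < δ) (hδ1 : δ ≤ 1 / 100)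
    (hh : 0 < h) (hdef : ∀ x y, lengthDist U S H x y = 0 → x = y) {X0 : ℂ²}
    (hX1 : ‖X0.1‖ ^ b1 ≤ δ) (hX2 : ‖X0.2‖ ^ b2 ≤ δ) :
    ghEDist (rescaledBallDist (lengthDist U S H) (Φ X0) h)
      (rescaledBallDist (coneDist b1 b2) 0 1) ≤ ofReal (40 * δ) := by
  set d := lengthDist U S H with hd
  set D := coneDist b1 b2 with hD
  have hDl := isLineElement_coneForm b1 b2
  have dtri : ∀ x y z, d x z ≤ d x y + d y z := lengthDist_triangle hH
  have Dtri : ∀ x y z, D x z ≤ D x y + D y z := lengthDist_triangle hDl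
  have dcomm : ∀ x y, d x y = d y x := lengthDist_comm hH
  have Dcomm : ∀ x y, D x y = D y x := lengthDist_comm hDl
  have hX0D : D 0 X0 ≤ ofReal (6 * δ) := by
    refine (coneDist_le hb1 hb11 hb2 hb21 _ _).trans (ofReal_le_ofReal ?_)
    simp only [Prod.fst_zero, Prod.snd_zero, sub_zero]; linarith
  have Dcoord : ∀ Y, D 0 Y < ofReal 1 → ‖Y.1‖ ^ b1 ≤ 3 / 2 ∧ ‖Y.2‖ ^ b2 ≤ 3 / 2 := by
    intro Y hY
    have := ofReal_le_coneDist hb1 hb2 0 Y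
    simp only [Prod.fst_zero, Prod.snd_zero, norm_zero, zero_rpow hb1.ne',
      zero_rpow hb2.ne', ENNReal.ofReal_zero, zero_add] at this
    have a1 := (ofReal_lt_ofReal_iff one_pos).1 (this.1.trans_lt hY)
    have a2 := (ofReal_lt_ofReal_iff one_pos).1 (this.2.trans_lt hY)
    constructor <;> linarith
  have dmet : IsMetric (rescaledBallDist d (Φ X0) h) := by
    have hf : ∀ x : ballOf d (Φ X0) h, d (Φ X0) x ≠ ⊤ := fun x => (lt_of_lt_of_le x.2 le_top).ne
    refine ⟨fun x y => ?_, fun x => ?_, fun x y => ?_, fun x y z => ?_, fun x y hxy => ?_⟩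
    · refine mul_ne_top ofReal_ne_top (ne_top_of_le_ne_top ?_ (dtri x (Φ X0) y))
      rw [dcomm]; exact add_ne_top.2 ⟨hf x, hf y⟩
    · simp only [rescaledBallDist]; rw [show d x x = 0 from lengthDist_self hH (hf x), mul_zero]
    · simp only [rescaledBallDist]; rw [dcomm]
    · simp only [rescaledBallDist]; rw [← mul_add]; gcongr; exact dtri _ _ _
    · simp only [rescaledBallDist, mul_eq_zero, ofReal_eq_zero, inv_nonpos,
        not_le.2 hh, false_or] at hxy
      exact Subtype.ext (hdef _ _ hxy)
  have Dmet : IsMetric (rescaledBallDist D 0 1) := by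
    have hf : ∀ x : ballOf D 0 1, D 0 x ≠ ⊤ := fun x => (lt_of_lt_of_le x.2 le_top).ne
    refine ⟨fun x y => ?_, fun x => ?_, fun x y => ?_, fun x y z => ?_, fun x y hxy => ?_⟩
    · refine mul_ne_top ofReal_ne_top (ne_top_of_le_ne_top ?_ (Dtri x 0 y))
      rw [Dcomm]; exact add_ne_top.2 ⟨hf x, hf y⟩
    · simp only [rescaledBallDist]; rw [show D x x = 0 from lengthDist_self hDl (hf x), mul_zero]
    · simp only [rescaledBallDist]; rw [Dcomm]
    · simp only [rescaledBallDist]; rw [← mul_add]; gcongr; exact Dtri _ _ _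
    · simp only [rescaledBallDist, mul_eq_zero, ofReal_eq_zero, inv_nonpos,
        not_le.2 one_pos, false_or] at hxy
      exact Subtype.ext (eq_of_coneDist_eq_zero hb1 hb11 hb2 hb21 hxy)
  -- a point of the cone ball and a point of the other ball correspond if they are close
  let R : ballOf d (Φ X0) h → ballOf D 0 1 → Prop := fun x Y => d x (Φ Y) ≤ ofReal (h * (24 * δ))
  have hR1 : ∀ x, ∃ Y, R x Y := by
    rintro ⟨x, hx⟩
    have hx' : d (Φ X0) x < ofReal (h * 1) := by rw [mul_one]; exact hx
    obtain ⟨X, hX, rfl, hXb1, hXb2⟩ := C.exists_preimage hb1 hb2 hδ.le (by linarith) hh hX1 hX2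
      le_rfl zero_le_one (by linarith) hx'
    have h1 := C.coneDist_le_of_dist_lt hb1 hb11 hb2 hb21 hδ (by linarith) hh (l := 1)
      (by linarith) (by linarith) hX zero_le_one (by norm_num) hx'
    have h2 : D 0 X < ofReal (1 + 21 * δ) := by
      refine (Dtri 0 X0 X).trans_lt ((add_le_add hX0D h1).trans_lt ?_)
      rw [ofReal_add_ofReal, ofReal_lt_ofReal_iff (by positivity)]
      linarith
    obtain ⟨Y, hY1, hY2⟩ := exists_intermediate hDl one_pos (by positivity) h2
    refine ⟨⟨Y, hY1⟩, ?_⟩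
    have hc := Dcoord Y hY1
    change d (Φ X) (Φ Y) ≤ _
    rw [dcomm]
    refine (C.dist_le_of_coneDist_lt hH hb1 hb2 hδ.le hh hc.1 hc.2 (by positivity)
      (by linarith) hY2).trans (ofReal_le_ofReal ?_)
    gcongr
    nlinarith
  have hR2 : ∀ Y, ∃ x, R x Y := by
    rintro ⟨Y, hY⟩
    have hY' : D 0 Y < ofReal 1 := hY
    have h1 : D X0 Y < ofReal (1 + 6 * δ) := by
      rw [add_comm 1, ofReal_add (by positivity) zero_le_one]
      refine (Dtri X0 0 Y).trans_lt ?_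
      rw [Dcomm]
      exact ENNReal.add_lt_add_of_le_of_lt (ne_top_of_le_ne_top ofReal_ne_top hX0D) hX0D hY'
    have h2 := C.dist_le_of_coneDist_lt hH hb1 hb2 hδ.le hh (by linarith : ‖X0.1‖ ^ b1 ≤ 3 / 2)
      (by linarith) (by positivity) (by linarith) h1
    have h3 : d (Φ X0) (Φ Y) < ofReal (h + h * (11 * δ)) := by
      refine h2.trans_lt ((ofReal_lt_ofReal_iff (by positivity)).2 ?_)
      have : (1 + δ) * (1 + 6 * δ) + 2 * δ < 1 + 11 * δ := by nlinarith
      nlinarith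
    obtain ⟨x, hx1, hx2⟩ := exists_intermediate hH hh (by positivity) h3
    refine ⟨⟨x, hx1⟩, hx2.le.trans (ofReal_le_ofReal ?_)⟩
    gcongr; linarith
  have : Nonempty (ballOf d (Φ X0) h) := by
    obtain ⟨x, -⟩ := hR2 ⟨0, by
      change D 0 0 < _
      rw [hD, coneDist, lengthDist_self hDl (p := X0)]
      · simp
      · rw [← coneDist, ← hD, Dcomm]; exact ne_top_of_le_ne_top ofReal_ne_top hX0D⟩
    exact ⟨x⟩
  refine ghEDist_le_of_correspondence dmet Dmet (by positivity) R hR1 hR2 ?_ ?_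
  · rintro ⟨x, hx⟩ ⟨Y, hY⟩ ⟨x', hx'⟩ ⟨Y', hY'⟩ hxY hxY'
    change d x (Φ Y) ≤ _ at hxY
    change d x' (Φ Y') ≤ _ at hxY'
    simp only [rescaledBallDist, inv_one, ofReal_one, one_mul]
    change D 0 Y < _ at hY
    change D 0 Y' < _ at hY'
    have hYY : D Y Y' < ofReal 2 := by
      refine (Dtri Y 0 Y').trans_lt ?_
      rw [Dcomm]
      refine (ENNReal.add_lt_add hY hY').trans_le ?_
      rw [← ofReal_add zero_le_one zero_le_one]; norm_num
    have hfin : D Y Y' ≠ ⊤ := (hYY.trans_le le_top).ne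
    set l := (D Y Y').toReal with hl
    have hl0 : 0 ≤ l := toReal_nonneg
    have hl2 : l < 2 := (lt_ofReal_iff_toReal_lt hfin).1 hYY
    have hlD : D Y Y' = ofReal l := (ofReal_toReal hfin).symm
    have hc := Dcoord Y hY
    have h1 := C.dist_le_of_coneDist_lt hH hb1 hb2 hδ.le hh hc.1 hc.2 (l := l + δ)
      (by positivity) (by linarith) (Y := Y') (by
        rw [← hD, hlD]; exact (ofReal_lt_ofReal_iff (by positivity)).2 (by linarith))
    have h2 : d x x' ≤ ofReal (h * (l + 80 * δ)) := by
      refine (dtri x (Φ Y) x').trans ((add_le_add hxY (dtri _ (Φ Y') _)).trans ?_)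
      rw [dcomm (Φ Y') x']
      refine (add_le_add le_rfl (add_le_add h1 hxY')).trans ?_
      rw [ofReal_add_ofReal, ofReal_add_ofReal]
      apply ofReal_le_ofReal
      rw [← mul_add, ← mul_add]
      apply mul_le_mul_of_nonneg_left _ hh.le
      nlinarith
    calc ofReal h⁻¹ * d x x' ≤ ofReal h⁻¹ * ofReal (h * (l + 80 * δ)) := by gcongr
      _ = ofReal (l + 80 * δ) := by rw [ofReal_mul_ofReal]; congr 1; field_simp
      _ = _ := by rw [ofReal_add hl0 (by positivity), hlD]; congr 2; ring
  · rintro ⟨x, hx⟩ ⟨Y, hY⟩ ⟨x', hx'⟩ ⟨Y', hY'⟩ hxY hxY'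
    change d x (Φ Y) ≤ _ at hxY
    change d x' (Φ Y') ≤ _ at hxY'
    change d (Φ X0) x < _ at hx
    change d (Φ X0) x' < _ at hx'
    simp only [rescaledBallDist, inv_one, ofReal_one, one_mul]
    have hxx : d x x' < ofReal (h * 2) := by
      refine (dtri x (Φ X0) x').trans_lt ?_
      rw [dcomm]
      refine (ENNReal.add_lt_add hx hx').trans_le ?_
      rw [← ofReal_add hh.le hh.le]; apply ofReal_le_ofReal; linarith
    have hfin : d x x' ≠ ⊤ := (hxx.trans_le le_top).ne
    set l := (d x x').toReal / h with hl
    have hl0 : 0 ≤ l := div_nonneg toReal_nonneg hh.le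
    have hhl : (d x x').toReal = h * l := by rw [hl]; field_simp
    have hl2 : l < 2 := by
      rw [hl, div_lt_iff₀ hh, mul_comm]; exact (lt_ofReal_iff_toReal_lt hfin).1 hxx
    have hld : d x x' = ofReal (h * l) := by rw [← hhl, ofReal_toReal hfin]
    have h1 : d (Φ Y) (Φ Y') < ofReal (h * (l + 49 * δ)) := by
      refine (dtri _ x _).trans_lt ((add_le_add le_rfl (dtri x x' _)).trans_lt ?_)
      rw [dcomm (Φ Y) x, hld]
      refine (add_le_add hxY (add_le_add le_rfl hxY')).trans_lt ?_
      rw [ofReal_add_ofReal, ofReal_add_ofReal, ofReal_lt_ofReal_iff (by positivity)]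
      have : 0 < h * δ := by positivity
      nlinarith
    have hc := Dcoord Y hY
    have hc' := Dcoord Y' hY'
    have h2 := C.coneDist_le_of_dist_lt hb1 hb11 hb2 hb21 hδ (by linarith) hh hc.1 hc.2
      (Y := Y') ⟨by linarith, by linarith⟩ (by positivity) (by linarith) h1
    refine h2.trans ?_
    have e : ofReal h⁻¹ * d x x' = ofReal l := by rw [hld, ofReal_mul_ofReal]; congr 1; field_simp
    rw [e, ← ofReal_add hl0 (by positivity)]
    apply ofReal_le_ofReal
    nlinarith

end ConeChart

/-! ### Logarithmic potentials: integrability -/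

theorem lintegral_ball_rpow_lt_top {m : ℝ} (hm : m < 2) :
    ∫⁻ t in ball (0 : ℂ) 1, ofReal (‖t‖ ^ (-m)) < ⊤ := by
  have h : IntegrableOn (fun t : ℂ => ‖t‖ ^ (-m)) (ball 0 1) := by
    rw [integrableOn_fun_norm_addHaar (μ := volume) (f := fun y => y ^ (-m))]
    simp only [Complex.finrank_real_complex, Nat.add_one_sub_one, pow_one, smul_eq_mul]
    have h2 : IntegrableOn (fun y : ℝ => y ^ (1 - m)) (Ioo 0 1) :=
      (intervalIntegral.integrableOn_Ioo_rpow_iff one_pos).2 (by linarith)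
    refine h2.congr_fun (fun y hy => ?_) measurableSet_Ioo
    simp only
    rw [sub_eq_add_neg, rpow_add hy.1, rpow_one]
  have := h.2
  rw [hasFiniteIntegral_iff_ofReal (.of_forall fun t => by positivity)] at this
  exact this

theorem lintegral_rpow_sub_le {m : ℝ} (hm : 0 ≤ m) (B : Set ℂ) (u : ℂ) :
    ∫⁻ t in B, ofReal (‖t - u‖ ^ (-m))
      ≤ volume B + ∫⁻ t in ball (0 : ℂ) 1, ofReal (‖t‖ ^ (-m)) := by
  set F : ℂ → ℝ≥0∞ := indicator (ball 0 1) fun t => ofReal (‖t‖ ^ (-m)) with hF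
  have hpt : ∀ t : ℂ, ofReal (‖t - u‖ ^ (-m)) ≤ 1 + F (t - u) := by
    intro t
    by_cases ht : t - u ∈ ball (0 : ℂ) 1
    · rw [hF, indicator_of_mem ht]; exact le_add_self
    · refine le_trans ?_ le_self_add
      rw [← ofReal_one]
      rw [mem_ball_zero_iff, not_lt] at ht
      exact ofReal_le_ofReal (Real.rpow_le_one_of_one_le_of_nonpos ht (by linarith))
  calc ∫⁻ t in B, ofReal (‖t - u‖ ^ (-m)) ≤ ∫⁻ t in B, (1 + F (t - u)) := lintegral_mono hpt
    _ = volume B + ∫⁻ t in B, F (t - u) := by rw [lintegral_add_left measurable_const]; simp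
    _ ≤ volume B + ∫⁻ t, F (t - u) := by gcongr; exact Measure.restrict_le_self
    _ = _ := by
        rw [lintegral_sub_right_eq_self F u, hF, lintegral_indicator isOpen_ball.measurableSet]

theorem lintegral_far_rpow_lt_top {m ρ : ℝ} (hm : 2 < m) (hρ : 1 ≤ ρ) :
    ∫⁻ t in {t : ℂ | ρ < ‖t‖}, ofReal (‖t‖ ^ (-m)) < ⊤ := by
  have h1 : Integrable (fun t : ℂ => 2 ^ m * (1 + ‖t‖) ^ (-m)) :=
    (integrable_one_add_norm (by simpa using hm)).const_mul _
  have h2 := h1.2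
  rw [hasFiniteIntegral_iff_ofReal (.of_forall fun t => by positivity)] at h2
  refine lt_of_le_of_lt ?_ h2
  refine le_trans ?_ (setLIntegral_le_lintegral {t : ℂ | ρ < ‖t‖} _)
  refine setLIntegral_mono' (measurableSet_lt measurable_const measurable_norm) fun t ht => ?_
  apply ofReal_le_ofReal
  have ht' : 1 < ‖t‖ := lt_of_le_of_lt hρ ht
  have h0 : 0 < ‖t‖ := by linarith
  calc ‖t‖ ^ (-m) = 2 ^ m * (2 * ‖t‖) ^ (-m) := by
        rw [mul_rpow (by norm_num) h0.le, ← mul_assoc, ← rpow_add (by norm_num)]; simp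
    _ ≤ _ := by
        gcongr ?_ * ?_
        exact rpow_le_rpow_of_nonpos (by positivity) (by linarith) (by linarith)

/-- Trading part of a product of two singular kernels for a power of the distance of their
poles: one of the two distances is at least half the distance of the poles. -/
theorem rpow_mul_rpow_le {p κ q x y d : ℝ} (hx : 0 < x) (hy : 0 < y) (hd : 0 ≤ d)
    (hdxy : d ≤ x + y) (hq : 0 ≤ q) (hqp : q ≤ p) (hqκ : q ≤ κ) (hd0 : q = 0 ∨ 0 < d) :
    x ^ (-p) * y ^ (-κ) ≤ (d / 2) ^ (-q) * (x ^ (-(p + κ - q)) + y ^ (-(p + κ - q))) := by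
  have key : ∀ {p κ x y : ℝ}, 0 < x → 0 < y → d ≤ x + y → q ≤ p → q ≤ κ → y ≤ x →
      x ^ (-p) * y ^ (-κ) ≤ (d / 2) ^ (-q) * y ^ (-(p + κ - q)) := by
    intro p κ x y hx hy hdxy hqp hqκ hyx
    have h1 : x ^ (-q) ≤ (d / 2) ^ (-q) := by
      rcases hd0 with h | h
      · simp [h]
      · exact rpow_le_rpow_of_nonpos (by positivity) (by linarith) (by linarith)
    have h2 : x ^ (-(p - q)) ≤ y ^ (-(p - q)) := rpow_le_rpow_of_nonpos hy hyx (by linarith)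
    calc x ^ (-p) * y ^ (-κ) = x ^ (-q) * (x ^ (-(p - q)) * y ^ (-κ)) := by
          rw [← mul_assoc, ← rpow_add hx]; congr 2; ring
      _ ≤ (d / 2) ^ (-q) * (y ^ (-(p - q)) * y ^ (-κ)) := by gcongr
      _ = _ := by rw [← rpow_add hy]; congr 2; ring
  rcases le_total y x with h | h
  · refine (key hx hy hdxy hqp hqκ h).trans ?_
    gcongr
    linarith [rpow_nonneg hx.le (-(p + κ - q))]
  · have := key hy hx (by linarith) hqκ hqp h
    rw [mul_comm, add_comm κ p] at this
    refine this.trans ?_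
    gcongr
    linarith [rpow_nonneg hy.le (-(p + κ - q))]

/-- A measurable density on `ℂ` with at most power singularities of order less than two at the
points `a j`, and decaying faster than `‖t‖⁻²` at infinity. -/
structure IsDensity {ι : Type} [Fintype ι] (a : ι → ℂ) (p : ι → ℝ) (m A ρ : ℝ) (f : ℂ → ℝ) :
    Prop where
  measurable : Measurable f
  p_pos : ∀ j, 0 < p j
  p_lt : ∀ j, p j < 2
  m_gt : 2 < m
  A_nonneg : 0 ≤ A
  one_le : 1 ≤ ρ
  near : ∀ᵐ t, ‖t‖ ≤ ρ → |f t| ≤ A * ∑ j, ‖t - a j‖ ^ (-p j)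
  far : ∀ᵐ t, ρ < ‖t‖ → |f t| ≤ A * ‖t‖ ^ (-m)

theorem lintegral_near_le {p κ q ρ : ℝ} (hq : 0 ≤ q) (hqp : q ≤ p) (hqκ : q ≤ κ)
    {a u : ℂ} (hu : q = 0 ∨ u ≠ a) :
    ∫⁻ t in closedBall (0 : ℂ) ρ, ofReal (‖t - a‖ ^ (-p) * ‖t - u‖ ^ (-κ))
      ≤ ofReal ((‖u - a‖ / 2) ^ (-q)) * (2 * (volume (closedBall (0 : ℂ) ρ)
        + ∫⁻ t in ball (0 : ℂ) 1, ofReal (‖t‖ ^ (-(p + κ - q))))) := by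
  set M := volume (closedBall (0 : ℂ) ρ) + ∫⁻ t in ball (0 : ℂ) 1, ofReal (‖t‖ ^ (-(p + κ - q)))
  have hr : 0 ≤ p + κ - q := by linarith
  calc _ ≤ ∫⁻ t in closedBall (0 : ℂ) ρ, ofReal ((‖u - a‖ / 2) ^ (-q)) *
        (ofReal (‖t - a‖ ^ (-(p + κ - q))) + ofReal (‖t - u‖ ^ (-(p + κ - q)))) := by
        apply lintegral_mono_ae
        have hfin : ({a, u} : Set ℂ).Countable := (toFinite _).countable
        filter_upwards [ae_restrict_of_ae (hfin.ae_notMem volume)] with t ht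
        simp only [mem_insert_iff, mem_singleton_iff, not_or] at ht
        rw [ofReal_add_ofReal, ofReal_mul_ofReal]
        apply ofReal_le_ofReal
        apply rpow_mul_rpow_le (norm_sub_pos_iff.2 ht.1)
          (norm_sub_pos_iff.2 ht.2) (norm_nonneg _) _ hq hqp hqκ
        · exact hu.imp id fun h => norm_sub_pos_iff.2 h
        · calc ‖u - a‖ = ‖(t - a) - (t - u)‖ := by congr 1; ring
            _ ≤ _ := norm_sub_le _ _
    _ ≤ ofReal ((‖u - a‖ / 2) ^ (-q)) * (M + M) := by
        rw [lintegral_const_mul' _ _ ofReal_ne_top, lintegral_add_left (by fun_prop)]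
        gcongr <;> exact lintegral_rpow_sub_le hr _ _
    _ = _ := by rw [two_mul]

theorem lintegral_far_le {m κ ρ : ℝ} (hm : 0 < m) (hκ : 0 ≤ κ) (hρ : 1 ≤ ρ) (u : ℂ) :
    ∫⁻ t in {t : ℂ | ρ < ‖t‖}, ofReal (‖t‖ ^ (-m) * ‖t - u‖ ^ (-κ))
      ≤ (∫⁻ t in {t : ℂ | ρ < ‖t‖}, ofReal (‖t‖ ^ (-m))) +
        ∫⁻ t in ball (0 : ℂ) 1, ofReal (‖t‖ ^ (-κ)) := by
  set F : ℂ → ℝ≥0∞ := indicator (ball 0 1) fun t => ofReal (‖t‖ ^ (-κ)) with hF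
  calc _ ≤ ∫⁻ t in {t : ℂ | ρ < ‖t‖}, (ofReal (‖t‖ ^ (-m)) + F (t - u)) := by
        refine setLIntegral_mono' (measurableSet_lt measurable_const measurable_norm) fun t ht => ?_
        have ht' : 1 < ‖t‖ := lt_of_le_of_lt hρ ht
        have h1 : ‖t‖ ^ (-m) ≤ 1 := Real.rpow_le_one_of_one_le_of_nonpos ht'.le (by linarith)
        by_cases h : t - u ∈ ball (0 : ℂ) 1
        · rw [hF, indicator_of_mem h]
          refine le_trans (ofReal_le_ofReal ?_) le_add_self
          exact mul_le_of_le_one_left (by positivity) h1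
        · refine le_trans (ofReal_le_ofReal ?_) le_self_add
          rw [mem_ball_zero_iff, not_lt] at h
          exact mul_le_of_le_one_right (by positivity)
            (Real.rpow_le_one_of_one_le_of_nonpos h (by linarith))
    _ = (∫⁻ t in {t : ℂ | ρ < ‖t‖}, ofReal (‖t‖ ^ (-m))) +
        ∫⁻ t in {t : ℂ | ρ < ‖t‖}, F (t - u) := by
        rw [lintegral_add_left (by fun_prop)]
    _ ≤ (∫⁻ t in {t : ℂ | ρ < ‖t‖}, ofReal (‖t‖ ^ (-m))) + ∫⁻ t, F (t - u) := by
        gcongr; exact Measure.restrict_le_self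
    _ = _ := by
        rw [lintegral_sub_right_eq_self F u, hF, lintegral_indicator isOpen_ball.measurableSet]

variable {ι : Type} [Fintype ι] {a : ι → ℂ} {p : ι → ℝ} {m A ρ : ℝ} {f : ℂ → ℝ}

namespace IsDensity

/-- The potential of a density for the kernel `‖t - u‖^(-κ)` is finite, and blows up at the
singular points at most like the powers `q j`. -/
theorem lintegral_kernel_le (hf : IsDensity a p m A ρ f) {κ : ℝ} (hκ2 : κ < 2)
    {q : ι → ℝ} (hκ : 0 ≤ κ) (hq : ∀ j, 0 ≤ q j) (hqp : ∀ j, q j ≤ p j) (hqκ : ∀ j, q j ≤ κ)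
    (hlt : ∀ j, p j + κ - q j < 2) : ∃ C : ℝ, 0 ≤ C ∧ ∀ u, (∀ j, q j = 0 ∨ u ≠ a j) →
      ∫⁻ t, ‖f t‖ₑ * ofReal (‖t - u‖ ^ (-κ)) ≤ ofReal (C * (1 + ∑ j, ‖u - a j‖ ^ (-q j))) := by
  set M : ι → ℝ≥0∞ := fun j => 2 * (volume (closedBall (0 : ℂ) ρ)
        + ∫⁻ t in ball (0 : ℂ) 1, ofReal (‖t‖ ^ (-(p j + κ - q j))))
  have hM : ∀ j, M j ≠ ⊤ := fun j => mul_ne_top (by norm_num) (add_ne_top.2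
    ⟨(Metric.isBounded_closedBall.measure_lt_top).ne, (lintegral_ball_rpow_lt_top (hlt j)).ne⟩)
  set M' : ℝ≥0∞ := (∫⁻ t in {t : ℂ | ρ < ‖t‖}, ofReal (‖t‖ ^ (-m))) +
        ∫⁻ t in ball (0 : ℂ) 1, ofReal (‖t‖ ^ (-κ))
  have hM' : M' ≠ ⊤ := add_ne_top.2
    ⟨(lintegral_far_rpow_lt_top hf.m_gt hf.one_le).ne, (lintegral_ball_rpow_lt_top hκ2).ne⟩
  set C : ℝ := A * (M'.toReal + ∑ j, (1 / 2 : ℝ) ^ (-q j) * (M j).toReal)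
  have hA := hf.A_nonneg
  refine ⟨C, by positivity, fun u hu => ?_⟩
  have hsplit : ∫⁻ t, ‖f t‖ₑ * ofReal (‖t - u‖ ^ (-κ)) =
      (∫⁻ t in closedBall (0 : ℂ) ρ, ‖f t‖ₑ * ofReal (‖t - u‖ ^ (-κ))) +
      ∫⁻ t in {t : ℂ | ρ < ‖t‖}, ‖f t‖ₑ * ofReal (‖t - u‖ ^ (-κ)) := by
    have : {t : ℂ | ρ < ‖t‖} = (closedBall (0 : ℂ) ρ)ᶜ := by ext t; simp
    rw [this, lintegral_add_compl _ isClosed_closedBall.measurableSet]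
  have hnear : ∫⁻ t in closedBall (0 : ℂ) ρ, ‖f t‖ₑ * ofReal (‖t - u‖ ^ (-κ))
      ≤ ofReal A * ∑ j, ofReal ((‖u - a j‖ / 2) ^ (-q j)) * M j := by
    calc _ ≤ ∫⁻ t in closedBall (0 : ℂ) ρ, ofReal A *
          ∑ j, ofReal (‖t - a j‖ ^ (-p j) * ‖t - u‖ ^ (-κ)) := by
          apply lintegral_mono_ae
          filter_upwards [ae_restrict_of_ae hf.near,
            ae_restrict_mem isClosed_closedBall.measurableSet] with t ht htm
          rw [← ofReal_sum_of_nonneg fun _ _ => by positivity,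
            ← ofReal_mul hA, ← ofReal_norm, ← ofReal_mul (norm_nonneg _)]
          apply ofReal_le_ofReal
          rw [← Finset.sum_mul, ← mul_assoc]
          gcongr
          exact ht (by simpa using htm)
      _ = ofReal A * ∑ j, ∫⁻ t in closedBall (0 : ℂ) ρ,
          ofReal (‖t - a j‖ ^ (-p j) * ‖t - u‖ ^ (-κ)) := by
          rw [lintegral_const_mul' _ _ ofReal_ne_top, lintegral_finsetSum _ fun j _ => by fun_prop]
      _ ≤ _ := by
          gcongr with j
          exact lintegral_near_le (hq j) (hqp j) (hqκ j) (hu j)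
  have hfar : ∫⁻ t in {t : ℂ | ρ < ‖t‖}, ‖f t‖ₑ * ofReal (‖t - u‖ ^ (-κ)) ≤ ofReal A * M' := by
    calc _ ≤ ∫⁻ t in {t : ℂ | ρ < ‖t‖}, ofReal A * ofReal (‖t‖ ^ (-m) * ‖t - u‖ ^ (-κ)) := by
          apply lintegral_mono_ae
          filter_upwards [ae_restrict_of_ae hf.far,
            ae_restrict_mem (measurableSet_lt measurable_const measurable_norm)] with t ht htm
          rw [← ofReal_mul hA, ← ofReal_norm, ← ofReal_mul (norm_nonneg _)]
          apply ofReal_le_ofReal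
          rw [← mul_assoc]
          gcongr
          exact ht htm
      _ ≤ _ := by
          rw [lintegral_const_mul' _ _ ofReal_ne_top]
          gcongr
          exact lintegral_far_le (by linarith [hf.m_gt]) hκ hf.one_le u
  rw [hsplit]
  refine (add_le_add hnear hfar).trans ?_
  have e1 : ofReal A * ∑ j, ofReal ((‖u - a j‖ / 2) ^ (-q j)) * M j
      = ofReal (A * ∑ j, (‖u - a j‖ / 2) ^ (-q j) * (M j).toReal) := by
    rw [ofReal_mul hA, ofReal_sum_of_nonneg fun _ _ => by positivity]
    congr 2
    ext j
    rw [ofReal_mul (by positivity), ofReal_toReal (hM j)]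
  have e2 : ofReal A * M' = ofReal (A * M'.toReal) := by rw [ofReal_mul hA, ofReal_toReal hM']
  rw [e1, e2, ofReal_add_ofReal]
  apply ofReal_le_ofReal
  rw [← mul_add, mul_assoc A]
  gcongr
  have hs : 0 ≤ ∑ j, ‖u - a j‖ ^ (-q j) := by positivity
  have hs2 : 0 ≤ ∑ j, (1 / 2 : ℝ) ^ (-q j) * (M j).toReal := by positivity
  have h3 : ∑ j, (‖u - a j‖ / 2) ^ (-q j) * (M j).toReal
      ≤ (∑ j, (1 / 2 : ℝ) ^ (-q j) * (M j).toReal) * ∑ j, ‖u - a j‖ ^ (-q j) := by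
    rw [Finset.sum_mul]
    refine Finset.sum_le_sum fun j _ => ?_
    rw [div_eq_mul_one_div, mul_rpow (norm_nonneg _) (by norm_num)]
    have : ‖u - a j‖ ^ (-q j) ≤ ∑ j, ‖u - a j‖ ^ (-q j) :=
      Finset.single_le_sum (f := fun j => ‖u - a j‖ ^ (-q j)) (fun _ _ => by positivity)
        (Finset.mem_univ j)
    calc ‖u - a j‖ ^ (-q j) * (1 / 2) ^ (-q j) * (M j).toReal
        = (1 / 2) ^ (-q j) * (M j).toReal * ‖u - a j‖ ^ (-q j) := by ring
      _ ≤ _ := by gcongr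
  nlinarith [mul_nonneg (toReal_nonneg (a := M')) hs]

theorem integrable (hf : IsDensity a p m A ρ f) : Integrable f := by
  obtain ⟨C, -, hC⟩ := hf.lintegral_kernel_le (κ := 0) (q := fun _ => 0) (by norm_num) le_rfl
    (fun _ => le_rfl) (fun j => (hf.p_pos j).le) (fun _ => le_rfl)
    (fun j => by linarith [hf.p_lt j])
  refine ⟨hf.measurable.aestronglyMeasurable, ?_⟩
  have := (hC 0 fun _ => Or.inl rfl).trans_lt ofReal_lt_top
  rw [HasFiniteIntegral]
  simpa using this

theorem integrable_mul_rpow (hf : IsDensity a p m A ρ f) {κ : ℝ} (hκ : 0 < κ)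
    (hκm : 2 < m - κ) : Integrable fun t => f t * (1 + ‖t‖) ^ κ := by
  have hm := hf.measurable
  have hA := hf.A_nonneg
  have hρ := hf.one_le
  have : IsDensity a p (m - κ) (A * (2 * ρ) ^ κ) ρ fun t => f t * (1 + ‖t‖) ^ κ := by
    refine ⟨by fun_prop, hf.p_pos, hf.p_lt, hκm, by positivity, hρ, ?_, ?_⟩
    · filter_upwards [hf.near] with t ht h
      rw [abs_mul, abs_of_nonneg (by positivity : 0 ≤ (1 + ‖t‖) ^ κ), mul_right_comm]
      gcongr
      · exact ht h
      · linarith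
    · filter_upwards [hf.far] with t ht h
      have h0 : 0 < ‖t‖ := by linarith
      rw [abs_mul, abs_of_nonneg (by positivity : 0 ≤ (1 + ‖t‖) ^ κ)]
      have e : ‖t‖ ^ (-(m - κ)) = ‖t‖ ^ (-m) * ‖t‖ ^ κ := by rw [← rpow_add h0]; congr 1; ring
      have h2 : (1 + ‖t‖) ^ κ ≤ (2 * ρ) ^ κ * ‖t‖ ^ κ := by
        rw [← mul_rpow (by positivity) (by positivity)]
        gcongr
        nlinarith
      calc |f t| * (1 + ‖t‖) ^ κ ≤ (A * ‖t‖ ^ (-m)) * ((2 * ρ) ^ κ * ‖t‖ ^ κ) := by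
            gcongr; exact ht h
        _ = _ := by rw [e]; ring
  exact this.integrable

/-- The logarithmic potential integral converges absolutely and grows slower than any power. -/
theorem lintegral_log_le (hf : IsDensity a p m A ρ f) {κ : ℝ} (hκ : 0 < κ)
    (hκp : ∀ j, p j + κ < 2) (hκm : 2 < m - κ) (hκ2 : κ < 2) : ∃ C : ℝ, 0 ≤ C ∧
    ∀ u, ∫⁻ t, ‖f t * log ‖u - t‖‖ₑ ≤ ofReal (C * (1 + ‖u‖) ^ κ) := by
  obtain ⟨C, hC0, hC⟩ := hf.lintegral_kernel_le (κ := κ) (q := fun _ => 0) hκ2 hκ.le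
    (fun _ => le_rfl) (fun j => (hf.p_pos j).le) (fun _ => hκ.le)
    (fun j => by linarith [hκp j])
  have hm := hf.measurable
  set I := (∫⁻ t, ‖f t * (1 + ‖t‖) ^ κ‖ₑ) with hI
  have hIt : I ≠ ⊤ := (hf.integrable_mul_rpow hκ hκm).2.ne
  set S : ℝ := C * (1 + ∑ _j : ι, 1) with hS
  have hS0 : 0 ≤ S := by positivity
  refine ⟨(S + I.toReal) / κ, by positivity, fun u => ?_⟩
  have hlog : ∀ x : ℝ, 0 ≤ x → |log x| ≤ (x ^ (-κ) + x ^ κ) / κ := by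
    intro x hx
    rw [abs_le']
    have h1 := Real.log_le_rpow_div hx hκ
    have h2 := Real.log_le_rpow_div (inv_nonneg.2 hx) hκ
    rw [log_inv, Real.inv_rpow hx, ← rpow_neg hx] at h2
    have h3 : 0 ≤ x ^ (-κ) / κ := by positivity
    have h4 : 0 ≤ x ^ κ / κ := by positivity
    rw [add_div]
    constructor <;> linarith
  have hpt : ∀ t, ‖f t * log ‖u - t‖‖ₑ ≤ ofReal κ⁻¹ * (‖f t‖ₑ * ofReal (‖t - u‖ ^ (-κ))
        + ofReal ((1 + ‖u‖) ^ κ) * ‖f t * (1 + ‖t‖) ^ κ‖ₑ) := by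
    intro t
    rw [← ofReal_norm, ← ofReal_norm, ← ofReal_norm, ← ofReal_mul (norm_nonneg _),
      ofReal_mul_ofReal, ofReal_add_ofReal,
      ofReal_mul_ofReal]
    apply ofReal_le_ofReal
    rw [norm_mul, norm_mul, norm_eq_abs (log _), norm_of_nonneg (by positivity : 0 ≤ (1 + ‖t‖) ^ κ)]
    have h1 : ‖t - u‖ ^ κ ≤ (1 + ‖u‖) ^ κ * (1 + ‖t‖) ^ κ := by
      rw [← mul_rpow (by positivity) (by positivity)]
      gcongr
      nlinarith [norm_sub_le t u, norm_nonneg u, norm_nonneg t,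
        mul_nonneg (norm_nonneg u) (norm_nonneg t)]
    have h2 := hlog ‖u - t‖ (norm_nonneg _)
    rw [norm_sub_rev u t] at h2 ⊢
    calc ‖f t‖ * |log ‖t - u‖|
        ≤ ‖f t‖ * ((‖t - u‖ ^ (-κ) + (1 + ‖u‖) ^ κ * (1 + ‖t‖) ^ κ) / κ) := by
          gcongr
          exact h2.trans (by gcongr)
      _ = _ := by field_simp
  refine (lintegral_mono hpt).trans ?_
  rw [lintegral_const_mul' _ _ ofReal_ne_top, lintegral_add_left (by fun_prop),
    lintegral_const_mul' _ _ ofReal_ne_top, ← hI]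
  have h1 := hC u fun _ => Or.inl rfl
  simp only [neg_zero, rpow_zero] at h1
  refine (mul_le_mul_right (add_le_add_left h1 _) _).trans ?_
  rw [← ofReal_toReal hIt, ofReal_mul_ofReal, ← ofReal_add hS0 (by positivity), ofReal_mul_ofReal]
  apply ofReal_le_ofReal
  rw [ENNReal.toReal_ofReal toReal_nonneg]
  have h3 : 1 ≤ (1 + ‖u‖) ^ κ := Real.one_le_rpow (by linarith [norm_nonneg u]) hκ.le
  rw [inv_mul_eq_div, div_mul_eq_mul_div]
  gcongr
  nlinarith

theorem exists_small_exponent (hf : IsDensity a p m A ρ f) {κ0 : ℝ} (hκ0 : 0 < κ0) :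
    ∃ κ : ℝ, 0 < κ ∧ (∀ j, p j + κ < 2) ∧ 2 < m - κ ∧ κ < 2 ∧ κ < κ0 := by
  have h1 : ∀ᶠ κ : ℝ in nhdsWithin 0 (Ioi 0), ∀ j, p j + κ < 2 := by
    rw [eventually_all]
    intro j
    filter_upwards [nhdsWithin_le_nhds (gt_mem_nhds (by linarith [hf.p_lt j] : 0 < 2 - p j))]
      with κ hκ
    linarith
  have h2 : ∀ᶠ κ : ℝ in nhdsWithin 0 (Ioi 0), κ < m - 2 ∧ κ < 2 ∧ κ < κ0 :=
    nhdsWithin_le_nhds ((gt_mem_nhds (by linarith [hf.m_gt])).and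
      ((gt_mem_nhds two_pos).and (gt_mem_nhds hκ0)))
  obtain ⟨κ, ⟨h1, h2, h3, h4⟩, h5⟩ := ((h1.and h2).and self_mem_nhdsWithin).exists
  exact ⟨κ, h5, h1, by linarith, h3, h4⟩

theorem integrable_log (hf : IsDensity a p m A ρ f) (u : ℂ) :
    Integrable fun t => f t * log ‖u - t‖ := by
  obtain ⟨κ, hκ, hκp, hκm, hκ2, -⟩ := hf.exists_small_exponent one_pos
  obtain ⟨C, -, hC⟩ := hf.lintegral_log_le hκ hκp hκm hκ2
  have hm := hf.measurable
  exact ⟨(by fun_prop : Measurable _).aestronglyMeasurable, (hC u).trans_lt ofReal_lt_top⟩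

end IsDensity

/-! ### Logarithmic potentials: the difference formula -/

/-- The logarithmic potential of the density `f`. -/
noncomputable def logPotential (f : ℂ → ℝ) (u : ℂ) : ℝ := ∫ t, f t * log ‖u - t‖

/-- The Cauchy transform of the density `f`, which is twice the holomorphic derivative of its
logarithmic potential. -/
noncomputable def cauchyTransform (f : ℂ → ℝ) (u : ℂ) : ℂ := ∫ t, (f t : ℂ) / (u - t)

theorem log_norm_add_sub {u v t : ℂ} (h : ∀ s ∈ 𝕀, u + s * v - t ≠ 0) :
    log ‖u + v - t‖ - log ‖u - t‖ = ∫ s in (0 : ℝ)..1, (v / (u + s * v - t)).re := by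
  have hd : ∀ s ∈ uIcc (0 : ℝ) 1, HasDerivAt (fun s : ℝ => log (‖u + s * v - t‖ ^ 2) / 2)
      ((v / (u + s * v - t)).re) s := by
    intro s hs
    rw [uIcc_of_le zero_le_one] at hs
    have h0 := h s hs
    have h1 : HasDerivAt (fun s : ℝ => u + s * v - t) v s := by
      simpa using (((ofRealCLM.hasDerivAt (x := s)).mul_const v).const_add u).sub_const t
    have h2 := (h1.norm_sq.log (by positivity)).div_const 2
    refine h2.congr_deriv ?_
    rw [Complex.inner, div_re, ← normSq_eq_norm_sq]
    simp only [mul_re, conj_re, conj_im]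
    field_simp
    ring
  have hc : ContinuousOn (fun s : ℝ => (v / (u + s * v - t)).re) (uIcc 0 1) := by
    rw [uIcc_of_le zero_le_one]
    exact continuous_re.comp_continuousOn (continuousOn_const.div (by fun_prop) h)
  rw [intervalIntegral.integral_eq_sub_of_hasDerivAt hd hc.intervalIntegrable]
  simp [Real.log_pow]

/-- The exponent of the blow-up of the Cauchy transform of a density at a pole of order `p`. -/
noncomputable def poleExp (p : ℝ) : ℝ := max 0 (3 / 4 * p - 1 / 2)

theorem poleExp_nonneg (p : ℝ) : 0 ≤ poleExp p := le_max_left _ _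

theorem poleExp_le {p : ℝ} (hp : 0 < p) : poleExp p ≤ p := max_le hp.le (by linarith)

theorem poleExp_lt_one {p : ℝ} (hp2 : p < 2) : poleExp p < 1 := max_lt one_pos (by linarith)

theorem sub_one_lt_poleExp {p : ℝ} (hp2 : p < 2) : p - 1 < poleExp p :=
  lt_max_of_lt_right (by linarith)

theorem two_mul_poleExp_lt {p : ℝ} (hp : 0 < p) (hp2 : p < 2) : 2 * poleExp p < p := by
  rw [poleExp, mul_max_of_nonneg _ _ two_pos.le]
  exact max_lt (by linarith) (by linarith)

namespace IsDensity

theorem lintegral_cauchy_le (hf : IsDensity a p m A ρ f) : ∃ C : ℝ, 0 ≤ C ∧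
    ∀ u, (∀ j, u ≠ a j) → ∫⁻ t, ‖f t‖ₑ * ofReal (‖t - u‖ ^ (-1 : ℝ))
        ≤ ofReal (C * (1 + ∑ j, ‖u - a j‖ ^ (-poleExp (p j)))) := by
  obtain ⟨C, hC0, hC⟩ := hf.lintegral_kernel_le (κ := 1) (q := fun j => poleExp (p j))
    (by norm_num) zero_le_one (fun _ => poleExp_nonneg _)
    (fun j => poleExp_le (hf.p_pos j)) (fun j => (poleExp_lt_one (hf.p_lt j)).le)
    (fun j => by linarith [sub_one_lt_poleExp (hf.p_lt j)])
  exact ⟨C, hC0, fun u hu => hC u fun j => Or.inr (hu j)⟩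

theorem enorm_cauchy_kernel (f : ℂ → ℝ) (u t : ℂ) :
    ‖(f t : ℂ) / (u - t)‖ₑ = ‖f t‖ₑ * ofReal (‖t - u‖ ^ (-1 : ℝ)) := by
  rw [← ofReal_norm, ← ofReal_norm, ← ofReal_mul (norm_nonneg _), norm_div,
    norm_real, rpow_neg_one, norm_sub_rev, div_eq_mul_inv]

theorem integrable_cauchy (hf : IsDensity a p m A ρ f) {u : ℂ} (hu : ∀ j, u ≠ a j) :
    Integrable fun t => (f t : ℂ) / (u - t) := by
  obtain ⟨C, -, hC⟩ := hf.lintegral_cauchy_le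
  have hm := hf.measurable
  refine ⟨(by fun_prop : Measurable _).aestronglyMeasurable, ?_⟩
  rw [HasFiniteIntegral]
  simp only [enorm_cauchy_kernel]
  exact (hC u hu).trans_lt ofReal_lt_top

theorem norm_cauchyTransform_le (hf : IsDensity a p m A ρ f) : ∃ C : ℝ, 0 ≤ C ∧
    ∀ u, (∀ j, u ≠ a j) → ‖cauchyTransform f u‖ ≤ C * (1 + ∑ j, ‖u - a j‖ ^ (-poleExp (p j))) := by
  obtain ⟨C, hC0, hC⟩ := hf.lintegral_cauchy_le
  refine ⟨C, hC0, fun u hu => ?_⟩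
  have h := (enorm_integral_le_lintegral_enorm (μ := volume) fun t : ℂ => (f t : ℂ) / (u - t))
  simp only [enorm_cauchy_kernel] at h
  have := h.trans (hC u hu)
  rw [← ofReal_norm] at this
  exact (ofReal_le_ofReal_iff (by positivity)).1 this

theorem ae_segment_ne {v : ℂ} (hv : v ≠ 0) (u : ℂ) (a : ι → ℂ) :
    ∀ᵐ s : ℝ, ∀ j, u + s * v ≠ a j := by
  have hfin : (⋃ j, {s : ℝ | u + s * v = a j}).Countable := by
    refine countable_iUnion fun j => Set.Subsingleton.countable ?_
    intro s hs s' hs'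
    simp only [mem_ofPred_eq] at hs hs'
    have : (s : ℂ) = s' := by apply mul_right_cancel₀ hv; linear_combination hs - hs'
    exact_mod_cast this
  filter_upwards [hfin.ae_notMem volume] with s hs j hj
  exact hs (mem_iUnion.2 ⟨j, hj⟩)

theorem ae_notMem_line (u v : ℂ) : ∀ᵐ t : ℂ, ∀ s : ℝ, u + s * v - t ≠ 0 := by
  have h0 : volume (AffineSubspace.mk' u (Submodule.span ℝ {v}) : Set ℂ) = 0 := by
    apply Measure.addHaar_affineSubspace
    intro h
    have h1 : (AffineSubspace.mk' u (Submodule.span ℝ {v})).direction = ⊤ := by rw [h]; simp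
    rw [AffineSubspace.direction_mk'] at h1
    have h2 : Module.finrank ℝ (Submodule.span ℝ {v}) ≤ 1 := by
      simpa using finrank_span_le_card (R := ℝ) ({v} : Set ℂ)
    rw [h1, finrank_top, Complex.finrank_real_complex] at h2
    norm_num at h2
  filter_upwards [measure_eq_zero_iff_ae_notMem.1 h0] with t ht s hs
  apply ht
  rw [SetLike.mem_coe, AffineSubspace.mem_mk', vsub_eq_sub, Submodule.mem_span_singleton]
  exact ⟨s, by rw [real_smul]; linear_combination hs⟩

theorem lintegral_segment_cauchy_le (hf : IsDensity a p m A ρ f) : ∃ C : ℝ, 0 ≤ C ∧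
    ∀ u v, ∫⁻ s in 𝕀, ofReal ((1 + ∑ j, ‖u + s * v - a j‖ ^ (-poleExp (p j))) * ‖v‖)
        ≤ ofReal (C * (‖v‖ + ∑ j, ‖v‖ ^ (1 - poleExp (p j)))) := by
  have hq : ∀ j, 0 < 1 - poleExp (p j) := fun j => by linarith [poleExp_lt_one (hf.p_lt j)]
  refine ⟨1 + ∑ j, 3 / (1 - poleExp (p j)), ?_, fun u v => ?_⟩
  · have : 0 ≤ ∑ j, 3 / (1 - poleExp (p j)) :=
      Finset.sum_nonneg fun j _ => div_nonneg (by norm_num) (hq j).le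
    linarith
  have hpt : ∀ s : ℝ, ofReal ((1 + ∑ j, ‖u + s * v - a j‖ ^ (-poleExp (p j))) * ‖v‖) = ofReal ‖v‖ +
        ∑ j, ofReal (‖(u - a j) + s * v‖ ^ ((1 - poleExp (p j)) - 1) * ‖v‖) := by
    intro s
    rw [← ofReal_sum_of_nonneg fun _ _ => by positivity,
      ofReal_add_ofReal, add_mul, one_mul, Finset.sum_mul]
    congr 2
    refine Finset.sum_congr rfl fun j _ => ?_
    rw [add_sub_right_comm]
    congr 2; ring
  simp only [hpt]
  rw [lintegral_add_left measurable_const, lintegral_finsetSum _ fun j _ => by fun_prop]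
  have h1 : ∑ j, ∫⁻ s in 𝕀, ofReal (‖(u - a j) + s * v‖ ^ ((1 - poleExp (p j)) - 1) * ‖v‖)
      ≤ ofReal (∑ j, 3 / (1 - poleExp (p j)) * ‖v‖ ^ (1 - poleExp (p j))) := by
    rw [ofReal_sum_of_nonneg fun j _ => mul_nonneg
      (div_nonneg (by norm_num) (hq j).le) (by positivity)]
    refine Finset.sum_le_sum fun j _ => lintegral_segment_le (hq j) ?_ _ _
    linarith [poleExp_nonneg (p j)]
  simp only [lintegral_const, Measure.restrict_apply_univ, Real.volume_Icc, sub_zero,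
    ofReal_one, mul_one]
  refine (add_le_add_right h1 _).trans ?_
  have hn : ∀ j, 0 ≤ 3 / (1 - poleExp (p j)) := fun j => div_nonneg (by norm_num) (hq j).le
  rw [← ofReal_add (norm_nonneg _) (Finset.sum_nonneg fun j _ => mul_nonneg (hn j) (by positivity))]
  apply ofReal_le_ofReal
  have h2 : ∑ j, 3 / (1 - poleExp (p j)) * ‖v‖ ^ (1 - poleExp (p j))
      ≤ (∑ j, 3 / (1 - poleExp (p j))) * ∑ j, ‖v‖ ^ (1 - poleExp (p j)) := by
    rw [Finset.sum_mul]
    refine Finset.sum_le_sum fun j _ => mul_le_mul_of_nonneg_left ?_ (hn j)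
    exact Finset.single_le_sum (f := fun j => ‖v‖ ^ (1 - poleExp (p j)))
      (fun _ _ => by positivity) (Finset.mem_univ j)
  have h3 : 0 ≤ ∑ j, 3 / (1 - poleExp (p j)) := Finset.sum_nonneg fun j _ => hn j
  have h4 : 0 ≤ ∑ j, ‖v‖ ^ (1 - poleExp (p j)) := by positivity
  nlinarith [norm_nonneg v, mul_nonneg h3 (norm_nonneg v)]

/-- The fundamental theorem of calculus for a logarithmic potential, valid along every segment,
also through the poles of the density. -/
theorem logPotential_add_sub (hf : IsDensity a p m A ρ f) (u v : ℂ) :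
    logPotential f (u + v) - logPotential f u
      = ∫ s in (0 : ℝ)..1, (v * cauchyTransform f (u + s * v)).re := by
  rcases eq_or_ne v 0 with rfl | hv
  · simp
  have hm := hf.measurable
  have e1 : logPotential f (u + v) - logPotential f u
      = ∫ t, ∫ s in Ioc (0 : ℝ) 1, f t * (v / (u + s * v - t)).re := by
    rw [logPotential, logPotential, ← integral_sub (hf.integrable_log _) (hf.integrable_log _)]
    refine integral_congr_ae ?_
    filter_upwards [ae_notMem_line u v] with t ht
    rw [← mul_sub, log_norm_add_sub fun s _ => ht s,
      intervalIntegral.integral_of_le zero_le_one, integral_const_mul]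
  have hint : Integrable (Function.uncurry fun (t : ℂ) (s : ℝ) => f t * (v / (u + s * v - t)).re)
      (volume.prod (volume.restrict (Ioc (0 : ℝ) 1))) := by
    have hmeas : Measurable
        (Function.uncurry fun (t : ℂ) (s : ℝ) => f t * (v / (u + s * v - t)).re) := by
      unfold Function.uncurry
      fun_prop
    refine ⟨hmeas.aestronglyMeasurable, ?_⟩
    rw [HasFiniteIntegral, lintegral_prod_symm _ hmeas.enorm.aemeasurable]
    obtain ⟨C, hC0, hC⟩ := hf.lintegral_cauchy_le
    obtain ⟨C', -, hC'⟩ := hf.lintegral_segment_cauchy_le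
    have hle : ∫⁻ s in Ioc (0 : ℝ) 1, ∫⁻ t, ‖f t * (v / (u + s * v - t)).re‖ₑ
        ≤ ∫⁻ s in 𝕀, ofReal C * ofReal ((1 + ∑ j, ‖u + s * v - a j‖ ^ (-poleExp (p j))) * ‖v‖) := by
      refine le_trans ?_ (lintegral_mono_set Ioc_subset_Icc_self)
      apply lintegral_mono_ae
      filter_upwards [ae_restrict_of_ae (ae_segment_ne hv u a)] with s hs
      calc ∫⁻ t, ‖f t * (v / (u + s * v - t)).re‖ₑ ≤ ∫⁻ t, ofReal ‖v‖ *
            (‖f t‖ₑ * ofReal (‖t - (u + s * v)‖ ^ (-1 : ℝ))) := by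
            refine lintegral_mono fun t => ?_
            rw [← ofReal_norm, ← ofReal_norm, ← ofReal_mul (norm_nonneg _),
              ← ofReal_mul (norm_nonneg _)]
            apply ofReal_le_ofReal
            rw [norm_mul, norm_eq_abs (re _)]
            have := abs_re_le_norm (v / (u + s * v - t))
            rw [norm_div, norm_sub_rev _ t, div_eq_mul_inv ‖v‖, ← rpow_neg_one] at this
            calc ‖f t‖ * |(v / (u + s * v - t)).re|
                ≤ ‖f t‖ * (‖v‖ * ‖t - (u + s * v)‖ ^ (-1 : ℝ)) := by gcongr
              _ = _ := by ring
        _ ≤ ofReal ‖v‖ * ofReal (C * (1 + ∑ j, ‖u + s * v - a j‖ ^ (-poleExp (p j)))) := by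
            rw [lintegral_const_mul' _ _ ofReal_ne_top]
            gcongr
            exact hC _ hs
        _ = _ := by
            rw [← ofReal_mul (norm_nonneg _), ← ofReal_mul hC0]
            congr 1; ring
    refine lt_of_le_of_lt hle ?_
    rw [lintegral_const_mul' _ _ ofReal_ne_top]
    exact ENNReal.mul_lt_top ofReal_lt_top ((hC' u v).trans_lt ofReal_lt_top)
  rw [e1, integral_integral_swap hint, intervalIntegral.integral_of_le zero_le_one]
  refine integral_congr_ae ?_
  filter_upwards [ae_restrict_of_ae (ae_segment_ne hv u a)] with s hs
  have i1 := (hf.integrable_cauchy hs).const_mul v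
  rw [cauchyTransform, ← integral_const_mul]
  have h2 := integral_re (𝕜 := ℂ) i1
  simp only [RCLike.re_to_complex] at h2
  rw [← h2]
  refine integral_congr_ae (.of_forall fun t => ?_)
  simp only
  rw [← re_ofReal_mul]
  congr 1; ring

theorem abs_logPotential_sub_le (hf : IsDensity a p m A ρ f) : ∃ C : ℝ, 0 ≤ C ∧
    ∀ u v, |logPotential f (u + v) - logPotential f u|
      ≤ C * (‖v‖ + ∑ j, ‖v‖ ^ (1 - poleExp (p j))) := by
  obtain ⟨C, hC0, hC⟩ := hf.norm_cauchyTransform_le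
  obtain ⟨C', hC'0, hC'⟩ := hf.lintegral_segment_cauchy_le
  refine ⟨C * C', by positivity, fun u v => ?_⟩
  rcases eq_or_ne v 0 with rfl | hv
  · simp only [add_zero, sub_self, abs_zero]; positivity
  rw [hf.logPotential_add_sub, intervalIntegral.integral_of_le zero_le_one]
  have h := enorm_integral_le_lintegral_enorm (μ := volume.restrict (Ioc (0 : ℝ) 1))
    fun s : ℝ => (v * cauchyTransform f (u + s * v)).re
  have h2 : ∫⁻ s in Ioc (0 : ℝ) 1, ‖(v * cauchyTransform f (u + s * v)).re‖ₑ ≤ ofReal C *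
        ofReal (C' * (‖v‖ + ∑ j, ‖v‖ ^ (1 - poleExp (p j)))) := by
    refine le_trans ?_ (mul_le_mul_right (hC' u v) _)
    rw [← lintegral_const_mul' _ _ ofReal_ne_top]
    refine le_trans ?_ (lintegral_mono_set Ioc_subset_Icc_self)
    apply lintegral_mono_ae
    filter_upwards [ae_restrict_of_ae (ae_segment_ne hv u a)] with s hs
    rw [← ofReal_norm, ← ofReal_mul hC0]
    apply ofReal_le_ofReal
    calc ‖(v * cauchyTransform f (u + s * v)).re‖ ≤ ‖v * cauchyTransform f (u + s * v)‖ :=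
          abs_re_le_norm _
      _ = ‖v‖ * ‖cauchyTransform f (u + s * v)‖ := norm_mul _ _
      _ ≤ ‖v‖ * (C * (1 + ∑ j, ‖u + s * v - a j‖ ^ (-poleExp (p j)))) := by gcongr; exact hC _ hs
      _ = _ := by ring
  have h3 := h.trans h2
  rw [← ofReal_mul hC0, ← ofReal_norm] at h3
  have := (ofReal_le_ofReal_iff (by positivity)).1 h3
  rw [← mul_assoc] at this
  exact this

theorem continuous_logPotential (hf : IsDensity a p m A ρ f) : Continuous (logPotential f) := by
  obtain ⟨C, -, hC⟩ := hf.abs_logPotential_sub_le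
  rw [continuous_iff_continuousAt]
  intro u
  rw [ContinuousAt, tendsto_iff_norm_sub_tendsto_zero]
  refine squeeze_zero (fun _ => norm_nonneg _)
    (fun x => ?_ : ∀ x, _ ≤ C * (‖x - u‖ + ∑ j, ‖x - u‖ ^ (1 - poleExp (p j)))) ?_
  · simpa using hC u (x - u)
  · have hc : Continuous fun x : ℂ => C * (‖x - u‖ + ∑ j, ‖x - u‖ ^ (1 - poleExp (p j))) := by
      refine continuous_const.mul (Continuous.add (by fun_prop)
        (continuous_finsetSum _ fun j _ => ?_))
      exact Continuous.rpow_const (by fun_prop)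
        fun x => Or.inr (by linarith [poleExp_lt_one (hf.p_lt j)])
    have := hc.tendsto u
    simp only [sub_self, norm_zero, zero_add] at this
    rwa [Finset.sum_eq_zero fun j _ => zero_rpow
      (by linarith [poleExp_lt_one (hf.p_lt j)] : 1 - poleExp (p j) ≠ 0), mul_zero] at this

end IsDensity

/-! ### Logarithmic potentials: regularity and the Poisson equation -/

theorem setIntegral_polar_radial {h : ℂ → ℝ} (hh : ContDiff ℝ 1 h) (hc : HasCompactSupport h)
    (θ : ℝ) : ∫ r in Ioi (0 : ℝ), 𝒟 h (r * exp (θ * I)) (exp (θ * I)) = -h 0 := by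
  set e := exp (θ * I)
  have he : ‖e‖ = 1 := Complex.norm_exp_ofReal_mul_I θ
  have hd : ∀ r : ℝ, HasDerivAt (fun r : ℝ => h (r * e)) (𝒟 h (r * e) e) r := by
    intro r
    have h1 : HasDerivAt (fun s : ℝ => (s : ℂ) * e) e r := by
      simpa using (ofRealCLM.hasDerivAt (x := r)).mul_const e
    exact (hh.differentiable one_ne_zero _).hasFDerivAt.comp_hasDerivAt r h1
  have hcont : ContDiff ℝ 1 fun r : ℝ => h (r * e) :=
    hh.comp (ofRealCLM.contDiff.mul contDiff_const)
  have hcs : HasCompactSupport fun r : ℝ => h (r * e) := by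
    obtain ⟨R, hR⟩ := hc.isBounded.subset_closedBall 0
    refine HasCompactSupport.intro (isCompact_closedBall (0 : ℝ) R) fun r hr => ?_
    by_contra h0
    have := hR (subset_tsupport _ h0)
    rw [mem_closedBall_zero_iff, norm_mul, he, norm_real, mul_one] at this
    exact hr (by simpa using this)
  have := hcs.integral_Ioi_deriv_eq hcont 0
  simp only [ofReal_zero, zero_mul] at this
  rw [← this]
  exact integral_congr_ae (.of_forall fun r => ((hd r).deriv).symm)

theorem setIntegral_polar_angular {h : ℂ → ℝ} (hh : ContDiff ℝ 1 h) {r : ℝ} (hr : r ≠ 0) :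
    ∫ θ in Ioo (-π) π, 𝒟 h (r * exp (θ * I)) (I * exp (θ * I)) = 0 := by
  have hd : ∀ θ ∈ uIcc (-π) π, HasDerivAt (fun θ : ℝ => r⁻¹ * h (r * exp (θ * I)))
      (𝒟 h (r * exp (θ * I)) (I * exp (θ * I)))
      θ := by
    intro θ _
    have h1 : HasDerivAt (fun s : ℝ => (r : ℂ) * exp (s * I)) (r * (exp (θ * I) * I)) θ := by
      simpa using (((ofRealCLM.hasDerivAt (x := θ)).mul_const I).cexp).const_mul (r : ℂ)
    have h2 := ((hh.differentiable one_ne_zero _).hasFDerivAt.comp_hasDerivAt θ h1).const_mul r⁻¹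
    refine h2.congr_deriv ?_
    have h3 := (𝒟 h (r * exp (θ * I))).map_smul r (exp (θ * I) * I)
    rw [real_smul, smul_eq_mul] at h3
    rw [mul_comm I, h3, ← mul_assoc, inv_mul_cancel₀ hr, one_mul]
  have hcont : Continuous fun θ : ℝ => 𝒟 h (r * exp (θ * I)) (I * exp (θ * I)) :=
    ((hh.continuous_fderiv one_ne_zero).comp (by fun_prop)).clm_apply (by fun_prop)
  have := intervalIntegral.integral_eq_sub_of_hasDerivAt hd (hcont.intervalIntegrable _ _)
  rw [intervalIntegral.integral_of_le (by linarith [pi_pos]), integral_Ioc_eq_integral_Ioo] at this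
  rw [this]
  simp [Complex.exp_neg]

/-- The Cauchy-Pompeiu formula for a compactly supported function. -/
theorem integral_dbar_div {h : ℂ → ℝ} (hh : ContDiff ℝ 1 h) (hc : HasCompactSupport h) :
    ∫ t : ℂ, ((𝒟 h t 1 : ℂ) + I * (𝒟 h t I : ℝ)) / t = -(2 * π * h 0 : ℝ) := by
  set e : ℝ → ℂ := fun θ => exp (θ * I) with he
  set P : ℝ × ℝ → ℝ := fun q => 𝒟 h (q.1 * e q.2) (e q.2)
  set Q : ℝ × ℝ → ℝ := fun q => 𝒟 h (q.1 * e q.2) (I * e q.2)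
  have hen : ∀ θ, ‖e θ‖ = 1 := fun θ => Complex.norm_exp_ofReal_mul_I θ
  have hP : Continuous P :=
    ((hh.continuous_fderiv one_ne_zero).comp (by fun_prop)).clm_apply (by fun_prop)
  have hQ : Continuous Q :=
    ((hh.continuous_fderiv one_ne_zero).comp (by fun_prop)).clm_apply (by fun_prop)
  obtain ⟨R, hR⟩ := hc.isBounded.subset_closedBall 0
  have hz : ∀ q : ℝ × ℝ, R < q.1 → 𝒟 h (q.1 * e q.2) = 0 := by
    intro q hq
    by_contra h0
    have := hR (support_fderiv_subset ℝ h0)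
    rw [mem_closedBall_zero_iff, norm_mul, hen, norm_real, mul_one] at this
    exact absurd ((le_abs_self _).trans this) (not_le.2 hq)
  have hint : ∀ F : ℝ × ℝ → ℝ, Continuous F → (∀ q, R < q.1 → F q = 0) →
      IntegrableOn F (Ioi 0 ×ˢ Ioo (-π) π) (volume.prod volume) := by
    intro F hF hF0
    have h1 : IntegrableOn F (Icc 0 R ×ˢ Icc (-π) π) (volume.prod volume) :=
      hF.continuousOn.integrableOn_compact (isCompact_Icc.prod isCompact_Icc)
    refine h1.of_forall_sdiff_eq_zero (measurableSet_Ioi.prod measurableSet_Ioo) ?_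
    rintro q ⟨⟨hq1, hq2⟩, hq3⟩
    apply hF0
    by_contra hle
    exact hq3 ⟨⟨le_of_lt hq1, not_lt.1 hle⟩, Ioo_subset_Icc_self hq2⟩
  have hP' := hint P hP fun q hq => by simp [P, hz q hq]
  have hQ' := hint Q hQ fun q hq => by simp [Q, hz q hq]
  have iP : ∫ q in Ioi 0 ×ˢ Ioo (-π) π, P q = -(2 * π * h 0) := by
    rw [Measure.volume_eq_prod, ← Measure.prod_restrict,
      integral_prod_symm _ (by rwa [Measure.prod_restrict])]
    simp only [P, he, setIntegral_polar_radial hh hc]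
    rw [integral_const, smul_eq_mul, measureReal_restrict_apply_univ,
      Real.volume_real_Ioo_of_le (by linarith [pi_pos])]
    ring
  have iQ : ∫ q in Ioi 0 ×ˢ Ioo (-π) π, Q q = 0 := by
    rw [Measure.volume_eq_prod, setIntegral_prod _ hQ']
    rw [setIntegral_congr_fun measurableSet_Ioi (g := fun _ => 0) fun r hr => ?_]
    · simp
    · exact setIntegral_polar_angular hh (ne_of_gt hr)
  rw [← Complex.integral_comp_polarCoord_symm, polarCoord_target]
  have hpt : ∀ q ∈ Ioi (0 : ℝ) ×ˢ Ioo (-π) π, q.1 • (((𝒟 h (Complex.polarCoord.symm q) 1 : ℂ) +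
        I * (𝒟 h (Complex.polarCoord.symm q) I : ℝ)) /
          Complex.polarCoord.symm q) = (P q : ℂ) + I * (Q q : ℂ) := by
    intro q hq
    have hq1 : (q.1 : ℂ) ≠ 0 := by exact_mod_cast ne_of_gt hq.1
    have hpol : Complex.polarCoord.symm q = q.1 * e q.2 := by
      rw [Complex.polarCoord_symm_apply, he]
      simp only
      rw [exp_mul_I]
      simp
    rw [hpol]
    have e0 : e q.2 ≠ 0 := Complex.exp_ne_zero _
    have eexp : e q.2 = cos q.2 + sin q.2 * I := by rw [he]; simp only; rw [exp_mul_I]; simp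
    set D := 𝒟 h (q.1 * e q.2)
    have d1 : P q = cos q.2 * D 1 + sin q.2 * D I := by
      change D (e q.2) = _
      have : e q.2 = cos q.2 • (1 : ℂ) + sin q.2 • I := by rw [eexp]; simp
      rw [this, map_add, map_smul, map_smul]; rfl
    have d2 : Q q = -sin q.2 * D 1 + cos q.2 * D I := by
      change D (I * e q.2) = _
      have : I * e q.2 = (-sin q.2) • (1 : ℂ) + cos q.2 • I := by
        rw [eexp]
        simp only [real_smul, ofReal_neg]
        linear_combination (sin q.2 : ℂ) * I_sq
      rw [this, map_add, map_smul, map_smul]; rfl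
    rw [d1, d2, real_smul]
    have e2 : (cos q.2 - sin q.2 * I) * e q.2 = 1 := by
      rw [eexp]
      have : (sin q.2 : ℂ) ^ 2 + (cos q.2 : ℂ) ^ 2 = 1 := by
        exact_mod_cast Real.sin_sq_add_cos_sq q.2
      linear_combination this - (sin q.2 : ℂ) ^ 2 * I_sq
    have e3 : (q.1 : ℂ) * ((D 1 + I * D I) / (q.1 * e q.2)) =
        (D 1 + I * D I) * (cos q.2 - sin q.2 * I) := by
      generalize (D 1 + I * D I : ℂ) = X
      field_simp
      linear_combination -X * e2
    rw [e3]
    simp only [Complex.ofReal_add, Complex.ofReal_mul, ofReal_neg]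
    linear_combination (-(sin q.2 : ℂ) * D I) * I_sq
  rw [setIntegral_congr_fun (measurableSet_Ioi.prod measurableSet_Ioo) hpt]
  have i1 : Integrable (fun q => (P q : ℂ))
      (volume.restrict (Ioi 0 ×ˢ Ioo (-π) π)) := Integrable.ofReal hP'
  have i2 : Integrable (fun q => (Q q : ℂ))
      (volume.restrict (Ioi 0 ×ˢ Ioo (-π) π)) := Integrable.ofReal hQ'
  rw [integral_add i1 (i2.const_mul _), integral_const_mul, integral_complex_ofReal,
    integral_complex_ofReal, iP, iQ]
  simp

theorem locallyIntegrable_inv : LocallyIntegrable (fun x : ℂ => x⁻¹) := by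
  intro x
  refine ⟨ball x 1, ball_mem_nhds x one_pos, ?_⟩
  refine ⟨(by fun_prop : Measurable fun x : ℂ => x⁻¹).aestronglyMeasurable, ?_⟩
  rw [HasFiniteIntegral]
  have h := lintegral_rpow_sub_le (m := 1) zero_le_one (ball x 1) 0
  have e : ∀ t : ℂ, ‖t⁻¹‖ₑ = ofReal (‖t - 0‖ ^ (-1 : ℝ)) := by
    intro t; rw [← ofReal_norm, norm_inv, sub_zero, rpow_neg_one]
  simp only [e]
  exact h.trans_lt (ENNReal.add_lt_top.2 ⟨Metric.isBounded_ball.measure_lt_top,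
    lintegral_ball_rpow_lt_top (by norm_num)⟩)

/-- The Cauchy transform of a compactly supported `C¹` function is `C¹` and solves the
inhomogeneous Cauchy-Riemann equation. -/
theorem cauchyTransform_of_hasCompactSupport {h : ℂ → ℝ} (hh : ContDiff ℝ 1 h)
    (hc : HasCompactSupport h) (u : ℂ) :
    ContDiffAt ℝ 1 (cauchyTransform h) u ∧ 𝒟 (cauchyTransform h) u 1 + I * 𝒟 (cauchyTransform h) u I
        = (2 * π * h u : ℝ) := by
  set L : ℂ →L[ℝ] ℝ →L[ℝ] ℂ := (ContinuousLinearMap.lsmul ℝ ℝ).flip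
  have hL : ∀ (z : ℂ) (x : ℝ), L z x = x * z := fun z x => by simp [L]
  have e : cauchyTransform h = convolution (fun x : ℂ => x⁻¹) h L volume := by
    ext x
    rw [cauchyTransform, convolution_def, ← integral_sub_left_eq_self _ volume x]
    refine integral_congr_ae (.of_forall fun t => ?_)
    simp only [hL, sub_sub_cancel, div_eq_mul_inv]
  have hcd := hc.contDiff_convolution_right L locallyIntegrable_inv hh
  have hfd := hc.hasFDerivAt_convolution_right L locallyIntegrable_inv hh u
  have hfv : ∀ v, 𝒟 (cauchyTransform h) u v = ∫ t, (𝒟 h (u - t) v : ℂ) * t⁻¹ := by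
    intro v
    rw [e, hfd.fderiv, convolution_precompR_apply L locallyIntegrable_inv (hc.fderiv ℝ)
      (hh.continuous_fderiv one_ne_zero), convolution_def]
    simp only [hL]
  refine ⟨e ▸ hcd.contDiffAt, ?_⟩
  have hint : ∀ v, Integrable fun t => (𝒟 h (u - t) v : ℂ) * t⁻¹ := by
    intro v
    have := (HasCompactSupport.convolutionExists_right L
      (g := fun x => 𝒟 h x v) (hc.fderiv_apply ℝ v) locallyIntegrable_inv
      ((hh.continuous_fderiv one_ne_zero).clm_apply continuous_const) u)
    rw [ConvolutionExistsAt] at this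
    simpa only [hL] using this
  rw [hfv, hfv, ← integral_const_mul, ← integral_add (hint 1) ((hint _).const_mul _)]
  set k : ℂ → ℝ := fun t => h (u - t) with hk
  have hkc : ContDiff ℝ 1 k := hh.comp (contDiff_const.sub contDiff_id)
  have hks : HasCompactSupport k := hc.comp_homeomorph (Homeomorph.subLeft u)
  have hkd : ∀ t v, 𝒟 k t v = -𝒟 h (u - t) v := by
    intro t v
    have h1 : HasFDerivAt (fun t => u - t) (-ContinuousLinearMap.id ℝ ℂ) t :=
      (hasFDerivAt_id t).const_sub u
    have h2 : HasFDerivAt k _ t := (hh.differentiable one_ne_zero (u - t)).hasFDerivAt.comp t h1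
    rw [h2.fderiv]
    simp
  have hp := integral_dbar_div hkc hks
  have hk0 : k 0 = h u := by simp [hk]
  simp only [hkd, hk0] at hp
  rw [← neg_inj, ← hp, ← integral_neg]
  refine integral_congr_ae (.of_forall fun t => ?_)
  simp only [ofReal_neg]
  ring

namespace IsDensity

theorem mono (hf : IsDensity a p m A ρ f) {g : ℂ → ℝ} (hg : Measurable g)
    (hle : ∀ t, |g t| ≤ |f t|) : IsDensity a p m A ρ g :=
  ⟨hg, hf.p_pos, hf.p_lt, hf.m_gt, hf.A_nonneg, hf.one_le,
    hf.near.mono fun t ht h => (hle t).trans (ht h),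
    hf.far.mono fun t ht h => (hle t).trans (ht h)⟩

/-- The Cauchy transform of a density is holomorphic where the density vanishes. -/
theorem differentiableAt_cauchyTransform (hf : IsDensity a p m A ρ f) {u0 : ℂ}
    (hu0 : ∀ j, u0 ≠ a j) {r : ℝ} (hr : 0 < r) (h0 : ∀ t ∈ ball u0 r, f t = 0) :
    DifferentiableAt ℂ (cauchyTransform f) u0 := by
  have hm := hf.measurable
  have hne : ∀ t ∉ ball u0 r, ∀ u ∈ ball u0 (r / 2), r / 2 ≤ ‖u - t‖ := by
    intro t ht u hu
    rw [mem_ball, not_lt, dist_eq_norm] at ht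
    rw [mem_ball_iff_norm] at hu
    have : ‖t - u0‖ ≤ ‖u - t‖ + ‖u - u0‖ := by
      rw [norm_sub_rev u t]; simpa using norm_add_le (t - u) (u - u0)
    linarith
  refine (hasDerivAt_integral_of_dominated_loc_of_deriv_le (𝕜 := ℂ)
    (F := fun u t => (f t : ℂ) / (u - t)) (F' := fun u t => -(f t : ℂ) / (u - t) ^ 2)
    (bound := fun t => ‖f t‖ * (4 / r ^ 2)) (s := ball u0 (r / 2))
    (ball_mem_nhds _ (half_pos hr)) ?_ (hf.integrable_cauchy hu0) ?_ ?_
    (hf.integrable.norm.mul_const _) ?_).2.differentiableAt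
  · exact .of_forall fun u => (by fun_prop : Measurable _).aestronglyMeasurable
  · exact (by fun_prop : Measurable _).aestronglyMeasurable
  · refine .of_forall fun t u hu => ?_
    by_cases ht : t ∈ ball u0 r
    · simp [h0 t ht]
    · have h1 := hne t ht u hu
      have h2 : (r / 2) ^ 2 ≤ ‖u - t‖ ^ 2 := by gcongr
      rw [norm_div, norm_neg, norm_real, norm_pow, div_eq_mul_inv]
      refine mul_le_mul_of_nonneg_left ?_ (abs_nonneg _)
      have h3 : 0 < (r / 2) ^ 2 := by positivity
      calc (‖u - t‖ ^ 2)⁻¹ ≤ ((r / 2) ^ 2)⁻¹ := inv_anti₀ h3 h2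
        _ = _ := by rw [div_pow, inv_div]; norm_num
  · refine .of_forall fun t u hu => ?_
    by_cases ht : t ∈ ball u0 r
    · simp only [h0 t ht, ofReal_zero, zero_div, neg_zero]
      exact hasDerivAt_const _ _
    · have h1 : u - t ≠ 0 := norm_pos_iff.1 (by linarith [hne t ht u hu])
      have := ((hasDerivAt_id u).sub_const t).inv h1 |>.const_mul (f t : ℂ)
      simp only [div_eq_mul_inv]
      refine this.congr_deriv ?_
      simp only [id_eq, div_eq_mul_inv]
      ring

/-- The Cauchy transform of a density is `C¹` where the density is, and solves the inhomogeneous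
Cauchy-Riemann equation there. -/
theorem cauchyTransform_regular (hf : IsDensity a p m A ρ f) {u0 : ℂ}
    (hu0 : ∀ j, u0 ≠ a j) {r : ℝ} (hr : 0 < r) (hfr : ContDiffOn ℝ 1 f (ball u0 r)) :
    ContDiffAt ℝ 1 (cauchyTransform f) u0 ∧
      𝒟 (cauchyTransform f) u0 1 + I * 𝒟 (cauchyTransform f) u0 I = (2 * π * f u0 : ℝ) := by
  have hm := hf.measurable
  let χ : ContDiffBump u0 := ⟨r / 4, r / 2, by linarith, by linarith⟩
  have hχc : Continuous χ := χ.continuous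
  set f1 : ℂ → ℝ := fun t => χ t * f t with hf1
  set f2 : ℂ → ℝ := fun t => (1 - χ t) * f t with hf2
  have hd1 : IsDensity a p m A ρ f1 := hf.mono (hχc.measurable.mul hm) fun t => by
    rw [hf1, abs_mul, abs_of_nonneg χ.nonneg]
    exact mul_le_of_le_one_left (abs_nonneg _) χ.le_one
  have hd2 : IsDensity a p m A ρ f2 :=
    hf.mono ((measurable_const.sub hχc.measurable).mul hm) fun t => by
      rw [hf2, abs_mul, abs_of_nonneg (by linarith [χ.le_one (x := t)] : 0 ≤ 1 - χ t)]
      exact mul_le_of_le_one_left (abs_nonneg _) (by linarith [χ.nonneg (x := t)])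
  have hc1 : HasCompactSupport f1 := χ.hasCompactSupport.mul_right
  have hs1 : ContDiff ℝ 1 f1 := by
    rw [contDiff_iff_contDiffAt]
    intro x
    by_cases hx : x ∈ ball u0 r
    · exact χ.contDiff.contDiffAt.mul (hfr.contDiffAt (isOpen_ball.mem_nhds hx))
    · have hx2 : x ∈ (closedBall u0 (r / 2))ᶜ := fun h =>
        hx (Metric.closedBall_subset_ball (by linarith) h)
      refine (contDiffAt_const (c := 0)).congr_of_eventuallyEq ?_
      filter_upwards [isClosed_closedBall.isOpen_compl.mem_nhds hx2] with y hy
      rw [hf1]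
      simp only
      rw [χ.zero_of_le_dist (le_of_not_ge fun h => hy (Metric.mem_closedBall.2 h)), zero_mul]
  obtain ⟨h1, h1'⟩ := cauchyTransform_of_hasCompactSupport hs1 hc1 u0
  have h2 : ∀ᶠ u in nhds u0, DifferentiableAt ℂ (cauchyTransform f2) u := by
    have hne : ∀ᶠ u in nhds u0, ∀ j, u ≠ a j := eventually_all.2 fun j => eventually_ne_nhds (hu0 j)
    filter_upwards [hne, ball_mem_nhds u0 (by linarith : 0 < r / 8)] with u hu hur
    refine hd2.differentiableAt_cauchyTransform hu (by linarith : 0 < r / 8) fun t ht => ?_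
    rw [hf2]
    simp only
    rw [χ.one_of_mem_closedBall, sub_self, zero_mul]
    rw [mem_ball] at ht hur
    rw [Metric.mem_closedBall]
    change _ ≤ r / 4
    linarith [dist_triangle t u u0]
  have h2a : AnalyticAt ℂ (cauchyTransform f2) u0 :=
    Complex.analyticAt_iff_eventually_differentiableAt.2 h2
  have h2c : ContDiffAt ℝ 1 (cauchyTransform f2) u0 := h2a.contDiffAt.restrict_scalars ℝ
  have h2d : 𝒟 (cauchyTransform f2) u0 1 + I * 𝒟 (cauchyTransform f2) u0 I = 0 := by
    have h3 := h2a.differentiableAt.hasFDerivAt.restrictScalars ℝ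
    rw [h3.fderiv, ContinuousLinearMap.coe_restrictScalars',
      ← mul_one I, ← smul_eq_mul I 1, map_smul, smul_eq_mul, smul_eq_mul, mul_one]
    linear_combination (fderiv ℂ (cauchyTransform f2) u0 1) * I_sq
  have hsum : cauchyTransform f =ᶠ[nhds u0] fun u => cauchyTransform f1 u + cauchyTransform f2 u := by
    have hne : ∀ᶠ u in nhds u0, ∀ j, u ≠ a j := eventually_all.2 fun j => eventually_ne_nhds (hu0 j)
    filter_upwards [hne] with u hu
    rw [cauchyTransform, cauchyTransform, cauchyTransform,
      ← integral_add (hd1.integrable_cauchy hu) (hd2.integrable_cauchy hu)]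
    refine integral_congr_ae (.of_forall fun t => ?_)
    simp only [hf1, hf2]
    push_cast
    ring
  refine ⟨(h1.add h2c).congr_of_eventuallyEq hsum, ?_⟩
  have e0 : f1 u0 = f u0 := by
    simp only [hf1]
    rw [χ.one_of_mem_closedBall (Metric.mem_closedBall_self χ.rIn_pos.le), one_mul]
  rw [hsum.fderiv_eq, fderiv_fun_add (h1.differentiableAt one_ne_zero)
    (h2c.differentiableAt one_ne_zero), ← e0, ← h1']
  simp only [add_apply]
  linear_combination h2d

/-- The differential of the logarithmic potential is the real part of the Cauchy transform. -/
theorem hasFDerivAt_logPotential (hf : IsDensity a p m A ρ f) {u0 : ℂ}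
    (hN : ∀ᶠ u in nhds u0, ContinuousAt (cauchyTransform f) u) :
    HasFDerivAt (logPotential f)
      (reCLM.comp ((ContinuousLinearMap.mul ℝ ℂ) (cauchyTransform f u0))) u0 := by
  rw [hasFDerivAt_iff_isLittleO_nhds_zero, Asymptotics.isLittleO_iff]
  intro c hc
  obtain ⟨δ', hδ', hb'⟩ := Metric.eventually_nhds_iff.1 hN
  obtain ⟨δ'', hδ'', hb⟩ := continuousAt_iff.1 hN.self_of_nhds c hc
  have hδ : 0 < min δ' δ'' := lt_min hδ' hδ''
  filter_upwards [ball_mem_nhds 0 hδ] with v hv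
  rw [mem_ball_zero_iff] at hv
  have hdist : ∀ s ∈ 𝕀, dist (u0 + s * v) u0 < min δ' δ'' := by
    intro s hs
    rw [dist_eq_norm, add_sub_cancel_left, norm_mul, norm_real]
    refine lt_of_le_of_lt (mul_le_of_le_one_left (norm_nonneg _) ?_) hv
    rw [norm_eq_abs, abs_of_nonneg hs.1]; exact hs.2
  have hbd : ∀ s ∈ uIoc (0 : ℝ) 1,
      ‖(v * cauchyTransform f (u0 + s * v)).re - (v * cauchyTransform f u0).re‖ ≤ c * ‖v‖ := by
    intro s hs
    rw [uIoc_of_le zero_le_one] at hs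
    rw [← sub_re, ← mul_sub]
    refine (abs_re_le_norm _).trans ?_
    rw [norm_mul, mul_comm]
    gcongr
    rw [← dist_eq_norm]
    exact (hb ((hdist s (Ioc_subset_Icc_self hs)).trans_le (min_le_right _ _))).le
  have key : ∫ s in (0 : ℝ)..1,
      ((v * cauchyTransform f (u0 + s * v)).re - (v * cauchyTransform f u0).re)
      = logPotential f (u0 + v) - logPotential f u0 - (v * cauchyTransform f u0).re := by
    rw [intervalIntegral.integral_sub _ intervalIntegrable_const, ← hf.logPotential_add_sub]
    · simp
    · apply ContinuousOn.intervalIntegrable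
      rw [uIcc_of_le zero_le_one]
      intro s hs
      have h1 := hb' ((hdist s hs).trans_le (min_le_left _ _))
      have h2 : ContinuousAt (fun s : ℝ => cauchyTransform f (u0 + s * v)) s :=
        ContinuousAt.comp (f := fun s : ℝ => u0 + s * v) h1 (by fun_prop)
      exact (continuous_re.continuousAt.comp (continuousAt_const.mul h2)).continuousWithinAt
  have := intervalIntegral.norm_integral_le_of_norm_le_const hbd
  rw [key] at this
  simp only [ContinuousLinearMap.comp_apply, ContinuousLinearMap.mul_apply', Complex.reCLM_apply]
  rw [mul_comm (cauchyTransform f u0) v]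
  simpa using this

/-- The logarithmic potential of a density is `C²` where the density is `C¹`, and solves the
Poisson equation there. -/
theorem logPotential_regular (hf : IsDensity a p m A ρ f) {u0 : ℂ}
    (hu0 : ∀ j, u0 ≠ a j) {r : ℝ} (hr : 0 < r) (hfr : ContDiffOn ℝ 1 f (ball u0 r)) :
    ContDiffAt ℝ 2 (logPotential f) u0 ∧
      (∀ᶠ u in nhds u0, ∀ v, 𝒟 (logPotential f) u v = (v * cauchyTransform f u).re) ∧
      𝒟 (fun u => 𝒟 (logPotential f) u 1) u0 1 + 𝒟 (fun u => 𝒟 (logPotential f) u I) u0 I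
        = 2 * π * f u0 := by
  obtain ⟨h1, h2⟩ := hf.cauchyTransform_regular hu0 hr hfr
  have hreg : ∀ᶠ u in nhds u0, ContDiffAt ℝ 1 (cauchyTransform f) u := by
    have hne : ∀ᶠ u in nhds u0, ∀ j, u ≠ a j := eventually_all.2 fun j => eventually_ne_nhds (hu0 j)
    filter_upwards [hne, ball_mem_nhds u0 (half_pos hr)] with u hu hur
    refine (hf.cauchyTransform_regular hu (half_pos hr) (hfr.mono fun x hx => ?_)).1
    rw [mem_ball] at *
    linarith [dist_triangle x u u0]
  have hF : ∀ᶠ u in nhds u0, HasFDerivAt (logPotential f)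
      (reCLM.comp ((ContinuousLinearMap.mul ℝ ℂ) (cauchyTransform f u))) u := by
    filter_upwards [hreg.eventually_nhds] with u hu
    exact hf.hasFDerivAt_logPotential (hu.mono fun x hx => hx.continuousAt)
  have hfd : ∀ᶠ u in nhds u0, ∀ v, 𝒟 (logPotential f) u v = (v * cauchyTransform f u).re := by
    filter_upwards [hF] with u hu v
    rw [hu.fderiv]
    simp [mul_comm v]
  refine ⟨?_, hfd, ?_⟩
  · have : ContDiffAt ℝ ((1 : ℕ) + 1) (logPotential f) u0 := by
      rw [contDiffAt_succ_iff_hasFDerivAt]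
      refine ⟨fun u => reCLM.comp ((ContinuousLinearMap.mul ℝ ℂ) (cauchyTransform f u)), ?_, ?_⟩
      · exact ⟨_, hF, fun x hx => hx⟩
      · exact contDiffAt_const.clm_comp
          ((ContinuousLinearMap.mul ℝ ℂ).contDiff.contDiffAt.comp u0 h1)
    rwa [Nat.cast_one, one_add_one_eq_two] at this
  · have hv : ∀ v, 𝒟 (fun u => 𝒟 (logPotential f) u v) u0 v
        = (v * 𝒟 (cauchyTransform f) u0 v).re := by
      intro v
      have e : (fun u => 𝒟 (logPotential f) u v) =ᶠ[nhds u0]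
          fun u => (v * cauchyTransform f u).re := hfd.mono fun u hu => hu v
      have h3 : HasFDerivAt (fun u => (v * cauchyTransform f u).re) _ u0 :=
        reCLM.hasFDerivAt.comp u0 ((h1.differentiableAt one_ne_zero).hasFDerivAt.const_mul v)
      rw [e.fderiv_eq, h3.fderiv]
      simp
    rw [hv, hv, one_mul, ← add_re, h2, ofReal_re]

end IsDensity

/-! ### The density of the flat metric with two cone points -/

/-- The density `|t - a₂|^(2β₂-2) |t - a₃|^(2β₃-2)` of the flat metric with two cone points. -/
noncomputable def flatDensity (β₂ β₃ : ℝ) (a₂ a₃ t : ℂ) : ℝ :=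
  ‖t - a₂‖ ^ (2 * β₂ - 2) * ‖t - a₃‖ ^ (2 * β₃ - 2)

/-- The conditions on the angles and the positions of the two cone points: the cone at infinity has
angle `2πγ`, and the barycentre is at the origin. -/
structure IsCentredPair (β₂ β₃ γ : ℝ) (a₂ a₃ : ℂ) : Prop where
  pos₂ : 0 < β₂
  lt₂ : β₂ < 1
  pos₃ : 0 < β₃
  lt₃ : β₃ < 1
  pos : 0 < γ
  lt : γ < 1
  angle : 1 - γ = (1 - β₂) + (1 - β₃)
  ne : a₂ ≠ a₃
  centre : ((1 - β₂ : ℝ) : ℂ) * a₂ + ((1 - β₃ : ℝ) : ℂ) * a₃ = 0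

theorem abs_log_norm_one_sub_add_re_le {x : ℂ} (hx : ‖x‖ ≤ 1 / 2) :
    |log ‖1 - x‖ + x.re| ≤ ‖x‖ ^ 2 := by
  have h := Complex.norm_log_one_add_sub_self_le (z := -x) (by rw [norm_neg]; linarith)
  rw [norm_neg] at h
  have e : log ‖1 - x‖ + x.re = (Complex.log (1 + -x) - -x).re := by
    rw [sub_re, log_re]; simp [sub_eq_add_neg]
  rw [e]
  refine (abs_re_le_norm _).trans (h.trans ?_)
  have : (1 - ‖x‖)⁻¹ ≤ 2 := by rw [inv_le_comm₀ (by linarith) two_pos]; linarith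
  nlinarith [sq_nonneg ‖x‖]

namespace IsCentredPair
variable {β₂ β₃ γ : ℝ} {a₂ a₃ : ℂ}

theorem flatDensity_sub_le (H : IsCentredPair β₂ β₃ γ a₂ a₃) {t : ℂ}
    (ht : 1 + 2 * (‖a₂‖ + ‖a₃‖) ≤ ‖t‖) :
    |flatDensity β₂ β₃ a₂ a₃ t - ‖t‖ ^ (2 * γ - 2)|
      ≤ 4 * (‖a₂‖ ^ 2 + ‖a₃‖ ^ 2) * ‖t‖ ^ (-(4 - 2 * γ)) := by
  have n2 := norm_nonneg a₂
  have n3 := norm_nonneg a₃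
  have ht0 : 0 < ‖t‖ := by linarith
  have ht1 : t ≠ 0 := norm_pos_iff.1 ht0
  have hx : ∀ {a : ℂ}, 2 * ‖a‖ ≤ ‖t‖ - 1 → ‖a / t‖ ≤ 1 / 2 := by
    intro a h
    rw [norm_div, div_le_iff₀ ht0]; linarith
  have h2 := hx (a := a₂) (by linarith)
  have h3 := hx (a := a₃) (by linarith)
  have hne : ∀ {x : ℂ}, ‖x‖ ≤ 1 / 2 → 0 < ‖1 - x‖ := by
    intro x h
    have := norm_sub_norm_le (1 : ℂ) x
    rw [norm_one] at this; linarith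
  have hfac : ∀ a : ℂ, t - a = t * (1 - a / t) := fun a => by field_simp
  set x := a₂ / t
  set y := a₃ / t
  set L := (2 * β₂ - 2) * log ‖1 - x‖ + (2 * β₃ - 2) * log ‖1 - y‖ with hL
  have e1 : flatDensity β₂ β₃ a₂ a₃ t = ‖t‖ ^ (2 * γ - 2) * Real.exp L := by
    rw [flatDensity, hfac a₂, hfac a₃, norm_mul, norm_mul, mul_rpow ht0.le (norm_nonneg _),
      mul_rpow ht0.le (norm_nonneg _), hL, Real.exp_add, mul_comm (2 * β₂ - 2),
      mul_comm (2 * β₃ - 2), ← Real.rpow_def_of_pos (hne h2), ← Real.rpow_def_of_pos (hne h3)]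
    have : 2 * γ - 2 = (2 * β₂ - 2) + (2 * β₃ - 2) := by linarith [H.angle]
    rw [this, rpow_add ht0]
    ring
  have hcen : (1 - β₂) * x.re + (1 - β₃) * y.re = 0 := by
    have : ((1 - β₂ : ℝ) : ℂ) * x + ((1 - β₃ : ℝ) : ℂ) * y = 0 := by
      have := H.centre
      simp only [x, y]
      field_simp
      rw [mul_zero]
      exact this
    have h := congrArg re this
    rwa [add_re, re_ofReal_mul, re_ofReal_mul, Complex.zero_re] at h
  have hLb : |L| ≤ 2 * (‖x‖ ^ 2 + ‖y‖ ^ 2) := by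
    have k2 := abs_log_norm_one_sub_add_re_le h2
    have k3 := abs_log_norm_one_sub_add_re_le h3
    have e : L = (2 * β₂ - 2) * (log ‖1 - x‖ + x.re) + (2 * β₃ - 2) * (log ‖1 - y‖ + y.re) := by
      rw [hL]; linarith
    have p2 := H.pos₂
    have p3 := H.pos₃
    have l2 := H.lt₂
    have l3 := H.lt₃
    rw [e]
    refine (abs_add_le _ _).trans ?_
    rw [abs_mul, abs_mul, mul_add]
    gcongr
    · rw [abs_le]; constructor <;> linarith
    · rw [abs_le]; constructor <;> linarith
  have hL1 : |L| ≤ 1 := by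
    have : ‖x‖ ^ 2 ≤ (1 / 2) ^ 2 := by gcongr
    have : ‖y‖ ^ 2 ≤ (1 / 2) ^ 2 := by gcongr
    linarith
  have hexp := Real.abs_exp_sub_one_le hL1
  have hxy : ‖x‖ ^ 2 + ‖y‖ ^ 2 = (‖a₂‖ ^ 2 + ‖a₃‖ ^ 2) * ‖t‖ ^ (-2 : ℝ) := by
    rw [rpow_neg ht0.le, rpow_two]
    simp only [x, y, norm_div, div_pow]
    field_simp
  have e2 : ‖t‖ ^ (-(4 - 2 * γ)) = ‖t‖ ^ (2 * γ - 2) * ‖t‖ ^ (-2 : ℝ) := by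
    rw [← rpow_add ht0]; congr 1; ring
  rw [e1, ← mul_sub_one, abs_mul, abs_of_nonneg (by positivity), e2]
  calc ‖t‖ ^ (2 * γ - 2) * |Real.exp L - 1|
      ≤ ‖t‖ ^ (2 * γ - 2) * (2 * (2 * (‖x‖ ^ 2 + ‖y‖ ^ 2))) := by
        gcongr; exact hexp.trans (by gcongr)
    _ = _ := by rw [hxy]; ring

theorem flatDensity_le (H : IsCentredPair β₂ β₃ γ a₂ a₃) : ∃ A : ℝ, 0 ≤ A ∧ ∀ t, t ≠ a₂ → t ≠ a₃ →
    flatDensity β₂ β₃ a₂ a₃ t ≤ A * (‖t - a₂‖ ^ (-(2 - 2 * β₂)) + ‖t - a₃‖ ^ (-(2 - 2 * β₃))) := by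
  have p2 := H.lt₂
  have p3 := H.lt₃
  have hd : 0 < ‖a₂ - a₃‖ := norm_sub_pos_iff.2 H.ne
  refine ⟨(‖a₂ - a₃‖ / 2) ^ (-(2 - 2 * β₂)) + (‖a₂ - a₃‖ / 2) ^ (-(2 - 2 * β₃)), by positivity,
    fun t h2 h3 => ?_⟩
  have htri : ‖a₂ - a₃‖ ≤ ‖t - a₂‖ + ‖t - a₃‖ := by
    calc ‖a₂ - a₃‖ = ‖(t - a₃) - (t - a₂)‖ := by congr 1; ring
      _ ≤ _ := by rw [add_comm]; exact norm_sub_le _ _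
  rw [flatDensity, ← neg_sub 2 (2 * β₂), ← neg_sub 2 (2 * β₃)]
  have hmono : ∀ {x e : ℝ}, ‖a₂ - a₃‖ / 2 ≤ x → e < 1 →
      x ^ (-(2 - 2 * e)) ≤ (‖a₂ - a₃‖ / 2) ^ (-(2 - 2 * e)) := fun hx he =>
    rpow_le_rpow_of_nonpos (by positivity) hx (by linarith)
  have q1 : 0 ≤ ‖t - a₂‖ ^ (-(2 - 2 * β₂)) := by positivity
  have q2 : 0 ≤ ‖t - a₃‖ ^ (-(2 - 2 * β₃)) := by positivity
  have q3 : 0 ≤ (‖a₂ - a₃‖ / 2) ^ (-(2 - 2 * β₂)) := by positivity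
  have q4 : 0 ≤ (‖a₂ - a₃‖ / 2) ^ (-(2 - 2 * β₃)) := by positivity
  rcases le_total ‖t - a₂‖ ‖t - a₃‖ with h | h
  · have := hmono (x := ‖t - a₃‖) (by linarith) p3
    nlinarith [mul_le_mul_of_nonneg_left this q1, mul_nonneg q3 q1, mul_nonneg q3 q2,
      mul_nonneg q4 q2]
  · have := hmono (x := ‖t - a₂‖) (by linarith) p2
    nlinarith [mul_le_mul_of_nonneg_right this q2, mul_nonneg q3 q1, mul_nonneg q4 q1,
      mul_nonneg q4 q2]

theorem measurable_flatDensity : Measurable (flatDensity β₂ β₃ a₂ a₃) := by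
  unfold flatDensity
  fun_prop

/-- The radius beyond which the flat metric is close to the cone at infinity. -/
noncomputable def farRadius (a₂ a₃ : ℂ) : ℝ := 1 + 2 * (‖a₂‖ + ‖a₃‖)

/-- The density of the flat metric, corrected outside the disc of radius `ρ` so as to be
integrable. -/
noncomputable def truncDensity (β₂ β₃ γ : ℝ) (a₂ a₃ : ℂ) (ρ : ℝ) (t : ℂ) : ℝ :=
  flatDensity β₂ β₃ a₂ a₃ t - (closedBall 0 ρ)ᶜ.indicator (fun t => ‖t‖ ^ (2 * γ - 2)) t

theorem isDensity_trunc (H : IsCentredPair β₂ β₃ γ a₂ a₃) {ρ : ℝ} (hρ : farRadius a₂ a₃ ≤ ρ) :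
    ∃ A, IsDensity ![a₂, a₃] ![2 - 2 * β₂, 2 - 2 * β₃] (4 - 2 * γ) A ρ
      (truncDensity β₂ β₃ γ a₂ a₃ ρ) := by
  obtain ⟨A, hA, hle⟩ := H.flatDensity_le
  have hfin : ({a₂, a₃} : Set ℂ).Countable := (toFinite _).countable
  refine ⟨A + 4 * (‖a₂‖ ^ 2 + ‖a₃‖ ^ 2), ?_, ?_, ?_, by linarith [H.lt], by positivity, ?_, ?_, ?_⟩
  · exact measurable_flatDensity.sub ((by fun_prop : Measurable _).indicator
      isClosed_closedBall.measurableSet.compl)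
  · rw [Fin.forall_fin_two]
    simp only [Matrix.cons_val_zero, Matrix.cons_val_one]
    exact ⟨by linarith [H.lt₂], by linarith [H.lt₃]⟩
  · rw [Fin.forall_fin_two]
    simp only [Matrix.cons_val_zero, Matrix.cons_val_one]
    exact ⟨by linarith [H.pos₂], by linarith [H.pos₃]⟩
  · refine le_trans ?_ hρ
    rw [farRadius]; linarith [norm_nonneg a₂, norm_nonneg a₃]
  · filter_upwards [hfin.ae_notMem volume] with t ht h
    simp only [mem_insert_iff, mem_singleton_iff, not_or] at ht
    rw [truncDensity, indicator_of_notMem (by simpa using h), sub_zero,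
      abs_of_nonneg (by unfold flatDensity; positivity), Fin.sum_univ_two]
    simp only [Matrix.cons_val_zero, Matrix.cons_val_one]
    refine (hle t ht.1 ht.2).trans ?_
    gcongr
    have : 0 ≤ 4 * (‖a₂‖ ^ 2 + ‖a₃‖ ^ 2) := by positivity
    linarith
  · refine .of_forall fun t h => ?_
    rw [truncDensity, indicator_of_mem (by simpa using h)]
    refine (H.flatDensity_sub_le (hρ.trans h.le)).trans ?_
    gcongr
    linarith

theorem isDensity_full (H : IsCentredPair β₂ β₃ γ a₂ a₃) :
    ∃ A, IsDensity ![a₂, a₃, 0] ![2 - 2 * β₂, 2 - 2 * β₃, 2 - 2 * γ] (4 - 2 * γ) A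
      (farRadius a₂ a₃) (fun t => flatDensity β₂ β₃ a₂ a₃ t - ‖t‖ ^ (2 * γ - 2)) := by
  obtain ⟨A, hA, hle⟩ := H.flatDensity_le
  have hfin : ({a₂, a₃} : Set ℂ).Countable := (toFinite _).countable
  refine ⟨A + 1 + 4 * (‖a₂‖ ^ 2 + ‖a₃‖ ^ 2), ?_, ?_, ?_, by linarith [H.lt], by positivity, ?_, ?_,
    ?_⟩
  · exact measurable_flatDensity.sub (by fun_prop : Measurable _)
  · intro j
    fin_cases j
    · change 0 < 2 - 2 * β₂; linarith [H.lt₂]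
    · change 0 < 2 - 2 * β₃; linarith [H.lt₃]
    · change 0 < 2 - 2 * γ; linarith [H.lt]
  · intro j
    fin_cases j
    · change 2 - 2 * β₂ < 2; linarith [H.pos₂]
    · change 2 - 2 * β₃ < 2; linarith [H.pos₃]
    · change 2 - 2 * γ < 2; linarith [H.pos]
  · rw [farRadius]; linarith [norm_nonneg a₂, norm_nonneg a₃]
  · filter_upwards [hfin.ae_notMem volume] with t ht h
    simp only [mem_insert_iff, mem_singleton_iff, not_or] at ht
    have h1 := hle t ht.1 ht.2
    have h0 : 0 ≤ flatDensity β₂ β₃ a₂ a₃ t := by unfold flatDensity; positivity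
    refine (abs_sub _ _).trans ?_
    rw [abs_of_nonneg h0, abs_of_nonneg (by positivity : 0 ≤ ‖t‖ ^ (2 * γ - 2)), Fin.sum_univ_three]
    change _ ≤ _ * (‖t - a₂‖ ^ (-(2 - 2 * β₂)) + ‖t - a₃‖ ^ (-(2 - 2 * β₃))
      + ‖t - 0‖ ^ (-(2 - 2 * γ)))
    rw [sub_zero, neg_sub 2 (2 * γ)]
    have q1 : 0 ≤ ‖t - a₂‖ ^ (-(2 - 2 * β₂)) := by positivity
    have q2 : 0 ≤ ‖t - a₃‖ ^ (-(2 - 2 * β₃)) := by positivity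
    have q3 : 0 ≤ ‖t‖ ^ (2 * γ - 2) := by positivity
    have q4 : 0 ≤ 4 * (‖a₂‖ ^ 2 + ‖a₃‖ ^ 2) := by positivity
    nlinarith [mul_nonneg q4 q1, mul_nonneg q4 q2, mul_nonneg q4 q3, mul_nonneg hA q3]
  · refine .of_forall fun t h => ?_
    refine (H.flatDensity_sub_le (le_of_lt h)).trans ?_
    gcongr
    linarith

end IsCentredPair

/-! ### The potential of a radial density -/

theorem continuousOn_log_mul_rpow {k : ℝ} (hk : 0 < k) :
    ContinuousOn (fun r : ℝ => log r * r ^ k) (Ici 0) := by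
  intro r hr
  rcases eq_or_lt_of_le (mem_Ici.1 hr) with rfl | h
  · rw [← continuousWithinAt_Ioi_iff_Ici, ContinuousWithinAt]
    simpa [zero_rpow hk.ne'] using tendsto_log_mul_rpow_nhdsGT_zero hk
  · exact ((Real.continuousAt_log h.ne').mul
      (Real.continuousAt_rpow_const r k (Or.inl h.ne'))).continuousWithinAt

theorem integral_rpow_mul_log_sub {k W : ℝ} (hk : 0 < k) (hW : 0 < W) :
    IntegrableOn (fun r : ℝ => r ^ (k - 1) * (log W - log r)) (Ioc 0 W) ∧
      ∫ r in Ioc 0 W, r ^ (k - 1) * (log W - log r) = W ^ k / k ^ 2 := by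
  set G : ℝ → ℝ := fun r => (log W / k + 1 / k ^ 2) * r ^ k - log r * r ^ k / k with hG
  have hc : ContinuousOn G (Icc 0 W) := by
    refine ContinuousOn.mono (s := Ici 0) ?_ Icc_subset_Ici_self
    exact (continuousOn_const.mul (Real.continuous_rpow_const hk.le).continuousOn).sub
      ((continuousOn_log_mul_rpow hk).div_const k)
  have hd : ∀ r ∈ Ioo 0 W, HasDerivAt G (r ^ (k - 1) * (log W - log r)) r := by
    intro r hr
    have h1 := Real.hasDerivAt_rpow_const (x := r) (p := k) (Or.inl hr.1.ne')
    have h2 := Real.hasDerivAt_log hr.1.ne'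
    refine ((h1.const_mul (log W / k + 1 / k ^ 2)).sub ((h2.mul h1).div_const k)).congr_deriv ?_
    have e : r ^ k = r ^ (k - 1) * r := by rw [← rpow_add_one hr.1.ne']; congr 1; ring
    have hr0 := hr.1.ne'
    rw [e]
    field_simp
    ring
  have hpos : ∀ r ∈ Ioo 0 W, 0 ≤ r ^ (k - 1) * (log W - log r) := fun r hr =>
    mul_nonneg (rpow_nonneg hr.1.le _) (sub_nonneg.2 (Real.log_le_log hr.1 hr.2.le))
  have hi := intervalIntegral.integrableOn_deriv_of_nonneg hc hd hpos
  refine ⟨hi, ?_⟩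
  rw [← intervalIntegral.integral_of_le hW.le,
    intervalIntegral.integral_eq_sub_of_hasDerivAt_of_le hW.le hc hd
      ((intervalIntegrable_iff_integrableOn_Ioc_of_le hW.le).2 hi)]
  simp only [hG, zero_rpow hk.ne', mul_zero, sub_zero, zero_div]
  ring

theorem setIntegral_log_norm_circle {r : ℝ} (hr : 0 < r) (w : ℂ) :
    ∫ θ in Ioo (-π) π, log ‖w - Complex.polarCoord.symm (r, θ)‖
      = 2 * π * (log r + posLog (r⁻¹ * ‖w‖)) := by
  have h := circleAverage_log_norm_sub_const_eq_log_radius_add_posLog (a := w) (c := 0) hr.ne'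
  rw [Real.circleAverage_eq_integral_add (-π), zero_sub, norm_neg, smul_eq_mul] at h
  rw [intervalIntegral.integral_comp_add_right (fun θ => log ‖circleMap 0 r θ - w‖)] at h
  have e1 : 0 + -π = -π := by ring
  have e2 : 2 * π + -π = π := by ring
  rw [e1, e2, intervalIntegral.integral_of_le (by linarith [pi_pos]),
    integral_Ioc_eq_integral_Ioo] at h
  rw [← h, ← mul_assoc, mul_inv_cancel₀ (by positivity), one_mul]
  refine integral_congr_ae (.of_forall fun θ => ?_)
  simp only
  rw [norm_sub_rev, Complex.polarCoord_symm_apply, circleMap, exp_mul_I]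
  simp

/-- The density `‖t‖^(2γ-2)` of a cone, restricted to a disc. -/
noncomputable def discDensity (γ ρ : ℝ) (t : ℂ) : ℝ :=
  (closedBall 0 ρ).indicator (fun t => ‖t‖ ^ (2 * γ - 2)) t

theorem isDensity_disc {γ : ℝ} (hγ : 0 < γ) (hγ1 : γ < 1) (ρ : ℝ) :
    IsDensity (fun _ : Unit => (0 : ℂ)) (fun _ => 2 - 2 * γ) 3 1 (max ρ 1) (discDensity γ ρ) := by
  refine ⟨(by fun_prop : Measurable _).indicator isClosed_closedBall.measurableSet,
    fun _ => by linarith, fun _ => by linarith, by norm_num, zero_le_one, le_max_right _ _,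
    .of_forall fun t h => ?_, .of_forall fun t h => ?_⟩
  · simp only [Finset.univ_unique, Finset.sum_const, Finset.card_singleton, one_smul, one_mul,
      sub_zero, neg_sub]
    unfold discDensity
    rw [abs_of_nonneg (indicator_nonneg (fun _ _ => by positivity) _)]
    exact indicator_le_self' (fun _ _ => by positivity) _
  · rw [discDensity, indicator_of_notMem, abs_zero]
    · positivity
    · rw [mem_closedBall_zero_iff, not_le]
      exact (le_max_left _ _).trans_lt h

theorem logPotential_disc {γ : ℝ} (hγ : 0 < γ) (hγ1 : γ < 1) (ρ : ℝ) : ∃ c, ∀ w, ‖w‖ ≤ ρ →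
      2 * γ ^ 2 / π * logPotential (discDensity γ ρ) w = ‖w‖ ^ (2 * γ) + c := by
  set k := 2 * γ with hk
  have hk0 : 0 < k := by positivity
  set J : ℂ → ℝ → ℝ := fun w r => 2 * π * (r ^ (k - 1) * (log r + posLog (r⁻¹ * ‖w‖))) with hJ
  have key : ∀ w, IntegrableOn (J w) (Ioc 0 ρ) ∧
      logPotential (discDensity γ ρ) w = ∫ r in Ioc 0 ρ, J w r := by
    intro w
    set F : ℂ → ℝ := fun t => discDensity γ ρ t * log ‖w - t‖ with hF
    have hFm : Measurable F := by
      have := (isDensity_disc hγ hγ1 ρ).measurable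
      fun_prop
    have hFi : Integrable F := (isDensity_disc hγ hγ1 ρ).integrable_log w
    have hPi : Integrable (fun q : ℝ × ℝ => q.1 • F (Complex.polarCoord.symm q))
        ((volume.restrict (Ioi 0)).prod (volume.restrict (Ioo (-π) π))) := by
      have hm : Measurable fun q : ℝ × ℝ => q.1 • F (Complex.polarCoord.symm q) := by
        simp only [Complex.polarCoord_symm_apply]
        fun_prop
      refine ⟨hm.aestronglyMeasurable, ?_⟩
      have h1 := hFi.2
      rw [HasFiniteIntegral, ← Complex.lintegral_comp_polarCoord_symm, polarCoord_target,
        Measure.volume_eq_prod, ← Measure.prod_restrict] at h1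
      rw [HasFiniteIntegral]
      refine lt_of_le_of_lt (lintegral_mono_ae ?_) h1
      have : ∀ᵐ q : ℝ × ℝ ∂((volume.restrict (Ioi 0)).prod
          (volume.restrict (Ioo (-π) π))), q ∈ Ioi (0 : ℝ) ×ˢ Ioo (-π) π := by
        rw [Measure.prod_restrict]
        exact ae_restrict_mem (measurableSet_Ioi.prod measurableSet_Ioo)
      filter_upwards [this] with q hq
      rw [smul_eq_mul, enorm_mul, smul_eq_mul, Real.enorm_eq_ofReal (le_of_lt hq.1)]
    have hin : ∀ r ∈ Ioi (0 : ℝ), ∫ θ in Ioo (-π) π,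
        r • F (Complex.polarCoord.symm (r, θ)) = (Ioc 0 ρ).indicator (J w) r := by
      intro r hr
      have hr0 : 0 < r := hr
      have hn : ∀ θ : ℝ, ‖Complex.polarCoord.symm (r, θ)‖ = r := fun θ => by
        rw [Complex.norm_polarCoord_symm]; exact abs_of_pos hr0
      by_cases hle : r ≤ ρ
      · rw [indicator_of_mem (show r ∈ Ioc 0 ρ from ⟨hr0, hle⟩)]
        have e : ∀ θ : ℝ, r • F (Complex.polarCoord.symm (r, θ))
            = r ^ (k - 1) * log ‖w - Complex.polarCoord.symm (r, θ)‖ := by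
          intro θ
          simp only [hF]
          rw [discDensity, indicator_of_mem (by rwa [mem_closedBall_zero_iff, hn]), hn,
            smul_eq_mul, ← mul_assoc]
          congr 1
          rw [mul_comm, ← rpow_add_one hr0.ne']
          congr 1; ring
        simp only [e]
        rw [integral_const_mul, setIntegral_log_norm_circle hr0]
        simp only [hJ]; ring
      · rw [indicator_of_notMem fun h => hle h.2]
        have e : ∀ θ : ℝ, r • F (Complex.polarCoord.symm (r, θ)) = 0 := by
          intro θ
          simp only [hF]
          rw [discDensity, indicator_of_notMem (by rwa [mem_closedBall_zero_iff, hn]), zero_mul,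
            smul_zero]
        simp only [e, integral_zero]
    have hii := hPi.integral_prod_left
    have h3 : IntegrableOn ((Ioc 0 ρ).indicator (J w)) (Ioi 0) :=
      (integrableOn_congr_fun hin measurableSet_Ioi).1 hii
    have hsub : Ioc 0 ρ ⊆ Ioi 0 := Ioc_subset_Ioi_self
    constructor
    · have h4 := h3.mono_set hsub
      exact (integrableOn_congr_fun (fun r hr => indicator_of_mem hr _) measurableSet_Ioc).1 h4
    · rw [logPotential, ← Complex.integral_comp_polarCoord_symm, polarCoord_target,
        Measure.volume_eq_prod, ← Measure.prod_restrict, integral_prod _ hPi,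
        setIntegral_congr_fun measurableSet_Ioi hin, setIntegral_indicator measurableSet_Ioc,
        inter_eq_right.2 hsub]
  have h0 : ∀ r, J 0 r = 2 * π * (r ^ (k - 1) * log r) := fun r => by simp [hJ]
  refine ⟨2 * γ ^ 2 / π * ∫ r in Ioc 0 ρ, J 0 r, fun w hw => ?_⟩
  rw [(key w).2]
  have hsplit : ∫ r in Ioc 0 ρ, J w r = (∫ r in Ioc 0 ρ, J 0 r) + 2 * π * (‖w‖ ^ k / k ^ 2) := by
    rcases eq_or_ne w 0 with rfl | hw0
    · simp [zero_rpow hk0.ne']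
    have hw' : 0 < ‖w‖ := norm_pos_iff.2 hw0
    rw [← sub_eq_iff_eq_add', ← integral_sub (key w).1 (key 0).1,
      ← (integral_rpow_mul_log_sub hk0 hw').2, ← integral_const_mul]
    have e : ∀ r ∈ Ioc 0 ρ, J w r - J 0 r = (Ioc 0 ‖w‖).indicator
        (fun r => 2 * π * (r ^ (k - 1) * (log ‖w‖ - log r))) r := by
      intro r hr
      have hr0 : 0 < r := hr.1
      rw [h0]
      simp only [hJ]
      by_cases hrw : r ≤ ‖w‖
      · rw [indicator_of_mem (show r ∈ Ioc 0 ‖w‖ from ⟨hr0, hrw⟩), Real.posLog_eq_log, Real.log_mul (by positivity) hw'.ne',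
          log_inv]
        · ring
        · rw [abs_of_nonneg (by positivity)]
          exact (one_le_inv_mul₀ hr0).2 hrw
      · rw [indicator_of_notMem fun h => hrw h.2, Real.posLog_eq_zero_iff _ |>.2]
        · ring
        · rw [abs_of_nonneg (by positivity)]
          exact (inv_mul_le_one₀ hr0).2 (not_le.1 hrw).le
    rw [setIntegral_congr_fun measurableSet_Ioc e, setIntegral_indicator measurableSet_Ioc,
      inter_eq_right.2 (Ioc_subset_Ioc_right hw)]
  rw [hsplit, hk]
  have := pi_pos.ne'
  field_simp
  ring

namespace IsCentredPair
variable {β₂ β₃ γ : ℝ} {a₂ a₃ : ℂ}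

/-- On a disc, the potential of the flat metric is up to a constant the logarithmic potential of
a density which is regular away from the two cone points, in particular at the origin. -/
theorem flatPotential_eq (H : IsCentredPair β₂ β₃ γ a₂ a₃) {ρ : ℝ} (hρ : farRadius a₂ a₃ ≤ ρ) :
    ∃ c, ∀ w, ‖w‖ ≤ ρ → flatPotential β₂ β₃ γ a₂ a₃ w =
      c + 2 * γ ^ 2 / π * logPotential (truncDensity β₂ β₃ γ a₂ a₃ ρ) w := by
  obtain ⟨c, hc⟩ := logPotential_disc H.pos H.lt ρ
  obtain ⟨A, hA⟩ := H.isDensity_trunc hρ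
  refine ⟨-c, fun w hw => ?_⟩
  have h1 := hc w hw
  have h2 : ∫ t : ℂ, (‖t - a₂‖ ^ (2 * β₂ - 2) * ‖t - a₃‖ ^ (2 * β₃ - 2) - ‖t‖ ^ (2 * γ - 2)) *
      log ‖w - t‖ = logPotential (truncDensity β₂ β₃ γ a₂ a₃ ρ) w
        - logPotential (discDensity γ ρ) w := by
    rw [logPotential, logPotential, ← integral_sub (hA.integrable_log w)
      ((isDensity_disc H.pos H.lt ρ).integrable_log w)]
    refine integral_congr_ae (.of_forall fun t => ?_)
    simp only
    rw [← sub_mul, truncDensity, discDensity, sub_sub, flatDensity]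
    congr 2
    exact (indicator_compl_add_self_apply (closedBall (0 : ℂ) ρ)
      (fun t => ‖t‖ ^ (2 * γ - 2)) t).symm
  rw [flatPotential, h2, mul_sub]
  linarith

end IsCentredPair

/-! ### The potential of the flat metric -/

theorem hasFDerivAt_norm_rpow {m : ℝ} {u : ℂ} (hu : u ≠ 0) :
    HasFDerivAt (fun w : ℂ => ‖w‖ ^ m) ((m * ‖u‖ ^ (m - 2)) • innerSL ℝ u) u := by
  have hu' : 0 < ‖u‖ := norm_pos_iff.2 hu
  have h1 := (hasStrictFDerivAt_norm_sq u).hasFDerivAt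
  have h2 := (h1.rpow_const (p := m / 2) (Or.inl (by positivity)))
  have e : (fun w : ℂ => (‖w‖ ^ 2) ^ (m / 2)) = fun w : ℂ => ‖w‖ ^ m := by
    ext w
    rw [← rpow_natCast, ← rpow_mul (norm_nonneg _)]
    congr 1; push_cast; ring
  rw [e] at h2
  refine h2.congr_fderiv ?_
  have e2 : (‖u‖ ^ 2) ^ (m / 2 - 1) = ‖u‖ ^ (m - 2) := by
    rw [← rpow_natCast, ← rpow_mul hu'.le]
    congr 1; push_cast; ring
  rw [e2]
  ext v
  simp
  ring

theorem norm_fderiv_norm_rpow_le' {m : ℝ} (hm : 0 ≤ m) {u : ℂ} (hu : u ≠ 0) :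
    ‖𝒟 (fun w : ℂ => ‖w‖ ^ m) u‖ ≤ m * ‖u‖ ^ (m - 1) := by
  have hu' : 0 < ‖u‖ := norm_pos_iff.2 hu
  rw [(hasFDerivAt_norm_rpow hu).fderiv, norm_smul, innerSL_apply_norm,
    norm_of_nonneg (by positivity), mul_assoc, ← rpow_add_one hu'.ne']
  apply le_of_eq
  congr 2; ring

theorem contDiffAt_norm_rpow {m : ℝ} {n : ℕ∞} {u : ℂ} (hu : u ≠ 0) :
    ContDiffAt ℝ n (fun w : ℂ => ‖w‖ ^ m) u :=
  (contDiffAt_norm ℝ hu).rpow_const_of_ne (norm_ne_zero_iff.2 hu)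

namespace IsDensity

theorem abs_logPotential_le (hf : IsDensity a p m A ρ f) {κ : ℝ} (hκ : 0 < κ)
    (hκp : ∀ j, p j + κ < 2) (hκm : 2 < m - κ) (hκ2 : κ < 2) : ∃ C : ℝ, 0 ≤ C ∧
    ∀ u, |logPotential f u| ≤ C * (1 + ‖u‖) ^ κ := by
  obtain ⟨C, hC0, hC⟩ := hf.lintegral_log_le hκ hκp hκm hκ2
  refine ⟨C, hC0, fun u => ?_⟩
  have h := (enorm_integral_le_lintegral_enorm (μ := volume)
    fun t : ℂ => f t * log ‖u - t‖).trans (hC u)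
  rw [← ofReal_norm] at h
  exact (ofReal_le_ofReal_iff (by positivity)).1 h

theorem norm_cauchyTransform_far_le (hf : IsDensity a p m A ρ f) : ∃ C : ℝ, 0 ≤ C ∧
    ∀ u, (∀ j, u ≠ a j) → 2 * ρ ≤ ‖u‖ → ‖cauchyTransform f u‖ ≤ C * (‖u‖⁻¹ + ‖u‖ ^ (2 - m)) := by
  have hm := hf.m_gt
  have hA := hf.A_nonneg
  set I := ∫⁻ t, ‖f t‖ₑ with hI
  have hIt : I ≠ ⊤ := hf.integrable.2.ne
  set K := ∫⁻ t in ball (0 : ℂ) 1, ofReal (‖t‖ ^ (-1 : ℝ)) with hK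
  have hKt : K ≠ ⊤ := (lintegral_ball_rpow_lt_top (by norm_num)).ne
  refine ⟨2 * I.toReal + A * 2 ^ m * (π + K.toReal), by positivity, fun u hu hρu => ?_⟩
  have hρ := hf.one_le
  have hu1 : 1 ≤ ‖u‖ := by linarith
  have hu0 : 0 < ‖u‖ := by linarith
  set B := ball u (‖u‖ / 2) with hB
  have hBm : MeasurableSet B := isOpen_ball.measurableSet
  have hin : ∫⁻ t in B, ‖f t‖ₑ * ofReal (‖t - u‖ ^ (-1 : ℝ))
      ≤ ofReal (A * (‖u‖ / 2) ^ (-m)) * (volume B + K) := by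
    refine le_trans ?_ (mul_le_mul_right (lintegral_rpow_sub_le zero_le_one B u) _)
    rw [← lintegral_const_mul' _ _ ofReal_ne_top]
    apply lintegral_mono_ae
    filter_upwards [ae_restrict_of_ae hf.far, ae_restrict_mem hBm] with t ht htB
    have h1 : ‖u‖ / 2 < ‖t‖ := by
      rw [hB, mem_ball_iff_norm] at htB
      have := norm_sub_norm_le u t
      rw [norm_sub_rev] at this
      linarith
    rw [← ofReal_norm]
    gcongr
    refine (ht (by linarith)).trans ?_
    gcongr ?_ * ?_
    exact rpow_le_rpow_of_nonpos (by positivity) h1.le (by linarith)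
  have hout : ∫⁻ t in Bᶜ, ‖f t‖ₑ * ofReal (‖t - u‖ ^ (-1 : ℝ)) ≤ ofReal (2 * ‖u‖⁻¹) * I := by
    calc _ ≤ ∫⁻ t in Bᶜ, ofReal (2 * ‖u‖⁻¹) * ‖f t‖ₑ := by
          refine setLIntegral_mono' hBm.compl fun t ht => ?_
          rw [mul_comm]
          gcongr
          rw [hB, mem_compl_iff, mem_ball_iff_norm, not_lt] at ht
          rw [rpow_neg_one]
          calc ‖t - u‖⁻¹ ≤ (‖u‖ / 2)⁻¹ := inv_anti₀ (by positivity) ht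
            _ = _ := by rw [inv_div]; rfl
      _ ≤ _ := by
          rw [lintegral_const_mul' _ _ ofReal_ne_top]
          gcongr
          exact setLIntegral_le_lintegral _ _
  have h := (enorm_integral_le_lintegral_enorm (μ := volume) fun t : ℂ => (f t : ℂ) / (u - t))
  simp only [enorm_cauchy_kernel] at h
  rw [← lintegral_add_compl _ hBm] at h
  have h2 := h.trans (add_le_add hin hout)
  have hvol : volume B = ofReal (π * (‖u‖ / 2) ^ 2) := by
    rw [hB, Complex.volume_ball, mul_comm, ofReal_mul pi_pos.le, ENNReal.ofReal_pow (by positivity)]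
    congr 1
    rw [← ofReal_coe_nnreal, NNReal.coe_real_pi]
  rw [hvol, ← ofReal_toReal hKt, ← ofReal_toReal hIt, ofReal_add_ofReal,
    ofReal_mul_ofReal, ofReal_mul_ofReal,
    ofReal_add_ofReal, ← ofReal_norm] at h2
  have h3 := (ofReal_le_ofReal_iff (by positivity)).1 h2
  rw [cauchyTransform]
  refine h3.trans ?_
  have e1 : (‖u‖ / 2) ^ (-m) = 2 ^ m * ‖u‖ ^ (-m) := by
    rw [div_rpow hu0.le two_pos.le, rpow_neg two_pos.le, div_inv_eq_mul, mul_comm]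
  have e2 : ‖u‖ ^ (2 - m) = ‖u‖ ^ (-m) * ‖u‖ ^ 2 := by
    rw [← rpow_natCast, ← rpow_add hu0]; congr 1; push_cast; ring
  have h4 : π * (‖u‖ / 2) ^ 2 + K.toReal ≤ (π + K.toReal) * ‖u‖ ^ 2 := by
    have : 1 ≤ ‖u‖ ^ 2 := one_le_pow₀ hu1
    nlinarith [pi_pos, toReal_nonneg (a := K), sq_nonneg ‖u‖]
  have h6 : 0 ≤ A * 2 ^ m * (π + K.toReal) := by positivity
  have h7 : 0 ≤ ‖u‖ ^ (2 - m) := by positivity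
  have h8 : 0 ≤ 2 * I.toReal := by positivity
  have h9 : 0 ≤ ‖u‖⁻¹ := by positivity
  calc A * (‖u‖ / 2) ^ (-m) * (π * (‖u‖ / 2) ^ 2 + K.toReal) + 2 * ‖u‖⁻¹ * I.toReal
      ≤ A * (2 ^ m * ‖u‖ ^ (-m)) * ((π + K.toReal) * ‖u‖ ^ 2) + 2 * ‖u‖⁻¹ * I.toReal := by
        rw [e1]; gcongr
    _ = A * 2 ^ m * (π + K.toReal) * ‖u‖ ^ (2 - m) + 2 * I.toReal * ‖u‖⁻¹ := by rw [e2]; ring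
    _ ≤ _ := by nlinarith [mul_nonneg h6 h9, mul_nonneg h8 h7]

/-- The derivative of the potential decays at infinity. -/
theorem norm_fderiv_logPotential_far_le (hf : IsDensity a p m A ρ f) : ∃ C M : ℝ, 0 ≤ C ∧
    ∀ u, M ≤ ‖u‖ → DifferentiableAt ℝ (logPotential f) u →
      ‖𝒟 (logPotential f) u‖ ≤ C * (‖u‖⁻¹ + ‖u‖ ^ (2 - m)) := by
  obtain ⟨C, hC0, hC⟩ := hf.norm_cauchyTransform_far_le
  have hm := hf.m_gt
  have hρ := hf.one_le
  set S := ∑ j, ‖a j‖ with hS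
  have hS0 : 0 ≤ S := by positivity
  refine ⟨C * (2 + 2 ^ (m - 2)), 4 * ρ + 4 * S, by positivity, fun u hu hd => ?_⟩
  have hu0 : 0 < ‖u‖ := by linarith
  refine hd.hasFDerivAt.le_of_lip' (by positivity) ?_
  filter_upwards [ball_mem_nhds u (half_pos hu0)] with x hx
  rw [mem_ball_iff_norm] at hx
  have hfar : ∀ s ∈ uIoc (0 : ℝ) 1, ‖u‖ / 2 < ‖u + s * (x - u)‖ := by
    intro s hs
    rw [uIoc_of_le zero_le_one] at hs
    have h1 : ‖(s : ℂ) * (x - u)‖ ≤ ‖x - u‖ := by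
      rw [norm_mul, norm_real, norm_eq_abs, abs_of_pos hs.1]
      exact mul_le_of_le_one_left (norm_nonneg _) hs.2
    have h2 := norm_sub_norm_le u (-((s : ℂ) * (x - u)))
    rw [norm_neg, sub_neg_eq_add] at h2
    linarith
  have hb : ∀ s ∈ uIoc (0 : ℝ) 1, ‖((x - u) * cauchyTransform f (u + s * (x - u))).re‖
      ≤ C * (2 + 2 ^ (m - 2)) * (‖u‖⁻¹ + ‖u‖ ^ (2 - m)) * ‖x - u‖ := by
    intro s hs
    have h1 := hfar s hs
    set y := u + s * (x - u)
    have hy : ∀ j, y ≠ a j := by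
      intro j hj
      have : ‖a j‖ ≤ S := Finset.single_le_sum (f := fun j => ‖a j‖)
        (fun _ _ => norm_nonneg _) (Finset.mem_univ j)
      rw [hj] at h1
      linarith
    refine (abs_re_le_norm _).trans ?_
    rw [norm_mul, mul_comm]
    gcongr
    refine (hC y hy (by linarith)).trans ?_
    rw [mul_assoc]
    gcongr
    have k1 : ‖y‖⁻¹ ≤ 2 * ‖u‖⁻¹ := by
      calc ‖y‖⁻¹ ≤ (‖u‖ / 2)⁻¹ := inv_anti₀ (by positivity) h1.le
        _ = _ := by rw [inv_div]; rfl
    have k2 : ‖y‖ ^ (2 - m) ≤ 2 ^ (m - 2) * ‖u‖ ^ (2 - m) := by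
      calc ‖y‖ ^ (2 - m) ≤ (‖u‖ / 2) ^ (2 - m) :=
            rpow_le_rpow_of_nonpos (by positivity) h1.le (by linarith)
        _ = _ := by
            rw [div_rpow hu0.le two_pos.le, ← neg_sub m 2, rpow_neg two_pos.le,
              div_inv_eq_mul, mul_comm]
    have k3 : 0 ≤ ‖u‖ ^ (2 - m) := by positivity
    have k4 : (0 : ℝ) ≤ 2 ^ (m - 2) := by positivity
    have k5 : 0 ≤ ‖u‖⁻¹ := by positivity
    nlinarith [mul_nonneg k4 k5]
  have h := intervalIntegral.norm_integral_le_of_norm_le_const hb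
  rw [← hf.logPotential_add_sub] at h
  simpa using h

end IsDensity

theorem flatDensity_comm (β₂ β₃ : ℝ) (a₂ a₃ : ℂ) :
    flatDensity β₂ β₃ a₂ a₃ = flatDensity β₃ β₂ a₃ a₂ := by
  ext t; exact mul_comm _ _

theorem flatPotential_comm (β₂ β₃ γ : ℝ) (a₂ a₃ : ℂ) :
    flatPotential β₂ β₃ γ a₂ a₃ = flatPotential β₃ β₂ γ a₃ a₂ := by
  ext w
  unfold flatPotential
  congr 3
  ext t
  rw [mul_comm (‖t - a₂‖ ^ (2 * β₂ - 2))]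

theorem flatDensity_nonneg {β₂ β₃ : ℝ} {a₂ a₃ t : ℂ} : 0 ≤ flatDensity β₂ β₃ a₂ a₃ t := by
  unfold flatDensity
  positivity

theorem contDiffAt_flatDensity {β₂ β₃ : ℝ} {a₂ a₃ t : ℂ} (h2 : t ≠ a₂) (h3 : t ≠ a₃) :
    ContDiffAt ℝ 1 (flatDensity β₂ β₃ a₂ a₃) t := by
  have k : ∀ {a : ℂ} {e : ℝ}, t ≠ a → ContDiffAt ℝ 1 (fun t : ℂ => ‖t - a‖ ^ e) t := by
    intro a e h
    exact (contDiffAt_norm_rpow (n := 1) (m := e) (sub_ne_zero.2 h)).comp t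
      (contDiffAt_id.sub contDiffAt_const)
  exact (k h2).mul (k h3)

namespace IsCentredPair
variable {β₂ β₃ γ : ℝ} {a₂ a₃ : ℂ}

local notation "φ" => flatPotential β₂ β₃ γ a₂ a₃
local notation "dens" => flatDensity β₂ β₃ a₂ a₃
local notation "𝓟" => IsCentredPair β₂ β₃ γ a₂ a₃

theorem symm (H : IsCentredPair β₂ β₃ γ a₂ a₃) : IsCentredPair β₃ β₂ γ a₃ a₂ :=
  ⟨H.pos₃, H.lt₃, H.pos₂, H.lt₂, H.pos, H.lt, by rw [H.angle, add_comm], H.ne.symm, by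
    rw [add_comm]; exact H.centre⟩

theorem continuous_flatPotential (H : 𝓟) : Continuous φ := by
  obtain ⟨A, hA⟩ := H.isDensity_full
  have := hA.continuous_logPotential
  exact (Continuous.rpow_const continuous_norm fun _ => Or.inr (by linarith [H.pos])).add
    (continuous_const.mul this)

theorem truncDensity_eq_of_norm_lt {ρ : ℝ} {t : ℂ} (h : ‖t‖ < ρ) :
    truncDensity β₂ β₃ γ a₂ a₃ ρ t = dens t := by
  rw [truncDensity, indicator_of_notMem (by simpa using h.le), sub_zero]

theorem truncDensity_regular {ρ : ℝ} {u : ℂ} (hu : ‖u‖ < ρ) (h2 : u ≠ a₂) (h3 : u ≠ a₃) :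
    ∃ r > 0, ContDiffOn ℝ 1 (truncDensity β₂ β₃ γ a₂ a₃ ρ) (ball u r) := by
  have ho : {t : ℂ | ‖t‖ < ρ ∧ t ≠ a₂ ∧ t ≠ a₃} ∈ nhds u := by
    filter_upwards [(isOpen_lt continuous_norm continuous_const).mem_nhds hu,
      eventually_ne_nhds h2, eventually_ne_nhds h3] with t k1 k2 k3
    exact ⟨k1, k2, k3⟩
  obtain ⟨r, hr, hb⟩ := Metric.mem_nhds_iff.1 ho
  refine ⟨r, hr, fun t ht => ?_⟩
  have k := hb ht
  refine ((contDiffAt_flatDensity (β₂ := β₂) (β₃ := β₃) k.2.1 k.2.2).congr_of_eventuallyEq ?_).contDiffWithinAt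
  filter_upwards [(isOpen_lt continuous_norm continuous_const).mem_nhds k.1] with s hs
  exact truncDensity_eq_of_norm_lt hs

theorem farRadius_pos (a₂ a₃ : ℂ) : 0 < farRadius a₂ a₃ := by
  rw [farRadius]; linarith [norm_nonneg a₂, norm_nonneg a₃]

/-- The potential of the flat metric is `C²` away from the cone points, and its Levi form is the
flat metric. -/
theorem flatPotential_regular (H : IsCentredPair β₂ β₃ γ a₂ a₃) {u : ℂ} (h2 : u ≠ a₂)
    (h3 : u ≠ a₃) : ContDiffAt ℝ 2 (flatPotential β₂ β₃ γ a₂ a₃) u ∧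
      𝒟 (fun w => 𝒟 (flatPotential β₂ β₃ γ a₂ a₃) w 1) u 1
        + 𝒟 (fun w => 𝒟 (flatPotential β₂ β₃ γ a₂ a₃) w I) u I
        = 4 * (γ ^ 2 * flatDensity β₂ β₃ a₂ a₃ u) := by
  set ρ := farRadius a₂ a₃ + ‖u‖ + 1 with hρ
  have hf0 := farRadius_pos a₂ a₃
  have hρf : farRadius a₂ a₃ ≤ ρ := by linarith [norm_nonneg u]
  have huρ : ‖u‖ < ρ := by linarith
  obtain ⟨A, hA⟩ := H.isDensity_trunc hρf
  obtain ⟨c, hc⟩ := H.flatPotential_eq hρf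
  obtain ⟨r, hr, hreg⟩ := truncDensity_regular (β₂ := β₂) (β₃ := β₃) (γ := γ) huρ h2 h3
  obtain ⟨k1, k2, k3⟩ := hA.logPotential_regular (by
    rw [Fin.forall_fin_two]; exact ⟨h2, h3⟩) hr hreg
  set F := logPotential (truncDensity β₂ β₃ γ a₂ a₃ ρ) with hF
  set K := 2 * γ ^ 2 / π with hK
  have e : flatPotential β₂ β₃ γ a₂ a₃ =ᶠ[nhds u] fun w => c + K * F w := by
    filter_upwards [(isOpen_lt continuous_norm continuous_const).mem_nhds huρ] with w hw
    exact hc w (le_of_lt hw)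
  have hd : ∀ᶠ w in nhds u, DifferentiableAt ℝ F w :=
    (k1.eventually (by simp)).mono fun w hw => hw.differentiableAt (by norm_num)
  have hv : ∀ v, 𝒟 (fun w => 𝒟 (flatPotential β₂ β₃ γ a₂ a₃) w v) u v
      = K * 𝒟 (fun w => 𝒟 F w v) u v := by
    intro v
    have e1 : (fun w => 𝒟 (flatPotential β₂ β₃ γ a₂ a₃) w v) =ᶠ[nhds u] fun w => K * 𝒟 F w v := by
      filter_upwards [e.fderiv (𝕜 := ℝ), hd] with w hw hdw
      rw [hw, fderiv_const_add, fderiv_const_mul hdw]; rfl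
    have hdd : DifferentiableAt ℝ (fun w => 𝒟 F w v) u :=
      ((k1.fderiv_right (m := 1) (by norm_num)).differentiableAt one_ne_zero).clm_apply
        (differentiableAt_const v)
    rw [e1.fderiv_eq, fderiv_const_mul hdd]; rfl
  have hcd : ContDiffAt ℝ 2 (fun w => c + K * F w) u :=
    contDiffAt_const.add (contDiffAt_const.mul k1)
  refine ⟨hcd.congr_of_eventuallyEq e, ?_⟩
  rw [hv, hv, ← mul_add, k3, truncDensity_eq_of_norm_lt huρ, hK]
  have := pi_pos.ne'
  field_simp
  ring

theorem norm_fderiv_flatPotential_le (H : IsCentredPair β₂ β₃ γ a₂ a₃) (M : ℝ) : ∃ C : ℝ, 0 ≤ C ∧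
    ∀ u, ‖u‖ ≤ M → u ≠ a₂ → u ≠ a₃ → ‖𝒟 (flatPotential β₂ β₃ γ a₂ a₃) u‖
      ≤ C * (1 + ‖u - a₂‖ ^ (-poleExp (2 - 2 * β₂)) + ‖u - a₃‖ ^ (-poleExp (2 - 2 * β₃))) := by
  set ρ := farRadius a₂ a₃ + |M| + 1 with hρ
  have hf0 := farRadius_pos a₂ a₃
  have hρf : farRadius a₂ a₃ ≤ ρ := by linarith [abs_nonneg M]
  obtain ⟨A, hA⟩ := H.isDensity_trunc hρf
  obtain ⟨c, hc⟩ := H.flatPotential_eq hρf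
  obtain ⟨C, hC0, hC⟩ := hA.norm_cauchyTransform_le
  set K := 2 * γ ^ 2 / π with hK
  have hK0 : 0 ≤ K := by positivity
  refine ⟨K * C, by positivity, fun u hu h2 h3 => ?_⟩
  have huρ : ‖u‖ < ρ := by linarith [le_abs_self M]
  have hne : ∀ j : Fin 2, u ≠ ![a₂, a₃] j := by rw [Fin.forall_fin_two]; exact ⟨h2, h3⟩
  obtain ⟨r, hr, hreg⟩ := truncDensity_regular (β₂ := β₂) (β₃ := β₃) (γ := γ) huρ h2 h3
  obtain ⟨k1, k2, k3⟩ := hA.logPotential_regular hne hr hreg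
  have e : flatPotential β₂ β₃ γ a₂ a₃ =ᶠ[nhds u]
      fun w => c + K * logPotential (truncDensity β₂ β₃ γ a₂ a₃ ρ) w := by
    filter_upwards [(isOpen_lt continuous_norm continuous_const).mem_nhds huρ] with w hw
    exact hc w (le_of_lt hw)
  refine ContinuousLinearMap.opNorm_le_bound _ (by positivity) fun v => ?_
  have hCu := hC u hne
  rw [Fin.sum_univ_two, ← add_assoc] at hCu
  have hCu' : ‖cauchyTransform (truncDensity β₂ β₃ γ a₂ a₃ ρ) u‖ ≤
    C * (1 + ‖u - a₂‖ ^ (-poleExp (2 - 2 * β₂)) + ‖u - a₃‖ ^ (-poleExp (2 - 2 * β₃))) := hCu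
  rw [e.fderiv_eq, fderiv_const_add, fderiv_const_mul (k1.differentiableAt (by norm_num)),
    smul_apply, smul_eq_mul, k2.self_of_nhds v, norm_mul, norm_of_nonneg hK0]
  refine (mul_le_mul_of_nonneg_left (abs_re_le_norm _) hK0).trans ?_
  rw [norm_mul]
  calc K * (‖v‖ * ‖cauchyTransform (truncDensity β₂ β₃ γ a₂ a₃ ρ) u‖)
      ≤ K * (‖v‖ * (C * (1 + ‖u - a₂‖ ^ (-poleExp (2 - 2 * β₂))
          + ‖u - a₃‖ ^ (-poleExp (2 - 2 * β₃))))) := by gcongr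
    _ = _ := by ring

/-- The potential is asymptotic to the potential of the cone of angle `2πγ`, up to first
derivatives. -/
theorem flatPotential_asymp (H : 𝓟) {δ : ℝ} (hδ : 0 < δ) :
    ∃ M : ℝ, 1 ≤ M ∧ ∀ u, M ≤ ‖u‖ → u ≠ a₂ ∧ u ≠ a₃ ∧
      |φ u - ‖u‖ ^ (2 * γ)| ≤ δ * ‖u‖ ^ (2 * γ) ∧
      ‖𝒟 (fun w => φ w - ‖w‖ ^ (2 * γ)) u‖ ≤ δ * ‖u‖ ^ (2 * γ - 1) := by
  have hγ := H.pos
  obtain ⟨A, hA⟩ := H.isDensity_full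
  set f : ℂ → ℝ := fun t => dens t - ‖t‖ ^ (2 * γ - 2) with hf
  set K := 2 * γ ^ 2 / π with hK
  have hK0 : 0 ≤ K := by positivity
  have hφ : ∀ w, φ w - ‖w‖ ^ (2 * γ) = K * logPotential f w := by
    intro w
    rw [flatPotential, add_sub_cancel_left]; rfl
  obtain ⟨κ, hκ, hκp, hκm, hκ2, hκγ⟩ := hA.exists_small_exponent (by positivity : 0 < 2 * γ)
  obtain ⟨C1, hC1, hb1⟩ := hA.abs_logPotential_le hκ hκp hκm hκ2
  obtain ⟨C2, M2, hC2, hb2⟩ := hA.norm_fderiv_logPotential_far_le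
  have lim : ∀ {e c : ℝ}, e < 0 → ∀ᶠ x : ℝ in atTop, c * x ^ e < δ / 2 := by
    intro e c he
    have h1 : Tendsto (fun x : ℝ => c * x ^ e) atTop (nhds (c * 0)) := by
      have := tendsto_rpow_neg_atTop (neg_pos.2 he)
      rw [neg_neg] at this
      exact this.const_mul c
    rw [mul_zero] at h1
    exact h1.eventually (gt_mem_nhds (half_pos hδ))
  have hev : ∀ᶠ x : ℝ in atTop, K * C1 * 2 ^ κ * x ^ (κ - 2 * γ) < δ / 2 ∧
      K * C2 * x ^ (-(2 * γ)) < δ / 2 ∧ K * C2 * x ^ (-1 : ℝ) < δ / 2 ∧ 1 < x ∧ M2 ≤ x ∧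
      ‖a₂‖ < x ∧ ‖a₃‖ < x := by
    filter_upwards [lim (c := K * C1 * 2 ^ κ) (by linarith : κ - 2 * γ < 0),
      lim (c := K * C2) (by linarith : -(2 * γ) < 0), lim (c := K * C2) (by norm_num : (-1 : ℝ) < 0),
      eventually_gt_atTop 1, Filter.eventually_ge_atTop M2,
      eventually_gt_atTop ‖a₂‖, eventually_gt_atTop ‖a₃‖] with x k1 k2 k3 k4 k5 k6 k7
    exact ⟨k1, k2, k3, k4, k5, k6, k7⟩
  obtain ⟨M, hM⟩ := Filter.eventually_atTop.1 hev
  refine ⟨max M 1, le_max_right _ _, fun u hu => ?_⟩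
  obtain ⟨m1, m2, m3, m4, m5, m6, m7⟩ := hM ‖u‖ ((le_max_left _ _).trans hu)
  have hu0 : 0 < ‖u‖ := by linarith
  have h2 : u ≠ a₂ := fun h => by rw [h] at m6; exact lt_irrefl _ m6
  have h3 : u ≠ a₃ := fun h => by rw [h] at m7; exact lt_irrefl _ m7
  refine ⟨h2, h3, ?_, ?_⟩
  · rw [hφ, abs_mul, abs_of_nonneg hK0]
    have e1 : ‖u‖ ^ κ = ‖u‖ ^ (κ - 2 * γ) * ‖u‖ ^ (2 * γ) := by rw [← rpow_add hu0]; congr 1; ring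
    have h4 : (1 + ‖u‖) ^ κ ≤ 2 ^ κ * ‖u‖ ^ κ := by
      rw [← mul_rpow two_pos.le hu0.le]
      gcongr; linarith
    calc K * |logPotential f u| ≤ K * (C1 * (2 ^ κ * ‖u‖ ^ κ)) := by
          gcongr; exact (hb1 u).trans (by gcongr)
      _ = (K * C1 * 2 ^ κ * ‖u‖ ^ (κ - 2 * γ)) * ‖u‖ ^ (2 * γ) := by rw [e1]; ring
      _ ≤ δ * ‖u‖ ^ (2 * γ) := by gcongr; linarith
  · have hne0 : u ≠ 0 := norm_pos_iff.1 hu0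
    have hdφ := (H.flatPotential_regular h2 h3).1.differentiableAt (by norm_num)
    have hdn := (hasFDerivAt_norm_rpow (m := 2 * γ) hne0).differentiableAt
    have hKp : K ≠ 0 := by positivity
    have hdF : DifferentiableAt ℝ (logPotential f) u := by
      have : logPotential f = fun w => K⁻¹ * (φ w - ‖w‖ ^ (2 * γ)) := by
        ext w; rw [hφ, ← mul_assoc, inv_mul_cancel₀ hKp, one_mul]
      rw [this]
      exact (hdφ.sub hdn).const_mul _
    simp only [hφ]
    rw [fderiv_const_mul hdF, norm_smul, norm_of_nonneg hK0]
    have e1 : ‖u‖⁻¹ = ‖u‖ ^ (-(2 * γ)) * ‖u‖ ^ (2 * γ - 1) := by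
      rw [← rpow_neg_one, ← rpow_add hu0]; congr 1; ring
    have e2 : ‖u‖ ^ (2 - (4 - 2 * γ)) = ‖u‖ ^ (-1 : ℝ) * ‖u‖ ^ (2 * γ - 1) := by
      rw [← rpow_add hu0]; congr 1; ring
    calc K * ‖𝒟 (logPotential f) u‖ ≤ K * (C2 * (‖u‖⁻¹ + ‖u‖ ^ (2 - (4 - 2 * γ)))) := by
          gcongr; exact hb2 u m5 hdF
      _ = (K * C2 * ‖u‖ ^ (-(2 * γ)) + K * C2 * ‖u‖ ^ (-1 : ℝ)) * ‖u‖ ^ (2 * γ - 1) := by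
          rw [e1, e2]; ring
      _ ≤ δ * ‖u‖ ^ (2 * γ - 1) := by gcongr; linarith

theorem abs_flatPotential_le (H : 𝓟) : ∃ C : ℝ, 0 ≤ C ∧ ∀ u, |φ u| ≤ C * (1 + ‖u‖ ^ (2 * γ)) := by
  obtain ⟨M, -, hM⟩ := H.flatPotential_asymp one_pos
  obtain ⟨C, hC⟩ := (isCompact_closedBall (0 : ℂ) M).exists_bound_of_continuousOn
    H.continuous_flatPotential.continuousOn
  refine ⟨max C 2, by positivity, fun u => ?_⟩
  have h0 : 0 ≤ ‖u‖ ^ (2 * γ) := by positivity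
  rcases le_total ‖u‖ M with h | h
  · have h1 := hC u (by simpa using h)
    rw [norm_eq_abs] at h1
    nlinarith [le_max_left C 2, le_max_right C 2]
  · have h1 := (hM u h).2.2.1
    have h2 := abs_sub_abs_le_abs_sub (φ u) (‖u‖ ^ (2 * γ))
    rw [abs_of_nonneg h0] at h2
    nlinarith [le_max_right C 2]

theorem le_flatDensity (H : 𝓟) (M : ℝ) : ∃ c : ℝ, 0 < c ∧ ∀ u, ‖u‖ ≤ M → u ≠ a₂ → u ≠ a₃ →
      c * ‖u - a₂‖ ^ (2 * β₂ - 2) ≤ dens u := by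
  refine ⟨(|M| + ‖a₃‖ + 1) ^ (2 * β₃ - 2), by positivity, fun u hu h2 h3 => ?_⟩
  have n3 : 0 < ‖u - a₃‖ := norm_sub_pos_iff.2 h3
  rw [flatDensity, mul_comm]
  gcongr ?_ * ?_
  refine rpow_le_rpow_of_nonpos n3 ?_ (by linarith [H.lt₃])
  linarith [norm_sub_le u a₃, le_abs_self M]

theorem exists_le_flatDensity (H : 𝓟) (M : ℝ) :
    ∃ g : ℝ, 0 < g ∧ ∀ u, ‖u‖ ≤ M → u ≠ a₂ → u ≠ a₃ → g ≤ dens u := by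
  obtain ⟨c, hc, hg⟩ := H.le_flatDensity M
  refine ⟨c * (|M| + ‖a₂‖ + 1) ^ (2 * β₂ - 2), by positivity, fun u hu h2 h3 =>
    (mul_le_mul_of_nonneg_left ?_ hc.le).trans (hg u hu h2 h3)⟩
  exact rpow_le_rpow_of_nonpos (norm_sub_pos_iff.2 h2)
    ((norm_sub_le _ _).trans (by linarith [le_abs_self M])) (by linarith [H.lt₂])

theorem le_flatDensity_far (H : 𝓟) {u : ℂ}
    (hu : farRadius a₂ a₃ ≤ ‖u‖) (h2 : u ≠ a₂) (h3 : u ≠ a₃) :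
    1 / 4 * ‖u‖ ^ (2 * γ - 2) ≤ dens u := by
  have hu0 : 0 < ‖u‖ := (farRadius_pos a₂ a₃).trans_le hu
  rw [farRadius] at hu
  have n2 : 0 < ‖u - a₂‖ := norm_sub_pos_iff.2 h2
  have n3 : 0 < ‖u - a₃‖ := norm_sub_pos_iff.2 h3
  have e : 2 * γ - 2 = (2 * β₂ - 2) + (2 * β₃ - 2) := by linarith [H.angle]
  have k2 : (2 * ‖u‖) ^ (2 * β₂ - 2) ≤ ‖u - a₂‖ ^ (2 * β₂ - 2) := rpow_le_rpow_of_nonpos n2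
      (by linarith [norm_sub_le u a₂, norm_nonneg a₂, norm_nonneg a₃]) (by linarith [H.lt₂])
  have k3 : (2 * ‖u‖) ^ (2 * β₃ - 2) ≤ ‖u - a₃‖ ^ (2 * β₃ - 2) := rpow_le_rpow_of_nonpos n3
      (by linarith [norm_sub_le u a₃, norm_nonneg a₂, norm_nonneg a₃]) (by linarith [H.lt₃])
  have k4 : (1 : ℝ) / 4 ≤ 2 ^ (2 * γ - 2) := by
    calc (1 : ℝ) / 4 = 2 ^ (-2 : ℝ) := by rw [rpow_neg two_pos.le]; norm_num
      _ ≤ _ := Real.rpow_le_rpow_of_exponent_le one_le_two (by linarith [H.pos])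
  calc 1 / 4 * ‖u‖ ^ (2 * γ - 2) ≤ 2 ^ (2 * γ - 2) * ‖u‖ ^ (2 * γ - 2) := by gcongr
    _ = (2 * ‖u‖) ^ (2 * γ - 2) := by rw [mul_rpow two_pos.le hu0.le]
    _ = (2 * ‖u‖) ^ (2 * β₂ - 2) * (2 * ‖u‖) ^ (2 * β₃ - 2) := by rw [e, rpow_add (by positivity)]
    _ ≤ _ := by unfold flatDensity; gcongr

/-- Near a cone point, the square of the derivative of the potential is negligible compared with
its Levi form. -/
theorem sq_norm_fderiv_flatPotential_le_near (H : 𝓟) {δ : ℝ}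
    (hδ : 0 < δ) : ∃ ν : ℝ, 0 < ν ∧ ∀ u, 0 < ‖u - a₂‖ → ‖u - a₂‖ < ν → u ≠ a₃ ∧
      ‖𝒟 φ u‖ ^ 2 ≤ δ * dens u := by
  obtain ⟨C, hC0, hC⟩ := H.norm_fderiv_flatPotential_le (‖a₂‖ + 1)
  obtain ⟨c, hc, hg⟩ := H.le_flatDensity (‖a₂‖ + 1)
  have hd : 0 < ‖a₂ - a₃‖ := norm_sub_pos_iff.2 H.ne
  set q := poleExp (2 - 2 * β₂) with hq
  set P := (‖a₂ - a₃‖ / 2) ^ (-poleExp (2 - 2 * β₃)) with hP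
  have hP0 : 0 ≤ P := by positivity
  have hq0 : 0 ≤ q := poleExp_nonneg _
  have hqp : 2 * q < 2 - 2 * β₂ := two_mul_poleExp_lt (by linarith [H.lt₂]) (by linarith [H.pos₂])
  set e := 2 - 2 * β₂ - 2 * q with he
  have he0 : 0 < e := by linarith
  have hlim : ∀ᶠ x : ℝ in nhds 0, (C * (2 + P)) ^ 2 * |x| ^ e < δ * c ∧ |x| < 1 ∧
      |x| < ‖a₂ - a₃‖ / 2 := by
    have h1 : Continuous fun x : ℝ => (C * (2 + P)) ^ 2 * |x| ^ e :=
      continuous_const.mul (continuous_abs.rpow_const fun _ => Or.inr he0.le)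
    have h2 := h1.tendsto 0
    simp only [abs_zero, zero_rpow he0.ne', mul_zero] at h2
    have h3 := (continuous_abs (G := ℝ)).tendsto 0
    rw [abs_zero] at h3
    exact (h2.eventually (gt_mem_nhds (by positivity))).and
      ((h3.eventually (gt_mem_nhds one_pos)).and (h3.eventually (gt_mem_nhds (half_pos hd))))
  obtain ⟨ν, hν, hb⟩ := Metric.eventually_nhds_iff.1 hlim
  refine ⟨ν, hν, fun u hu0 hu => ?_⟩
  obtain ⟨b1, b2, b3⟩ := hb (y := ‖u - a₂‖) (by simpa using hu)
  rw [abs_norm] at b1 b2 b3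
  have h2 : u ≠ a₂ := fun h => by simp [h] at hu0
  have hd3 : ‖a₂ - a₃‖ / 2 ≤ ‖u - a₃‖ := by
    have : ‖a₂ - a₃‖ ≤ ‖u - a₃‖ + ‖u - a₂‖ := by
      calc ‖a₂ - a₃‖ = ‖(u - a₃) - (u - a₂)‖ := by congr 1; ring
        _ ≤ _ := norm_sub_le _ _
    linarith
  have h3 : u ≠ a₃ := fun h => by rw [h, sub_self, norm_zero] at hd3; linarith
  have huM : ‖u‖ ≤ ‖a₂‖ + 1 := by
    have := norm_add_le (u - a₂) a₂
    rw [sub_add_cancel] at this; linarith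
  refine ⟨h3, ?_⟩
  have k1 := hC u huM h2 h3
  have k2 : 1 ≤ ‖u - a₂‖ ^ (-q) :=
    Real.one_le_rpow_of_pos_of_le_one_of_nonpos hu0 b2.le (by linarith)
  have k3 : ‖u - a₃‖ ^ (-poleExp (2 - 2 * β₃)) ≤ P :=
    rpow_le_rpow_of_nonpos (by positivity) hd3 (by linarith [poleExp_nonneg (2 - 2 * β₃)])
  have k4 : ‖𝒟 φ u‖ ≤ C * (2 + P) * ‖u - a₂‖ ^ (-q) := by
    refine k1.trans ?_
    rw [mul_assoc]
    gcongr
    nlinarith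
  have k5 : (‖u - a₂‖ ^ (-q)) ^ 2 = ‖u - a₂‖ ^ e * ‖u - a₂‖ ^ (2 * β₂ - 2) := by
    rw [← rpow_natCast, ← rpow_mul hu0.le, ← rpow_add hu0]
    congr 1; rw [he]; push_cast; ring
  calc ‖𝒟 φ u‖ ^ 2 ≤ (C * (2 + P) * ‖u - a₂‖ ^ (-q)) ^ 2 := by gcongr
    _ = (C * (2 + P)) ^ 2 * ‖u - a₂‖ ^ e * ‖u - a₂‖ ^ (2 * β₂ - 2) := by rw [mul_pow, k5]; ring
    _ ≤ δ * c * ‖u - a₂‖ ^ (2 * β₂ - 2) := by gcongr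
    _ = δ * (c * ‖u - a₂‖ ^ (2 * β₂ - 2)) := by ring
    _ ≤ _ := by gcongr; exact hg u huM h2 h3

theorem sq_norm_fderiv_flatPotential_le (H : 𝓟) : ∃ C : ℝ, 0 ≤ C ∧
    ∀ u, u ≠ a₂ → u ≠ a₃ → ‖𝒟 φ u‖ ^ 2 ≤ C * (1 + ‖u‖ ^ (2 * γ)) * dens u := by
  have hγ := H.pos
  obtain ⟨M0, hM01, hM0⟩ := H.flatPotential_asymp one_pos
  set M := max M0 (farRadius a₂ a₃) with hM
  have hM1 : 1 ≤ M := hM01.trans (le_max_left _ _)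
  obtain ⟨ν2, hν2, hn2⟩ := H.sq_norm_fderiv_flatPotential_le_near one_pos
  obtain ⟨ν3, hν3, hn3⟩ := H.symm.sq_norm_fderiv_flatPotential_le_near one_pos
  rw [flatPotential_comm, flatDensity_comm] at hn3
  obtain ⟨C, hC0, hC⟩ := H.norm_fderiv_flatPotential_le M
  obtain ⟨c', hc'0, hg⟩ := H.exists_le_flatDensity M
  set D := C * (1 + ν2 ^ (-poleExp (2 - 2 * β₂)) + ν3 ^ (-poleExp (2 - 2 * β₃))) with hD
  refine ⟨1 + D ^ 2 / c' + 36, by positivity, fun u h2 h3 => ?_⟩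
  have h0 : 0 ≤ ‖u‖ ^ (2 * γ) := by positivity
  have hg0 : 0 ≤ dens u := flatDensity_nonneg
  have n2 : 0 < ‖u - a₂‖ := norm_sub_pos_iff.2 h2
  have n3 : 0 < ‖u - a₃‖ := norm_sub_pos_iff.2 h3
  have hDc : 0 ≤ D ^ 2 / c' := by positivity
  have fin : ∀ X : ℝ, 0 ≤ X → X ≤ 1 + D ^ 2 / c' + 36 → X * dens u ≤
      (1 + D ^ 2 / c' + 36) * (1 + ‖u‖ ^ (2 * γ)) * dens u := by
    intro X hX hle
    gcongr
    nlinarith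
  by_cases c2 : ‖u - a₂‖ < ν2
  · exact ((hn2 u n2 c2).2).trans (fin 1 zero_le_one (by linarith))
  by_cases c3 : ‖u - a₃‖ < ν3
  · exact ((hn3 u n3 c3).2).trans (fin 1 zero_le_one (by linarith))
  rcases le_total ‖u‖ M with hu | hu
  · refine le_trans ?_ (fin (D ^ 2 / c') (by positivity) (by linarith))
    have k1 := hC u hu h2 h3
    have k2 : ‖𝒟 φ u‖ ≤ D := by
      refine k1.trans ?_
      rw [hD]
      gcongr ?_ * (1 + ?_ + ?_)
      · exact rpow_le_rpow_of_nonpos hν2 (not_lt.1 c2) (by linarith [poleExp_nonneg (2 - 2 * β₂)])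
      · exact rpow_le_rpow_of_nonpos hν3 (not_lt.1 c3) (by linarith [poleExp_nonneg (2 - 2 * β₃)])
    calc ‖𝒟 φ u‖ ^ 2 ≤ D ^ 2 := by gcongr
      _ = D ^ 2 / c' * c' := by field_simp
      _ ≤ _ := by gcongr; exact hg u hu h2 h3
  · have hu0 : 0 < ‖u‖ := by linarith
    have hne0 : u ≠ 0 := norm_pos_iff.1 hu0
    obtain ⟨-, -, -, k1⟩ := hM0 u ((le_max_left _ _).trans hu)
    have k2 := H.le_flatDensity_far ((le_max_right _ _).trans hu) h2 h3
    have hdφ := (H.flatPotential_regular h2 h3).1.differentiableAt (by norm_num)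
    have hdn := (hasFDerivAt_norm_rpow (m := 2 * γ) hne0).differentiableAt
    rw [fderiv_fun_sub hdφ hdn] at k1
    have k3 := norm_fderiv_norm_rpow_le' (m := 2 * γ) (by positivity) hne0
    have k4 : ‖𝒟 φ u‖ ≤ 3 * ‖u‖ ^ (2 * γ - 1) := by
      have := norm_le_norm_sub_add (𝒟 φ u) (𝒟 (fun w : ℂ => ‖w‖ ^ (2 * γ)) u)
      have h5 : 0 ≤ ‖u‖ ^ (2 * γ - 1) := by positivity
      nlinarith [H.lt]
    have e1 : (‖u‖ ^ (2 * γ - 1)) ^ 2 = ‖u‖ ^ (2 * γ) * ‖u‖ ^ (2 * γ - 2) := by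
      rw [← rpow_natCast, ← rpow_mul hu0.le, ← rpow_add hu0]
      congr 1; push_cast; ring
    calc ‖𝒟 φ u‖ ^ 2 ≤ (3 * ‖u‖ ^ (2 * γ - 1)) ^ 2 := by gcongr
      _ = 36 * ‖u‖ ^ (2 * γ) * (1 / 4 * ‖u‖ ^ (2 * γ - 2)) := by rw [mul_pow, e1]; ring
      _ ≤ 36 * ‖u‖ ^ (2 * γ) * dens u := by gcongr
      _ ≤ _ := by
          gcongr
          · linarith
          · linarith

end IsCentredPair

/-! ### Calculus of Levi forms -/

/-- `f : ℂ² → ℝ` is `C²` at `x`, with holomorphic differential `∂f = A` and Levi form `Λ`. -/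
structure HasLevi (f : ℂ² → ℝ) (x : ℂ²) (A : ℂ² → ℂ) (Λ : ℂ² → ℝ) : Prop where
  contDiffAt : ContDiffAt ℝ 2 f x
  fderiv_eq : ∀ v, 𝒟 f x v = 2 * (A v).re
  smul_I : ∀ v, A (I • v) = I * A v
  levi_eq : ∀ v, leviForm f x v = Λ v

namespace HasLevi
variable {f g : ℂ² → ℝ} {x : ℂ²} {A B : ℂ² → ℂ} {Λ M : ℂ² → ℝ}

theorem differentiableAt_fderiv (hf : ContDiffAt ℝ 2 f x) (v : ℂ²) :
    DifferentiableAt ℝ (fun y => 𝒟 f y v) x :=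
  ((hf.fderiv_right (m := 1) (by norm_num)).differentiableAt one_ne_zero).clm_apply
    (differentiableAt_const v)

theorem eventually_differentiableAt (hf : ContDiffAt ℝ 2 f x) :
    ∀ᶠ y in nhds x, DifferentiableAt ℝ f y :=
  (hf.eventually (by simp)).mono fun _ hw => hw.differentiableAt (by norm_num)

theorem congr (h : HasLevi f x A Λ) (e : g =ᶠ[nhds x] f) : HasLevi g x A Λ := by
  have e2 : ∀ v, (fun y => 𝒟 g y v) =ᶠ[nhds x] fun y => 𝒟 f y v := fun v =>
    (e.fderiv (𝕜 := ℝ)).mono fun y hy => by simp only [hy]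
  refine ⟨h.contDiffAt.congr_of_eventuallyEq e, fun v => ?_, h.smul_I, fun v => ?_⟩
  · rw [e.fderiv_eq]; exact h.fderiv_eq v
  · rw [← h.levi_eq, leviForm, leviForm, (e2 _).fderiv_eq, (e2 _).fderiv_eq]

theorem add (hf : HasLevi f x A Λ) (hg : HasLevi g x B M) :
    HasLevi (fun y => f y + g y) x (fun v => A v + B v) (fun v => Λ v + M v) := by
  have hd := hf.contDiffAt.differentiableAt (by norm_num)
  have hd' := hg.contDiffAt.differentiableAt (by norm_num)
  refine ⟨hf.contDiffAt.add hg.contDiffAt, fun v => ?_, fun v => ?_, fun v => ?_⟩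
  · rw [fderiv_fun_add hd hd', add_apply, hf.fderiv_eq, hg.fderiv_eq, add_re, mul_add]
  · rw [hf.smul_I, hg.smul_I, mul_add]
  · have e : ∀ v, 𝒟 (fun y => 𝒟 (fun y => f y + g y) y v) x =
        𝒟 (fun y => 𝒟 f y v) x + 𝒟 (fun y => 𝒟 g y v) x := by
      intro v
      rw [← fderiv_fun_add (differentiableAt_fderiv hf.contDiffAt v)
        (differentiableAt_fderiv hg.contDiffAt v)]
      apply Filter.EventuallyEq.fderiv_eq
      filter_upwards [eventually_differentiableAt hf.contDiffAt,
        eventually_differentiableAt hg.contDiffAt] with y h1 h2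
      rw [fderiv_fun_add h1 h2, add_apply]
    rw [← hf.levi_eq, ← hg.levi_eq, leviForm, leviForm, leviForm, e, e, add_apply, add_apply]
    ring

theorem mul (hf : HasLevi f x A Λ) (hg : HasLevi g x B M) :
    HasLevi (fun y => f y * g y) x (fun v => f x * B v + g x * A v)
      (fun v => f x * M v + g x * Λ v + 2 * (A v * (starRingEnd ℂ) (B v)).re) := by
  have hd := hf.contDiffAt.differentiableAt (by norm_num)
  have hd' := hg.contDiffAt.differentiableAt (by norm_num)
  refine ⟨hf.contDiffAt.mul hg.contDiffAt, fun v => ?_, fun v => ?_, fun v => ?_⟩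
  · rw [fderiv_fun_mul hd hd', add_apply, smul_apply, smul_apply, hf.fderiv_eq, hg.fderiv_eq,
      add_re, re_ofReal_mul, re_ofReal_mul, smul_eq_mul, smul_eq_mul]
    ring
  · rw [hf.smul_I, hg.smul_I]; ring
  · have e : ∀ v, 𝒟 (fun y => 𝒟 (fun y => f y * g y) y v) x v =
        f x * 𝒟 (fun y => 𝒟 g y v) x v + g x * 𝒟 (fun y => 𝒟 f y v) x v
          + 2 * (𝒟 f x v * 𝒟 g x v) := by
      intro v
      have h1 := differentiableAt_fderiv hf.contDiffAt v
      have h2 := differentiableAt_fderiv hg.contDiffAt v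
      have h3 : (fun y => 𝒟 (fun y => f y * g y) y v) =ᶠ[nhds x]
          fun y => f y * 𝒟 g y v + g y * 𝒟 f y v := by
        filter_upwards [eventually_differentiableAt hf.contDiffAt,
          eventually_differentiableAt hg.contDiffAt] with y h1 h2
        rw [fderiv_fun_mul h1 h2, add_apply, smul_apply, smul_apply, smul_eq_mul, smul_eq_mul]
      have h6 : HasFDerivAt (fun y => f y * 𝒟 g y v + g y * 𝒟 f y v) _ x :=
        (hd.hasFDerivAt.mul h2.hasFDerivAt).add (hd'.hasFDerivAt.mul h1.hasFDerivAt)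
      rw [h3.fderiv_eq, h6.fderiv]
      simp only [add_apply, smul_apply, smul_eq_mul]
      ring
    rw [← hf.levi_eq, ← hg.levi_eq, leviForm, leviForm, leviForm, e, e]
    simp only [hf.fderiv_eq, hg.fderiv_eq, hf.smul_I, hg.smul_I, mul_re,
      conj_re, conj_im, I_re, I_im]
    ring

theorem comp_real (hf : HasLevi f x A Λ) {θ : ℝ → ℝ} (hθ : ContDiff ℝ 2 θ) :
    HasLevi (fun y => θ (f y)) x (fun v => deriv θ (f x) * A v)
      (fun v => deriv θ (f x) * Λ v + deriv (deriv θ) (f x) * ‖A v‖ ^ 2) := by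
  have hd := hf.contDiffAt.differentiableAt (by norm_num)
  have hθd : ∀ s, HasDerivAt θ (deriv θ s) s := fun s =>
    (hθ.differentiable (by norm_num) s).hasDerivAt
  have hθ' : ContDiff ℝ 1 (deriv θ) := hθ.deriv'
  have hθdd : ∀ s, HasDerivAt (deriv θ) (deriv (deriv θ) s) s := fun s =>
    (hθ'.differentiable one_ne_zero s).hasDerivAt
  refine ⟨hθ.contDiffAt.comp x hf.contDiffAt, fun v => ?_, fun v => ?_, fun v => ?_⟩
  · have h1 : HasFDerivAt (fun y => θ (f y)) _ x := (hθd (f x)).comp_hasFDerivAt x hd.hasFDerivAt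
    rw [h1.fderiv, smul_apply, hf.fderiv_eq, re_ofReal_mul, smul_eq_mul]
    ring
  · rw [hf.smul_I]; ring
  · have e : ∀ v, 𝒟 (fun y => 𝒟 (fun y => θ (f y)) y v) x v =
        deriv θ (f x) * 𝒟 (fun y => 𝒟 f y v) x v + deriv (deriv θ) (f x) * 𝒟 f x v ^ 2 := by
      intro v
      have h2 := differentiableAt_fderiv hf.contDiffAt v
      have h3 : (fun y => 𝒟 (fun y => θ (f y)) y v) =ᶠ[nhds x]
          fun y => deriv θ (f y) * 𝒟 f y v := by
        filter_upwards [eventually_differentiableAt hf.contDiffAt] with y h1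
        have h4 : HasFDerivAt (fun y => θ (f y)) _ y :=
          (hθd (f y)).comp_hasFDerivAt y h1.hasFDerivAt
        rw [h4.fderiv, smul_apply, smul_eq_mul]
      have h5 : HasFDerivAt (fun y => deriv θ (f y)) _ x :=
        (hθdd (f x)).comp_hasFDerivAt x hd.hasFDerivAt
      rw [h3.fderiv_eq, fderiv_fun_mul h5.differentiableAt h2, h5.fderiv]
      simp only [add_apply, smul_apply, smul_eq_mul]
      ring
    rw [← hf.levi_eq, leviForm, leviForm, e, e, ← normSq_eq_norm_sq, normSq_apply]
    simp only [hf.fderiv_eq, hf.smul_I, mul_re, I_re, I_im]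
    ring

/-- The pullback of a function of one complex variable under a holomorphic function. -/
theorem comp_holomorphic {φ : ℂ → ℝ} {u : ℂ² → ℂ} {L : ℝ} (hu : ContDiffAt ℂ 2 u x)
    (hφ : ContDiffAt ℝ 2 φ (u x))
    (hL : 𝒟 (fun w => 𝒟 φ w 1) (u x) 1 + 𝒟 (fun w => 𝒟 φ w I) (u x) I = 4 * L) :
    HasLevi (fun y => φ (u y)) x (fun v => ((𝒟 φ (u x) 1 : ℂ) - I * (𝒟 φ (u x) I : ℝ)) / 2
        * fderiv ℂ u x v) (fun v => L * ‖fderiv ℂ u x v‖ ^ 2) := by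
  have huR : ContDiffAt ℝ 2 u x := hu.restrict_scalars ℝ
  have hud : ∀ᶠ y in nhds x, DifferentiableAt ℂ u y :=
    (hu.eventually (by simp)).mono fun _ hw => hw.differentiableAt (by norm_num)
  have hφd : ∀ᶠ y in nhds x, DifferentiableAt ℝ φ (u y) := huR.continuousAt.eventually
      ((hφ.eventually (by simp)).mono fun _ hw => hw.differentiableAt (by norm_num))
  have hD : ∀ᶠ y in nhds x, ∀ v, 𝒟 (fun y => φ (u y)) y v = 𝒟 φ (u y) (fderiv ℂ u y v) := by
    filter_upwards [hud, hφd] with y h1 h2 v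
    have h3 : HasFDerivAt (fun y => φ (u y)) _ y :=
      h2.hasFDerivAt.comp y (h1.hasFDerivAt.restrictScalars ℝ)
    rw [h3.fderiv]; rfl
  have hlin : ∀ (D : ℂ →L[ℝ] ℝ) (ξ : ℂ), D ξ = ξ.re * D 1 + ξ.im * D I := by
    intro D ξ
    have : ξ = ξ.re • (1 : ℂ) + ξ.im • I := by rw [real_smul, real_smul, mul_one, Complex.re_add_im]
    conv_lhs => rw [this]
    rw [map_add, map_smul, map_smul]; rfl
  set B := 𝒟 (𝒟 φ) (u x) with hB
  have hφ2 : DifferentiableAt ℝ (𝒟 φ) (u x) :=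
    (hφ.fderiv_right (m := 1) (by norm_num)).differentiableAt one_ne_zero
  have hBv : ∀ ξ η, 𝒟 (fun w => 𝒟 φ w ξ) (u x) η = B η ξ := by
    intro ξ η
    rw [fderiv_clm_apply hφ2 (differentiableAt_const ξ)]
    simp [hB]
  have hU2 : ∀ v, DifferentiableAt ℂ (fun y => fderiv ℂ u y v) x := fun v =>
    ((hu.fderiv_right (m := 1) (by norm_num)).differentiableAt one_ne_zero).clm_apply
      (differentiableAt_const v)
  set k : ℂ² → ℂ := fun v => fderiv ℂ (fun y => fderiv ℂ u y v) x v with hk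
  have hkI : ∀ v, k (I • v) = -k v := by
    intro v
    have e : (fun y => fderiv ℂ u y (I • v)) = fun y => I * fderiv ℂ u y v := by
      ext y; rw [map_smul, smul_eq_mul]
    simp only [hk]
    rw [e, fderiv_const_mul (hU2 v), smul_apply, map_smul, smul_eq_mul, smul_eq_mul, ← mul_assoc,
      Complex.I_mul_I, neg_one_mul]
  have e : ∀ v, 𝒟 (fun y => 𝒟 (fun y => φ (u y)) y v) x v =
      B (fderiv ℂ u x v) (fderiv ℂ u x v) + 𝒟 φ (u x) (k v) := by
    intro v
    have e1 : (fun y => 𝒟 (fun y => φ (u y)) y v) =ᶠ[nhds x]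
        fun y => 𝒟 φ (u y) (fderiv ℂ u y v) := hD.mono fun y hy => hy v
    have h1 : HasFDerivAt (fun y => 𝒟 φ (u y)) _ x :=
      hφ2.hasFDerivAt.comp x (hud.self_of_nhds.hasFDerivAt.restrictScalars ℝ)
    have h2 := (hU2 v).hasFDerivAt.restrictScalars ℝ
    rw [e1.fderiv_eq, (h1.clm_apply h2).fderiv]
    simp [hk, hB, add_comm]
  refine ⟨hφ.comp x huR, fun v => ?_, fun v => ?_, fun v => ?_⟩
  · rw [hD.self_of_nhds v, hlin]
    simp only [mul_re, Complex.div_ofNat_re, Complex.div_ofNat_im, sub_re,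
      sub_im, ofReal_re, Complex.ofReal_im, I_re, I_im,
      mul_im]
    ring
  · rw [map_smul, smul_eq_mul]; ring
  · rw [leviForm, e, e, hkI, map_neg, map_smul, smul_eq_mul]
    set ξ := fderiv ℂ u x v
    rw [hBv, hBv] at hL
    have hB2 : ∀ ξ : ℂ, B ξ ξ = ξ.re ^ 2 * B 1 1 + ξ.re * ξ.im * (B 1 I + B I 1)
        + ξ.im ^ 2 * B I I := by
      intro ξ
      have h1 : ∀ η, B ξ η = ξ.re * B 1 η + ξ.im * B I η := fun η => by
        simpa using hlin (B.flip η) ξ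
      rw [h1, hlin (B 1) ξ, hlin (B I) ξ]
      ring
    rw [hB2 ξ, hB2 (I * ξ), ← normSq_eq_norm_sq, normSq_apply]
    simp only [mul_re, mul_im, I_re, I_im]
    linear_combination (ξ.re * ξ.re + ξ.im * ξ.im) / 4 * hL

end HasLevi

theorem laplacian_norm_rpow {m : ℝ} {u : ℂ} (hu : u ≠ 0) :
    𝒟 (fun w => 𝒟 (fun w : ℂ => ‖w‖ ^ m) w 1) u 1 + 𝒟 (fun w => 𝒟 (fun w : ℂ => ‖w‖ ^ m) w I) u I
      = 4 * (m ^ 2 / 4 * ‖u‖ ^ (m - 2)) := by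
  have hu' : 0 < ‖u‖ := norm_pos_iff.2 hu
  have e : ∀ v, 𝒟 (fun w => 𝒟 (fun w : ℂ => ‖w‖ ^ m) w v) u v
      = m * ((m - 2) * ‖u‖ ^ (m - 2 - 2) * inner ℝ u v ^ 2 + ‖u‖ ^ (m - 2) * ‖v‖ ^ 2) := by
    intro v
    have h1 : (fun w => 𝒟 (fun w : ℂ => ‖w‖ ^ m) w v) =ᶠ[nhds u]
        fun w => m * (‖w‖ ^ (m - 2) * inner ℝ w v) := by
      filter_upwards [eventually_ne_nhds hu] with w hw
      rw [(hasFDerivAt_norm_rpow hw).fderiv, smul_apply, innerSL_apply_apply, smul_eq_mul, mul_assoc]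
    have h2 := (hasFDerivAt_norm_rpow (m := m - 2) hu).mul
      ((hasFDerivAt_id u).inner ℝ (hasFDerivAt_const v u))
    have h3 : HasFDerivAt (fun w : ℂ => m * (‖w‖ ^ (m - 2) * inner ℝ w v)) _ u := h2.const_mul m
    rw [h1.fderiv_eq, h3.fderiv]
    simp [fderivInnerCLM_apply, -Complex.inner]
    ring
  rw [e, e]
  have e2 : ‖u‖ ^ (m - 2) = ‖u‖ ^ (m - 2 - 2) * ‖u‖ ^ 2 := by
    rw [← rpow_natCast, ← rpow_add hu']; congr 1; push_cast; ring
  have e3 : (inner ℝ u 1 : ℝ) ^ 2 + (inner ℝ u I : ℝ) ^ 2 = ‖u‖ ^ 2 := by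
    rw [Complex.inner, Complex.inner, ← normSq_eq_norm_sq, normSq_apply]
    simp
    ring
  rw [norm_one, norm_I, e2]
  linear_combination (m * (m - 2) * ‖u‖ ^ (m - 2 - 2)) * e3

/-- The power of the modulus of a nonvanishing holomorphic function. -/
theorem HasLevi.norm_rpow {x : ℂ²} {u : ℂ² → ℂ} (hu : ContDiffAt ℂ 2 u x) (h0 : u x ≠ 0)
    (m : ℝ) : HasLevi (fun y => ‖u y‖ ^ m) x
      (fun v => (m / 2 * ‖u x‖ ^ m : ℝ) * (fderiv ℂ u x v / u x))
      (fun v => m ^ 2 / 4 * ‖u x‖ ^ m * ‖fderiv ℂ u x v / u x‖ ^ 2) := by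
  have h := HasLevi.comp_holomorphic (φ := fun w => ‖w‖ ^ m) hu (contDiffAt_norm_rpow (n := 2) h0)
    (laplacian_norm_rpow h0)
  have hp : 0 < ‖u x‖ := norm_pos_iff.2 h0
  have e2 : ‖u x‖ ^ m = ‖u x‖ ^ (m - 2) * ‖u x‖ ^ 2 := by
    rw [← rpow_natCast, ← rpow_add hp]; congr 1; push_cast; ring
  convert h using 2 with v v
  · rw [(hasFDerivAt_norm_rpow h0).fderiv, e2]
    simp only [smul_apply, innerSL_apply_apply, smul_eq_mul, Complex.inner]
    have h1 : ((1 * (starRingEnd ℂ) (u x)).re : ℂ) - I *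
        ((I * (starRingEnd ℂ) (u x)).re : ℝ) = (starRingEnd ℂ) (u x) := by
      apply Complex.ext <;> simp
    have h2 : ((‖u x‖ ^ 2 : ℝ) : ℂ) = u x * (starRingEnd ℂ) (u x) := by
      rw [Complex.mul_conj, normSq_eq_norm_sq]
    have h3 : (fderiv ℂ u x v / u x) * u x = fderiv ℂ u x v := div_mul_cancel₀ _ h0
    generalize fderiv ℂ u x v / u x = q at *
    rw [← h3]
    push_cast at h1 h2 ⊢
    linear_combination (m / 2 * (‖u x‖ ^ (m - 2) : ℝ) * q : ℂ) * h2
      - (m / 2 * (‖u x‖ ^ (m - 2) : ℝ) * q * u x : ℂ) * h1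
  · rw [norm_div, div_pow, e2]
    field_simp

/-! ### Asymptotics of the metric -/

/-- The conditions on the angles, the lines, the exponent of the gluing region and the cutoff
function that enter the definition of the metric. -/
structure GluingData (β₁ β₂ β₃ γ α₀ : ℝ) (a₂ a₃ : ℂ) (χ : ℝ → ℝ) : Prop
    extends IsCentredPair β₂ β₃ γ a₂ a₃ where
  pos₁ : 0 < β₁
  lt_γ : β₁ < γ
  one_lt : 1 < α₀
  mul_lt : β₁ * α₀ < γ
  smooth : ContDiff ℝ 2 χ
  nonneg : ∀ s, 0 ≤ χ s
  le_one : ∀ s, χ s ≤ 1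
  eq_one : ∀ s, 2 < s → χ s = 1
  eq_zero : ∀ s, s < 1 → χ s = 0

/-- A Hermitian form adapted to the coordinates `(z, w / z)`: the coefficient of `|dz|²` is `A`,
and the fibres carry the flat metric with density `γ² |z|^(2γ) g`. -/
noncomputable def fibreForm (γ : ℝ) (g : ℂ → ℝ) (A : ℝ) (x v : ℂ²) : ℝ := A * ‖v.1‖ ^ 2
    + γ ^ 2 * ‖x.1‖ ^ (2 * γ) * g (x.2 / x.1) * ‖(v.2 - x.2 / x.1 * v.1) / x.1‖ ^ 2

/-- The coefficient `β₁² |z|^(2β₁-2)` of the cone of angle `2πβ₁`. -/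
noncomputable def baseCoeff (β₁ : ℝ) (z : ℂ) : ℝ := β₁ ^ 2 * ‖z‖ ^ (2 * β₁ - 2)

theorem exists_small {β e C δ : ℝ} (hβ : 0 < β) (he : 0 < e) (hC : 0 ≤ C) (hδ : 0 < δ) :
    ∃ τ : ℝ, 0 < τ ∧ τ ≤ 1 ∧ ∀ z : ℂ, ‖z‖ ^ β < τ → C * ‖z‖ ^ e ≤ δ ∧ ‖z‖ ≤ 1 := by
  refine ⟨min 1 ((δ / (C + 1)) ^ (β / e)), lt_min one_pos (by positivity), min_le_left _ _,
    fun z hz => ⟨?_, ?_⟩⟩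
  · have h1 : ‖z‖ ^ e ≤ δ / (C + 1) := by
      have h2 : (‖z‖ ^ β) ^ (e / β) ≤ ((δ / (C + 1)) ^ (β / e)) ^ (e / β) := by
        gcongr; exact (hz.trans_le (min_le_right _ _)).le
      rw [← rpow_mul (norm_nonneg _), ← rpow_mul (by positivity)] at h2
      have e1 : β * (e / β) = e := by field_simp
      have e2 : β / e * (e / β) = 1 := by field_simp
      rwa [e1, e2, rpow_one] at h2
    calc C * ‖z‖ ^ e ≤ C * (δ / (C + 1)) := by gcongr
      _ ≤ δ := by rw [mul_div_assoc', div_le_iff₀ (by positivity)]; nlinarith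
  · by_contra h
    exact absurd (Real.one_lt_rpow (not_le.1 h) hβ) (not_lt.2 (hz.trans_le (min_le_left _ _)).le)

theorem rpow_sub_two_mul {z : ℂ} (hz : z ≠ 0) (m : ℝ) (v : ℂ) :
    ‖z‖ ^ (m - 2) * ‖v‖ ^ 2 = ‖z‖ ^ m * ‖v / z‖ ^ 2 := by
  have h : 0 < ‖z‖ := norm_pos_iff.2 hz
  have e : ‖z‖ ^ m = ‖z‖ ^ (m - 2) * ‖z‖ ^ 2 := by
    rw [← rpow_natCast, ← rpow_add h]; congr 1; push_cast; ring
  rw [norm_div, div_pow, e]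
  field_simp

theorem two_mul_mul_le {X Y D C g δ : ℝ} (hC : 0 < C) (hδ : 0 < δ)
    (h : D ^ 2 ≤ C * g) : 2 * X * D * Y ≤ δ * (g * Y ^ 2) + C / δ * X ^ 2 := by
  have h1 : 2 * X * D * Y ≤ δ / C * (D * Y) ^ 2 + C / δ * X ^ 2 := by
    have : 0 ≤ δ / C * (D * Y - C / δ * X) ^ 2 := by positivity
    have e : δ / C * (D * Y - C / δ * X) ^ 2
        = δ / C * (D * Y) ^ 2 + C / δ * X ^ 2 - 2 * X * D * Y := by
      field_simp; ring
    linarith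
  have h2 : δ / C * (D * Y) ^ 2 ≤ δ * (g * Y ^ 2) := by
    rw [mul_pow]
    calc δ / C * (D ^ 2 * Y ^ 2) ≤ δ / C * (C * g * Y ^ 2) := by gcongr
      _ = _ := by field_simp
  linarith

theorem contDiffAt_quot {x : ℂ²} (hx : x.1 ≠ 0) : ContDiffAt ℂ 2 (fun y : ℂ² => y.2 / y.1) x :=
  contDiffAt_snd.div contDiffAt_fst hx

theorem fderiv_quot {x : ℂ²} (hx : x.1 ≠ 0) (v : ℂ²) :
    fderiv ℂ (fun y : ℂ² => y.2 / y.1) x v = (v.2 - x.2 / x.1 * v.1) / x.1 := by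
  have h : HasFDerivAt (fun y : ℂ² => y.2 * y.1⁻¹) _ x :=
    (hasFDerivAt_snd (𝕜 := ℂ)).mul ((hasDerivAt_inv hx).comp_hasFDerivAt x hasFDerivAt_fst)
  simp only [div_eq_mul_inv]
  rw [h.fderiv]
  simp
  field_simp
  ring

theorem hasLevi_fst_rpow {x : ℂ²} (hx : x.1 ≠ 0) (m : ℝ) :
    HasLevi (fun y => ‖y.1‖ ^ m) x (fun v => (m / 2 * ‖x.1‖ ^ m : ℝ) * (v.1 / x.1))
      (fun v => m ^ 2 / 4 * ‖x.1‖ ^ m * ‖v.1 / x.1‖ ^ 2) := by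
  simpa [fderiv_fst] using HasLevi.norm_rpow (u := fun y : ℂ² => y.1) contDiffAt_fst hx m

theorem hasLevi_snd_rpow {x : ℂ²} (hx : x.2 ≠ 0) (m : ℝ) :
    HasLevi (fun y => ‖y.2‖ ^ m) x (fun v => (m / 2 * ‖x.2‖ ^ m : ℝ) * (v.2 / x.2))
      (fun v => m ^ 2 / 4 * ‖x.2‖ ^ m * ‖v.2 / x.2‖ ^ 2) := by
  simpa [fderiv_snd] using HasLevi.norm_rpow (u := fun y : ℂ² => y.2) contDiffAt_snd hx m

/-- The Levi form of `|z|^(2γ) E(w / z)` is that of `E` on the fibres up to terms which are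
controlled by `E` and its first derivative. -/
theorem exists_hasLevi_fibre {γ : ℝ} (hγ : 0 ≤ γ) {E : ℂ → ℝ} {L : ℝ} {x : ℂ²} (hx : x.1 ≠ 0)
    (hE : ContDiffAt ℝ 2 E (x.2 / x.1))
    (hL : 𝒟 (fun w => 𝒟 E w 1) (x.2 / x.1) 1 + 𝒟 (fun w => 𝒟 E w I) (x.2 / x.1) I = 4 * L) :
    ∃ A Λ, HasLevi (fun y => ‖y.1‖ ^ (2 * γ) * E (y.2 / y.1)) x A Λ ∧ ∀ v : ℂ²,
      ‖A v‖ ≤ ‖x.1‖ ^ (2 * γ) * (γ * |E (x.2 / x.1)| * ‖v.1 / x.1‖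
        + ‖𝒟 E (x.2 / x.1)‖ * ‖(v.2 - x.2 / x.1 * v.1) / x.1‖) ∧
      |Λ v - ‖x.1‖ ^ (2 * γ) * (L * ‖(v.2 - x.2 / x.1 * v.1) / x.1‖ ^ 2)|
        ≤ ‖x.1‖ ^ (2 * γ) * (γ ^ 2 * |E (x.2 / x.1)| * ‖v.1 / x.1‖ ^ 2
          + 2 * γ * ‖v.1 / x.1‖ * ‖𝒟 E (x.2 / x.1)‖ * ‖(v.2 - x.2 / x.1 * v.1) / x.1‖) := by
  have h1 := hasLevi_fst_rpow hx (2 * γ)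
  have h2 := HasLevi.comp_holomorphic (contDiffAt_quot hx) hE hL
  refine ⟨_, _, h1.mul h2, fun v => ?_⟩
  rw [fderiv_quot hx]
  set u := x.2 / x.1
  set T := ‖x.1‖ ^ (2 * γ)
  have hT : 0 ≤ T := by positivity
  set q := ((𝒟 E u 1 : ℂ) - I * (𝒟 E u I : ℝ)) / 2
  set D := ‖𝒟 E u‖
  have hq : ‖q‖ ≤ D := by
    have k1 := (𝒟 E u).le_opNorm 1
    have k2 := (𝒟 E u).le_opNorm I
    rw [norm_one, mul_one] at k1
    rw [norm_I, mul_one] at k2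
    rw [norm_div, Complex.norm_ofNat, div_le_iff₀ two_pos]
    refine (norm_sub_le _ _).trans ?_
    rw [norm_mul, norm_I, one_mul, norm_real, norm_real]
    linarith
  set a := v.1 / x.1
  set d := (v.2 - u * v.1) / x.1
  have e1 : 2 * γ / 2 * T = γ * T := by ring
  rw [e1]
  have hqd : ‖q * d‖ ≤ D * ‖d‖ := by rw [norm_mul]; gcongr
  constructor
  · refine (norm_add_le _ _).trans ?_
    rw [norm_mul, norm_mul _ (_ * a), norm_mul _ a, norm_real, norm_real,
      norm_real, norm_of_nonneg hT, norm_of_nonneg (by positivity : 0 ≤ γ * T),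
      norm_eq_abs]
    nlinarith [mul_le_mul_of_nonneg_left hqd hT]
  · have e2 : T * (L * ‖d‖ ^ 2) + E u * ((2 * γ) ^ 2 / 4 * T * ‖a‖ ^ 2)
        + 2 * (((γ * T : ℝ) : ℂ) * a * (starRingEnd ℂ) (q * d)).re - T * (L * ‖d‖ ^ 2)
        = T * (γ ^ 2 * E u * ‖a‖ ^ 2) + 2 * (((γ * T : ℝ) : ℂ) * a * (starRingEnd ℂ) (q * d)).re := by
      ring
    rw [e2]
    refine (abs_add_le _ _).trans ?_
    rw [mul_add]
    refine add_le_add ?_ ?_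
    · rw [abs_mul, abs_of_nonneg hT, abs_mul, abs_mul, abs_of_nonneg (sq_nonneg γ),
        abs_of_nonneg (sq_nonneg ‖a‖)]
    · rw [abs_mul, abs_two]
      have k := abs_re_le_norm (((γ * T : ℝ) : ℂ) * a * (starRingEnd ℂ) (q * d))
      rw [norm_mul, norm_mul, RCLike.norm_conj, norm_real,
        norm_of_nonneg (by positivity : 0 ≤ γ * T)] at k
      calc 2 * |(((γ * T : ℝ) : ℂ) * a * (starRingEnd ℂ) (q * d)).re|
          ≤ 2 * (γ * T * ‖a‖ * (D * ‖d‖)) := by gcongr; exact k.trans (by gcongr)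
        _ = _ := by ring

variable {β₁ β₂ β₃ γ α₀ : ℝ} {a₂ a₃ : ℂ} {χ : ℝ → ℝ}

local notation "ω" => approxForm β₁ β₂ β₃ γ α₀ a₂ a₃ χ
local notation "dist_ω" => approxDist β₁ β₂ β₃ γ α₀ a₂ a₃ χ
local notation "φ" => flatPotential β₂ β₃ γ a₂ a₃
local notation "dens" => flatDensity β₂ β₃ a₂ a₃
local notation "cones" => modelCones β₁ β₂ β₃ γ
local notation "𝓡" => linesCompl a₂ a₃
local notation "𝓖" => GluingData β₁ β₂ β₃ γ α₀ a₂ a₃ χ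

namespace GluingData

theorem symm (H : GluingData β₁ β₂ β₃ γ α₀ a₂ a₃ χ) : GluingData β₁ β₃ β₂ γ α₀ a₃ a₂ χ :=
  { H.toIsCentredPair.symm with
    pos₁ := H.pos₁, lt_γ := H.lt_γ, one_lt := H.one_lt, mul_lt := H.mul_lt, smooth := H.smooth
    nonneg := H.nonneg, le_one := H.le_one, eq_one := H.eq_one, eq_zero := H.eq_zero }

theorem _root_.ConicalLines.approxForm_comm (β₁ β₂ β₃ γ α₀ : ℝ) (a₂ a₃ : ℂ) (χ : ℝ → ℝ) :
    approxForm β₁ β₂ β₃ γ α₀ a₂ a₃ χ = approxForm β₁ β₃ β₂ γ α₀ a₃ a₂ χ := by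
  unfold approxForm approxPotential
  rw [flatPotential_comm]

/-- The argument of the cutoff function. -/
noncomputable def cutoffArg (β₁ γ α₀ : ℝ) (x : ℂ²) : ℝ := ‖x.2‖ ^ γ * (‖x.1‖ ^ β₁) ^ (-α₀)

theorem cutoffArg_eq (x : ℂ²) : cutoffArg β₁ γ α₀ x = ‖x.2‖ ^ γ * ‖x.1‖ ^ (-(β₁ * α₀)) := by
  rw [cutoffArg, ← rpow_mul (norm_nonneg _), mul_neg]

theorem continuousAt_cutoffArg (hγ : 0 ≤ γ) {x : ℂ²} (hx : x.1 ≠ 0) :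
    ContinuousAt (cutoffArg β₁ γ α₀) x := by
  have e : cutoffArg β₁ γ α₀ = fun y : ℂ² => ‖y.2‖ ^ γ * ‖y.1‖ ^ (-(β₁ * α₀)) := funext cutoffArg_eq
  rw [e]
  exact (continuousAt_snd.norm.rpow_const (Or.inr hγ)).mul
    (continuousAt_fst.norm.rpow_const (Or.inl (norm_ne_zero_iff.2 hx)))

theorem potential_eq_of_lt (H : 𝓖) {x : ℂ²} (hx : x.1 ≠ 0)
    (hs : cutoffArg β₁ γ α₀ x < 1) : approxPotential β₁ β₂ β₃ γ α₀ a₂ a₃ χ =ᶠ[nhds x]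
      fun y => ‖y.1‖ ^ (2 * β₁) + ‖y.1‖ ^ (2 * γ) * φ (y.2 / y.1) := by
  filter_upwards [(continuousAt_cutoffArg H.pos.le hx).eventually (gt_mem_nhds hs)] with y hy
  have := H.eq_zero _ hy
  rw [cutoffArg] at this
  rw [approxPotential, this]
  ring

/-- The error term `|z|^(2γ) (φ(u) - |u|^(2γ))` of the gluing. -/
noncomputable def gluingError (β₂ β₃ γ : ℝ) (a₂ a₃ : ℂ) (y : ℂ²) : ℝ :=
  ‖y.1‖ ^ (2 * γ) * (flatPotential β₂ β₃ γ a₂ a₃ (y.2 / y.1) - ‖y.2 / y.1‖ ^ (2 * γ))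

theorem potential_eq (x : ℂ²) (hx : x.1 ≠ 0) : approxPotential β₁ β₂ β₃ γ α₀ a₂ a₃ χ =ᶠ[nhds x]
      fun y => (‖y.1‖ ^ (2 * β₁) + ‖y.2‖ ^ (2 * γ))
        + (1 - χ (cutoffArg β₁ γ α₀ y)) * gluingError β₂ β₃ γ a₂ a₃ y := by
  filter_upwards [continuousAt_fst.eventually (eventually_ne_nhds hx)] with y hy
  have e : ‖y.2‖ ^ (2 * γ) = ‖y.1‖ ^ (2 * γ) * ‖y.2 / y.1‖ ^ (2 * γ) := by
    rw [← mul_rpow (norm_nonneg _) (norm_nonneg _), ← norm_mul, mul_div_cancel₀ _ hy]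
  rw [gluingError, mul_sub, ← e, approxPotential, cutoffArg]
  ring

theorem hasLevi_cone {β γ : ℝ} {x : ℂ²} (hx : x.1 ≠ 0) (hx2 : x.2 ≠ 0) :
    ∃ A, HasLevi (fun y => ‖y.1‖ ^ (2 * β) + ‖y.2‖ ^ (2 * γ)) x A (coneForm β γ x) := by
  have h := (hasLevi_fst_rpow hx (2 * β)).add (hasLevi_snd_rpow hx2 (2 * γ))
  have e : coneForm β γ x = fun v => (2 * β) ^ 2 / 4 * ‖x.1‖ ^ (2 * β) * ‖v.1 / x.1‖ ^ 2
      + (2 * γ) ^ 2 / 4 * ‖x.2‖ ^ (2 * γ) * ‖v.2 / x.2‖ ^ 2 := by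
    ext v
    rw [coneForm, mul_assoc, rpow_sub_two_mul hx, mul_assoc (γ ^ 2), rpow_sub_two_mul hx2]
    ring
  rw [e]
  exact ⟨_, h⟩

/-- Away from the line `{z = 0}` and the other two lines, but not too close to `{z = 0}`, the
metric is exactly the product cone metric. -/
theorem approxForm_eq_coneForm (H : 𝓖) {x : ℂ²} (hx : x.1 ≠ 0)
    (hs : 2 < cutoffArg β₁ γ α₀ x) : ω x = coneForm β₁ γ x := by
  have hx2 : x.2 ≠ 0 := by
    intro h
    rw [cutoffArg, h, norm_zero, zero_rpow H.pos.ne', zero_mul] at hs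
    norm_num at hs
  obtain ⟨A, hA⟩ := hasLevi_cone (β := β₁) (γ := γ) hx hx2
  have h := hA.congr (g := approxPotential β₁ β₂ β₃ γ α₀ a₂ a₃ χ) (by
    refine (potential_eq x hx).trans ?_
    filter_upwards [(continuousAt_cutoffArg H.pos.le hx).eventually (lt_mem_nhds hs)] with y hy
    rw [H.eq_one _ hy]; ring)
  exact funext h.levi_eq

theorem cutoffArg_lt_one (H : 𝓖) (M : ℝ) : ∃ τ : ℝ, 0 < τ ∧
    ∀ x : ℂ², x.1 ≠ 0 → ‖x.1‖ ^ β₁ < τ → ‖x.2 / x.1‖ ≤ M → cutoffArg β₁ γ α₀ x < 1 := by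
  have hγ := H.pos
  obtain ⟨τ, hτ, -, h⟩ := exists_small (C := |M| ^ γ) H.pos₁ (sub_pos.2 H.mul_lt) (by positivity)
    (by norm_num : (0 : ℝ) < 1 / 2)
  refine ⟨τ, hτ, fun x hx hr hu => ?_⟩
  have h0 : 0 < ‖x.1‖ := norm_pos_iff.2 hx
  have e : ‖x.2‖ = ‖x.2 / x.1‖ * ‖x.1‖ := by rw [← norm_mul, div_mul_cancel₀ _ hx]
  rw [cutoffArg_eq, e, mul_rpow (norm_nonneg _) (norm_nonneg _), mul_assoc,
    ← rpow_add h0, ← sub_eq_add_neg]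
  calc ‖x.2 / x.1‖ ^ γ * ‖x.1‖ ^ (γ - β₁ * α₀) ≤ |M| ^ γ * ‖x.1‖ ^ (γ - β₁ * α₀) := by
        gcongr; exact hu.trans (le_abs_self _)
    _ ≤ 1 / 2 := (h x.1 hr).1
    _ < 1 := by norm_num

/-- Where the cutoff vanishes, the metric is a fibre metric up to terms controlled by the
potential of the fibre metric. -/
theorem approxForm_sub_le (H : 𝓖) {x : ℂ²}
    (hx : x ∈ 𝓡) (hs : cutoffArg β₁ γ α₀ x < 1) (v : ℂ²) (c : ℝ) :
    |ω x v - fibreForm γ dens (baseCoeff β₁ x.1 + γ ^ 2 * ‖x.1‖ ^ (2 * γ - 2) * c) x v|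
      ≤ ‖x.1‖ ^ (2 * γ) * (γ ^ 2 * |φ (x.2 / x.1) - c| * ‖v.1 / x.1‖ ^ 2
          + 2 * γ * ‖v.1 / x.1‖ * ‖𝒟 φ (x.2 / x.1)‖ * ‖(v.2 - x.2 / x.1 * v.1) / x.1‖) := by
  obtain ⟨hx1, h2, h3⟩ := hx
  have k2 := mt (div_eq_iff hx1).1 h2
  have k3 := mt (div_eq_iff hx1).1 h3
  obtain ⟨p1, p2⟩ := H.flatPotential_regular k2 k3
  have q1 : ContDiffAt ℝ 2 (fun w => φ w - c) (x.2 / x.1) := p1.sub contDiffAt_const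
  obtain ⟨A, Λ, hΛ, hb⟩ := exists_hasLevi_fibre H.pos.le hx1 q1 (by
    simpa only [fderiv_sub_const] using p2)
  have e : approxPotential β₁ β₂ β₃ γ α₀ a₂ a₃ χ =ᶠ[nhds x] fun y => (‖y.1‖ ^ (2 * β₁) +
      ‖y.1‖ ^ (2 * γ) * (φ (y.2 / y.1) - c)) + ‖y.1‖ ^ (2 * γ) * c := by
    filter_upwards [H.potential_eq_of_lt hx1 hs] with y hy
    rw [hy]; ring
  have hc : HasLevi (fun y : ℂ² => ‖y.1‖ ^ (2 * γ) * c) x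
      (fun v => c * ((2 * γ / 2 * ‖x.1‖ ^ (2 * γ) : ℝ) * (v.1 / x.1)))
      (fun v => c * ((2 * γ) ^ 2 / 4 * ‖x.1‖ ^ (2 * γ) * ‖v.1 / x.1‖ ^ 2)) := by
    have h0 := hasLevi_fst_rpow hx1 (2 * γ)
    have := h0.comp_real (θ := fun s => s * c) (by fun_prop)
    have d1 : deriv (fun s : ℝ => s * c) = fun _ => c := by ext s; simp
    simpa [d1] using this
  have h := (((hasLevi_fst_rpow hx1 (2 * β₁)).add hΛ).add hc).congr e
  have hl := h.levi_eq v
  have hbv := (hb v).2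
  simp only [fderiv_sub_const] at hbv
  rw [approxForm, hl]
  refine le_trans (le_of_eq ?_) hbv
  congr 1
  rw [fibreForm, baseCoeff]
  linear_combination (-β₁ ^ 2) * rpow_sub_two_mul hx1 (2 * β₁) v.1
    - (γ ^ 2 * c) * rpow_sub_two_mul hx1 (2 * γ) v.1

end GluingData

/-! ### Comparison of the metric with its two asymptotic models -/

namespace GluingData

/-- The coefficient of `|dz|²` in `i∂∂̄ (|z|^(2β₁) + c |z|^(2γ))`. -/
noncomputable def _root_.ConicalLines.fibreCoeff (β₁ γ c : ℝ) (z : ℂ) : ℝ :=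
  baseCoeff β₁ z + γ ^ 2 * ‖z‖ ^ (2 * γ - 2) * c

/-- Smallness of the contribution of `c |z|^(2γ)` to `fibreCoeff β₁ γ c`. -/
def _root_.ConicalLines.IsSubordinate (β₁ γ c : ℝ) (z : ℂ) : Prop :=
  γ ^ 2 * ‖z‖ ^ (2 * γ - 2) * |c| ≤ baseCoeff β₁ z / 2

theorem _root_.ConicalLines.IsSubordinate.le_fibreCoeff {c : ℝ} {z : ℂ}
    (h : IsSubordinate β₁ γ c z) : baseCoeff β₁ z / 2 ≤ fibreCoeff β₁ γ c z := by
  have : -(γ ^ 2 * ‖z‖ ^ (2 * γ - 2) * |c|) ≤ γ ^ 2 * ‖z‖ ^ (2 * γ - 2) * c := by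
    rw [← mul_neg]; gcongr; exact neg_abs_le c
  unfold IsSubordinate at h; unfold fibreCoeff; linarith

theorem fibreForm_close (H : 𝓖) {x : ℂ²}
    (hx : x ∈ 𝓡) (hs : cutoffArg β₁ γ α₀ x < 1) {c δ P Q : ℝ} (hδ : 0 < δ)
    (hQ0 : 0 < Q) (hc : IsSubordinate β₁ γ c x.1) (hP : |φ (x.2 / x.1) - c| ≤ P)
    (hQ : ‖𝒟 φ (x.2 / x.1)‖ ^ 2 ≤ Q * dens (x.2 / x.1))
    (hr : ‖x.1‖ ^ (2 * γ) * (P + Q / δ) ≤ δ * (β₁ ^ 2 / 2 * ‖x.1‖ ^ (2 * β₁))) (v : ℂ²) :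
    |ω x v - fibreForm γ dens (fibreCoeff β₁ γ c x.1) x v|
      ≤ δ * fibreForm γ dens (fibreCoeff β₁ γ c x.1) x v := by
  have hγ := H.pos
  have hγ1 : γ ≤ 1 := by linarith [H.angle, H.lt₂, H.lt₃]
  refine (H.approxForm_sub_le hx hs v c).trans ?_
  set u := x.2 / x.1
  set T := ‖x.1‖ ^ (2 * γ)
  set d := (v.2 - u * v.1) / x.1 with hd
  set a := v.1 / x.1 with ha
  have hT : 0 ≤ T := by positivity
  have h1 := two_mul_mul_le (X := ‖a‖) (Y := ‖d‖) hQ0 (mul_pos hδ hγ) hQ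
  have h2 : β₁ ^ 2 / 2 * ‖x.1‖ ^ (2 * β₁) * ‖a‖ ^ 2 ≤ fibreCoeff β₁ γ c x.1 * ‖v.1‖ ^ 2 := by
    have := mul_le_mul_of_nonneg_right hc.le_fibreCoeff (sq_nonneg ‖v.1‖)
    rw [baseCoeff] at this
    linear_combination this - β₁ ^ 2 / 2 * rpow_sub_two_mul hx.1 (2 * β₁) v.1
  have h3 : fibreForm γ dens (fibreCoeff β₁ γ c x.1) x v
      = fibreCoeff β₁ γ c x.1 * ‖v.1‖ ^ 2 + γ ^ 2 * T * dens u * ‖d‖ ^ 2 := rfl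
  rw [h3]
  have h4 : γ * (Q / (δ * γ)) = Q / δ := by field_simp
  calc T * (γ ^ 2 * |φ u - c| * ‖a‖ ^ 2 + 2 * γ * ‖a‖ * ‖𝒟 φ u‖ * ‖d‖) ≤ T * (1 * P * ‖a‖ ^ 2
          + γ * (δ * γ * (dens u * ‖d‖ ^ 2) + Q / (δ * γ) * ‖a‖ ^ 2)) := by
        refine mul_le_mul_of_nonneg_left (add_le_add ?_ ?_) hT
        · gcongr; exact pow_le_one₀ hγ.le hγ1
        · calc _ = γ * (2 * ‖a‖ * ‖𝒟 φ u‖ * ‖d‖) := by ring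
            _ ≤ _ := mul_le_mul_of_nonneg_left h1 hγ.le
    _ = T * (P + Q / δ) * ‖a‖ ^ 2 + δ * (γ ^ 2 * T * dens u * ‖d‖ ^ 2) := by
        linear_combination (T * ‖a‖ ^ 2) * h4
    _ ≤ δ * (β₁ ^ 2 / 2 * ‖x.1‖ ^ (2 * β₁)) * ‖a‖ ^ 2 + δ * (γ ^ 2 * T * dens u * ‖d‖ ^ 2) := by
        gcongr
    _ ≤ _ := by nlinarith [mul_le_mul_of_nonneg_left h2 hδ.le]

theorem _root_.ConicalLines.rpow_two_mul_le {z : ℂ} (hz : z ≠ 0) {C k : ℝ}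
    (h : C * ‖z‖ ^ (2 * (γ - β₁)) ≤ k) : C * ‖z‖ ^ (2 * γ) ≤ k * ‖z‖ ^ (2 * β₁) := by
  have e : ‖z‖ ^ (2 * γ) = ‖z‖ ^ (2 * (γ - β₁)) * ‖z‖ ^ (2 * β₁) := by
    rw [← rpow_add (norm_pos_iff.2 hz)]; congr 1; ring
  rw [e, ← mul_assoc]; gcongr

theorem isSubordinate_of_le (H : 𝓖) {z : ℂ} (hz : z ≠ 0) {c : ℝ}
    (h : |c| * ‖z‖ ^ (2 * (γ - β₁)) ≤ β₁ ^ 2 / 2) : IsSubordinate β₁ γ c z := by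
  have hγ1 : γ ≤ 1 := by linarith [H.angle, H.lt₂, H.lt₃]
  have e : ‖z‖ ^ (2 * γ - 2) = ‖z‖ ^ (2 * (γ - β₁)) * ‖z‖ ^ (2 * β₁ - 2) := by
    rw [← rpow_add (norm_pos_iff.2 hz)]; congr 1; ring
  rw [IsSubordinate, baseCoeff, e]
  calc γ ^ 2 * (‖z‖ ^ (2 * (γ - β₁)) * ‖z‖ ^ (2 * β₁ - 2)) * |c|
      ≤ 1 * (‖z‖ ^ (2 * (γ - β₁)) * ‖z‖ ^ (2 * β₁ - 2)) * |c| := by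
        gcongr; exact pow_le_one₀ H.pos.le hγ1
    _ = (|c| * ‖z‖ ^ (2 * (γ - β₁))) * ‖z‖ ^ (2 * β₁ - 2) := by ring
    _ ≤ β₁ ^ 2 / 2 * ‖z‖ ^ (2 * β₁ - 2) := by gcongr
    _ = _ := by ring

/-- In a sector `|w| ≤ M |z|` the metric is asymptotic to the fibre metric. -/
theorem exists_fibre_close (H : 𝓖) (M : ℝ) {δ : ℝ} (hδ : 0 < δ) :
    ∃ τ : ℝ, 0 < τ ∧ ∀ x ∈ 𝓡, ‖x.1‖ ^ β₁ < τ → ‖x.2 / x.1‖ ≤ M → ∀ v,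
      |ω x v - fibreForm γ dens (fibreCoeff β₁ γ 0 x.1) x v|
        ≤ δ * fibreForm γ dens (fibreCoeff β₁ γ 0 x.1) x v := by
  obtain ⟨C1, hC1, h1⟩ := H.toIsCentredPair.abs_flatPotential_le
  obtain ⟨C2, hC2, h2⟩ := H.toIsCentredPair.sq_norm_fderiv_flatPotential_le
  obtain ⟨τ1, hτ1, h3⟩ := H.cutoffArg_lt_one M
  have hγ := H.pos
  have hβ1 := H.pos₁
  set B := 1 + |M| ^ (2 * γ)
  have hB : 0 < B := by positivity
  set Q := (C2 + 1) * B
  obtain ⟨τ2, hτ2, -, h4⟩ := exists_small (C := C1 * B + Q / δ) H.pos₁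
    (e := 2 * (γ - β₁)) (by linarith [H.lt_γ]) (by positivity) (δ := δ * (β₁ ^ 2 / 2))
    (by positivity)
  refine ⟨min τ1 τ2, lt_min hτ1 hτ2, fun x hx hr hu => ?_⟩
  have k2 := mt (div_eq_iff hx.1).1 hx.2.1
  have k3 := mt (div_eq_iff hx.1).1 hx.2.2
  have hB' : 1 + ‖x.2 / x.1‖ ^ (2 * γ) ≤ B := by
    exact add_le_add_right (rpow_le_rpow (norm_nonneg _) (hu.trans (le_abs_self _))
      (by positivity)) 1
  refine H.fibreForm_close hx (h3 x hx.1 (hr.trans_le (min_le_left _ _)) hu) hδ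
    (Q := Q) (P := C1 * B) (by positivity) ?_ ?_ ?_ ?_
  · rw [IsSubordinate, abs_zero, mul_zero, baseCoeff]; positivity
  · rw [sub_zero]; exact (h1 _).trans (by gcongr)
  · refine (h2 _ k2 k3).trans ?_
    have : 0 ≤ dens (x.2 / x.1) := flatDensity_nonneg
    calc C2 * (1 + ‖x.2 / x.1‖ ^ (2 * γ)) * dens (x.2 / x.1) ≤ (C2 + 1) * B * dens (x.2 / x.1) := by
          gcongr; linarith
      _ = _ := rfl
  · have := rpow_two_mul_le hx.1 (h4 x.1 (hr.trans_le (min_le_right _ _))).1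
    linarith

theorem exists_isSubordinate (H : 𝓖) (c : ℝ) : ∃ τ : ℝ, 0 < τ ∧
    ∀ z : ℂ, z ≠ 0 → ‖z‖ ^ β₁ < τ → IsSubordinate β₁ γ c z := by
  have hβ1 := H.pos₁
  obtain ⟨τ, hτ, -, h⟩ := exists_small (C := |c|) H.pos₁ (e := 2 * (γ - β₁))
    (by linarith [H.lt_γ]) (abs_nonneg c) (δ := β₁ ^ 2 / 2) (by positivity)
  exact ⟨τ, hτ, fun z hz hr => H.isSubordinate_of_le hz (h z hr).1⟩

/-- Near the conical line `{w = a₂ z}` the metric is close to a fibre metric, uniformly in `z`. -/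
theorem exists_fibre_close_near (H : 𝓖) : ∃ τ : ℝ, 0 < τ ∧
    ∀ δ > 0, ∃ ν : ℝ, 0 < ν ∧ ∀ x ∈ 𝓡, ‖x.1‖ ^ β₁ < τ → ‖x.2 / x.1 - a₂‖ < ν →
      ∀ v, |ω x v - fibreForm γ dens (fibreCoeff β₁ γ (φ a₂) x.1) x v|
        ≤ δ * fibreForm γ dens (fibreCoeff β₁ γ (φ a₂) x.1) x v := by
  obtain ⟨τ1, hτ1, h1⟩ := H.cutoffArg_lt_one (‖a₂‖ + 1)
  obtain ⟨τ2, hτ2, h2⟩ := H.exists_isSubordinate (φ a₂)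
  obtain ⟨τ3, hτ3, -, h3⟩ := exists_small (C := 1) H.pos₁ (e := 2 * (γ - β₁))
    (by linarith [H.lt_γ]) zero_le_one one_pos
  have hβ1 := H.pos₁
  refine ⟨min τ1 (min τ2 τ3), lt_min hτ1 (lt_min hτ2 hτ3), fun δ hδ => ?_⟩
  obtain ⟨ν1, hν1, h4⟩ := H.toIsCentredPair.sq_norm_fderiv_flatPotential_le_near
    (δ := δ ^ 2 * β₁ ^ 2 / 4) (by positivity)
  have h5 := H.toIsCentredPair.continuous_flatPotential.continuousAt (x := a₂)
  obtain ⟨ν2, hν2, h6⟩ := continuousAt_iff.1 h5 (δ * β₁ ^ 2 / 4) (by positivity)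
  refine ⟨min 1 (min ν1 ν2), lt_min one_pos (lt_min hν1 hν2), fun x hx hr hu => ?_⟩
  simp only [lt_min_iff] at hr hu
  have k2 := mt (div_eq_iff hx.1).1 hx.2.1
  have hu' : ‖x.2 / x.1‖ ≤ ‖a₂‖ + 1 := by
    have := norm_sub_norm_le (x.2 / x.1) a₂; linarith [hu.1]
  refine H.fibreForm_close hx (h1 x hx.1 hr.1 hu') hδ (Q := δ ^ 2 * β₁ ^ 2 / 4)
    (P := δ * β₁ ^ 2 / 4) (by positivity) (h2 _ hx.1 hr.2.1) ?_ ?_ ?_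
  · rw [← dist_eq]; exact (h6 (by rw [dist_eq_norm]; exact hu.2.2)).le
  · exact (h4 _ (norm_sub_pos_iff.2 k2) hu.2.1).2
  · have := rpow_two_mul_le hx.1 (h3 x.1 hr.2.2).1
    have e : δ * β₁ ^ 2 / 4 + δ ^ 2 * β₁ ^ 2 / 4 / δ = δ * (β₁ ^ 2 / 2) := by field_simp; ring
    rw [e]
    nlinarith [show 0 < δ * (β₁ ^ 2 / 2) by positivity]

theorem hasLevi_cutoffArg {x : ℂ²} (hx : x.1 ≠ 0) (hx2 : x.2 ≠ 0) (hγ : 0 ≤ γ) (hγ1 : γ ≤ 1)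
    (hm : 0 ≤ β₁ * α₀) (hm1 : β₁ * α₀ ≤ 1) : ∃ A Λ, HasLevi (cutoffArg β₁ γ α₀) x A Λ ∧
      ∀ v : ℂ², ‖A v‖ ≤ cutoffArg β₁ γ α₀ x * (‖v.1 / x.1‖ + ‖v.2 / x.2‖) ∧
        |Λ v| ≤ cutoffArg β₁ γ α₀ x * (‖v.1 / x.1‖ + ‖v.2 / x.2‖) ^ 2 := by
  have h := (hasLevi_snd_rpow hx2 γ).mul (hasLevi_fst_rpow hx (-(β₁ * α₀)))
  have e : cutoffArg β₁ γ α₀ = fun y : ℂ² => ‖y.2‖ ^ γ * ‖y.1‖ ^ (-(β₁ * α₀)) := funext cutoffArg_eq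
  rw [e]
  refine ⟨_, _, h, fun v => ?_⟩
  set m := β₁ * α₀
  set a := v.1 / x.1
  set b := v.2 / x.2
  set P := ‖x.2‖ ^ γ
  set N := ‖x.1‖ ^ (-m)
  have hP : 0 ≤ P := by positivity
  have hN : 0 ≤ N := by positivity
  constructor
  · refine (norm_add_le _ _).trans ?_
    simp only [norm_mul, norm_real, norm_eq_abs, abs_of_nonneg hP,
      abs_of_nonneg hN, abs_div, abs_neg, abs_two, abs_of_nonneg hγ, abs_of_nonneg hm]
    calc P * (m / 2 * N * ‖a‖) + N * (γ / 2 * P * ‖b‖)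
        = P * N * (m / 2 * ‖a‖ + γ / 2 * ‖b‖) := by ring
      _ ≤ P * N * (1 * ‖a‖ + 1 * ‖b‖) := by gcongr <;> linarith
      _ = _ := by ring
  · have k : |(((γ / 2 * P : ℝ) : ℂ) * b
        * (starRingEnd ℂ) (((-m / 2 * N : ℝ) : ℂ) * a)).re| ≤ γ / 2 * P * ‖b‖ * (m / 2 * N * ‖a‖) := by
      refine (abs_re_le_norm _).trans (le_of_eq ?_)
      simp only [norm_mul, RCLike.norm_conj, norm_real, norm_eq_abs,
        abs_of_nonneg hP, abs_of_nonneg hN, abs_div, abs_neg, abs_two, abs_of_nonneg hγ,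
        abs_of_nonneg hm]
    refine (abs_add_le _ _).trans ?_
    rw [abs_mul, abs_two]
    have k2 : 0 ≤ P * ((-m) ^ 2 / 4 * N * ‖a‖ ^ 2) + N * (γ ^ 2 / 4 * P * ‖b‖ ^ 2) := by positivity
    rw [abs_of_nonneg k2]
    have e1 : P * N * (m / 2 * ‖a‖ + γ / 2 * ‖b‖) ^ 2 ≤ P * N * (1 * ‖a‖ + 1 * ‖b‖) ^ 2 := by
      gcongr <;> linarith
    linarith

theorem _root_.ConicalLines.coneForm_eq_log {β γ : ℝ} {x : ℂ²} (hx : x.1 ≠ 0) (hx2 : x.2 ≠ 0)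
    (v : ℂ²) : coneForm β γ x v
      = β ^ 2 * ((‖x.1‖ ^ β) ^ 2 * ‖v.1 / x.1‖ ^ 2) + γ ^ 2 * ((‖x.2‖ ^ γ) ^ 2 * ‖v.2 / x.2‖ ^ 2) := by
  have e : ∀ (y : ℂ) (m : ℝ), ‖y‖ ^ (2 * m) = (‖y‖ ^ m) ^ 2 := fun y m => by
    rw [mul_comm, rpow_mul (norm_nonneg _), rpow_two]
  rw [coneForm, mul_assoc, rpow_sub_two_mul hx, mul_assoc (γ ^ 2), rpow_sub_two_mul hx2, e, e]

theorem _root_.ConicalLines.sq_mul_sq_le_coneForm {β γ : ℝ} {x : ℂ²} (hx : x.1 ≠ 0)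
    (hx2 : x.2 ≠ 0) (hβ : 0 < β) (hγ : 0 < γ) (hR : ‖x.2‖ ^ γ ≤ 2 * ‖x.1‖ ^ β) (v : ℂ²) :
    (‖x.2‖ ^ γ) ^ 2 * (‖v.1 / x.1‖ + ‖v.2 / x.2‖) ^ 2
      ≤ (8 / β ^ 2 + 2 / γ ^ 2) * coneForm β γ x v := by
  rw [coneForm_eq_log hx hx2]
  set a := ‖v.1 / x.1‖
  set b := ‖v.2 / x.2‖
  set R := ‖x.2‖ ^ γ
  have hR0 : 0 ≤ R := by positivity
  set r := ‖x.1‖ ^ β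
  have i2 : R ^ 2 ≤ (2 * r) ^ 2 := by gcongr
  have i3 : R ^ 2 * (a + b) ^ 2 ≤ 8 * (r ^ 2 * a ^ 2) + 2 * (R ^ 2 * b ^ 2) := by
    nlinarith [mul_le_mul_of_nonneg_right i2 (sq_nonneg a),
      mul_nonneg (sq_nonneg R) (sq_nonneg (a - b))]
  have e1 : 8 / β ^ 2 * (β ^ 2 * (r ^ 2 * a ^ 2)) = 8 * (r ^ 2 * a ^ 2) := by field_simp
  have e2 : 2 / γ ^ 2 * (γ ^ 2 * (R ^ 2 * b ^ 2)) = 2 * (R ^ 2 * b ^ 2) := by field_simp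
  have p1 : 0 ≤ 8 / β ^ 2 * (γ ^ 2 * (R ^ 2 * b ^ 2)) := by positivity
  have p2 : 0 ≤ 2 / γ ^ 2 * (β ^ 2 * (r ^ 2 * a ^ 2)) := by positivity
  rw [add_mul, mul_add, mul_add, e1, e2]
  linarith

/-- Away from a sector `|w| ≤ M |z|` the metric is asymptotic to the product cone metric. -/
theorem exists_cone_close (H : 𝓖) {δ : ℝ} (hδ : 0 < δ) :
    ∃ M τ : ℝ, 1 ≤ M ∧ 0 < τ ∧ ∀ x : ℂ², x.1 ≠ 0 → ‖x.1‖ ^ β₁ < τ → M ≤ ‖x.2 / x.1‖ → ∀ v,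
      |ω x v - coneForm β₁ γ x v| ≤ δ * coneForm β₁ γ x v := by
  have hγ := H.pos
  have hγ1 : γ ≤ 1 := by linarith [H.angle, H.lt₂, H.lt₃]
  have hβ1 := H.pos₁
  have hα := H.one_lt
  have hθs : ContDiff ℝ 2 fun s => 1 - χ s := contDiff_const.sub H.smooth
  set θ : ℝ → ℝ := fun s => 1 - χ s
  have hθ1 : ContDiff ℝ 1 (deriv θ) := (contDiff_succ_iff_deriv (n := 1)).1
    (by rw [one_add_one_eq_two]; exact hθs) |>.2.2
  obtain ⟨C1, hC1⟩ := (isCompact_Icc (a := (0 : ℝ)) (b := 2)).exists_bound_of_continuousOn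
    hθ1.continuous.continuousOn
  obtain ⟨C2, hC2⟩ := (isCompact_Icc (a := (0 : ℝ)) (b := 2)).exists_bound_of_continuousOn
    (hθ1.continuous_deriv le_rfl).continuousOn
  set C := max C1 C2
  have hC : 0 ≤ C := ((norm_nonneg _).trans (hC1 0 (by simp))).trans (le_max_left _ _)
  set D := (4 + 14 * C) * (8 / β₁ ^ 2 + 2 / γ ^ 2)
  set δ' := δ / D
  have hD : 0 < D := by positivity
  have hδ' : 0 < δ' := by positivity
  obtain ⟨M1, hM1, h1⟩ := H.toIsCentredPair.flatPotential_asymp hδ'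
  set E0 := 4 * (‖a₂‖ ^ 2 + ‖a₃‖ ^ 2)
  refine ⟨max M1 (max (IsCentredPair.farRadius a₂ a₃) (E0 / δ')), 1, hM1.trans (le_max_left _ _), one_pos,
    fun x hx hr hu v => ?_⟩
  rcases lt_or_ge 2 (cutoffArg β₁ γ α₀ x) with hs | hs
  · rw [H.approxForm_eq_coneForm hx hs, sub_self, abs_zero, coneForm]; positivity
  simp only [max_le_iff] at hu
  obtain ⟨k2, k3, p1, p2⟩ := h1 _ hu.1
  have hu0 : 1 ≤ ‖x.2 / x.1‖ := hM1.trans hu.1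
  have hune : x.2 / x.1 ≠ 0 := norm_pos_iff.1 (by linarith)
  have hx2 : x.2 ≠ 0 := fun h => hune (by rw [h, zero_div])
  obtain ⟨q1, q2⟩ := H.flatPotential_regular k2 k3
  have q3 := contDiffAt_norm_rpow (m := 2 * γ) (n := 2) hune
  have hE2 : ContDiffAt ℝ 2 (fun w => φ w - ‖w‖ ^ (2 * γ)) (x.2 / x.1) := q1.sub q3
  have hsub : ∀ y : ℂ, (fun w => 𝒟 (fun w => φ w - ‖w‖ ^ (2 * γ)) w y)
      =ᶠ[nhds (x.2 / x.1)] fun w => 𝒟 φ w y - 𝒟 (fun w : ℂ => ‖w‖ ^ (2 * γ)) w y := by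
    intro y
    filter_upwards [q1.eventually (by simp), q3.eventually (by simp)] with w h1 h2
    rw [fderiv_fun_sub (h1.differentiableAt (by norm_num)) (h2.differentiableAt (by norm_num))]
    rfl
  have hdf : ∀ (f : ℂ → ℝ), ContDiffAt ℝ 2 f (x.2 / x.1) → ∀ y,
      DifferentiableAt ℝ (fun w => 𝒟 f w y) (x.2 / x.1) := fun f hf y =>
    ((hf.fderiv_right (m := 1) (by norm_num)).differentiableAt one_ne_zero).clm_apply
      (differentiableAt_const y)
  obtain ⟨A, Λ, hΛ, hb⟩ := exists_hasLevi_fibre hγ.le hx hE2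
    (L := γ ^ 2 * (dens (x.2 / x.1) - ‖x.2 / x.1‖ ^ (2 * γ - 2))) (by
      rw [(hsub 1).fderiv_eq, (hsub I).fderiv_eq,
        fderiv_fun_sub (hdf _ q1 _) (hdf _ q3 _), fderiv_fun_sub (hdf _ q1 _) (hdf _ q3 _)]
      have := laplacian_norm_rpow (m := 2 * γ) hune
      simp only [sub_apply]
      linear_combination q2 - this)
  have hm : β₁ * α₀ ≤ 1 := H.mul_lt.le.trans hγ1
  obtain ⟨As, Λs, hs1, hs2⟩ := hasLevi_cutoffArg (α₀ := α₀) (β₁ := β₁) hx hx2 hγ.le hγ1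
    (by positivity) hm
  obtain ⟨A0, hcone⟩ := hasLevi_cone (β := β₁) (γ := γ) hx hx2
  have htot := (hcone.add ((hs1.comp_real hθs).mul hΛ)).congr (potential_eq x hx)
  have hl := htot.levi_eq v
  obtain ⟨hA, hΛv⟩ := hb v
  obtain ⟨hAs, hΛs⟩ := hs2 v
  have hdens := H.toIsCentredPair.flatDensity_sub_le hu.2.1
  set s := cutoffArg β₁ γ α₀ x with hsdef
  have hs0 : 0 ≤ s := by rw [hsdef, cutoffArg]; positivity
  set u := x.2 / x.1 with hudef
  set a := v.1 / x.1 with ha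
  set b := v.2 / x.2 with hbdef
  set q := ‖a‖ + ‖b‖
  have hq : 0 ≤ q := by positivity
  have haq : ‖a‖ ≤ q := le_add_of_nonneg_right (norm_nonneg _)
  set d := (v.2 - u * v.1) / x.1 with hd
  have hdu : ‖d‖ ≤ ‖u‖ * q := by
    have e : d = u * (b - a) := by rw [hd, hbdef, ha, hudef]; field_simp
    rw [e, norm_mul]
    gcongr
    exact (norm_sub_le _ _).trans (add_comm _ _).le
  set T := ‖x.1‖ ^ (2 * γ)
  have hT : 0 ≤ T := by positivity
  set R2 := T * ‖u‖ ^ (2 * γ) with hR2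
  have hu00 : 0 < ‖u‖ := by linarith
  have hR20 : 0 ≤ R2 := by positivity
  set e := φ u - ‖u‖ ^ (2 * γ)
  have hTe : T * |e| ≤ δ' * R2 := by
    calc T * |e| ≤ T * (δ' * ‖u‖ ^ (2 * γ)) := by gcongr
      _ = _ := by ring
  set De := ‖𝒟 (fun w => φ w - ‖w‖ ^ (2 * γ)) u‖
  have hTD : T * (De * ‖d‖) ≤ δ' * R2 * q := by
    calc T * (De * ‖d‖) ≤ T * (δ' * ‖u‖ ^ (2 * γ - 1) * (‖u‖ * q)) := by gcongr
      _ = T * δ' * (‖u‖ ^ (2 * γ - 1) * ‖u‖) * q := by ring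
      _ = _ := by rw [← rpow_add_one hu00.ne', sub_add_cancel]; ring
  have hA' : ‖A v‖ ≤ 2 * δ' * R2 * q := by
    refine hA.trans ?_
    calc T * (γ * |e| * ‖a‖ + De * ‖d‖) = γ * (T * |e|) * ‖a‖ + T * (De * ‖d‖) := by ring
      _ ≤ 1 * (δ' * R2) * q + δ' * R2 * q := by gcongr
      _ = _ := by ring
  have hLd : |T * (γ ^ 2 * (dens u - ‖u‖ ^ (2 * γ - 2)) * ‖d‖ ^ 2)| ≤ δ' * R2 * q ^ 2 := by
    rw [abs_mul, abs_mul, abs_mul, abs_of_nonneg hT, abs_of_nonneg (sq_nonneg γ),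
      abs_of_nonneg (sq_nonneg ‖d‖)]
    have h6 : |dens u - ‖u‖ ^ (2 * γ - 2)| ≤ δ' * ‖u‖ ^ (2 * γ - 2) := by
      refine hdens.trans ?_
      have e1 : ‖u‖ ^ (2 * γ - 2) = ‖u‖ ^ (-(4 - 2 * γ)) * ‖u‖ ^ 2 := by
        rw [← rpow_natCast, ← rpow_add hu00]; congr 1; push_cast; ring
      rw [e1]
      have h7 : E0 ≤ δ' * ‖u‖ := by
        have := hu.2.2; rwa [div_le_iff₀ hδ', mul_comm] at this
      calc E0 * ‖u‖ ^ (-(4 - 2 * γ)) ≤ δ' * ‖u‖ * ‖u‖ ^ (-(4 - 2 * γ)) := by gcongr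
        _ ≤ δ' * ‖u‖ * ‖u‖ ^ (-(4 - 2 * γ)) * ‖u‖ := le_mul_of_one_le_right (by positivity) hu0
        _ = _ := by ring
    calc T * (γ ^ 2 * |dens u - ‖u‖ ^ (2 * γ - 2)| * ‖d‖ ^ 2)
        ≤ T * (1 * (δ' * ‖u‖ ^ (2 * γ - 2)) * (‖u‖ * q) ^ 2) := by
          gcongr; exact pow_le_one₀ hγ.le hγ1
      _ = δ' * T * (‖u‖ ^ (2 * γ - 2) * ‖u‖ ^ 2) * q ^ 2 := by ring
      _ = _ := by
        rw [← rpow_natCast ‖u‖ 2, ← rpow_add hu00, hR2]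
        push_cast
        rw [sub_add_cancel]; ring
  have hΛ' : |Λ v| ≤ 4 * δ' * R2 * q ^ 2 := by
    have h8 : T * (γ ^ 2 * |e| * ‖a‖ ^ 2 + 2 * γ * ‖a‖ * De * ‖d‖) ≤ 3 * δ' * R2 * q ^ 2 := by
      calc _ = γ ^ 2 * (T * |e|) * ‖a‖ ^ 2 + 2 * γ * ‖a‖ * (T * (De * ‖d‖)) := by ring
        _ ≤ 1 * (δ' * R2) * q ^ 2 + 2 * 1 * q * (δ' * R2 * q) := by
          gcongr; exact pow_le_one₀ hγ.le hγ1
        _ = _ := by ring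
    have h9 := abs_le.1 (hΛv.trans h8)
    have h10 := abs_le.1 hLd
    rw [abs_le]; constructor <;> linarith
  have hsI : s ∈ Icc (0 : ℝ) 2 := ⟨hs0, hs⟩
  have hd1 : |deriv θ s| ≤ C := (hC1 s hsI).trans (le_max_left _ _)
  have hd2 : |deriv (deriv θ) s| ≤ C := (hC2 s hsI).trans (le_max_right _ _)
  have hAθ : ‖((deriv θ s : ℝ) : ℂ) * As v‖ ≤ 2 * C * q := by
    rw [norm_mul, norm_real, norm_eq_abs]
    calc |deriv θ s| * ‖As v‖ ≤ C * (2 * q) := by gcongr; exact hAs.trans (by gcongr)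
      _ = _ := by ring
  have hΛθ : |deriv θ s * Λs v + deriv (deriv θ) s * ‖As v‖ ^ 2| ≤ 6 * C * q ^ 2 := by
    refine (abs_add_le _ _).trans ?_
    rw [abs_mul, abs_mul, abs_of_nonneg (sq_nonneg ‖As v‖)]
    calc |deriv θ s| * |Λs v| + |deriv (deriv θ) s| * ‖As v‖ ^ 2
        ≤ C * (2 * q ^ 2) + C * (2 * q) ^ 2 := by
          gcongr
          · exact hΛs.trans (by gcongr)
          · exact hAs.trans (by gcongr)
      _ = _ := by ring
  have hθ0 : 0 ≤ θ s := sub_nonneg.2 (H.le_one s)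
  have hθ1 : θ s ≤ 1 := sub_le_self _ (H.nonneg s)
  rw [approxForm, hl, add_sub_cancel_left]
  have hcross : |2 * (((deriv θ s : ℝ) : ℂ) * As v * (starRingEnd ℂ) (A v)).re|
      ≤ 2 * (2 * C * q * (2 * δ' * R2 * q)) := by
    rw [abs_mul, abs_two]
    refine mul_le_mul_of_nonneg_left ((abs_re_le_norm _).trans ?_) zero_le_two
    rw [norm_mul, RCLike.norm_conj]
    gcongr
  have hfin : (4 + 14 * C) * δ' * R2 * q ^ 2 ≤ δ * coneForm β₁ γ x v := by
    -- in the gluing region `R ≤ 2 r`, as `α₀ > 1`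
    have hR : ‖x.2‖ ^ γ ≤ 2 * ‖x.1‖ ^ β₁ := by
      have h0 : 0 < ‖x.1‖ := norm_pos_iff.2 hx
      have h1 : ‖x.2‖ ^ γ = s * (‖x.1‖ ^ β₁) ^ α₀ := by
        rw [hsdef, cutoffArg, mul_assoc, ← rpow_add (by positivity), neg_add_cancel,
          rpow_zero, mul_one]
      rw [h1]
      gcongr
      calc (‖x.1‖ ^ β₁) ^ α₀ ≤ (‖x.1‖ ^ β₁) ^ (1 : ℝ) :=
            rpow_le_rpow_of_exponent_ge (by positivity) hr.le hα.le
        _ = _ := rpow_one _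
    have hR2' : R2 = (‖x.2‖ ^ γ) ^ 2 := by
      rw [hR2, ← mul_rpow (norm_nonneg _) (norm_nonneg _), ← norm_mul, hudef,
        mul_div_cancel₀ _ hx, mul_comm 2 γ, rpow_mul (norm_nonneg _)]
      norm_num
    have h11 := sq_mul_sq_le_coneForm hx hx2 hβ1 hγ hR v
    rw [← hR2'] at h11
    calc (4 + 14 * C) * δ' * R2 * q ^ 2 = (4 + 14 * C) * δ' * (R2 * q ^ 2) := by ring
      _ ≤ (4 + 14 * C) * δ' * ((8 / β₁ ^ 2 + 2 / γ ^ 2) * coneForm β₁ γ x v) := by gcongr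
      _ = δ' * D * coneForm β₁ γ x v := by ring
      _ = _ := by rw [div_mul_cancel₀ _ hD.ne']
  refine le_trans ?_ hfin
  have hEabs : |T * e| ≤ δ' * R2 := by rw [abs_mul, abs_of_nonneg hT]; exact hTe
  have t1 : |θ s * Λ v| ≤ 1 * (4 * δ' * R2 * q ^ 2) := by rw [abs_mul, abs_of_nonneg hθ0]; gcongr
  have t2 : |T * e * (deriv θ s * Λs v + deriv (deriv θ) s * ‖As v‖ ^ 2)|
      ≤ δ' * R2 * (6 * C * q ^ 2) := by
    rw [abs_mul]; gcongr
  refine (abs_add_le _ _).trans ?_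
  refine (add_le_add ((abs_add_le _ _).trans (add_le_add t1 t2)) hcross).trans (le_of_eq ?_)
  ring

end GluingData

/-! ### Regularity and positivity of the metric, lengths along the fibres -/

theorem isLineElement_leviForm (f : ℂ² → ℝ) : IsLineElement (leviForm f) := by
  intro x k v
  have e : ∀ w : ℂ², 𝒟 (fun y => 𝒟 f y (k • w)) x (k • w) = k ^ 2 * 𝒟 (fun y => 𝒟 f y w) x w := by
    intro w
    have : (fun y => 𝒟 f y (k • w)) = k • fun y => 𝒟 f y w := by ext y; simp
    rw [this, fderiv_const_smul_field]
    simp only [FunLike.coe_smul, Pi.smul_apply, map_smul, smul_eq_mul]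
    ring
  rw [leviForm, leviForm, smul_comm, e, e]
  ring

/-- The second derivative, of which the Levi form is the Hermitian part. -/
noncomputable def hessian (f : ℂ² → ℝ) (x : ℂ²) : ℂ² →L[ℝ] ℂ² →L[ℝ] ℝ := 𝒟 (𝒟 f) x

theorem leviForm_eq_hessian {f : ℂ² → ℝ} {x : ℂ²} (hf : ContDiffAt ℝ 2 f x) (v : ℂ²) :
    leviForm f x v = (hessian f x v v + hessian f x (I • v) (I • v)) / 4 := by
  have hd : DifferentiableAt ℝ (𝒟 f) x :=
    (hf.fderiv_right (m := 1) (by norm_num)).differentiableAt one_ne_zero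
  have e : ∀ w u, 𝒟 (fun y => 𝒟 f y w) x u = hessian f x u w := by
    intro w u
    rw [fderiv_clm_apply hd (differentiableAt_const w)]
    simp [hessian]
  rw [leviForm, e, e]

theorem continuousAt_hessian {f : ℂ² → ℝ} {x : ℂ²} (hf : ContDiffAt ℝ 2 f x) :
    ContinuousAt (hessian f) x :=
  ((hf.fderiv_right (m := 1) (by norm_num)).fderiv_right (m := 0) (by norm_num)).continuousAt

theorem abs_hessian_sub_le (A B : ℂ² →L[ℝ] ℂ² →L[ℝ] ℝ) (v : ℂ²) :
    |A v v - B v v| ≤ ‖A - B‖ * ‖v‖ ^ 2 := by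
  have h := (A - B).le_opNorm₂ v v
  simpa [sq, mul_assoc] using h

/-- A Hermitian form on `ℂ²` that is positive definite, with a quantitative lower bound, is a sum
of two squares. -/
theorem exists_diagonalization {D : ℂ² →L[ℝ] ℂ² →L[ℝ] ℝ} {q : ℂ² → ℝ} {k : ℝ} (hk : 0 < k)
    (hq : ∀ v, q v = (D v v + D (I • v) (I • v)) / 4)
    (hlow : ∀ v, k * ‖v‖ ^ 2 ≤ q v) : ∃ (c : ℂ) (A B : ℝ), k ≤ A ∧ k ≤ B ∧ k * ‖c‖ ^ 2 ≤ q (1, 0) ∧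
      ∀ v : ℂ², q v = A * ‖v.1‖ ^ 2 + B * ‖v.2 - c * v.1‖ ^ 2 := by
  set e₁ : ℂ² := (1, 0)
  set e2 : ℂ² := (0, 1)
  set i1 : ℂ² := (I, 0)
  set i2 : ℂ² := (0, I)
  have hv : ∀ v : ℂ², v = v.1.re • e₁ + v.1.im • i1 + v.2.re • e2 + v.2.im • i2 := by
    intro v
    ext <;> simp [e₁, e2, i1, i2]
  have hIv : ∀ v : ℂ², I • v = v.1.re • i1 - v.1.im • e₁ + v.2.re • i2 - v.2.im • e2 := by
    intro v
    ext <;> apply Complex.ext <;> simp [e₁, e2, i1, i2]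
  set α := (D e₁ e2 + D e2 e₁ + D i1 i2 + D i2 i1) / 4 with hα
  set β := (D i1 e2 + D e2 i1 - D e₁ i2 - D i2 e₁) / 4 with hβ
  have hP : q e₁ = (D e₁ e₁ + D i1 i1) / 4 := by rw [hq]; congr 2; simp [e₁, i1]
  have hQ : q e2 = (D e2 e2 + D i2 i2) / 4 := by rw [hq]; congr 2; simp [e2, i2]
  have hform : ∀ v : ℂ², q v = q e₁ * ‖v.1‖ ^ 2 + q e2 * ‖v.2‖ ^ 2
      + α * (v.1.re * v.2.re + v.1.im * v.2.im) + β * (v.1.im * v.2.re - v.1.re * v.2.im) := by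
    intro v
    rw [hq v, hIv, hP, hQ]
    nth_rewrite 1 2 [hv v]
    simp only [map_add, map_sub, map_smul, add_apply, sub_apply, smul_apply, smul_eq_mul,
      sq_norm, normSq_apply]
    rw [hα, hβ]
    ring
  have hB : k ≤ q e2 := by have := hlow e2; simpa [e2] using this
  have hB0 : 0 < q e2 := hk.trans_le hB
  -- completing the square in the second variable
  set c : ℂ := ⟨-α / (2 * q e2), β / (2 * q e2)⟩ with hc
  have hdiag : ∀ v : ℂ², q v = (q e₁ - q e2 * ‖c‖ ^ 2) * ‖v.1‖ ^ 2
      + q e2 * ‖v.2 - c * v.1‖ ^ 2 := by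
    intro v
    rw [hform v]
    simp only [sq_norm, normSq_apply, sub_re, sub_im, mul_re, mul_im, hc]
    field_simp
    ring
  have hA : k ≤ q e₁ - q e2 * ‖c‖ ^ 2 := by
    have h1 := hdiag (1, c)
    have h2 := hlow (1, c)
    rw [h1] at h2
    have h3 : (1 : ℝ) ≤ ‖((1 : ℂ), c)‖ := by rw [Prod.norm_def]; simp
    have h4 : k * 1 ≤ k * ‖((1 : ℂ), c)‖ ^ 2 := by gcongr; exact one_le_pow₀ h3
    simp only [norm_one, one_pow, mul_one, sub_self, norm_zero] at h2 h4
    linarith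
  exact ⟨c, _, _, hA, hB, by nlinarith [sq_nonneg ‖c‖], hdiag⟩

theorem isOpen_linesCompl (a₂ a₃ : ℂ) : IsOpen (linesCompl a₂ a₃) :=
  (isOpen_ne_fun continuous_fst continuous_const).inter
    ((isOpen_ne_fun continuous_snd (by fun_prop)).inter
      (isOpen_ne_fun continuous_snd (by fun_prop)))

theorem continuous_rho {β₁ γ : ℝ} (hβ : 0 ≤ β₁) (hγ : 0 ≤ γ) : Continuous (rho β₁ γ) := by
  have h1 : Continuous fun x : ℂ² => ‖x.1‖ ^ β₁ := continuous_fst.norm.rpow_const fun _ => Or.inr hβ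
  have h2 : Continuous fun x : ℂ² => ‖x.2‖ ^ γ := continuous_snd.norm.rpow_const fun _ => Or.inr hγ
  exact ((h1.pow 2).add (h2.pow 2)).sqrt

theorem fst_rpow_le_rho (β₁ γ : ℝ) (x : ℂ²) : ‖x.1‖ ^ β₁ ≤ rho β₁ γ x :=
  le_sqrt_of_sq_le (by nlinarith [sq_nonneg (‖x.2‖ ^ γ)])

theorem snd_rpow_le_rho (β₁ γ : ℝ) (x : ℂ²) : ‖x.2‖ ^ γ ≤ rho β₁ γ x :=
  le_sqrt_of_sq_le (by nlinarith [sq_nonneg (‖x.1‖ ^ β₁)])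

theorem norm_le_one_of_rpow_le {β : ℝ} (hβ : 0 < β) {z : ℂ} (h : ‖z‖ ^ β ≤ 1) : ‖z‖ ≤ 1 := by
  by_contra hz
  exact absurd (Real.one_lt_rpow (not_le.1 hz) hβ) (not_lt.2 h)

theorem one_le_rpow_two_mul_sub {β x : ℝ} (hβ : β ≤ 1) (h0 : 0 < x) (h1 : x ≤ 1) :
    1 ≤ x ^ (2 * β - 2) :=
  Real.one_le_rpow_of_pos_of_le_one_of_nonpos h0 h1 (by linarith)

namespace GluingData

theorem γ_lt_one (H : 𝓖) : γ < 1 := by linarith [H.angle, H.lt₂, H.lt₃]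

theorem contDiffAt_approxPotential (H : 𝓖) {x : ℂ²}
    (hx : x ∈ 𝓡) : ContDiffAt ℝ 2 (approxPotential β₁ β₂ β₃ γ α₀ a₂ a₃ χ) x := by
  have k2 := mt (div_eq_iff hx.1).1 hx.2.1
  have k3 := mt (div_eq_iff hx.1).1 hx.2.2
  obtain ⟨q1, -⟩ := H.flatPotential_regular k2 k3
  have hu : ContDiffAt ℝ 2 (fun y : ℂ² => y.2 / y.1) x := (contDiffAt_quot hx.1).restrict_scalars ℝ
  have hφ : ContDiffAt ℝ 2 (fun y : ℂ² => φ (y.2 / y.1)) x := ContDiffAt.comp (g := φ) x q1 hu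
  have hz : ∀ m : ℝ, ContDiffAt ℝ 2 (fun y : ℂ² => ‖y.1‖ ^ m) x := fun m =>
    (hasLevi_fst_rpow hx.1 m).contDiffAt
  rcases eq_or_ne x.2 0 with h0 | h0
  · have hs : cutoffArg β₁ γ α₀ x < 1 := by
      rw [cutoffArg, h0, norm_zero, zero_rpow H.pos.ne', zero_mul]; exact one_pos
    exact ((hz _).add ((hz _).mul hφ)).congr_of_eventuallyEq (H.potential_eq_of_lt hx.1 hs)
  · have hw : ∀ m : ℝ, ContDiffAt ℝ 2 (fun y : ℂ² => ‖y.2‖ ^ m) x := fun m =>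
      (hasLevi_snd_rpow h0 m).contDiffAt
    have hs : ContDiffAt ℝ 2 (cutoffArg β₁ γ α₀) x := by
      have e : cutoffArg β₁ γ α₀ = fun y : ℂ² => ‖y.2‖ ^ γ * ‖y.1‖ ^ (-(β₁ * α₀)) :=
        funext cutoffArg_eq
      rw [e]; exact (hw _).mul (hz _)
    have hχ : ContDiffAt ℝ 2 (fun y => χ (cutoffArg β₁ γ α₀ y)) x := H.smooth.contDiffAt.comp x hs
    exact ((hz _).add (hχ.mul (hw _))).add ((contDiffAt_const.sub hχ).mul ((hz _).mul hφ))

/-- Near the origin, the metric dominates a multiple of the Euclidean metric. -/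
theorem exists_mul_sq_norm_le (H : 𝓖) : ∃ τ k : ℝ, 0 < τ ∧ 0 < k ∧
    ∀ x ∈ 𝓡, ‖x.1‖ ^ β₁ < τ → ‖x.2‖ ^ γ ≤ 1 → ∀ v, k * ‖v‖ ^ 2 ≤ ω x v := by
  have hγ := H.pos
  have hγ1 := H.γ_lt_one
  have hβ1 := H.pos₁
  have hβγ := H.lt_γ
  have hβ2 := H.lt₂
  obtain ⟨M, τ1, hM, hτ1, h1⟩ := H.exists_cone_close (δ := 1 / 2) (by norm_num)
  obtain ⟨τ2, hτ2, h2⟩ := H.exists_fibre_close M (δ := 1 / 2) (by norm_num)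
  obtain ⟨g0, hg0, h3⟩ := H.toIsCentredPair.exists_le_flatDensity M
  set L := (1 + 2 * M ^ 2) / β₁ ^ 2 + 2 / (γ ^ 2 * g0)
  have hL : 0 < L := by positivity
  refine ⟨min 1 (min τ1 τ2), min (β₁ ^ 2) L⁻¹ / 2, by positivity, by positivity,
    fun x hx hr hR v => ?_⟩
  simp only [lt_min_iff] at hr
  have hz0 : 0 < ‖x.1‖ := norm_pos_iff.2 hx.1
  have hz1 := one_le_rpow_two_mul_sub (hβγ.trans hγ1).le hz0 (norm_le_one_of_rpow_le hβ1 hr.1.le)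
  have hn : ‖v‖ ^ 2 ≤ ‖v.1‖ ^ 2 + ‖v.2‖ ^ 2 := by
    rw [Prod.norm_def]
    rcases max_choice ‖v.1‖ ‖v.2‖ with h | h <;> rw [h] <;> nlinarith [sq_nonneg ‖v.1‖, sq_nonneg ‖v.2‖]
  rcases le_total M ‖x.2 / x.1‖ with hu | hu
  · have hx2 : x.2 ≠ 0 := fun h => by rw [h, zero_div, norm_zero] at hu; linarith
    have hw1 := one_le_rpow_two_mul_sub hγ1.le (norm_pos_iff.2 hx2) (norm_le_one_of_rpow_le hγ hR)
    have hc := (abs_le.1 (h1 x hx.1 hr.2.1 hu v)).1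
    have hcone : β₁ ^ 2 * ‖v‖ ^ 2 ≤ coneForm β₁ γ x v := by
      calc β₁ ^ 2 * ‖v‖ ^ 2 ≤ β₁ ^ 2 * (‖v.1‖ ^ 2 + ‖v.2‖ ^ 2) := by gcongr
        _ = β₁ ^ 2 * 1 * ‖v.1‖ ^ 2 + β₁ ^ 2 * 1 * ‖v.2‖ ^ 2 := by ring
        _ ≤ _ := by rw [coneForm]; gcongr
    have : min (β₁ ^ 2) L⁻¹ * ‖v‖ ^ 2 ≤ β₁ ^ 2 * ‖v‖ ^ 2 := by gcongr; exact min_le_left _ _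
    linarith
  · have k2 := mt (div_eq_iff hx.1).1 hx.2.1
    have k3 := mt (div_eq_iff hx.1).1 hx.2.2
    have hdens := h3 _ hu k2 k3
    have hc := (abs_le.1 (h2 x hx hr.2.2 hu v)).1
    set u := x.2 / x.1
    set G := fibreForm γ dens (fibreCoeff β₁ γ 0 x.1) x v with hG
    set e := ‖v.2 - u * v.1‖
    have hG1 : β₁ ^ 2 * ‖v.1‖ ^ 2 + γ ^ 2 * g0 * e ^ 2 ≤ G := by
      have h5 : ‖x.1‖ ^ (2 * γ) * ‖(v.2 - u * v.1) / x.1‖ ^ 2 = ‖x.1‖ ^ (2 * γ - 2) * e ^ 2 :=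
        (rpow_sub_two_mul hx.1 _ _).symm
      have hz2 := one_le_rpow_two_mul_sub hγ1.le hz0 (norm_le_one_of_rpow_le hβ1 hr.1.le)
      have h6 : G = β₁ ^ 2 * ‖x.1‖ ^ (2 * β₁ - 2) * ‖v.1‖ ^ 2
          + γ ^ 2 * dens u * (‖x.1‖ ^ (2 * γ - 2) * e ^ 2) := by
        rw [hG, fibreForm, fibreCoeff, baseCoeff, ← h5]; ring
      rw [h6]
      calc _ = β₁ ^ 2 * 1 * ‖v.1‖ ^ 2 + γ ^ 2 * g0 * (1 * e ^ 2) := by ring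
        _ ≤ _ := by
          have : 0 ≤ dens u := hg0.le.trans hdens
          gcongr
    have hv2 : ‖v.2‖ ^ 2 ≤ 2 * e ^ 2 + 2 * M ^ 2 * ‖v.1‖ ^ 2 := by
      have h7 : ‖v.2‖ ≤ e + M * ‖v.1‖ := by
        calc ‖v.2‖ = ‖(v.2 - u * v.1) + u * v.1‖ := by rw [sub_add_cancel]
          _ ≤ e + ‖u * v.1‖ := norm_add_le _ _
          _ ≤ _ := by rw [norm_mul]; gcongr
      have h8 : ‖v.2‖ ^ 2 ≤ (e + M * ‖v.1‖) ^ 2 := by gcongr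
      nlinarith [sq_nonneg (e - M * ‖v.1‖)]
    have hLG : ‖v‖ ^ 2 ≤ L * G := by
      have h9 : (1 + 2 * M ^ 2) / β₁ ^ 2 * (β₁ ^ 2 * ‖v.1‖ ^ 2) = (1 + 2 * M ^ 2) * ‖v.1‖ ^ 2 := by
        field_simp
      have h10 : 2 / (γ ^ 2 * g0) * (γ ^ 2 * g0 * e ^ 2) = 2 * e ^ 2 := by field_simp
      have p1 : 0 ≤ (1 + 2 * M ^ 2) / β₁ ^ 2 * (γ ^ 2 * g0 * e ^ 2) := by positivity
      have p2 : 0 ≤ 2 / (γ ^ 2 * g0) * (β₁ ^ 2 * ‖v.1‖ ^ 2) := by positivity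
      refine le_trans ?_ (mul_le_mul_of_nonneg_left hG1 hL.le)
      rw [add_mul, mul_add, mul_add, h9, h10]
      linarith
    have : min (β₁ ^ 2) L⁻¹ * ‖v‖ ^ 2 ≤ G := by
      calc min (β₁ ^ 2) L⁻¹ * ‖v‖ ^ 2 ≤ L⁻¹ * (L * G) := by gcongr; exact min_le_right _ _
        _ = G := by field_simp
    linarith

/-- Points in a sector `|w| ≤ M |z|` with the same first coordinate are at distance at most a
multiple of `|z|^γ`. -/
theorem exists_vertical_le (H : 𝓖) (M : ℝ) : ∃ C τ : ℝ, 0 < C ∧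
    0 < τ ∧ ∀ (U : Set ℂ²) (z u u' : ℂ), z ≠ 0 → ‖z‖ ^ β₁ < τ → ‖u‖ ≤ M → ‖u'‖ ≤ M →
      u' ≠ a₂ → u' ≠ a₃ → (∀ u, ‖u‖ ≤ M → (z, z * u) ∈ U) →
      lengthDist U (U ∩ 𝓡) ω (z, z * u) (z, z * u') ≤ ofReal (C * ‖z‖ ^ γ) := by
  have hγ := H.pos
  have hγ1 := H.γ_lt_one
  have hβ2 := H.pos₂
  have hβ3 := H.pos₃
  obtain ⟨τ, hτ, h1⟩ := H.exists_fibre_close M (δ := 1) one_pos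
  obtain ⟨A, hA, h2⟩ := H.toIsCentredPair.flatDensity_le
  set k := √(2 * A)
  set C := k * (3 / β₂ * (2 * |M|) ^ β₂) + k * (3 / β₃ * (2 * |M|) ^ β₃)
  refine ⟨C + 1, τ, by positivity, hτ, fun U z u u' hz hr hu hu' n2 n3 hU => ?_⟩
  have hγz : 0 ≤ ‖z‖ ^ γ := by positivity
  set c : ℝ → ℂ² := fun t => (z + t * ((0 : ℂ), z * (u' - u)).1,
    z * u + t * ((0 : ℂ), z * (u' - u)).2) with hc
  have hcc := contDiff_segment (z, z * u) (0, z * (u' - u))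
  have hct : ∀ t : ℝ, c t = (z, z * (u + t * (u' - u))) := by
    intro t; simp only [hc]; ext <;> simp; ring
  have hseg : ∀ t ∈ 𝕀, ‖u + t * (u' - u)‖ ≤ M := by
    intro t ht
    have e : u + t * (u' - u) = ((1 - t : ℝ) : ℂ) * u + (t : ℂ) * u' := by push_cast; ring
    rw [e]
    refine (norm_add_le _ _).trans ?_
    rw [norm_mul, norm_mul, norm_real, norm_real,
      norm_of_nonneg (by linarith [ht.2]), norm_of_nonneg ht.1]
    nlinarith [ht.1, ht.2]
  have hd : ∀ t : ℝ, deriv c t = (0, z * (u' - u)) := fun t =>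
    (hasDerivAt_segment (z, z * u) (0, z * (u' - u)) t).deriv
  set T := {t : ℝ | (u - a₂) + t * ((u' - a₂) - (u - a₂)) = 0} ∪
    {t : ℝ | (u - a₃) + t * ((u' - a₃) - (u - a₃)) = 0} with hT
  have hTf : T.Finite := (finite_zeros_of_segment (Or.inr (sub_ne_zero.2 n2))).union
    (finite_zeros_of_segment (Or.inr (sub_ne_zero.2 n3)))
  have hreg : ∀ t ∈ 𝕀 \ T, c t ∈ 𝓡 := by
    intro t ht
    have h3 := ht.2
    simp only [hT, mem_union, mem_ofPred_eq, not_or] at h3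
    rw [hct]
    refine ⟨hz, fun h => h3.1 ?_, fun h => h3.2 ?_⟩ <;>
    · have := mul_left_cancel₀ hz (h.trans (mul_comm _ _))
      linear_combination this
  have hp : IsPathOn U (U ∩ 𝓡) c 0 1 := by
    refine ⟨hcc.continuous.continuousOn, fun t ht => ?_, T, hTf, fun t ht => ⟨⟨?_,
      hreg t ⟨Ioo_subset_Icc_self ht.1, ht.2⟩⟩, hcc.contDiffAt⟩⟩
    · rw [hct]; exact hU _ (hseg t ht)
    · rw [hct]; exact hU _ (hseg t (Ioo_subset_Icc_self ht.1))
  have h4 := hp.lengthDist_le (isLineElement_leviForm _) one_pos (h := ω)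
  have e0 : c 0 = (z, z * u) := by rw [hct]; simp
  have e1 : c 1 = (z, z * u') := by rw [hct]; simp
  rw [e0, e1] at h4
  refine h4.trans ?_
  have hsp : ∀ t ∈ 𝕀 \ T, speed ω c t ≤ ofReal (k * ‖z‖ ^ γ) *
      (ofReal (‖(u - a₂) + t * (u' - u)‖ ^ (β₂ - 1) * ‖u' - u‖)
        + ofReal (‖(u - a₃) + t * (u' - u)‖ ^ (β₃ - 1) * ‖u' - u‖)) := by
    intro t ht
    have h5 := hreg t ht
    rw [hct] at h5
    have h6 := (abs_le.1 (h1 _ h5 hr (by simp only [mul_div_cancel_left₀ _ hz]; exact hseg t ht.1)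
      (0, z * (u' - u)))).2
    rw [speed, hd, hct, ofReal_add_ofReal, ofReal_mul_ofReal]
    apply ofReal_le_ofReal
    rw [sqrt_le_left (by positivity)]
    set y := u + t * (u' - u)
    have q2 : (u - a₂) + t * (u' - u) = y - a₂ := by simp only [y]; ring
    have q3 : (u - a₃) + t * (u' - u) = y - a₃ := by simp only [y]; ring
    have n2' : y ≠ a₂ := fun h => h5.2.1 (by simp only [h, mul_comm])
    have n3' : y ≠ a₃ := fun h => h5.2.2 (by simp only [h, mul_comm])
    rw [q2, q3]
    have h7 := h2 y n2' n3'
    have h8 : fibreForm γ dens (fibreCoeff β₁ γ 0 z) (z, z * y) (0, z * (u' - u))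
        = γ ^ 2 * (‖z‖ ^ γ) ^ 2 * dens y * ‖u' - u‖ ^ 2 := by
      simp only [fibreForm, mul_div_cancel_left₀ _ hz, norm_zero, mul_zero, sub_zero]
      rw [mul_comm 2 γ, rpow_mul (norm_nonneg _), rpow_two]; ring
    simp only [h8] at h6
    rw [neg_sub, neg_sub, norm_rpow_two_mul_sub_two, norm_rpow_two_mul_sub_two] at h7
    set p := ‖y - a₂‖ ^ (β₂ - 1)
    set r := ‖y - a₃‖ ^ (β₃ - 1)
    have hp0 : 0 ≤ p := by positivity
    have hr0 : 0 ≤ r := by positivity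
    have hk : k ^ 2 = 2 * A := sq_sqrt (by positivity)
    calc ω (z, z * y) (0, z * (u' - u))
        ≤ 2 * (γ ^ 2 * (‖z‖ ^ γ) ^ 2 * dens y * ‖u' - u‖ ^ 2) := by linarith
      _ ≤ 2 * (1 * (‖z‖ ^ γ) ^ 2 * (A * (p ^ 2 + r ^ 2)) * ‖u' - u‖ ^ 2) := by
        have : 0 ≤ dens y := flatDensity_nonneg
        gcongr; exact pow_le_one₀ hγ.le hγ1.le
      _ = 2 * A * (‖z‖ ^ γ) ^ 2 * (p ^ 2 + r ^ 2) * ‖u' - u‖ ^ 2 := by ring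
      _ ≤ 2 * A * (‖z‖ ^ γ) ^ 2 * (p + r) ^ 2 * ‖u' - u‖ ^ 2 := by
        gcongr; nlinarith [mul_nonneg hp0 hr0]
      _ = _ := by rw [← hk]; ring
  have huu : ‖u' - u‖ ≤ 2 * |M| := by
    have := norm_sub_le u' u; linarith [le_abs_self M]
  calc arcLength ω c 0 1 ≤ ∫⁻ t in 𝕀, ofReal (k * ‖z‖ ^ γ) *
      (ofReal (‖(u - a₂) + t * (u' - u)‖ ^ (β₂ - 1) * ‖u' - u‖)
        + ofReal (‖(u - a₃) + t * (u' - u)‖ ^ (β₃ - 1) * ‖u' - u‖)) := by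
        apply lintegral_mono_ae
        filter_upwards [ae_restrict_mem measurableSet_Icc,
          ae_restrict_of_ae (hTf.countable.ae_notMem volume)] with t h5 h6
        exact hsp t ⟨h5, h6⟩
    _ ≤ ofReal (k * ‖z‖ ^ γ) * (ofReal (3 / β₂ * ‖u' - u‖ ^ β₂)
        + ofReal (3 / β₃ * ‖u' - u‖ ^ β₃)) := by
        rw [lintegral_const_mul' _ _ ofReal_ne_top, lintegral_add_left (by fun_prop)]
        gcongr
        · exact lintegral_segment_le hβ2 H.lt₂.le _ _
        · exact lintegral_segment_le hβ3 H.lt₃.le _ _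
    _ = ofReal (k * ‖z‖ ^ γ * (3 / β₂ * ‖u' - u‖ ^ β₂ + 3 / β₃ * ‖u' - u‖ ^ β₃)) := by
        rw [ofReal_add_ofReal, ofReal_mul_ofReal]
    _ ≤ _ := by
        apply ofReal_le_ofReal
        calc k * ‖z‖ ^ γ * (3 / β₂ * ‖u' - u‖ ^ β₂ + 3 / β₃ * ‖u' - u‖ ^ β₃)
            ≤ k * ‖z‖ ^ γ * (3 / β₂ * (2 * |M|) ^ β₂ + 3 / β₃ * (2 * |M|) ^ β₃) := by gcongr
          _ = C * ‖z‖ ^ γ := by ring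
          _ ≤ (C + 1) * ‖z‖ ^ γ := by gcongr; linarith

end GluingData

/-! ### Blow-ups modelled on products of cones -/

theorem exists_norm_rpow_close (e : ℝ) {δ : ℝ} (hδ : 0 < δ) : ∃ η : ℝ, 0 < η ∧ η ≤ 1 / 2 ∧
    ∀ z z0 : ℂ, z0 ≠ 0 → ‖z - z0‖ ≤ η * ‖z0‖ → |‖z‖ ^ e - ‖z0‖ ^ e| ≤ δ * ‖z0‖ ^ e := by
  have hc : ContinuousAt (fun x : ℝ => x ^ e) 1 :=
    Real.continuousAt_rpow_const _ _ (Or.inl one_ne_zero)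
  obtain ⟨η, hη, h⟩ := continuousAt_iff.1 hc δ hδ
  refine ⟨min (1 / 2) (η / 2), by positivity, min_le_left _ _, fun z z0 h0 hz => ?_⟩
  have hn : 0 < ‖z0‖ := norm_pos_iff.2 h0
  have h1 : |‖z‖ - ‖z0‖| ≤ η / 2 * ‖z0‖ :=
    (abs_norm_sub_norm_le z z0).trans (hz.trans (by gcongr; exact min_le_right _ _))
  have h2 : dist (‖z‖ / ‖z0‖) 1 < η := by
    rw [dist_eq, div_sub_one hn.ne', abs_div, abs_of_pos hn, div_lt_iff₀ hn]
    nlinarith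
  have h3 := (h h2).le
  rw [dist_eq, Real.one_rpow, div_rpow (norm_nonneg _) hn.le,
    div_sub_one (by positivity), abs_div, abs_of_pos (by positivity : 0 < ‖z0‖ ^ e),
    div_le_iff₀ (by positivity)] at h3
  exact h3

/-- The map `X ↦ z0 + κ X` is nearly a homothety of ratio `h` from a ball about the apex of `C_b`
to `C_β`: either `z0` is the apex and `b = β`, or `z0` is a regular point and `b = 1`. -/
structure IsScaling (β b h δ : ℝ) (z0 : ℂ) (κ : ℝ) : Prop where
  pos : 0 < κ
  ne_zero_iff : ∀ X : ℂ, ‖X‖ ^ b < 8 → (z0 + κ * X ≠ 0 ↔ (b ≠ 1 → X ≠ 0))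
  lower : ∀ X : ℂ, ‖X‖ ^ b < 8 →
    (1 - δ) * (h * (b * ‖X‖ ^ (b - 1))) ^ 2 ≤ (β * ‖z0 + κ * X‖ ^ (β - 1) * κ) ^ 2
  upper : ∀ X : ℂ, ‖X‖ ^ b < 8 →
    (β * ‖z0 + κ * X‖ ^ (β - 1) * κ) ^ 2 ≤ (1 + δ) * (h * (b * ‖X‖ ^ (b - 1))) ^ 2

theorem norm_ofReal_mul {κ : ℝ} (hκ : 0 ≤ κ) (X : ℂ) : ‖(κ : ℂ) * X‖ = κ * ‖X‖ := by
  rw [norm_mul, norm_real, norm_of_nonneg hκ]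

theorem norm_rpow_inv_mul {β h : ℝ} (hβ : β ≠ 0) (hh : 0 ≤ h) (X : ℂ) :
    ‖((h ^ (1 / β) : ℝ) : ℂ) * X‖ ^ β = h * ‖X‖ ^ β := by
  rw [norm_ofReal_mul (by positivity),
    mul_rpow (by positivity) (norm_nonneg _), ← rpow_mul hh, one_div_mul_cancel hβ,
    rpow_one]

theorem isScaling_apex {β h δ : ℝ} (hβ : 0 < β) (hβ1 : β < 1) (hh : 0 < h) (hδ : 0 ≤ δ) :
    IsScaling β β h δ 0 (h ^ (1 / β)) := by
  have key : ∀ X : ℂ, β * ‖0 + ((h ^ (1 / β) : ℝ) : ℂ) * X‖ ^ (β - 1) * h ^ (1 / β)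
      = h * (β * ‖X‖ ^ (β - 1)) := by
    intro X
    rw [zero_add, norm_ofReal_mul (by positivity),
      mul_rpow (by positivity) (norm_nonneg _)]
    have e : (h ^ (1 / β)) ^ (β - 1) * h ^ (1 / β) = h := by
      rw [← rpow_add_one (by positivity), sub_add_cancel, ← rpow_mul hh.le,
        one_div_mul_cancel hβ.ne', rpow_one]
    linear_combination (β * ‖X‖ ^ (β - 1)) * e
  have hk : (0 : ℝ) < h ^ (1 / β) := by positivity
  refine ⟨hk, fun X _ => ?_, fun X _ => ?_, fun X _ => ?_⟩
  · rw [zero_add, mul_ne_zero_iff, and_iff_right (ofReal_ne_zero.2 hk.ne')]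
    exact ⟨fun h _ => h, fun h => h hβ1.ne⟩
  · rw [key]; nlinarith [sq_nonneg (h * (β * ‖X‖ ^ (β - 1)))]
  · rw [key]; nlinarith [sq_nonneg (h * (β * ‖X‖ ^ (β - 1)))]

theorem exists_isScaling_regular {β : ℝ} (hβ : 0 < β) {δ η : ℝ} (hδ : 0 < δ) (hη : 0 < η) :
    ∃ ζ : ℝ, 0 < ζ ∧ ∀ (h : ℝ) (z0 : ℂ), z0 ≠ 0 → 0 < h → h ≤ ζ * ‖z0‖ ^ β →
      IsScaling β 1 h δ z0 (h / (β * ‖z0‖ ^ (β - 1))) ∧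
      ∀ X : ℂ, ‖X‖ ^ (1 : ℝ) < 8 → ‖((h / (β * ‖z0‖ ^ (β - 1)) : ℝ) : ℂ) * X‖ ≤ η * ‖z0‖ := by
  obtain ⟨η', hη', hη1, hr⟩ := exists_norm_rpow_close (2 * β - 2) hδ
  refine ⟨β / 8 * min η η', by positivity, fun h z0 h0 hh hle => ?_⟩
  have hn : 0 < ‖z0‖ := norm_pos_iff.2 h0
  have hq : 0 < ‖z0‖ ^ (β - 1) := by positivity
  set κ := h / (β * ‖z0‖ ^ (β - 1)) with hκ
  have hκ0 : 0 < κ := by positivity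
  have hκ8 : κ * 8 ≤ min η η' * ‖z0‖ := by
    have e : ‖z0‖ ^ β = ‖z0‖ ^ (β - 1) * ‖z0‖ := by rw [← rpow_add_one hn.ne', sub_add_cancel]
    rw [e] at hle
    rw [hκ, div_mul_eq_mul_div, div_le_iff₀ (by positivity)]
    linarith
  have hX : ∀ X : ℂ, ‖X‖ ^ (1 : ℝ) < 8 → ‖(κ : ℂ) * X‖ ≤ min η η' * ‖z0‖ := by
    intro X hX
    rw [rpow_one] at hX
    rw [norm_ofReal_mul hκ0.le]
    exact (by gcongr : κ * ‖X‖ ≤ κ * 8).trans hκ8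
  have key : ∀ X : ℂ, ‖X‖ ^ (1 : ℝ) < 8 →
      |(β * ‖z0 + κ * X‖ ^ (β - 1) * κ) ^ 2 - h ^ 2| ≤ δ * h ^ 2 := by
    intro X hX'
    have h1 := hr (z0 + κ * X) z0 h0 (by
      rw [add_sub_cancel_left]; exact (hX X hX').trans (by gcongr; exact min_le_right _ _))
    rw [norm_rpow_two_mul_sub_two, norm_rpow_two_mul_sub_two] at h1
    have e2 : h = β * κ * ‖z0‖ ^ (β - 1) := by rw [hκ]; field_simp
    have e3 : (β * ‖z0 + κ * X‖ ^ (β - 1) * κ) ^ 2 - h ^ 2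
        = (β * κ) ^ 2 * ((‖z0 + κ * X‖ ^ (β - 1)) ^ 2 - (‖z0‖ ^ (β - 1)) ^ 2) := by
      rw [e2]; ring
    rw [e3, abs_mul, abs_of_nonneg (sq_nonneg _)]
    calc _ ≤ (β * κ) ^ 2 * (δ * (‖z0‖ ^ (β - 1)) ^ 2) := by gcongr
      _ = _ := by rw [e2]; ring
  refine ⟨⟨hκ0, fun X hX' => ?_, fun X hX' => ?_, fun X hX' => ?_⟩, fun X hX' =>
    (hX X hX').trans (by gcongr; exact min_le_left _ _)⟩
  · refine ⟨fun _ h => absurd rfl h, fun _ h => ?_⟩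
    have h2 : ‖z0‖ ≤ η' * ‖z0‖ := by
      calc ‖z0‖ = ‖(κ : ℂ) * X‖ := by rw [eq_neg_of_add_eq_zero_left h, norm_neg]
        _ ≤ min η η' * ‖z0‖ := hX X hX'
        _ ≤ _ := by gcongr; exact min_le_right _ _
    nlinarith
  · rw [sub_self, rpow_zero, mul_one, mul_one]; linarith [(abs_le.1 (key X hX')).1]
  · rw [sub_self, rpow_zero, mul_one, mul_one]; linarith [(abs_le.1 (key X hX')).2]

/-- The complex affine map `(X1, X2) ↦ (z0 + κ1 X1, w0 + c κ1 X1 + κ2 X2)`. -/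
noncomputable def affineChart (z0 w0 c : ℂ) (κ1 κ2 : ℝ) (X : ℂ²) : ℂ² :=
  (z0 + κ1 * X.1, w0 + c * (κ1 * X.1) + κ2 * X.2)

/-- The inverse of `affineChart`. -/
noncomputable def affineChartInv (z0 w0 c : ℂ) (κ1 κ2 : ℝ) (x : ℂ²) : ℂ² :=
  ((x.1 - z0) / κ1, (x.2 - w0 - c * (x.1 - z0)) / κ2)

section affineChart
variable {z0 w0 c : ℂ} {κ1 κ2 : ℝ}

theorem contDiff_affineChart : ContDiff ℝ 1 (affineChart z0 w0 c κ1 κ2) := by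
  unfold affineChart; fun_prop

theorem contDiff_affineChartInv : ContDiff ℝ 1 (affineChartInv z0 w0 c κ1 κ2) := by
  unfold affineChartInv; fun_prop

theorem fderiv_affineChart (X Y : ℂ²) :
    𝒟 (affineChart z0 w0 c κ1 κ2) X Y = (κ1 * Y.1, c * (κ1 * Y.1) + κ2 * Y.2) := by
  have h1 : HasFDerivAt (fun X : ℂ² => X.1) (ContinuousLinearMap.fst ℝ ℂ ℂ) X := hasFDerivAt_fst
  have h2 : HasFDerivAt (fun X : ℂ² => X.2) (ContinuousLinearMap.snd ℝ ℂ ℂ) X := hasFDerivAt_snd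
  have h : HasFDerivAt (affineChart z0 w0 c κ1 κ2) _ X := ((h1.const_mul (κ1 : ℂ)).const_add z0).prodMk
    ((((h1.const_mul (κ1 : ℂ)).const_mul c).const_add w0).add (h2.const_mul (κ2 : ℂ)))
  rw [h.fderiv]
  simp

theorem affineChart_inv (h₁ : κ1 ≠ 0) (h₂ : κ2 ≠ 0) (x : ℂ²) :
    affineChart z0 w0 c κ1 κ2 (affineChartInv z0 w0 c κ1 κ2 x) = x := by
  have h1' : (κ1 : ℂ) ≠ 0 := ofReal_ne_zero.2 h₁
  have h2' : (κ2 : ℂ) ≠ 0 := ofReal_ne_zero.2 h₂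
  simp only [affineChart, affineChartInv, mul_div_cancel₀ _ h1', mul_div_cancel₀ _ h2']
  ext <;> simp

theorem affineChartInv_apply (h₁ : κ1 ≠ 0) (h₂ : κ2 ≠ 0) (X : ℂ²) :
    affineChartInv z0 w0 c κ1 κ2 (affineChart z0 w0 c κ1 κ2 X) = X := by
  have h1' : (κ1 : ℂ) ≠ 0 := ofReal_ne_zero.2 h₁
  have h2' : (κ2 : ℂ) ≠ 0 := ofReal_ne_zero.2 h₂
  ext
  · simp [affineChart, affineChartInv, h1']
  · simp only [affineChart, affineChartInv]
    field_simp
    ring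

end affineChart

theorem mul_mul_le_one_add {δ x y : ℝ} (hδ : 0 < δ) (hδ1 : δ ≤ 1) (hx : x ≤ (1 + δ / 4) * y)
    (hy : 0 ≤ y) : (1 + δ / 4) * x ≤ (1 + δ) * y := by
  have h1 : (1 + δ / 4) * x ≤ (1 + δ / 4) * ((1 + δ / 4) * y) := by gcongr
  have h2 : (1 + δ / 4) * (1 + δ / 4) ≤ 1 + δ := by nlinarith
  nlinarith [mul_le_mul_of_nonneg_right h2 hy]

theorem one_sub_mul_le_mul {δ x y : ℝ} (hδ : 0 < δ) (hδ1 : δ ≤ 1) (hx : (1 - δ / 4) * y ≤ x)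
    (hy : 0 ≤ y) : (1 - δ) * y ≤ (1 - δ / 4) * x := by
  have h1 : (1 - δ / 4) * ((1 - δ / 4) * y) ≤ (1 - δ / 4) * x :=
    mul_le_mul_of_nonneg_left hx (by linarith)
  have h2 : 1 - δ ≤ (1 - δ / 4) * (1 - δ / 4) := by nlinarith
  nlinarith [mul_le_mul_of_nonneg_right h2 hy]

namespace GluingData

set_option maxHeartbeats 800000 in
/-- Blow-ups at points that see the metric as the product cone `C_β₁ × C_γ`, possibly outside a
thin sector `|w| ≤ M |z|`. -/
theorem exists_ghEDist_le_of_isScaling (H : 𝓖) {δ : ℝ} (hδ : 0 < δ)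
    (hδ1 : δ ≤ 1 / 100) : ∃ M τ η : ℝ, 1 ≤ M ∧ 0 < τ ∧ 0 < η ∧
      ∀ (U : Set ℂ²) (b1 b2 h : ℝ) (z0 w0 : ℂ) (κ1 κ2 : ℝ) (X0 : ℂ²),
      (∀ x y, lengthDist U (U ∩ 𝓡) ω x y = 0 → x = y) →
      0 < b1 → b1 ≤ 1 → 0 < b2 → b2 ≤ 1 → 0 < h →
      IsScaling β₁ b1 h (δ / 4) z0 κ1 → IsScaling γ b2 h (δ / 4) w0 κ2 →
      (∀ X ∈ coneBox b1 b2, affineChart z0 w0 0 κ1 κ2 X ∈ U) →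
      (∀ y : ℂ, ‖y‖ ^ b1 < 8 → ‖z0 + κ1 * y‖ ^ β₁ < τ) →
      (b2 = γ ∧ w0 = 0 ∧ κ2 = h ^ (1 / γ) ∧ (∀ y : ℂ, ‖y‖ ^ b1 < 8 → ‖z0 + κ1 * y‖ ^ γ ≤ η * h) ∨
        ∀ X ∈ coneBox b1 b2, M * ‖z0 + κ1 * X.1‖ < ‖w0 + κ2 * X.2‖) →
      ‖X0.1‖ ^ b1 ≤ δ → ‖X0.2‖ ^ b2 ≤ δ →
      ghEDist (rescaledBallDist (lengthDist U (U ∩ 𝓡) ω)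
        (affineChart z0 w0 0 κ1 κ2 X0) h) (rescaledBallDist (coneDist b1 b2) 0 1)
        ≤ ofReal (40 * δ) := by
  have hγ := H.pos
  have hβ₁ := H.pos₁
  obtain ⟨M', τ1, hM', hτ1, hT2⟩ := H.exists_cone_close (δ := δ / 4) (by positivity)
  set M := M' + ‖a₂‖ + ‖a₃‖ with hMdef
  have hMM : M' ≤ M := by linarith [norm_nonneg a₂, norm_nonneg a₃]
  have hM : 1 ≤ M := hM'.trans hMM
  have hM2 : ‖a₂‖ < M := by linarith [norm_nonneg a₃]
  have hM3 : ‖a₃‖ < M := by linarith [norm_nonneg a₂]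
  obtain ⟨τ2, hτ2, hT1⟩ := H.exists_fibre_close M (δ := δ / 4) (by positivity)
  obtain ⟨C, τ3, hC, hτ3, hvert⟩ := H.exists_vertical_le M
  obtain ⟨τ4, hτ4, hsub⟩ := H.exists_isSubordinate (M ^ (2 * γ) / (2 * (δ / 4)))
  refine ⟨M, min (min τ1 τ2) (min τ3 τ4), min (δ / C) (δ / M ^ γ), hM, by positivity,
    by positivity, ?_⟩
  intro U b1 b2 h z0 w0 κ1 κ2 X0 hdef hb1 hb11 hb2 hb21 hh s1 s2 hU hr hK hX1 hX₂
  set P : Prop := b2 = γ ∧ w0 = 0 ∧ κ2 = h ^ (1 / γ) ∧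
    (∀ y : ℂ, ‖y‖ ^ b1 < 8 → ‖z0 + κ1 * y‖ ^ γ ≤ min (δ / C) (δ / M ^ γ) * h) with hP
  set Φ := affineChart z0 w0 0 κ1 κ2 with hΦ
  set K : Set ℂ² := {X | P ∧ ‖w0 + κ2 * X.2‖ ≤ M * ‖z0 + κ1 * X.1‖} with hKdef
  have hΦ1 : ∀ X, (Φ X).1 = z0 + κ1 * X.1 := fun X => rfl
  have hΦ2 : ∀ X, (Φ X).2 = w0 + κ2 * X.2 := fun X => by simp [hΦ, affineChart]
  have hD : ∀ X Y, 𝒟 Φ X Y = (κ1 * Y.1, κ2 * Y.2) := fun X Y => by rw [hΦ, fderiv_affineChart]; simp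
  have hoff : ∀ X ∈ coneBox b1 b2, X ∉ K → M * ‖z0 + κ1 * X.1‖ < ‖w0 + κ2 * X.2‖ := by
    intro X hX hXK
    rcases hK with hK | hK
    · by_contra hcon; exact hXK ⟨hK, not_lt.1 hcon⟩
    · exact hK X hX
  have hk1 : κ1 ≠ 0 := s1.pos.ne'
  have hk2 : κ2 ≠ 0 := s2.pos.ne'
  have hn1 := norm_ofReal_mul s1.pos.le
  have hn2 := norm_ofReal_mul s2.pos.le
  have hr' : ∀ y : ℂ, ‖y‖ ^ b1 < 8 → ‖z0 + κ1 * y‖ ^ β₁ < τ1 ∧ ‖z0 + κ1 * y‖ ^ β₁ < τ2 ∧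
      ‖z0 + κ1 * y‖ ^ β₁ < τ3 ∧ ‖z0 + κ1 * y‖ ^ β₁ < τ4 := fun y hy => by
    have := hr y hy; simp only [lt_min_iff] at this; exact ⟨this.1.1, this.1.2, this.2.1, this.2.2⟩
  have hquot : ∀ X : ℂ², (Φ X).1 ≠ 0 → M * ‖z0 + κ1 * X.1‖ ≤ ‖w0 + κ2 * X.2‖ →
      M ≤ ‖(Φ X).2 / (Φ X).1‖ := fun X h0 hX => by
    rw [norm_div, le_div_iff₀ (norm_pos_iff.2 h0), hΦ1, hΦ2]; exact hX
  have hcone : ∀ X Y, coneForm β₁ γ (Φ X) (𝒟 Φ X Y)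
      = (β₁ * ‖z0 + κ1 * X.1‖ ^ (β₁ - 1) * κ1) ^ 2 * ‖Y.1‖ ^ 2
        + (γ * ‖w0 + κ2 * X.2‖ ^ (γ - 1) * κ2) ^ 2 * ‖Y.2‖ ^ 2 := fun X Y => by
    rw [coneForm_eq, hD, hΦ1, hΦ2, hn1, hn2]; ring
  have hcone' : ∀ X Y, h ^ 2 * coneForm b1 b2 X Y = (h * (b1 * ‖X.1‖ ^ (b1 - 1))) ^ 2 * ‖Y.1‖ ^ 2
      + (h * (b2 * ‖X.2‖ ^ (b2 - 1))) ^ 2 * ‖Y.2‖ ^ 2 := fun X Y => by rw [coneForm_eq]; ring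
  have hfst : ∀ X Y : ℂ², h ^ 2 * (b1 * ‖X.1‖ ^ (b1 - 1) * ‖Y.1‖) ^ 2
      = (h * (b1 * ‖X.1‖ ^ (b1 - 1))) ^ 2 * ‖Y.1‖ ^ 2 := fun X Y => by ring
  have hbase : ∀ (z : ℂ) (y : ℝ), baseCoeff β₁ z * y ^ 2 = (β₁ * ‖z‖ ^ (β₁ - 1) * y) ^ 2 :=
    fun z y => by rw [baseCoeff, norm_rpow_two_mul_sub_two]; ring
  have hregz : ∀ X ∈ coneBox b1 b2, (Φ X).1 ≠ 0 ↔ (b1 ≠ 1 → X.1 ≠ 0) := fun X hX =>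
    s1.ne_zero_iff X.1 hX.1
  have hoffne : ∀ X : ℂ², M * ‖z0 + κ1 * X.1‖ < ‖w0 + κ2 * X.2‖ →
      (Φ X).2 ≠ a₂ * (Φ X).1 ∧ (Φ X).2 ≠ a₃ * (Φ X).1 := by
    intro X hX
    rw [hΦ1, hΦ2]
    constructor <;>
    · intro hcon
      rw [hcon, norm_mul] at hX
      nlinarith [norm_nonneg (z0 + κ1 * X.1)]
  -- the section is the graph of slope `M`
  set σ : ℂ → ℂ := fun y => M / κ2 * (z0 + κ1 * y) with hσ
  have hσd : ∀ z y, 𝒟 σ z y = M / κ2 * (κ1 * y) := fun z y => by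
    have h1 : HasFDerivAt σ _ z :=
      (((hasFDerivAt_id (𝕜 := ℝ) z).const_mul (κ1 : ℂ)).const_add z0).const_mul ((M : ℂ) / κ2)
    rw [h1.fderiv]; simp
  have hk2' : (κ2 : ℂ) ≠ 0 := ofReal_ne_zero.2 hk2
  have hsec : P → ∀ y : ℂ, Φ (y, σ y) = (z0 + κ1 * y, (z0 + κ1 * y) * M) := fun hp y => by
    ext
    · rfl
    · rw [hΦ2, hp.2.1]; simp only [hσ]; field_simp; ring
  have hMn : ‖(M : ℂ)‖ = M := by rw [norm_real, norm_of_nonneg (by linarith)]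
  have hthin : P → ∀ X : ℂ², ‖X.1‖ ^ b1 < 8 → ‖w0 + κ2 * X.2‖ ≤ M * ‖z0 + κ1 * X.1‖ →
      ‖X.2‖ ^ b2 ≤ δ := by
    rintro ⟨rfl, rfl, rfl, hp⟩ X hX hX2
    have h1 := norm_rpow_inv_mul hγ.ne' hh.le X.2
    rw [zero_add] at hX2
    have h2 : h * ‖X.2‖ ^ b2 ≤ h * δ := by
      rw [← h1]
      calc _ ≤ (M * ‖z0 + κ1 * X.1‖) ^ b2 := by gcongr
        _ = M ^ b2 * ‖z0 + κ1 * X.1‖ ^ b2 := mul_rpow (by linarith) (norm_nonneg _)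
        _ ≤ M ^ b2 * (δ / M ^ b2 * h) := by
          gcongr; exact (hp _ hX).trans (by gcongr; exact min_le_right _ _)
        _ = h * δ := by field_simp
    exact le_of_mul_le_mul_left h2 hh
  have hsecbox : P → ∀ y : ℂ, ‖y‖ ^ b1 < 8 → ∀ u : ℂ, ‖u‖ ≤ M →
      (z0 + κ1 * y, (z0 + κ1 * y) * u) ∈ U := by
    intro hp y hy u hu
    have h1 : Φ (y, (z0 + κ1 * y) * u / κ2) = (z0 + κ1 * y, (z0 + κ1 * y) * u) := by
      ext
      · rfl
      · rw [hΦ2, hp.2.1]; simp only []; field_simp; ring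
    rw [← h1]
    refine hU _ ⟨hy, lt_of_le_of_lt (hthin hp _ hy ?_) (by linarith)⟩
    have := congr_arg Prod.snd h1
    rw [hΦ2] at this
    simp only [] at this ⊢
    rw [this, norm_mul, mul_comm]
    gcongr
  have hσreg : P → ∀ y : ℂ, ‖y‖ ^ b1 < 8 → (b1 ≠ 1 → y ≠ 0) → Φ (y, σ y) ∈ 𝓡 := by
    intro hp y hy hy0
    have h0 : z0 + κ1 * y ≠ 0 := (s1.ne_zero_iff y hy).2 hy0
    rw [hsec hp]
    refine ⟨h0, fun hcon => ?_, fun hcon => ?_⟩ <;>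
    · have h1 := mul_left_cancel₀ h0 (hcon.trans (mul_comm _ _))
      have h2 := congr_arg norm h1
      rw [hMn] at h2
      linarith
  have C : ConeChart U (U ∩ 𝓡) ω b1 b2 h δ Φ (affineChartInv z0 w0 0 κ1 κ2) univ K σ :=
    { contDiff := contDiff_affineChart
      isOpen := isOpen_univ
      contDiffOn := contDiff_affineChartInv.contDiffOn
      right_inv := fun x _ => affineChart_inv hk1 hk2 x
      mapsTo := fun X hX => ⟨mem_univ _, hU X hX⟩
      left_inv := fun X _ => affineChartInv_apply hk1 hk2 X
      isClosed := by
        by_cases hp : P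
        · simp only [hKdef, hp, true_and]
          exact isClosed_le (by fun_prop) (by fun_prop)
        · simp [hKdef, hp]
      regular_iff := fun X hX hXK => by
        have h1 := hoff X hX hXK
        have h2 : w0 + κ2 * X.2 ≠ 0 := norm_pos_iff.1 (lt_of_le_of_lt (by positivity) h1)
        have h3 := (s2.ne_zero_iff X.2 hX.2).1 h2
        exact ⟨fun h4 => ⟨(hregz X hX).1 h4.2.1, h3⟩, fun h4 => ⟨hU X hX, (hregz X hX).2 h4.1,
          (hoffne X h1).1, (hoffne X h1).2⟩⟩
      regular_fst := fun X hX hS => (hregz X hX).1 hS.2.1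
      lower := fun X hX hXK hS Y => by
        have h1 := (abs_le.1 (hT2 (Φ X) hS.2.1 (hr' X.1 hX.1).1
          (hMM.trans (hquot X hS.2.1 (hoff X hX hXK).le)) (𝒟 Φ X Y))).1
        refine (one_sub_mul_le_mul hδ (by linarith) (x := coneForm β₁ γ (Φ X) (𝒟 Φ X Y))
          ?_ (by rw [hcone']; positivity)).trans (by linarith)
        rw [hcone, hcone', mul_add, ← mul_assoc (1 - δ / 4), ← mul_assoc (1 - δ / 4)]
        exact add_le_add (mul_le_mul_of_nonneg_right (s1.lower X.1 hX.1) (sq_nonneg _))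
          (mul_le_mul_of_nonneg_right (s2.lower X.2 hX.2) (sq_nonneg _))
      upper := fun X hX hXK hS Y => by
        have h1 := (abs_le.1 (hT2 (Φ X) hS.2.1 (hr' X.1 hX.1).1
          (hMM.trans (hquot X hS.2.1 (hoff X hX hXK).le)) (𝒟 Φ X Y))).2
        refine le_trans (by linarith) (mul_mul_le_one_add hδ (by linarith)
          (x := coneForm β₁ γ (Φ X) (𝒟 Φ X Y)) ?_ (by rw [hcone']; positivity))
        rw [hcone, hcone', mul_add, ← mul_assoc (1 + δ / 4), ← mul_assoc (1 + δ / 4)]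
        exact add_le_add (mul_le_mul_of_nonneg_right (s1.upper X.1 hX.1) (sq_nonneg _))
          (mul_le_mul_of_nonneg_right (s2.upper X.2 hX.2) (sq_nonneg _))
      lower_fst := fun X hX hS Y => by
        rw [hfst]
        refine (one_sub_mul_le_mul hδ (by linarith)
          (x := (β₁ * ‖z0 + κ1 * X.1‖ ^ (β₁ - 1) * κ1) ^ 2 * ‖Y.1‖ ^ 2) ?_ (by positivity)).trans ?_
        · rw [← mul_assoc]; gcongr; exact s1.lower X.1 hX.1
        have hδ4 : 0 ≤ 1 - δ / 4 := by linarith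
        rcases le_total M ‖(Φ X).2 / (Φ X).1‖ with hu | hu
        · have h1 := (abs_le.1 (hT2 (Φ X) hS.2.1 (hr' X.1 hX.1).1 (hMM.trans hu) (𝒟 Φ X Y))).1
          have h2 := hcone X Y
          have h3 : 0 ≤ (γ * ‖w0 + κ2 * X.2‖ ^ (γ - 1) * κ2) ^ 2 * ‖Y.2‖ ^ 2 := by positivity
          nlinarith
        · have h1 := (abs_le.1 (hT1 (Φ X) hS.2 (hr' X.1 hX.1).2.1 hu (𝒟 Φ X Y))).1
          have h2 : (β₁ * ‖z0 + κ1 * X.1‖ ^ (β₁ - 1) * κ1) ^ 2 * ‖Y.1‖ ^ 2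
              ≤ fibreForm γ dens (fibreCoeff β₁ γ 0 (Φ X).1) (Φ X) (𝒟 Φ X Y) := by
            have h3 : (β₁ * ‖z0 + κ1 * X.1‖ ^ (β₁ - 1) * κ1) ^ 2 * ‖Y.1‖ ^ 2
                = fibreCoeff β₁ γ 0 (Φ X).1 * ‖(𝒟 Φ X Y).1‖ ^ 2 := by
              rw [fibreCoeff, mul_zero, add_zero, hbase, hD, hΦ1, hn1]; ring
            rw [h3, fibreForm]
            have : 0 ≤ dens ((Φ X).2 / (Φ X).1) := flatDensity_nonneg
            exact le_add_of_nonneg_right (by positivity)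
          nlinarith
      thin := fun X hX hXK => hthin hXK.1 X hX.1 hXK.2
      contDiff_sec := by rw [hσ]; fun_prop
      sec_mem := by
        rintro ⟨_, hp, _⟩ z hz
        rw [hsec hp]; exact hsecbox hp z hz M hMn.le
      sec_regular := by
        rintro ⟨_, hp, _⟩ z hz hz0
        refine ⟨?_, hσreg hp z hz hz0⟩
        rw [hsec hp]; exact hsecbox hp z hz M hMn.le
      sec_upper := by
        rintro ⟨_, hp, _⟩ z hz hz0 y
        have h0 : z0 + κ1 * z ≠ 0 := (s1.ne_zero_iff z hz).2 hz0
        have hn0 : 0 < ‖z0 + κ1 * z‖ := norm_pos_iff.2 h0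
        have e1 : 𝒟 Φ (z, σ z) (y, 𝒟 σ z y) = (κ1 * y, M * (κ1 * y)) := by
          rw [hD, hσd]; ext
          · rfl
          · simp only []; field_simp
        rw [e1]
        have h1 := (abs_le.1 (hT2 (Φ (z, σ z)) h0 (hr' z hz).1 (by
          rw [hsec hp, mul_div_cancel_left₀ _ h0, hMn]; exact hMM) (κ1 * y, M * (κ1 * y)))).2
        have h2 := hsub _ h0 (hr' z hz).2.2.2
        set f := (β₁ * ‖z0 + κ1 * z‖ ^ (β₁ - 1) * κ1) ^ 2 * ‖y‖ ^ 2
        have h3 : coneForm β₁ γ (Φ (z, σ z)) (κ1 * y, M * (κ1 * y)) ≤ (1 + δ / 4) * f := by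
          have h4 : γ ^ 2 * ‖z0 + κ1 * z‖ ^ (2 * γ - 2) * M ^ (2 * γ)
              ≤ δ / 4 * baseCoeff β₁ (z0 + κ1 * z) := by
            rw [IsSubordinate, abs_of_nonneg (by positivity), mul_div_assoc',
              div_le_iff₀ (by positivity)] at h2
            linarith
          have e2 : M ^ (2 * γ) = M ^ (2 * γ - 2) * M ^ 2 := by
            rw [← rpow_natCast, ← rpow_add (by linarith)]; congr 1; push_cast; ring
          have e3 : baseCoeff β₁ (z0 + κ1 * z) * (κ1 * ‖y‖) ^ 2 = f := by rw [hbase]; ring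
          have e4 : coneForm β₁ γ (Φ (z, σ z)) (κ1 * y, M * (κ1 * y)) = f
              + γ ^ 2 * ‖z0 + κ1 * z‖ ^ (2 * γ - 2) * M ^ (2 * γ) * (κ1 * ‖y‖) ^ 2 := by
            rw [hsec hp, coneForm, ← e3, baseCoeff, e2]
            simp only [norm_mul, hMn, ← hn1]
            rw [mul_rpow (norm_nonneg _) (by linarith)]
            ring
          rw [e4, add_mul, one_mul, ← e3, ← mul_assoc]
          gcongr
        have h5 : f ≤ (1 + δ / 4) * (h ^ 2 * (b1 * ‖z‖ ^ (b1 - 1) * ‖y‖) ^ 2) := by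
          rw [hfst (z, 0) (y, 0), ← mul_assoc]
          exact mul_le_mul_of_nonneg_right (s1.upper z hz) (sq_nonneg _)
        set B := h ^ 2 * (b1 * ‖z‖ ^ (b1 - 1) * ‖y‖) ^ 2
        have hB : 0 ≤ B := by positivity
        calc _ ≤ (1 + δ / 4) * ((1 + δ / 4) * ((1 + δ / 4) * B)) := by
              refine le_trans (by linarith) (mul_le_mul_of_nonneg_left (h3.trans ?_)
                (by positivity : 0 ≤ 1 + δ / 4))
              gcongr
          _ = (1 + δ / 4) ^ 3 * B := by ring
          _ ≤ (1 + δ) * B := by gcongr; nlinarith [mul_pos hδ hδ, mul_pos (mul_pos hδ hδ) hδ]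
      vertical := fun X hX hXK => by
        obtain ⟨hp, hX2⟩ := hXK
        rcases eq_or_ne (z0 + κ1 * X.1) 0 with h0 | h0
        · left
          rw [h0, norm_zero, mul_zero, hp.2.1, zero_add] at hX2
          have h1 : (κ2 : ℂ) * X.2 = 0 := norm_le_zero_iff.1 hX2
          rw [hσ]; simp only [h0, mul_zero]
          exact (mul_eq_zero.1 h1).resolve_left hk2'
        · right
          have h1 := hvert U (z0 + κ1 * X.1) ((Φ X).2 / (Φ X).1) M h0 (hr' X.1 hX.1).2.2.1 (by
            rw [norm_div, hΦ1, hΦ2, div_le_iff₀ (norm_pos_iff.2 h0)]; exact hX2) hMn.le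
            (fun hcon => by rw [← hcon, hMn] at hM2; exact lt_irrefl _ hM2)
            (fun hcon => by rw [← hcon, hMn] at hM3; exact lt_irrefl _ hM3)
            (hsecbox hp X.1 hX.1)
          have h2 : (z0 + κ1 * X.1, (z0 + κ1 * X.1) * ((Φ X).2 / (Φ X).1)) = Φ X := by
            rw [← hΦ1, mul_div_cancel₀ _ (by exact h0)]
          rw [h2, ← hsec hp] at h1
          refine h1.trans (ofReal_le_ofReal ?_)
          calc C * ‖z0 + κ1 * X.1‖ ^ γ ≤ C * (δ / C * h) := by
                gcongr; exact (hp.2.2.2 _ hX.1).trans (by gcongr; exact min_le_left _ _)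
            _ = δ * h := by field_simp }
  exact C.ghEDist_le (isLineElement_leviForm _) hb1 hb11 hb2 hb21 hδ hδ1 hh hdef hX1 hX₂

end GluingData

/-! ### Blow-ups along the fibres and at regular points -/

/-- A chart without exceptional set. -/
theorem coneChart_empty {U S O : Set ℂ²} {F : ℂ² → ℂ² → ℝ} {b₁ b₂ h δ : ℝ}
    {Φ Ψ : ℂ² → ℂ²} (hΦ : ContDiff ℝ 1 Φ) (hO : IsOpen O) (hΨ : ContDiffOn ℝ 1 Ψ O)
    (hr : ∀ x ∈ O, Φ (Ψ x) = x) (hb₁ : b₁ = 1) (hδ : δ ≤ 1)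
    (hbox : ∀ X ∈ coneBox b₁ b₂, (Φ X ∈ O ∧ Φ X ∈ U) ∧ Ψ (Φ X) = X ∧
      (Φ X ∈ S ↔ X ∈ coneRegular b₁ b₂) ∧ (Φ X ∈ S → ∀ Y,
        (1 - δ) * (h ^ 2 * coneForm b₁ b₂ X Y) ≤ F (Φ X) (𝒟 Φ X Y) ∧
        F (Φ X) (𝒟 Φ X Y) ≤ (1 + δ) * (h ^ 2 * coneForm b₁ b₂ X Y))) :
    ConeChart U S F b₁ b₂ h δ Φ Ψ O ∅ 0 where
  contDiff := hΦ
  isOpen := hO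
  contDiffOn := hΨ
  right_inv := hr
  mapsTo X hX := (hbox X hX).1
  left_inv X hX := (hbox X hX).2.1
  isClosed := isClosed_empty
  regular_iff X hX _ := (hbox X hX).2.2.1
  regular_fst X _ _ h := absurd hb₁ h
  lower X hX _ hS Y := ((hbox X hX).2.2.2 hS Y).1
  upper X hX _ hS Y := ((hbox X hX).2.2.2 hS Y).2
  lower_fst X hX hS Y := by
    refine le_trans ?_ ((hbox X hX).2.2.2 hS Y).1
    have : 0 ≤ 1 - δ := by linarith
    rw [coneForm_eq]
    gcongr
    exact le_add_of_nonneg_right (sq_nonneg _)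
  thin X _ h := absurd h (notMem_empty X)
  contDiff_sec := contDiff_const
  sec_mem h := absurd h not_nonempty_empty
  sec_regular h := absurd h not_nonempty_empty
  sec_upper h := absurd h not_nonempty_empty
  vertical X _ h := absurd h (notMem_empty X)

/-- The map `(z, u) ↦ (z, z u)`. -/
def sectorMap (y : ℂ²) : ℂ² := (y.1, y.1 * y.2)

theorem hasFDerivAt_sectorMap_affineChart {z0 u0 : ℂ} {κ1 κ2 : ℝ} (X Y : ℂ²) :
    𝒟 (fun X => sectorMap (affineChart z0 u0 0 κ1 κ2 X)) X Y
      = (κ1 * Y.1, (z0 + κ1 * X.1) * (κ2 * Y.2) + (u0 + κ2 * X.2) * (κ1 * Y.1)) := by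
  have h1 : HasFDerivAt (fun X : ℂ² => X.1) (ContinuousLinearMap.fst ℝ ℂ ℂ) X := hasFDerivAt_fst
  have h2 : HasFDerivAt (fun X : ℂ² => X.2) (ContinuousLinearMap.snd ℝ ℂ ℂ) X := hasFDerivAt_snd
  have k1 := (h1.const_mul (κ1 : ℂ)).const_add z0
  have k2 := (h2.const_mul (κ2 : ℂ)).const_add u0
  have e : (fun X => sectorMap (affineChart z0 u0 0 κ1 κ2 X))
      = fun X : ℂ² => (z0 + κ1 * X.1, (z0 + κ1 * X.1) * (u0 + κ2 * X.2)) := by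
    ext X <;> simp [sectorMap, affineChart]
  have k : HasFDerivAt (fun X : ℂ² => (z0 + κ1 * X.1, (z0 + κ1 * X.1) * (u0 + κ2 * X.2))) _ X :=
    k1.prodMk (k1.mul k2)
  rw [e, k.fderiv]
  simp

theorem abs_mul_sub_le {δ w B T T0 : ℝ} (h1 : |T - T0| ≤ δ / 16 * T0)
    (h2 : |w * T0 - B| ≤ δ / 16 * B) (hw : 0 ≤ w) (hB : 0 ≤ B) (hδ : 0 < δ) (hδ1 : δ ≤ 1) :
    |w * T - B| ≤ δ / 4 * B := by
  have h3 : w * |T - T0| ≤ δ / 16 * (w * T0) := by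
    rw [mul_left_comm]; exact mul_le_mul_of_nonneg_left h1 hw
  have h4 : δ / 16 * (w * T0) ≤ δ / 16 * (2 * B) := by
    refine mul_le_mul_of_nonneg_left ?_ (by positivity)
    nlinarith [(abs_le.1 h2).2]
  calc |w * T - B| = |w * (T - T0) + (w * T0 - B)| := by congr 1; ring
    _ ≤ w * |T - T0| + |w * T0 - B| := by
      rw [← abs_of_nonneg hw, ← abs_mul, abs_of_nonneg hw]; exact abs_add_le _ _
    _ ≤ δ / 4 * B := by nlinarith

theorem abs_fibreCoeff_sub_le {β₁ γ c η : ℝ} {z z0 : ℂ} (hη : 0 ≤ η)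
    (h1 : |‖z‖ ^ (2 * β₁ - 2) - ‖z0‖ ^ (2 * β₁ - 2)| ≤ η * ‖z0‖ ^ (2 * β₁ - 2))
    (h2 : |‖z‖ ^ (2 * γ - 2) - ‖z0‖ ^ (2 * γ - 2)| ≤ η * ‖z0‖ ^ (2 * γ - 2))
    (hc : IsSubordinate β₁ γ c z0) :
    |fibreCoeff β₁ γ c z - fibreCoeff β₁ γ c z0| ≤ 3 * η * fibreCoeff β₁ γ c z0 := by
  have e : fibreCoeff β₁ γ c z - fibreCoeff β₁ γ c z0
      = β₁ ^ 2 * (‖z‖ ^ (2 * β₁ - 2) - ‖z0‖ ^ (2 * β₁ - 2))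
        + γ ^ 2 * (‖z‖ ^ (2 * γ - 2) - ‖z0‖ ^ (2 * γ - 2)) * c := by
    simp only [fibreCoeff, baseCoeff]; ring
  have h3 := hc.le_fibreCoeff
  unfold IsSubordinate at hc
  rw [e]
  refine (abs_add_le _ _).trans ?_
  rw [abs_mul, abs_mul, abs_mul, abs_of_nonneg (sq_nonneg β₁), abs_of_nonneg (sq_nonneg γ)]
  calc β₁ ^ 2 * |‖z‖ ^ (2 * β₁ - 2) - ‖z0‖ ^ (2 * β₁ - 2)|
      + γ ^ 2 * |‖z‖ ^ (2 * γ - 2) - ‖z0‖ ^ (2 * γ - 2)| * |c|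
      ≤ β₁ ^ 2 * (η * ‖z0‖ ^ (2 * β₁ - 2)) + γ ^ 2 * (η * ‖z0‖ ^ (2 * γ - 2)) * |c| := by gcongr
    _ = η * baseCoeff β₁ z0 + η * (γ ^ 2 * ‖z0‖ ^ (2 * γ - 2) * |c|) := by rw [baseCoeff]; ring
    _ ≤ η * baseCoeff β₁ z0 + η * (baseCoeff β₁ z0 / 2) := by gcongr
    _ = 3 * η * (baseCoeff β₁ z0 / 2) := by ring
    _ ≤ _ := by gcongr

namespace GluingData

set_option maxHeartbeats 600000 in
/-- Blow-ups where the metric is close to a fibre metric, at scales small compared with the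
distance to the line `{z = 0}`. The fibre is blown up by the factor `κ2` around `u0`. -/
theorem exists_ghEDist_le_of_fibre (H : 𝓖) {δ : ℝ} (hδ : 0 < δ)
    (hδ1 : δ ≤ 1 / 100) : ∃ ζ : ℝ, 0 < ζ ∧ ∀ (U : Set ℂ²) (b h κ2 c : ℝ) (z0 u0 X2 : ℂ),
      (∀ x y, lengthDist U (U ∩ 𝓡) ω x y = 0 → x = y) →
      0 < b → b ≤ 1 → 0 < h → z0 ≠ 0 → ‖z0‖ ≤ 1 → h ≤ ζ * ‖z0‖ ^ β₁ →
      IsSubordinate β₁ γ c z0 → 0 < κ2 →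
      (∀ z X : ℂ, ‖z - z0‖ ≤ 1 / 2 * ‖z0‖ → ‖z - z0‖ ≤ 16 * h / β₁ → ‖X‖ ^ b < 8 →
        (z, z * (u0 + κ2 * X)) ∈ U ∧ ((z, z * (u0 + κ2 * X)) ∈ 𝓡 → ∀ v,
          |ω (z, z * (u0 + κ2 * X)) v
              - fibreForm γ dens (fibreCoeff β₁ γ c z) (z, z * (u0 + κ2 * X)) v|
            ≤ δ / 4 * fibreForm γ dens (fibreCoeff β₁ γ c z) (z, z * (u0 + κ2 * X)) v)) →
      (∀ X : ℂ, ‖X‖ ^ b < 8 → (u0 + κ2 * X ≠ a₂ ∧ u0 + κ2 * X ≠ a₃ ↔ (b ≠ 1 → X ≠ 0)) ∧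
        |(γ * ‖z0‖ ^ γ) ^ 2 * dens (u0 + κ2 * X) * κ2 ^ 2 - (h * (b * ‖X‖ ^ (b - 1))) ^ 2|
          ≤ δ / 16 * (h * (b * ‖X‖ ^ (b - 1))) ^ 2) →
      ‖X2‖ ^ b ≤ δ →
      ghEDist (rescaledBallDist (lengthDist U (U ∩ 𝓡) ω)
        (z0, z0 * (u0 + κ2 * X2)) h) (rescaledBallDist (coneDist 1 b) 0 1)
        ≤ ofReal (40 * δ) := by
  have hγ := H.pos
  have hβ1 := H.pos₁
  have hβ11 : β₁ < 1 := H.lt_γ.trans H.γ_lt_one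
  obtain ⟨η1, hη1, hη11, k1⟩ := exists_norm_rpow_close (2 * β₁ - 2) (δ := δ / 16) (by positivity)
  obtain ⟨η2, hη2, -, k2⟩ := exists_norm_rpow_close (2 * γ - 2) (δ := δ / 16) (by positivity)
  obtain ⟨η3, hη3, -, k3⟩ := exists_norm_rpow_close (2 * γ) (δ := δ / 16) (by positivity)
  refine ⟨β₁ / 16 * min η1 (min η2 η3), by positivity, ?_⟩
  intro U b h κ2 c z0 u0 X2 hdef hb hb1 hh hz₀ hz01 hle hc hκ2 hU hfib hX₂
  have hn : 0 < ‖z0‖ := norm_pos_iff.2 hz₀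
  set η := min η1 (min η2 η3)
  set A0 := fibreCoeff β₁ γ c z0 with hA₀
  set q := β₁ * ‖z0‖ ^ (β₁ - 1) with hq
  have hq0 : 0 < q := by positivity
  have hA : (q / 2) ^ 2 ≤ A0 := by
    refine le_trans ?_ hc.le_fibreCoeff
    rw [baseCoeff, norm_rpow_two_mul_sub_two, hq]
    nlinarith [mul_pos (pow_pos hβ1 2) (pow_pos (Real.rpow_pos_of_pos hn (β₁ - 1)) 2)]
  have hA0 : 0 < A0 := lt_of_lt_of_le (by positivity) hA
  set κ1 := h / √A0 with hκ1
  have hκ10 : 0 < κ1 := by positivity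
  have hκA : κ1 ^ 2 * A0 = h ^ 2 := by rw [hκ1, div_pow, sq_sqrt hA0.le]; field_simp
  have hκq : κ1 * 8 ≤ 16 * h / q := by
    rw [hκ1, div_mul_eq_mul_div, div_le_div_iff₀ (by positivity) hq0]
    nlinarith [le_sqrt_of_sq_le hA]
  have hκz : ∀ X : ℂ, ‖X‖ ^ (1 : ℝ) < 8 → ‖z0 + κ1 * X - z0‖ ≤ η * ‖z0‖ ∧
      ‖z0 + κ1 * X - z0‖ ≤ 16 * h / β₁ := by
    intro X hX
    rw [rpow_one] at hX
    rw [add_sub_cancel_left, norm_ofReal_mul hκ10.le]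
    have h1 : κ1 * ‖X‖ ≤ 16 * h / q := (by gcongr : κ1 * ‖X‖ ≤ κ1 * 8).trans hκq
    constructor
    · refine h1.trans ?_
      have e : ‖z0‖ ^ β₁ = ‖z0‖ ^ (β₁ - 1) * ‖z0‖ := by rw [← rpow_add_one hn.ne', sub_add_cancel]
      rw [e] at hle
      rw [div_le_iff₀ hq0, hq]
      linarith
    · refine h1.trans ?_
      have : 1 ≤ ‖z0‖ ^ (β₁ - 1) :=
        Real.one_le_rpow_of_pos_of_le_one_of_nonpos hn hz01 (by linarith)
      gcongr
      rw [hq]; exact le_mul_of_one_le_right hβ1.le this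
  have hηhalf : η ≤ 1 / 2 := (min_le_left _ _).trans hη11
  set Φ : ℂ² → ℂ² := fun X => sectorMap (affineChart z0 u0 0 κ1 κ2 X) with hΦ
  have hΦX : ∀ X, Φ X = (z0 + κ1 * X.1, (z0 + κ1 * X.1) * (u0 + κ2 * X.2)) := fun X => by
    ext <;> simp [hΦ, sectorMap, affineChart]
  have hz : ∀ X ∈ coneBox 1 b, z0 + κ1 * X.1 ≠ 0 := by
    intro X hX h0
    have h1 := (hκz X.1 hX.1).1
    rw [h0, zero_sub, norm_neg] at h1
    nlinarith
  have C : ConeChart U (U ∩ 𝓡) ω 1 b h δ Φ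
      (fun x => affineChartInv z0 u0 0 κ1 κ2 (x.1, x.2 / x.1)) {x | x.1 ≠ 0} ∅ 0 := by
    refine coneChart_empty ?_ (isOpen_ne_fun continuous_fst continuous_const) ?_ ?_ rfl
      (by linarith) fun X hX => ?_
    · have e : Φ = fun X : ℂ² => (z0 + κ1 * X.1, (z0 + κ1 * X.1) * (u0 + κ2 * X.2)) := funext hΦX
      rw [e]; fun_prop
    · refine contDiff_affineChartInv.comp_contDiffOn ?_
      have hdiv : ContDiffOn ℝ 1 (fun x : ℂ² => x.2 / x.1) {x | x.1 ≠ 0} :=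
        fun x hx => ((contDiffAt_quot hx).restrict_scalars ℝ |>.of_le (by norm_num)).contDiffWithinAt
      exact contDiffOn_fst.prodMk hdiv
    · intro x hx
      simp only [hΦ, affineChart_inv hκ10.ne' hκ2.ne', sectorMap]
      rw [mul_div_cancel₀ _ hx]
    have hz0 := hz X hX
    set z := z0 + κ1 * X.1 with hzdef
    set u := u0 + κ2 * X.2 with hudef
    obtain ⟨d1, d2⟩ := hκz X.1 hX.1
    obtain ⟨m1, m2⟩ := hU z X.2 (d1.trans (by gcongr)) d2 hX.2
    obtain ⟨f1, f2⟩ := hfib X.2 hX.2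
    have hΦX' : Φ X = (z, z * u) := hΦX X
    rw [hΦX']
    refine ⟨⟨hz0, m1⟩, ?_, ?_, fun hS Y => ?_⟩
    · simp only [mul_div_cancel_left₀ _ hz0]
      have : (z, u) = affineChart z0 u0 0 κ1 κ2 X := by ext <;> simp [affineChart, hzdef, hudef]
      rw [this, affineChartInv_apply hκ10.ne' hκ2.ne']
    · have hl : ∀ a : ℂ, z * u ≠ a * z ↔ u ≠ a := fun a => by
        rw [mul_comm a, ne_eq, ne_eq, mul_right_inj' hz0]
      refine ⟨fun h => ⟨fun h => absurd rfl h, f1.1 ⟨(hl a₂).1 h.2.2.1, (hl a₃).1 h.2.2.2⟩⟩,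
        fun h => ⟨m1, hz0, (hl a₂).2 (f1.2 h.2).1, (hl a₃).2 (f1.2 h.2).2⟩⟩
    have hω := abs_le.1 (m2 hS.2 (𝒟 Φ X Y))
    rw [hΦ, hasFDerivAt_sectorMap_affineChart, ← hzdef, ← hudef] at hω ⊢
    set v : ℂ² := (κ1 * Y.1, z * (κ2 * Y.2) + u * (κ1 * Y.1))
    have hF : fibreForm γ dens (fibreCoeff β₁ γ c z) (z, z * u) v
        = fibreCoeff β₁ γ c z * κ1 ^ 2 * ‖Y.1‖ ^ 2
          + γ ^ 2 * ‖z‖ ^ (2 * γ) * dens u * κ2 ^ 2 * ‖Y.2‖ ^ 2 := by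
      have e1 : (v.2 - u * v.1) / z = κ2 * Y.2 := by simp only [v]; field_simp; ring
      simp only [fibreForm, mul_div_cancel_left₀ _ hz0]
      rw [e1, norm_mul, norm_mul, norm_real, norm_real,
        norm_of_nonneg hκ10.le, norm_of_nonneg hκ2.le]
      ring
    have hcone : h ^ 2 * coneForm 1 b X Y
        = h ^ 2 * ‖Y.1‖ ^ 2 + (h * (b * ‖X.2‖ ^ (b - 1))) ^ 2 * ‖Y.2‖ ^ 2 := by
      rw [coneForm_eq, sub_self, rpow_zero]; ring
    have hdn : ∀ η' : ℝ, η ≤ η' → ‖z - z0‖ ≤ η' * ‖z0‖ := fun η' h => d1.trans (by gcongr)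
    have r1 := k1 z z0 hz₀ (hdn _ (min_le_left _ _))
    have r2 := k2 z z0 hz₀ (hdn _ ((min_le_right _ _).trans (min_le_left _ _)))
    have rA := abs_le.1 (abs_fibreCoeff_sub_le (by positivity) r1 r2 hc)
    have b1 : (1 - δ / 4) * h ^ 2 ≤ fibreCoeff β₁ γ c z * κ1 ^ 2 ∧
        fibreCoeff β₁ γ c z * κ1 ^ 2 ≤ (1 + δ / 4) * h ^ 2 := by
      have hδA : 0 ≤ δ * A0 := by positivity
      rw [← hκA]
      constructor
      · calc (1 - δ / 4) * (κ1 ^ 2 * A0) = (A0 - δ / 4 * A0) * κ1 ^ 2 := by ring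
          _ ≤ _ := by gcongr; linarith [rA.1]
      · calc _ ≤ (A0 + δ / 4 * A0) * κ1 ^ 2 := by gcongr; linarith [rA.2]
          _ = _ := by ring
    set B := (h * (b * ‖X.2‖ ^ (b - 1))) ^ 2
    have hB : 0 ≤ B := sq_nonneg _
    have e2 : (γ * ‖z0‖ ^ γ) ^ 2 = γ ^ 2 * ‖z0‖ ^ (2 * γ) := by
      rw [mul_pow, mul_comm 2 γ, rpow_mul (norm_nonneg _), rpow_two]
    rw [e2] at f2
    have hw : 0 ≤ γ ^ 2 * dens u * κ2 ^ 2 := by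
      have : 0 ≤ dens u := flatDensity_nonneg
      positivity
    have b2 := abs_mul_sub_le (k3 z z0 hz₀ (hdn _ ((min_le_right _ _).trans (min_le_right _ _))))
      (w := γ ^ 2 * dens u * κ2 ^ 2) (B := B) (by convert f2 using 2; ring) hw hB hδ (by linarith)
    have e3 : γ ^ 2 * dens u * κ2 ^ 2 * ‖z‖ ^ (2 * γ) = γ ^ 2 * ‖z‖ ^ (2 * γ) * dens u * κ2 ^ 2 := by
      ring
    rw [e3, abs_le] at b2
    have hF1 : (1 - δ / 4) * (h ^ 2 * coneForm 1 b X Y)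
        ≤ fibreForm γ dens (fibreCoeff β₁ γ c z) (z, z * u) v := by
      rw [hF, hcone, mul_add, ← mul_assoc, ← mul_assoc]
      exact add_le_add (mul_le_mul_of_nonneg_right b1.1 (sq_nonneg _))
        (mul_le_mul_of_nonneg_right (by linarith [b2.1]) (sq_nonneg _))
    have hF2 : fibreForm γ dens (fibreCoeff β₁ γ c z) (z, z * u) v
        ≤ (1 + δ / 4) * (h ^ 2 * coneForm 1 b X Y) := by
      rw [hF, hcone, mul_add, ← mul_assoc, ← mul_assoc]
      exact add_le_add (mul_le_mul_of_nonneg_right b1.2 (sq_nonneg _))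
        (mul_le_mul_of_nonneg_right (by linarith [b2.2]) (sq_nonneg _))
    have hnn : 0 ≤ h ^ 2 * coneForm 1 b X Y := by rw [hcone]; positivity
    exact ⟨(one_sub_mul_le_mul hδ (by linarith) hF1 hnn).trans (by linarith [hω.1]),
      le_trans (by linarith [hω.2]) (mul_mul_le_one_add hδ (by linarith) hF2 hnn)⟩
  have h0 : Φ (0, X2) = (z0, z0 * (u0 + κ2 * X2)) := by simp [hΦX]
  rw [← h0]
  refine C.ghEDist_le (isLineElement_leviForm _) one_pos le_rfl hb hb1 hδ hδ1 hh hdef ?_ hX₂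
  rw [norm_zero, zero_rpow one_ne_zero]; exact hδ.le

/-- Blow-ups at regular points in a compact set are uniformly close to the flat space. -/
theorem exists_ghEDist_le_of_isCompact (H : 𝓖) {δ : ℝ} (hδ : 0 < δ)
    (hδ1 : δ ≤ 1 / 100) {U Q : Set ℂ²} (hUo : IsOpen U) (hQ : IsCompact Q)
    (hQS : Q ⊆ U ∩ 𝓡)
    (hdef : ∀ x y, lengthDist U (U ∩ 𝓡) ω x y = 0 → x = y) {k : ℝ} (hk : 0 < k)
    (hlow : ∀ x ∈ Q, ∀ v, k * ‖v‖ ^ 2 ≤ ω x v) : ∃ h₀ : ℝ, 0 < h₀ ∧ ∀ p ∈ Q, ∀ h, 0 < h → h < h₀ →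
      ghEDist (rescaledBallDist (lengthDist U (U ∩ 𝓡) ω) p h)
        (rescaledBallDist (coneDist 1 1) 0 1) ≤ ofReal (40 * δ) := by
  have hSo : IsOpen (U ∩ 𝓡) := hUo.inter (isOpen_linesCompl a₂ a₃)
  set ψ := approxPotential β₁ β₂ β₃ γ α₀ a₂ a₃ χ
  obtain ⟨ε, hε, hεS⟩ := hQ.exists_cthickening_subset_open hSo hQS
  have hQ' : IsCompact (cthickening ε Q) := hQ.cthickening
  have hcont : ContinuousOn (hessian ψ) (cthickening ε Q) := fun x hx =>
    (continuousAt_hessian (H.contDiffAt_approxPotential (hεS hx).2)).continuousWithinAt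
  obtain ⟨B, hB⟩ := hQ'.exists_bound_of_continuousOn (f := hessian ψ) hcont
  obtain ⟨η, hη, hu⟩ := (Metric.uniformContinuousOn_iff (f := hessian ψ)).1
    (hQ'.uniformContinuousOn_of_continuous (f := hessian ψ) hcont) (2 * δ * k) (by positivity)
  set L := (1 + √(|B| / k)) * (8 / √k) + 8 / √k
  have hL : 0 < L := by positivity
  refine ⟨min ε η / (L + 1), by positivity, fun p hp h hh hh0 => ?_⟩
  have hpc : p ∈ cthickening ε Q := Metric.self_subset_cthickening Q hp
  have hform : ∀ x ∈ cthickening ε Q, ∀ v, ω x v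
      = (hessian ψ x v v + hessian ψ x (I • v) (I • v)) / 4 := fun x hx v =>
    leviForm_eq_hessian (H.contDiffAt_approxPotential (hεS hx).2) v
  have hI : ∀ v : ℂ², ‖I • v‖ = ‖v‖ := fun v => by rw [norm_smul, norm_I, one_mul]
  obtain ⟨c, A, D, hA, hD, hc, hq⟩ := exists_diagonalization hk (hform p hpc) (hlow p hp)
  have hA0 : 0 < A := hk.trans_le hA
  have hD0 : 0 < D := hk.trans_le hD
  have hcn : ‖c‖ ≤ √(|B| / k) := by
    apply le_sqrt_of_sq_le
    rw [le_div_iff₀ hk]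
    have h1 : ω p (1, 0) ≤ |B| := by
      rw [hform p hpc]
      have e1 : ‖((1 : ℂ), (0 : ℂ))‖ = 1 := by simp
      have h2 := (hessian ψ p).le_opNorm₂ (1, 0) (1, 0)
      have h3 := (hessian ψ p).le_opNorm₂ (I • (1, 0)) (I • (1, 0))
      rw [hI] at h3
      rw [e1, mul_one, mul_one, norm_eq_abs] at h2 h3
      have h4 := (hB p hpc).trans (le_abs_self B)
      linarith [le_abs_self (hessian ψ p (1, 0) (1, 0)), abs_nonneg B,
        le_abs_self (hessian ψ p (I • (1, 0)) (I • (1, 0)))]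
    linarith
  set κ1 := h / √A
  set κ2 := h / √D
  have hκ1 : 0 < κ1 := by positivity
  have hκ2 : 0 < κ2 := by positivity
  have hκA : A * κ1 ^ 2 = h ^ 2 := by simp only [κ1]; rw [div_pow, sq_sqrt hA0.le]; field_simp
  have hκD : D * κ2 ^ 2 = h ^ 2 := by simp only [κ2]; rw [div_pow, sq_sqrt hD0.le]; field_simp
  set Φ := affineChart p.1 p.2 c κ1 κ2
  have hnear : ∀ X ∈ coneBox 1 1, dist (Φ X) p < min ε η := by
    intro X hX
    have hX1 : ‖X.1‖ ≤ 8 := by simpa using hX.1.le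
    have hX2 : ‖X.2‖ ≤ 8 := by simpa using hX.2.le
    have t (a : ℝ) (ha : k ≤ a) (y : ℂ) (hy : ‖y‖ ≤ 8) :
        ‖((h / √a : ℝ) : ℂ) * y‖ ≤ h * (8 / √k) := by
      rw [norm_ofReal_mul (by positivity)]
      calc _ ≤ h / √k * 8 := by gcongr
        _ = _ := by ring
    have t1 := t A hA _ hX1
    have t2 := t D hD _ hX2
    have e : Φ X - p = (κ1 * X.1, c * (κ1 * X.1) + κ2 * X.2) := by
      ext <;> simp [Φ, affineChart]; ring
    rw [dist_eq_norm, e]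
    have t3 : ‖(κ1 * X.1, c * (κ1 * X.1) + κ2 * X.2)‖ ≤ h * L := by
      rw [Prod.norm_def]
      refine max_le ?_ ?_
      · refine t1.trans ?_
        have : 0 ≤ √(|B| / k) * (8 / √k) + 8 / √k := by positivity
        gcongr
        simp only [L]; linarith
      · refine (norm_add_le _ _).trans ?_
        rw [norm_mul]
        have : 0 ≤ h * (8 / √k) := by positivity
        calc ‖c‖ * ‖(κ1 : ℂ) * X.1‖ + ‖(κ2 : ℂ) * X.2‖
            ≤ (1 + √(|B| / k)) * (h * (8 / √k)) + h * (8 / √k) := by gcongr; linarith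
          _ = _ := by simp only [L]; ring
    refine t3.trans_lt ?_
    rw [lt_div_iff₀ (by positivity)] at hh0
    nlinarith
  have C : ConeChart U (U ∩ 𝓡) ω 1 1 h δ Φ (affineChartInv p.1 p.2 c κ1 κ2) univ ∅ 0 := by
    refine coneChart_empty contDiff_affineChart isOpen_univ contDiff_affineChartInv.contDiffOn
      (fun x _ => affineChart_inv hκ1.ne' hκ2.ne' x) rfl (by linarith) fun X hX => ?_
    have hd := hnear X hX
    have hXc : Φ X ∈ cthickening ε Q :=
      Metric.mem_cthickening_of_dist_le _ p ε Q hp (hd.le.trans (min_le_left _ _))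
    refine ⟨⟨mem_univ _, (hεS hXc).1⟩, affineChartInv_apply hκ1.ne' hκ2.ne' X,
      ⟨fun _ => ⟨fun h => absurd rfl h, fun h => absurd rfl h⟩, fun _ => hεS hXc⟩, fun _ Y => ?_⟩
    set v := 𝒟 Φ X Y with hv
    have hpv : ω p v = h ^ 2 * coneForm 1 1 X Y := by
      have e1 : coneForm 1 1 X Y = ‖Y.1‖ ^ 2 + ‖Y.2‖ ^ 2 := by
        rw [coneForm_eq, sub_self, rpow_zero, rpow_zero]; ring
      rw [hq v, hv, fderiv_affineChart, e1, mul_add]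
      simp only [add_sub_cancel_left, norm_ofReal_mul hκ1.le,
        norm_ofReal_mul hκ2.le]
      rw [mul_pow, mul_pow, ← mul_assoc, ← mul_assoc, hκA, hκD]
    have hdiff : |ω (Φ X) v - ω p v| ≤ δ * ω p v := by
      have h1 : ‖hessian ψ (Φ X) - hessian ψ p‖ < 2 * δ * k :=
        (dist_eq_norm (hessian ψ (Φ X)) (hessian ψ p)).symm.trans_lt
          (hu _ hXc p hpc (hd.trans_le (min_le_right _ _)))
      have h2 := abs_le.1 (abs_hessian_sub_le (hessian ψ (Φ X)) (hessian ψ p) v)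
      have h3 := abs_le.1 (abs_hessian_sub_le (hessian ψ (Φ X)) (hessian ψ p) (I • v))
      rw [hI] at h3
      have h4 : ‖hessian ψ (Φ X) - hessian ψ p‖ * ‖v‖ ^ 2 ≤ 2 * δ * (k * ‖v‖ ^ 2) := by
        rw [← mul_assoc]; gcongr
      have h5 := mul_le_mul_of_nonneg_left (hlow p hp v) (by positivity : 0 ≤ 2 * δ)
      refine le_trans ?_ (mul_le_mul_of_nonneg_left (hlow p hp v) hδ.le)
      rw [hform _ hXc, hform p hpc, abs_le]
      constructor <;> linarith [h2.1, h2.2, h3.1, h3.2]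
    have h6 := abs_le.1 hdiff
    rw [hpv] at h6
    constructor <;> linarith [h6.1, h6.2]
  have h0 : Φ (0, 0) = p := by simp [Φ, affineChart]
  rw [← h0]
  refine C.ghEDist_le (isLineElement_leviForm _) one_pos le_rfl one_pos le_rfl hδ hδ1 hh hdef ?_ ?_
  all_goals rw [norm_zero, zero_rpow one_ne_zero]; exact hδ.le

end GluingData

/-! ### Choice of the model cone -/

theorem coneDist_le_swap (b1 b2 : ℝ) (p q : ℂ²) :
    coneDist b1 b2 p q ≤ coneDist b2 b1 p.swap q.swap := by
  refine le_of_forall_gt fun L hL => ?_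
  obtain ⟨c, h0, h1, hc, hl⟩ := exists_path_of_lengthDist_lt hL
  obtain ⟨T, hT, hr⟩ := hc.regular
  have hd : ∀ τ ∈ Ioo (0 : ℝ) 1 \ T, deriv (fun τ => (c τ).swap) τ = (deriv c τ).swap := by
    intro τ hτ
    have h := ((hr τ hτ).2.differentiableAt one_ne_zero).hasDerivAt
    exact (((ContinuousLinearMap.snd ℝ ℂ ℂ).hasFDerivAt.comp_hasDerivAt τ h).prodMk
      ((ContinuousLinearMap.fst ℝ ℂ ℂ).hasFDerivAt.comp_hasDerivAt τ h)).deriv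
  have hp : IsPathOn univ (coneRegular b1 b2) (fun τ => (c τ).swap) 0 1 :=
    ⟨continuous_swap.comp_continuousOn hc.continuousOn, mapsTo_univ _ _, T, hT, fun τ hτ =>
      ⟨(hr τ hτ).1.symm, (contDiff_snd.prodMk contDiff_fst).contDiffAt.comp τ (hr τ hτ).2⟩⟩
  have h2 := hp.lengthDist_le (isLineElement_coneForm b1 b2) one_pos
  simp only [h0, h1, Prod.swap_swap] at h2
  refine h2.trans_lt (lt_of_le_of_lt ?_ hl)
  have h3 := arcLength_le_mul (h := coneForm b1 b2) (h' := coneForm b2 b1) (c' := c) hT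
    ENNReal.one_ne_top (c := fun τ => (c τ).swap) fun τ hτ => by
      rw [one_mul, speed, speed, hd τ hτ]
      simp [coneForm, add_comm]
  rwa [one_mul] at h3

/-- `C_b₁ × C_b₂` and `C_b₂ × C_b₁` have the same unit balls. -/
theorem ghEDist_cone_swap_le {X : Type} (d : X → X → ℝ≥0∞) (b1 b2 : ℝ) :
    ghEDist d (rescaledBallDist (coneDist b1 b2) 0 1)
      ≤ ghEDist d (rescaledBallDist (coneDist b2 b1) 0 1) := by
  have hs : ∀ p q, coneDist b1 b2 p q = coneDist b2 b1 p.swap q.swap := fun p q =>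
    (coneDist_le_swap b1 b2 p q).antisymm (coneDist_le_swap b2 b1 p.swap q.swap)
  let e : ballOf (coneDist b1 b2) 0 1 ≃ ballOf (coneDist b2 b1) 0 1 :=
    (Equiv.prodComm ℂ ℂ).subtypeEquiv fun p => by
      change coneDist b1 b2 0 p < _ ↔ coneDist b2 b1 0 p.swap < _
      rw [hs]; rfl
  refine le_iInf fun Z => le_iInf fun iZ => le_iInf fun f => le_iInf fun g => le_iInf fun hf =>
    le_iInf fun hg => ?_
  refine iInf_le_of_le Z (iInf_le_of_le iZ (iInf_le_of_le f (iInf_le_of_le (g ∘ e)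
    (iInf_le_of_le hf (iInf_le_of_le (fun y y' => ?_) ?_)))))
  · exact (hg (e y) (e y')).trans (by rw [rescaledBallDist, rescaledBallDist, hs]; rfl)
  · rw [e.surjective.range_comp]

/-- The rescaled ball `h⁻¹ B(p, h)` is `e`-close to a unit ball in one of the cones `B`. -/
def IsConical (d : ℂ² → ℂ² → ℝ≥0∞) (B : Set (ℝ × ℝ)) (e : ℝ) (p : ℂ²) (h : ℝ) : Prop :=
  ∃ b ∈ B, ghEDist (rescaledBallDist d p h) (rescaledBallDist (coneDist b.1 b.2) 0 1) ≤ ofReal e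

/-- The scales `h` and `c` are separated by a factor `M`. -/
def IsSeparated (M h c : ℝ) : Prop := M * c ≤ h ∨ M * h ≤ c

theorem IsSeparated.mono {M M' h c : ℝ} (hM : IsSeparated M h c) (hle : M' ≤ M) (hh : 0 ≤ h)
    (hc : 0 ≤ c) : IsSeparated M' h c :=
  hM.imp (fun h1 => (mul_le_mul_of_nonneg_right hle hc).trans h1)
    fun h1 => (mul_le_mul_of_nonneg_right hle hh).trans h1

theorem IsSeparated.mul_le {M m h c : ℝ} (hM : IsSeparated M h c) (hM1 : 1 < M) (hm : 1 ≤ m)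
    (hc : 0 ≤ c) (hh : 0 < h) (h1 : m * c ≤ h) : M * c ≤ h := hM.resolve_right fun h2 => by nlinarith

theorem IsSeparated.le_mul {M m h c : ℝ} (hM : IsSeparated M h c) (hM1 : 1 < M) (hm : 1 ≤ m)
    (hh : 0 < h) (h1 : m * h ≤ c) : M * h ≤ c := hM.resolve_left fun h2 => by
    have : h ≤ c := by nlinarith
    nlinarith

theorem exists_rho_lt {β₁ γ s t : ℝ} (hβ : 0 < β₁) (hβγ : β₁ ≤ γ) (hγ : γ ≤ 1) (hst : s < t) :
    ∃ κ : ℝ, 0 < κ ∧ ∀ p x : ℂ², rho β₁ γ p < s → ‖x.1 - p.1‖ ≤ κ → ‖x.2 - p.2‖ ≤ κ →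
      rho β₁ γ x < t := by
  have hts : 0 < t - s := sub_pos.2 hst
  set κ := min 1 (((t - s) / 2) ^ (1 / β₁))
  have hκ : 0 < κ := by positivity
  have hκ1 : κ ^ β₁ ≤ (t - s) / 2 := by
    calc κ ^ β₁ ≤ (((t - s) / 2) ^ (1 / β₁)) ^ β₁ := by gcongr; exact min_le_right _ _
      _ = _ := by rw [← rpow_mul (by positivity), one_div_mul_cancel hβ.ne', rpow_one]
  refine ⟨κ, hκ, fun p x hp h1 h2 => ?_⟩
  have step : ∀ (β : ℝ) (a b : ℂ), β₁ ≤ β → β ≤ 1 → ‖a - b‖ ≤ κ →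
      ‖a‖ ^ β ≤ ‖b‖ ^ β + (t - s) / 2 := by
    intro β a b hβ1 hβ2 hab
    have hβ0 : 0 < β := hβ.trans_le hβ1
    calc ‖a‖ ^ β ≤ (‖b‖ + κ) ^ β := by gcongr; linarith [norm_sub_norm_le a b]
      _ ≤ ‖b‖ ^ β + κ ^ β := Real.rpow_add_le_add_rpow (norm_nonneg _) hκ.le hβ0.le hβ2
      _ ≤ _ := by
        gcongr
        exact (rpow_le_rpow_of_exponent_ge hκ (min_le_left _ _) hβ1).trans hκ1
  have e1 := step β₁ _ _ le_rfl (hβγ.trans hγ) h1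
  have e2 := step γ _ _ hβγ hγ h2
  have f1 := fst_rpow_le_rho β₁ γ p
  have f2 := snd_rpow_le_rho β₁ γ p
  have f3 : rho β₁ γ p ^ 2 = (‖p.1‖ ^ β₁) ^ 2 + (‖p.2‖ ^ γ) ^ 2 := sq_sqrt (by positivity)
  have g1 : 0 ≤ ‖p.1‖ ^ β₁ := by positivity
  have g2 : 0 ≤ ‖p.2‖ ^ γ := by positivity
  have : rho β₁ γ x ≤ rho β₁ γ p + (t - s) := by
    rw [rho, sqrt_le_left (by linarith)]
    calc (‖x.1‖ ^ β₁) ^ 2 + (‖x.2‖ ^ γ) ^ 2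
        ≤ (‖p.1‖ ^ β₁ + (t - s) / 2) ^ 2 + (‖p.2‖ ^ γ + (t - s) / 2) ^ 2 := by gcongr
      _ ≤ _ := by nlinarith
  linarith

theorem rpow_le_two_mul {β : ℝ} (hβ : 0 ≤ β) (hβ1 : β ≤ 1) {z z0 : ℂ} (h : ‖z - z0‖ ≤ 1 / 2 * ‖z0‖) :
    ‖z‖ ^ β ≤ 2 * ‖z0‖ ^ β := by
  have h1 : ‖z‖ ≤ 2 * ‖z0‖ := by linarith [norm_sub_norm_le z z0, norm_nonneg z0]
  calc ‖z‖ ^ β ≤ (2 * ‖z0‖) ^ β := by gcongr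
    _ = 2 ^ β * ‖z0‖ ^ β := mul_rpow zero_le_two (norm_nonneg _)
    _ ≤ _ := by
      gcongr
      calc (2 : ℝ) ^ β ≤ 2 ^ (1 : ℝ) := Real.rpow_le_rpow_of_exponent_le one_le_two hβ1
        _ = 2 := rpow_one 2

/-- At a scale that is separated from `|z|^β`, the cone `C_β` looks near `z` like a cone with apex
`z0 = 0` or like a plane. -/
theorem exists_isScaling {β δ e : ℝ} (hβ : 0 < β) (hβ1 : β < 1) (hδ : 0 < δ) (he : 0 < e) :
    ∃ M h₀ : ℝ, 1 ≤ M ∧ 0 < h₀ ∧ ∀ (h : ℝ) (z : ℂ), 0 < h → h < h₀ → ‖z‖ ≤ 1 →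
      IsSeparated M h (‖z‖ ^ β) → ∃ (b : ℝ) (z0 : ℂ) (κ : ℝ) (X0 : ℂ), 0 < b ∧ b ≤ 1 ∧
        IsScaling β b h (δ / 4) z0 κ ∧ z0 + κ * X0 = z ∧ ‖X0‖ ^ b ≤ δ ∧
        (∀ X : ℂ, ‖X‖ ^ b < 8 → ‖κ * X‖ ≤ e) ∧
        ((M * ‖z‖ ^ β ≤ h ∧ b = β ∧ z0 = 0 ∧ κ = h ^ (1 / β)) ∨ (M * h ≤ ‖z‖ ^ β ∧ b = 1 ∧ z0 = z ∧
            ∀ X : ℂ, ‖X‖ ^ b < 8 → ‖κ * X‖ ≤ 1 / 2 * ‖z‖)) := by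
  obtain ⟨ζ, hζ, hreg⟩ := exists_isScaling_regular hβ (δ := δ / 4) (η := 1 / 2) (by positivity)
    (by norm_num)
  refine ⟨max 1 (max (1 / ζ) (1 / δ)), min (e ^ β / 8) (e * β / 8), le_max_left _ _,
    by positivity, fun h z hh hh0 hz hsep => ?_⟩
  have hM0 : 0 < max 1 (max (1 / ζ) (1 / δ)) := by positivity
  have hM1 : 1 / ζ ≤ max 1 (max (1 / ζ) (1 / δ)) := (le_max_left _ _).trans (le_max_right _ _)
  have hM2 : 1 / δ ≤ max 1 (max (1 / ζ) (1 / δ)) := (le_max_right _ _).trans (le_max_right _ _)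
  set M := max 1 (max (1 / ζ) (1 / δ))
  rw [lt_min_iff] at hh0
  rcases hsep with hsep | hsep
  · have hk : ((h ^ (1 / β) : ℝ) : ℂ) ≠ 0 := ofReal_ne_zero.2 (Real.rpow_pos_of_pos hh _).ne'
    have hX : ((h ^ (1 / β) : ℝ) : ℂ) * (z / (h ^ (1 / β) : ℝ)) = z := mul_div_cancel₀ _ hk
    refine ⟨β, 0, h ^ (1 / β), z / (h ^ (1 / β) : ℝ), hβ, hβ1.le,
      isScaling_apex hβ hβ1 hh (by positivity), by rw [zero_add, hX], ?_, fun X hX8 => ?_,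
      Or.inl ⟨hsep, rfl, rfl, rfl⟩⟩
    · have h1 := norm_rpow_inv_mul hβ.ne' hh.le (z / (h ^ (1 / β) : ℝ))
      rw [hX] at h1
      have h2 : 1 / δ * (h * ‖z / (h ^ (1 / β) : ℝ)‖ ^ β) ≤ h := by
        rw [← h1]; exact (by gcongr : _ ≤ M * ‖z‖ ^ β).trans hsep
      rw [one_div_mul_eq_div, div_le_iff₀ hδ] at h2
      exact le_of_mul_le_mul_left h2 hh
    · refine le_of_not_gt fun hcon => ?_
      have h1 := Real.rpow_lt_rpow he.le hcon hβ
      rw [norm_rpow_inv_mul hβ.ne' hh.le] at h1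
      nlinarith [hh0.1]
  · have hz0 : z ≠ 0 := by
      rintro rfl
      rw [norm_zero, zero_rpow hβ.ne'] at hsep
      nlinarith
    obtain ⟨s1, s2⟩ := hreg h z hz0 hh (by
      have : 1 / ζ * h ≤ ‖z‖ ^ β := (by gcongr : _ ≤ M * h).trans hsep
      rwa [one_div_mul_eq_div, div_le_iff₀ hζ, mul_comm] at this)
    refine ⟨1, z, _, 0, one_pos, le_rfl, s1, by simp, by simpa using hδ.le, fun X hX => ?_,
      Or.inr ⟨hsep, rfl, rfl, s2⟩⟩
    rw [rpow_one] at hX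
    rw [norm_ofReal_mul s1.pos.le]
    have h1 : 1 ≤ ‖z‖ ^ (β - 1) :=
      Real.one_le_rpow_of_pos_of_le_one_of_nonpos (norm_pos_iff.2 hz0) hz (by linarith)
    calc h / (β * ‖z‖ ^ (β - 1)) * ‖X‖ ≤ h / (β * 1) * 8 := by gcongr
      _ ≤ e := by rw [mul_one, div_mul_eq_mul_div, div_le_iff₀ hβ]; linarith [hh0.2]

namespace GluingData

theorem norm_le_one (H : 𝓖) {s : ℝ} (hs : s ≤ 1) {p : ℂ²}
    (hp : p ∈ rhoBall β₁ γ s) : ‖p.1‖ ≤ 1 ∧ ‖p.2‖ ≤ 1 :=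
  ⟨norm_le_one_of_rpow_le H.pos₁ ((fst_rpow_le_rho β₁ γ p).trans (hp.le.trans hs)),
    norm_le_one_of_rpow_le H.pos ((snd_rpow_le_rho β₁ γ p).trans (hp.le.trans hs))⟩

end GluingData

local notation:max "conical" t:max δ:max => IsConical (dist_ω t) cones (40 * δ)

namespace GluingData

set_option maxHeartbeats 800000 in
/-- Balls whose scale is separated from `r` and `R`, and which are large compared with `|z|^γ` or
far from the lines `{w = a_j z}`, are close to balls in products of the cones `C_β₁`, `C_γ`,
`ℂ`. -/
theorem exists_isConical_product (H : 𝓖) {δ s t : ℝ} (hδ : 0 < δ)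
    (hδ1 : δ ≤ 1 / 100) (hst : s < t) (ht : t ≤ 1)
    (hdef : ∀ x y, dist_ω t x y = 0 → x = y) :
    ∃ M M1 τ h₀ : ℝ, 1 ≤ M ∧ 1 ≤ M1 ∧ 0 < τ ∧ 0 < h₀ ∧ ∀ p ∈ rhoBall β₁ γ s, ‖p.1‖ ^ β₁ < τ →
      ∀ h, 0 < h → h < h₀ → IsSeparated M h (‖p.1‖ ^ β₁) → IsSeparated M h (‖p.2‖ ^ γ) →
      (M * ‖p.1‖ ^ γ ≤ h ∨ M1 * ‖p.1‖ ≤ ‖p.2‖) →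
      conical t δ p h := by
  have hγ := H.pos
  have hγ1 := H.γ_lt_one
  have hβ1 := H.pos₁
  have hβγ := H.lt_γ
  obtain ⟨N, τ, η, hN, hτ, hη, main⟩ := H.exists_ghEDist_le_of_isScaling hδ hδ1
  obtain ⟨κ, hκ, hrho⟩ := exists_rho_lt hβ1 hβγ.le hγ1.le hst
  obtain ⟨m1, k1, hm1, hk1, sc1⟩ := exists_isScaling hβ1 (hβγ.trans hγ1) hδ (half_pos hκ)
  obtain ⟨m2, k2, hm2, hk2, sc2⟩ := exists_isScaling hγ hγ1 hδ (half_pos hκ)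
  -- `(8h)^(γ/β₁) ≤ η h` for small `h`
  obtain ⟨k3, hk3, -, hsm⟩ := exists_small (β := 1) (e := γ / β₁ - 1) (C := 8) one_pos
    (by rw [sub_pos, one_lt_div hβ1]; exact hβγ) (by norm_num) hη
  set M := max (max m1 m2) (max (17 * N) (2 / η)) with hM
  have hMm : m1 ≤ M ∧ m2 ≤ M ∧ 17 * N ≤ M ∧ 2 / η ≤ M := by simp [hM]
  have hM1 : 1 < M := by linarith
  have hM0 : 0 < M := by linarith
  refine ⟨M, 4 * N, τ / 2, min (min k1 k2) (min (k3 / 8) (min (τ / 8) (1 / 8))), by linarith,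
    by linarith, by positivity, by positivity, fun p hp hpr h hh hh0 hs1 hs2 hc => ?_⟩
  simp only [lt_min_iff] at hh0
  obtain ⟨⟨hhk1, hhk2⟩, hhk3, hhτ, hh8⟩ := hh0
  obtain ⟨hp1, hp2⟩ := H.norm_le_one (hst.le.trans ht) hp
  have r0 : 0 ≤ ‖p.1‖ ^ β₁ := by positivity
  have R0 : 0 ≤ ‖p.2‖ ^ γ := by positivity
  obtain ⟨b1, z0, κ1, X1, hb1, hb11, S1, hX1, hX1δ, hX1e, c1⟩ :=
    sc1 h p.1 hh hhk1 hp1 (hs1.mono hMm.1 hh.le r0)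
  obtain ⟨b2, w0, κ2, X2, hb2, hb21, S2, hX2, hX2δ, hX2e, c2⟩ :=
    sc2 h p.2 hh hhk2 hp2 (hs2.mono hMm.2.1 hh.le R0)
  have hpX : affineChart z0 w0 0 κ1 κ2 (X1, X2) = p := by
    ext
    · exact hX1
    · simpa [affineChart] using hX2
  have hpow : ∀ {x y : ℝ}, 0 ≤ x → 0 ≤ y → x ^ γ ≤ y ^ γ → x ≤ y := fun hx hy hxy =>
    le_of_not_gt fun hcon => absurd (Real.rpow_lt_rpow hy hcon hγ) (not_lt.2 hxy)
  -- the size of the first coordinate in the chart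
  have hz8 : ∀ y : ℂ, ‖y‖ ^ b1 < 8 → z0 = 0 ∧ ‖z0 + κ1 * y‖ ^ β₁ < 8 * h ∨
      z0 = p.1 ∧ ‖z0 + κ1 * y - p.1‖ ≤ 1 / 2 * ‖p.1‖ := by
    intro y hy
    rcases c1 with ⟨-, rfl, rfl, rfl⟩ | ⟨-, rfl, rfl, hk⟩
    · left
      rw [zero_add, norm_rpow_inv_mul hβ1.ne' hh.le]
      exact ⟨rfl, by nlinarith⟩
    · right
      rw [add_sub_cancel_left]
      exact ⟨rfl, hk y hy⟩
  have hmul : ∀ {A x : ℝ}, 1 ≤ A → 0 ≤ x → (A * x) ^ γ ≤ A * x ^ γ := fun {A x} hA hx => by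
    rw [mul_rpow (by linarith) hx]
    gcongr
    exact (Real.rpow_le_rpow_of_exponent_le hA hγ1.le).trans (rpow_one _).le
  have gh := main (rhoBall β₁ γ t) b1 b2 h z0 w0 κ1 κ2 (X1, X2) hdef hb1 hb11 hb2 hb21 hh S1 S2
    (fun X hX => hrho p _ hp (by
        rw [← hX1]
        have e : (affineChart z0 w0 0 κ1 κ2 X).1 - (z0 + κ1 * X1) = κ1 * X.1 - κ1 * X1 := by
          simp [affineChart]
        rw [e]
        exact (norm_sub_le _ _).trans (by linarith [hX1e X.1 hX.1, hX1e X1 (by linarith)]))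
      (by
        rw [← hX2]
        have e : (affineChart z0 w0 0 κ1 κ2 X).2 - (w0 + κ2 * X2) = κ2 * X.2 - κ2 * X2 := by
          simp [affineChart]
        rw [e]
        exact (norm_sub_le _ _).trans (by linarith [hX2e X.2 hX.2, hX2e X2 (by linarith)])))
    (fun y hy => by
      rcases hz8 y hy with h1 | h1
      · linarith [h1.2]
      · exact (rpow_le_two_mul hβ1.le (hβγ.trans hγ1).le h1.2).trans_lt (by linarith))
    (by
      rcases c2 with ⟨hR, rfl, rfl, rfl⟩ | ⟨hR, rfl, rfl, hk⟩
      · refine Or.inl ⟨rfl, rfl, rfl, fun y hy => ?_⟩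
        rcases hz8 y hy with h1 | h1
        · have h2 := (hsm ((8 * h : ℝ) : ℂ) (by
            rw [rpow_one, norm_real, norm_of_nonneg (by positivity)]
            linarith)).1
          rw [norm_real, norm_of_nonneg (by positivity)] at h2
          calc ‖z0 + κ1 * y‖ ^ b2 = (‖z0 + κ1 * y‖ ^ β₁) ^ (b2 / β₁) := by
                rw [← rpow_mul (norm_nonneg _), mul_div_cancel₀ _ hβ1.ne']
            _ ≤ (8 * h) ^ (b2 / β₁) := by gcongr; exact h1.2.le
            _ = (8 * h) ^ (b2 / β₁ - 1) * (8 * h) := by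
                rw [← rpow_add_one (by positivity), sub_add_cancel]
            _ ≤ η * h := by nlinarith
        · refine (rpow_le_two_mul hγ.le hγ1.le h1.2).trans ?_
          have h3 : M * ‖p.1‖ ^ b2 ≤ h := by
            rcases hc with hc | hc
            · exact hc
            · refine (mul_le_mul_of_nonneg_left ?_ hM0.le).trans (hs2.mul_le hM1 hm2 R0 hh hR)
              gcongr; nlinarith [norm_nonneg p.1]
          have h4 : 2 / η * ‖p.1‖ ^ b2 ≤ h := le_trans (by gcongr; exact hMm.2.2.2) h3
          rw [div_mul_eq_mul_div, div_le_iff₀ hη] at h4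
          linarith
      · right
        intro X hX
        have hR' := hs2.le_mul hM1 hm2 hh hR
        have h3 : 2 * N * ‖z0 + κ1 * X.1‖ < ‖p.2‖ := by
          rcases hz8 X.1 hX.1 with h1 | h1
          · refine lt_of_not_ge fun hcon => ?_
            have h4 := norm_le_one_of_rpow_le hβ1 (h1.2.le.trans (by linarith))
            have h5 := Real.rpow_le_rpow_of_exponent_ge' (norm_nonneg _) h4 hβ1.le hβγ.le
            have h6 := (rpow_le_rpow (norm_nonneg _) hcon hγ.le).trans
              (hmul (by linarith : 1 ≤ 2 * N) (norm_nonneg _))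
            nlinarith
          · have h2 : 4 * N * ‖p.1‖ ≤ ‖p.2‖ := by
              rcases hc with hc | hc
              · refine hpow (by positivity) (norm_nonneg _)
                  ((hmul (by linarith : 1 ≤ 4 * N) (norm_nonneg _)).trans ?_)
                have : 4 * N * ‖p.1‖ ^ γ ≤ M * ‖p.1‖ ^ γ := by gcongr; linarith
                nlinarith
              · exact hc
            have h4 : 0 < ‖p.2‖ := by
              refine (norm_nonneg _).lt_of_ne fun h0 => ?_
              rw [← h0, zero_rpow hγ.ne'] at hR'
              nlinarith
            have h5 : ‖z0 + κ1 * X.1‖ ≤ 3 / 2 * ‖p.1‖ := by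
              have := norm_sub_norm_le (z0 + κ1 * X.1) p.1; linarith [h1.2]
            nlinarith
        have h4 := norm_sub_le (p.2 + κ2 * X.2) (κ2 * X.2)
        rw [add_sub_cancel_right] at h4
        linarith [hk X.2 hX.2])
    hX1δ hX2δ
  rw [hpX] at gh
  rcases c1 with ⟨-, rfl, -, -⟩ | ⟨-, rfl, -, -⟩ <;> rcases c2 with ⟨-, rfl, -, -⟩ | ⟨-, rfl, -, -⟩
  · exact ⟨(b1, b2), by simp [modelCones], gh⟩
  · exact ⟨(b1, 1), by simp [modelCones], gh⟩
  · exact ⟨(b2, 1), by simp [modelCones], (ghEDist_cone_swap_le _ _ _).trans gh⟩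
  · exact ⟨(1, 1), by simp [modelCones], gh⟩

end GluingData

theorem exists_flatDensity_close (β₂ β₃ : ℝ) (a₂ a₃ : ℂ) {δ : ℝ} (hδ : 0 < δ) (hδ1 : δ ≤ 1) :
    ∃ η : ℝ, 0 < η ∧ η ≤ 1 / 2 ∧ ∀ u u0 : ℂ, u0 ≠ a₂ → u0 ≠ a₃ → ‖u - u0‖ ≤ η * ‖u0 - a₂‖ →
      ‖u - u0‖ ≤ η * ‖u0 - a₃‖ → |flatDensity β₂ β₃ a₂ a₃ u - flatDensity β₂ β₃ a₂ a₃ u0|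
        ≤ δ * flatDensity β₂ β₃ a₂ a₃ u0 := by
  obtain ⟨η2, hη2, hη, k₂⟩ := exists_norm_rpow_close (2 * β₂ - 2) (δ := δ / 3) (by positivity)
  obtain ⟨η3, hη3, -, k₃⟩ := exists_norm_rpow_close (2 * β₃ - 2) (δ := δ / 3) (by positivity)
  refine ⟨min η2 η3, by positivity, (min_le_left _ _).trans hη, fun u u0 h2 h3 d2 d3 => ?_⟩
  have r2 := k₂ (u - a₂) (u0 - a₂) (sub_ne_zero.2 h2) (by
    rw [sub_sub_sub_cancel_right]; exact d2.trans (by gcongr; exact min_le_left _ _))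
  have r3 := k₃ (u - a₃) (u0 - a₃) (sub_ne_zero.2 h3) (by
    rw [sub_sub_sub_cancel_right]; exact d3.trans (by gcongr; exact min_le_right _ _))
  unfold flatDensity
  set p := ‖u - a₂‖ ^ (2 * β₂ - 2)
  set q := ‖u - a₃‖ ^ (2 * β₃ - 2)
  set p0 := ‖u0 - a₂‖ ^ (2 * β₂ - 2)
  set q0 := ‖u0 - a₃‖ ^ (2 * β₃ - 2)
  have hq : 0 ≤ q := by positivity
  have hp₀ : 0 ≤ p0 := by positivity
  have hq0 : 0 ≤ q0 := by positivity
  have hq2 : q ≤ 2 * q0 := by nlinarith [(abs_le.1 r3).2]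
  calc |p * q - p0 * q0| = |(p - p0) * q + p0 * (q - q0)| := by congr 1; ring
    _ ≤ |p - p0| * q + p0 * |q - q0| := by
      refine (abs_add_le _ _).trans_eq ?_
      rw [abs_mul, abs_mul, abs_of_nonneg hq, abs_of_nonneg hp₀]
    _ ≤ δ / 3 * p0 * (2 * q0) + p0 * (δ / 3 * q0) := by gcongr
    _ = _ := by ring

/-- At `x`, the metric is `δ`-close to the fibre metric with base coefficient `fibreCoeff β₁ γ c`. -/
def IsFibreClose (β₁ β₂ β₃ γ α₀ : ℝ) (a₂ a₃ : ℂ) (χ : ℝ → ℝ) (δ c : ℝ) (x : ℂ²) : Prop :=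
  ∀ v, |approxForm β₁ β₂ β₃ γ α₀ a₂ a₃ χ x v
      - fibreForm γ (flatDensity β₂ β₃ a₂ a₃) (fibreCoeff β₁ γ c x.1) x v|
    ≤ δ * fibreForm γ (flatDensity β₂ β₃ a₂ a₃) (fibreCoeff β₁ γ c x.1) x v

local notation "close" => IsFibreClose β₁ β₂ β₃ γ α₀ a₂ a₃ χ

namespace GluingData

theorem exists_ghEDist_fibre_le (H : 𝓖) {δ s t : ℝ} (hδ : 0 < δ)
    (hδ1 : δ ≤ 1 / 100) (hst : s < t) (ht : t ≤ 1) (hdef : ∀ x y, dist_ω t x y = 0 → x = y)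
    (L : ℝ) : ∃ M h0 e : ℝ, 1 ≤ M ∧ 0 < h0 ∧ 0 < e ∧
      ∀ p ∈ rhoBall β₁ γ s, p.1 ≠ 0 → ∀ (h b κ c : ℝ) (u0 X2 : ℂ), 0 < h → h < h0 → 0 < b → b ≤ 1 →
      0 < κ → M * h ≤ ‖p.1‖ ^ β₁ → p.2 / p.1 = u0 + κ * X2 → ‖X2‖ ^ b ≤ δ →
      IsSubordinate β₁ γ c p.1 →
      (∀ X : ℂ, ‖X‖ ^ b < 8 → ‖u0 + κ * X‖ ≤ L ∧ ‖p.1‖ * ‖κ * X‖ ≤ e ∧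
        (u0 + κ * X ≠ a₂ ∧ u0 + κ * X ≠ a₃ ↔ (b ≠ 1 → X ≠ 0)) ∧
        |(γ * ‖p.1‖ ^ γ) ^ 2 * dens (u0 + κ * X) * κ ^ 2 - (h * (b * ‖X‖ ^ (b - 1))) ^ 2|
          ≤ δ / 16 * (h * (b * ‖X‖ ^ (b - 1))) ^ 2 ∧
        ∀ x ∈ rhoBall β₁ γ t ∩ 𝓡, ‖x.1 - p.1‖ ≤ 1 / 2 * ‖p.1‖ →
          x.2 / x.1 = u0 + κ * X → close (δ / 4) c x) →
      ghEDist (rescaledBallDist (dist_ω t) p h) (rescaledBallDist (coneDist 1 b) 0 1)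
        ≤ ofReal (40 * δ) := by
  have hβ1 := H.pos₁
  obtain ⟨ζ, hζ, main⟩ := H.exists_ghEDist_le_of_fibre hδ hδ1
  obtain ⟨κ', hκ', hrho⟩ := exists_rho_lt hβ1 H.lt_γ.le H.γ_lt_one.le hst
  set e := κ' / 4
  set h1 := κ' * β₁ / (32 * (|L| + 1))
  have hh1 : 16 * h1 / β₁ * (|L| + 1) = κ' / 2 := by simp only [h1]; field_simp; norm_num
  refine ⟨max 1 (1 / ζ), h1, e, le_max_left _ _, by positivity, by positivity, ?_⟩
  intro p hp hp0 h b κ c u0 X2 hh hh0 hb hb1 hκ hM hpu hX2 hc hX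
  have hle : h ≤ ζ * ‖p.1‖ ^ β₁ := by
    have : 1 / ζ * h ≤ ‖p.1‖ ^ β₁ := (by gcongr; exact le_max_right _ _ : _ ≤ _ * h).trans hM
    rwa [one_div_mul_eq_div, div_le_iff₀ hζ, mul_comm] at this
  have hp2 : (p.1, p.1 * (u0 + κ * X2)) = p := by rw [← hpu, mul_div_cancel₀ _ hp0]
  have hL := abs_nonneg L
  have gh := main (rhoBall β₁ γ t) b h κ c p.1 u0 X2 hdef hb hb1 hh hp0
    (H.norm_le_one (hst.le.trans ht) hp).1 hle hc hκ (fun z X hz1 hz2 hX8 => by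
      obtain ⟨k1, k2, -, -, k3⟩ := hX X hX8
      have hzs : ‖z - p.1‖ * (|L| + 1) ≤ κ' / 2 := by
        rw [← hh1]; gcongr; exact hz2.trans (by gcongr)
      have hU : (z, z * (u0 + κ * X)) ∈ rhoBall β₁ γ t := by
        refine hrho p _ hp (by dsimp only; nlinarith [norm_nonneg (z - p.1)]) ?_
        have e1 : z * (u0 + κ * X) - p.2
            = (z - p.1) * (u0 + κ * X) + (p.1 * (κ * X) - p.1 * (κ * X2)) := by
          rw [← hp2]; ring
        dsimp only
        rw [e1]
        refine (norm_add_le _ _).trans ?_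
        have k4 := (hX X2 (by linarith)).2.1
        rw [norm_mul]
        have k5 := norm_sub_le (p.1 * (κ * X)) (p.1 * (κ * X2))
        rw [norm_mul p.1, norm_mul p.1] at k5
        have k6 : ‖z - p.1‖ * ‖u0 + κ * X‖ ≤ ‖z - p.1‖ * (|L| + 1) := by
          gcongr; linarith [le_abs_self L]
        simp only [e] at k2 k4
        linarith
      refine ⟨hU, fun hl => k3 _ ⟨hU, hl⟩ hz1 ?_⟩
      rw [mul_div_cancel_left₀ _ hl.1])
    (fun X hX8 => ⟨(hX X hX8).2.2.1, (hX X hX8).2.2.2.1⟩) hX2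
  rwa [hp2] at gh

/-- Balls around points away from the lines `{w = a_j z}`, at scales small compared with the
distance to these lines, are nearly flat. -/
theorem exists_isConical_regular (H : 𝓖) {δ s t : ℝ} (hδ : 0 < δ)
    (hδ1 : δ ≤ 1 / 100) (hst : s < t) (ht : t ≤ 1) (hdef : ∀ x y, dist_ω t x y = 0 → x = y)
    (M1 : ℝ) : ∃ M h0 : ℝ, 1 ≤ M ∧ 0 < h0 ∧
      ∀ p ∈ rhoBall β₁ γ s, p ∈ 𝓡 → ‖p.2 / p.1‖ ≤ M1 → ∀ h c : ℝ, 0 < h → h < h0 →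
      M * h ≤ ‖p.1‖ ^ β₁ → IsSubordinate β₁ γ c p.1 →
      M * h ≤ ‖p.1‖ ^ γ * (√(dens (p.2 / p.1)) * ‖p.2 / p.1 - a₂‖) →
      M * h ≤ ‖p.1‖ ^ γ * (√(dens (p.2 / p.1)) * ‖p.2 / p.1 - a₃‖) →
      (∀ x ∈ rhoBall β₁ γ t ∩ 𝓡, ‖x.1 - p.1‖ ≤ 1 / 2 * ‖p.1‖ →
        ‖x.2 / x.1 - p.2 / p.1‖ ≤ ‖p.2 / p.1 - a₂‖ → close (δ / 4) c x) →
      conical t δ p h := by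
  have hγ := H.pos
  have hγ1 := H.γ_lt_one
  obtain ⟨η, hη, hη1, hd⟩ := exists_flatDensity_close β₂ β₃ a₂ a₃ (δ := δ / 16) (by positivity)
    (by linarith)
  obtain ⟨M, h0, e, hM, hh₀, he, main⟩ := H.exists_ghEDist_fibre_le hδ hδ1 hst ht hdef
    (2 * |M1| + ‖a₂‖)
  obtain ⟨g0, hg, hgd⟩ := H.toIsCentredPair.exists_le_flatDensity M1
  have hg0 := sqrt_pos.2 hg
  refine ⟨max M (8 / (γ * η)), min h0 (e * γ * √g0 / 8), hM.trans (le_max_left _ _),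
    by positivity, ?_⟩
  intro p hp hl hu h c hh hh0 hr hc h2 h3 hcl
  rw [lt_min_iff] at hh0
  set u0 := p.2 / p.1 with hu0
  have hp0 : 0 < ‖p.1‖ := norm_pos_iff.2 hl.1
  have hne : u0 ≠ a₂ ∧ u0 ≠ a₃ := by rw [hu0, Ne, Ne, div_eq_iff hl.1, div_eq_iff hl.1]; exact hl.2
  have hd0 := Real.sqrt_le_sqrt (hgd u0 hu hne.1 hne.2)
  have hd1 : 0 < √(dens u0) := hg0.trans_le hd0
  set κ := h / (γ * ‖p.1‖ ^ γ * √(dens u0)) with hκ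
  have hκ0 : 0 < κ := by positivity
  have hκη : ∀ r, max M (8 / (γ * η)) * h ≤ ‖p.1‖ ^ γ * (√(dens u0) * r) → 8 * κ ≤ η * r := by
    intro r hr
    have : 8 / (γ * η) * h ≤ ‖p.1‖ ^ γ * (√(dens u0) * r) :=
      (by gcongr; exact le_max_right _ _ : _ ≤ _ * h).trans hr
    rw [div_mul_eq_mul_div, div_le_iff₀ (by positivity)] at this
    rw [hκ, mul_div_assoc', div_le_iff₀ (by positivity)]
    linarith
  have hk2 := hκη _ h2
  have hk3 := hκη _ h3
  have h8 : ∀ X : ℂ, ‖X‖ ^ (1 : ℝ) < 8 → ‖(κ : ℂ) * X‖ ≤ 8 * κ := fun X hX => by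
    rw [rpow_one] at hX
    rw [norm_ofReal_mul hκ0.le]
    nlinarith
  have hw : ‖u0 - a₂‖ ≤ |M1| + ‖a₂‖ := (norm_sub_le _ _).trans (by linarith [le_abs_self M1])
  refine ⟨(1, 1), by simp [modelCones], main p hp hl.1 h 1 κ c u0 0 hh hh0.1 one_pos le_rfl hκ0
    (le_trans (by gcongr; exact le_max_left _ _) hr) (by simp [hu0])
    (by simpa using hδ.le) hc fun X hX => ⟨?_, ?_, ?_, ?_, ?_⟩⟩
  · have := norm_add_le u0 (κ * X)
    nlinarith [h8 X hX, le_abs_self M1, norm_nonneg (u0 - a₂)]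
  · have h5 : ‖p.1‖ ≤ ‖p.1‖ ^ γ := by
      simpa using rpow_le_rpow_of_exponent_ge hp0 (H.norm_le_one (hst.le.trans ht) hp).1 hγ1.le
    calc ‖p.1‖ * ‖(κ : ℂ) * X‖ ≤ ‖p.1‖ ^ γ * (8 * κ) := by gcongr; exact h8 X hX
      _ = 8 * h / (γ * √(dens u0)) := by rw [hκ]; field_simp
      _ ≤ 8 * h / (γ * √g0) := by gcongr
      _ ≤ e := by rw [div_le_iff₀ (by positivity)]; linarith [hh0.2]
  · have key : ∀ a, u0 ≠ a → 8 * κ ≤ η * ‖u0 - a‖ → u0 + κ * X ≠ a := by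
      rintro _ ha hk rfl
      have := norm_sub_pos_iff.2 ha
      rw [sub_add_cancel_left, norm_neg] at hk this
      nlinarith [h8 X hX]
    simpa using ⟨key _ hne.1 hk2, key _ hne.2 hk3⟩
  · have k := hd (u0 + κ * X) u0 hne.1 hne.2 (by simpa using (h8 X hX).trans hk2)
      (by simpa using (h8 X hX).trans hk3)
    have h6 : (γ * ‖p.1‖ ^ γ) ^ 2 * κ ^ 2 * dens u0 = h ^ 2 := by
      rw [hκ]; field_simp
      exact (sq_sqrt flatDensity_nonneg).symm
    have h7 : (h * (1 * ‖X‖ ^ ((1 : ℝ) - 1))) ^ 2 = h ^ 2 := by simp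
    rw [h7, ← h6, show ∀ a b c d : ℝ, a * b * c - a * c * d = a * c * (b - d) from
      fun _ _ _ _ => by ring, abs_mul, abs_of_nonneg (by positivity)]
    refine (mul_le_mul_of_nonneg_left k (by positivity)).trans_eq (by ring)
  · intro x hx hx1 hx2
    refine hcl x hx hx1 ?_
    rw [hx2, add_sub_cancel_left]
    nlinarith [h8 X hX, norm_nonneg (u0 - a₂)]


/-- Around points close to the line `{w = a₂ z}` and at scales small compared with `|z|^γ`, a ball
is close to one in `C_β₂ × ℂ` centred at the apex if its scale is large compared with the distance
`|z|^γ |w/z - a₂|^β₂` to the line. -/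
theorem exists_isConical_apex (H : 𝓖) {δ s t ν : ℝ} (hδ : 0 < δ)
    (hδ1 : δ ≤ 1 / 100) (hst : s < t) (ht : t ≤ 1) (hdef : ∀ x y, dist_ω t x y = 0 → x = y)
    (hν : 0 < ν) : ∃ M h₀ : ℝ, 1 ≤ M ∧ 0 < h₀ ∧
      ∀ p ∈ rhoBall β₁ γ s, p.1 ≠ 0 → ∀ h c : ℝ, 0 < h → h < h₀ → M * h ≤ ‖p.1‖ ^ γ →
      IsSubordinate β₁ γ c p.1 → M * (‖p.1‖ ^ γ * ‖p.2 / p.1 - a₂‖ ^ β₂) ≤ h →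
      (∀ x ∈ rhoBall β₁ γ t ∩ 𝓡, ‖x.2 / x.1 - a₂‖ < ν → close (δ / 4) c x) →
      conical t δ p h := by
  have hγ := H.pos
  have hγ1 := H.γ_lt_one
  have hβ2 := H.pos₂
  have hd : 0 < ‖a₂ - a₃‖ := norm_sub_pos_iff.2 H.ne
  obtain ⟨η, hη, hη1, hc3⟩ := exists_norm_rpow_close (2 * β₃ - 2) (δ := δ / 16) (by positivity)
  obtain ⟨M, h₀, e, hM, hh₀, he, main⟩ := H.exists_ghEDist_fibre_le hδ hδ1 hst ht hdef
    (‖a₂‖ + ‖a₂ - a₃‖)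
  set g := ‖a₂ - a₃‖ ^ (β₃ - 1) with hg
  have hg0 : 0 < g := by positivity
  set m := min ν (η * ‖a₂ - a₃‖)
  have hm : 0 < m := by positivity
  set K := γ * g / β₂ with hK
  have hK0 : 0 < K := by positivity
  refine ⟨max M (max (8 / (K * m ^ β₂)) (K / δ)), min h₀ (e ^ β₂ * K / 8),
    hM.trans (le_max_left _ _), by positivity, ?_⟩
  intro p hp hp0 h c hh hh0 hr hc hF hcl
  rw [lt_min_iff] at hh0
  set N := max M (max (8 / (K * m ^ β₂)) (K / δ))
  have hN : M ≤ N ∧ 8 / (K * m ^ β₂) ≤ N ∧ K / δ ≤ N := by simp [N]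
  set u0 := p.2 / p.1
  have hp0' : 0 < ‖p.1‖ := norm_pos_iff.2 hp0
  have hp1 := (H.norm_le_one (hst.le.trans ht) hp).1
  set C := ‖p.1‖ ^ γ with hC
  have hC0 : 0 < C := by positivity
  set h' := h / (C * K) with hh'
  have hh'0 : 0 < h' := by positivity
  set κ := h' ^ (1 / β₂)
  have hκ0 : 0 < κ := by positivity
  have hκX : ∀ X : ℂ, ‖(κ : ℂ) * X‖ ^ β₂ = h' * ‖X‖ ^ β₂ := norm_rpow_inv_mul hβ2.ne' hh'0.le
  have hpow : ∀ {x y : ℝ}, 0 ≤ y → x ^ β₂ < y ^ β₂ → x < y := fun hy hxy =>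
    lt_of_not_ge fun hcon => absurd (rpow_le_rpow hy hcon hβ2.le) (not_le.2 hxy)
  have h8 : ∀ X : ℂ, ‖X‖ ^ β₂ < 8 → ‖(κ : ℂ) * X‖ < m := fun X hX => hpow hm.le (by
    have h1 : 8 / (K * m ^ β₂) * h ≤ C := le_trans (by gcongr; exact hN.2.1) hr
    rw [div_mul_eq_mul_div, div_le_iff₀ (by positivity)] at h1
    have h2 : 8 * h' ≤ m ^ β₂ := by rw [hh', mul_div_assoc', div_le_iff₀ (by positivity)]; linarith
    rw [hκX]
    nlinarith)
  have hmη : m ≤ η * ‖a₂ - a₃‖ := min_le_right _ _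
  refine ⟨(β₂, 1), by simp [modelCones], (ghEDist_cone_swap_le _ _ _).trans
    (main p hp hp0 h β₂ κ c a₂ ((u0 - a₂) / κ) hh hh0.1 hβ2 H.lt₂.le hκ0 ?_ ?_ ?_ hc
      fun X hX => ⟨?_, ?_, ?_, ?_, ?_⟩)⟩
  · exact (mul_le_mul_of_nonneg_right hN.1 hh.le).trans (hr.trans
      (rpow_le_rpow_of_exponent_ge hp0' hp1 H.lt_γ.le))
  · rw [mul_div_cancel₀ _ (by exact_mod_cast hκ0.ne'), add_sub_cancel]
  · have h1 := hκX ((u0 - a₂) / κ)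
    rw [mul_div_cancel₀ _ (by exact_mod_cast hκ0.ne')] at h1
    rw [h1] at hF
    have h2 : K / δ * (C * (h' * ‖(u0 - a₂) / κ‖ ^ β₂)) ≤ h := le_trans (by gcongr; exact hN.2.2) hF
    rw [hh', div_mul_eq_mul_div, div_le_iff₀ hδ,
      show K * (C * (h / (C * K) * ‖(u0 - a₂) / κ‖ ^ β₂)) = h * ‖(u0 - a₂) / κ‖ ^ β₂ by
        field_simp] at h2
    exact le_of_mul_le_mul_left h2 hh
  · refine (norm_add_le _ _).trans ?_
    nlinarith [h8 X hX]
  · refine (hpow he.le ?_).le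
    rw [mul_rpow hp0'.le (norm_nonneg _), hκX]
    have h1 : ‖p.1‖ ^ β₂ ≤ C := rpow_le_rpow_of_exponent_ge hp0' hp1 (by linarith [H.angle, H.lt₃])
    calc ‖p.1‖ ^ β₂ * (h' * ‖X‖ ^ β₂) ≤ C * (h' * 8) := by gcongr
      _ = 8 * h / K := by rw [hh']; field_simp
      _ < e ^ β₂ := by rw [div_lt_iff₀ hK0]; linarith [hh0.2]
  · have h1 : a₂ + κ * X ≠ a₃ := fun hcon => by
      have := h8 X hX
      rw [eq_sub_of_add_eq' hcon, norm_sub_rev] at this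
      nlinarith
    simp [h1, H.lt₂.ne, hκ0.ne']
  · have k := hc3 (a₂ + κ * X - a₃) (a₂ - a₃) (sub_ne_zero.2 H.ne) (by
      rw [add_sub_right_comm, add_sub_cancel_left]; exact ((h8 X hX).trans_le hmη).le)
    have hκh : κ ^ (β₂ - 1) * κ = h' := by
      rw [← rpow_add_one hκ0.ne', sub_add_cancel, ← rpow_mul hh'0.le,
        one_div_mul_cancel hβ2.ne', rpow_one]
    have e1 : ‖(κ : ℂ) * X‖ ^ (β₂ - 1) * κ = h' * ‖X‖ ^ (β₂ - 1) := by
      rw [norm_ofReal_mul hκ0.le,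
        mul_rpow hκ0.le (norm_nonneg _), mul_right_comm, hκh]
    have e2 : (h * (β₂ * ‖X‖ ^ (β₂ - 1))) ^ 2
        = (γ * C * (‖(κ : ℂ) * X‖ ^ (β₂ - 1) * κ)) ^ 2 * ‖a₂ - a₃‖ ^ (2 * β₃ - 2) := by
      rw [e1, norm_rpow_two_mul_sub_two, ← hg, hh', hK]; field_simp
    rw [e2, flatDensity, add_sub_cancel_left, norm_rpow_two_mul_sub_two, show ∀ a b c d e : ℝ,
      a ^ 2 * (b ^ 2 * c) * d ^ 2 - (a * (b * d)) ^ 2 * e = (a * (b * d)) ^ 2 * (c - e) from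
      fun _ _ _ _ _ => by ring, abs_mul, abs_of_nonneg (by positivity)]
    exact (mul_le_mul_of_nonneg_left k (by positivity)).trans_eq (by ring)
  · intro x hx _ hx2
    refine hcl x hx ?_
    rw [hx2, add_sub_cancel_left]
    exact (h8 X hX).trans_le (min_le_left _ _)

/-- Around points close to the line `{w = a₂ z}`, balls whose scale is small compared with `|z|^γ`
and separated from the distance to the line are close to balls in `C_β₂ × ℂ` or `ℂ²`. -/
theorem exists_isConical_near (H : 𝓖) {δ s t c : ℝ} (hδ : 0 < δ)
    (hδ1 : δ ≤ 1 / 100) (hst : s < t) (ht : t ≤ 1) (hdef : ∀ x y, dist_ω t x y = 0 → x = y)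
    (hnear : ∀ δ > 0, ∃ ν > 0, ∀ x ∈ rhoBall β₁ γ t ∩ 𝓡, ‖x.2 / x.1 - a₂‖ < ν → close δ c x)
    (hc : ∀ p ∈ rhoBall β₁ γ t, p.1 ≠ 0 → IsSubordinate β₁ γ c p.1) :
    ∃ ν M h₀ : ℝ, 0 < ν ∧ 1 ≤ M ∧ 0 < h₀ ∧ ∀ p ∈ rhoBall β₁ γ s, p.1 ≠ 0 →
      ‖p.2 / p.1 - a₂‖ < ν → ∀ h : ℝ, 0 < h → h < h₀ → M * h ≤ ‖p.1‖ ^ γ →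
      IsSeparated M h (‖p.1‖ ^ γ * ‖p.2 / p.1 - a₂‖ ^ β₂) →
      conical t δ p h := by
  have hd : 0 < ‖a₂ - a₃‖ := norm_sub_pos_iff.2 H.ne
  obtain ⟨ν, hν, hcl⟩ := hnear (δ / 4) (by positivity)
  obtain ⟨M1, h₁, hM1, hh1, apex⟩ := H.exists_isConical_apex hδ hδ1 hst ht hdef hν
  obtain ⟨M2, h₂, hM2, hh2, reg⟩ := H.exists_isConical_regular hδ hδ1 hst ht hdef (‖a₂‖ + ‖a₂ - a₃‖)
  set g := (2 * ‖a₂ - a₃‖) ^ (β₃ - 1)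
  have hg : 0 < g := by positivity
  set M := max M1 (max M2 (M2 / g))
  have hM : M1 ≤ M ∧ M2 ≤ M ∧ M2 / g ≤ M := by simp [M]
  refine ⟨min (ν / 2) (‖a₂ - a₃‖ / 2), M, min h₁ h₂, by positivity, hM1.trans hM.1,
    by positivity, fun p hp hp0 hu h hh hh0 hr hs => ?_⟩
  rw [lt_min_iff] at hh0 hu
  have hp0' : 0 < ‖p.1‖ := norm_pos_iff.2 hp0
  have hp1 := (H.norm_le_one (hst.le.trans ht) hp).1
  have hsub := hc p (lt_trans hp hst) hp0
  rcases hs with hs | hs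
  · exact apex p hp hp0 h c hh hh0.1 (le_trans (by gcongr; exact hM.1) hr) hsub
      (le_trans (by gcongr; exact hM.1) hs) hcl
  have hne : p.2 / p.1 ≠ a₂ := fun h0 => by
    rw [h0, sub_self, norm_zero, zero_rpow H.pos₂.ne', mul_zero] at hs
    nlinarith
  have hu0 : 0 < ‖p.2 / p.1 - a₂‖ := norm_sub_pos_iff.2 hne
  have t1 := norm_sub_le_norm_sub_add_norm_sub a₂ (p.2 / p.1) a₃
  have t2 := norm_sub_le_norm_sub_add_norm_sub (p.2 / p.1) a₂ a₃
  have t3 := norm_le_norm_add_norm_sub' (p.2 / p.1) a₂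
  rw [norm_sub_rev a₂ (p.2 / p.1)] at t1
  have h23 : ‖p.2 / p.1 - a₂‖ ≤ ‖p.2 / p.1 - a₃‖ := by linarith
  have hne3 : p.2 / p.1 ≠ a₃ := norm_sub_pos_iff.1 (hu0.trans_le h23)
  have key : M2 * h ≤ ‖p.1‖ ^ γ * (√(dens (p.2 / p.1)) * ‖p.2 / p.1 - a₂‖) := by
    have h1 : M2 / g * h ≤ ‖p.1‖ ^ γ * ‖p.2 / p.1 - a₂‖ ^ β₂ :=
      le_trans (by gcongr; exact hM.2.2) hs
    rw [div_mul_eq_mul_div, div_le_iff₀ hg] at h1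
    have h2 : √(dens (p.2 / p.1)) = ‖p.2 / p.1 - a₂‖ ^ (β₂ - 1) * ‖p.2 / p.1 - a₃‖ ^ (β₃ - 1) := by
      rw [flatDensity, Real.sqrt_eq_iff_eq_sq (by positivity) (by positivity), mul_pow,
        ← rpow_mul_natCast (norm_nonneg _), ← rpow_mul_natCast (norm_nonneg _)]
      push_cast; ring_nf
    have h3 : g ≤ ‖p.2 / p.1 - a₃‖ ^ (β₃ - 1) := rpow_le_rpow_of_nonpos (hu0.trans_le h23)
      (by linarith) (by linarith [H.lt₃])
    rw [h2, mul_right_comm, ← rpow_add_one hu0.ne', sub_add_cancel, ← mul_assoc]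
    exact h1.trans (by gcongr)
  refine reg p hp ⟨hp0, fun h0 => hne ((div_eq_iff hp0).2 h0), fun h0 => hne3
    ((div_eq_iff hp0).2 h0)⟩ (by linarith) h c hh hh0.2 ?_ hsub key
    (key.trans (by gcongr)) fun x hx _ hx2 => hcl x hx ?_
  · exact (mul_le_mul_of_nonneg_right hM.2.1 hh.le).trans (hr.trans
      (rpow_le_rpow_of_exponent_ge hp0' hp1 H.lt_γ.le))
  · linarith [norm_sub_le_norm_sub_add_norm_sub (x.2 / x.1) (p.2 / p.1) a₂]

end GluingData

theorem approxDist_comm (β₁ β₂ β₃ γ α₀ : ℝ) (a₂ a₃ : ℂ) (χ : ℝ → ℝ) (t : ℝ) :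
    approxDist β₁ β₂ β₃ γ α₀ a₂ a₃ χ t = approxDist β₁ β₃ β₂ γ α₀ a₃ a₂ χ t := by
  have : linesCompl a₂ a₃ = linesCompl a₃ a₂ := by ext x; simp [linesCompl, and_comm]
  rw [approxDist, approxDist, approxForm_comm, this]

theorem modelCones_comm (β₁ β₂ β₃ γ : ℝ) : modelCones β₁ β₂ β₃ γ = modelCones β₁ β₃ β₂ γ := by
  ext b; simp only [modelCones, mem_insert_iff, mem_singleton_iff]; tauto

namespace GluingData

/-- Around points in a compact set away from all lines, small balls are nearly flat. -/
theorem exists_isConical_compact (H : 𝓖) {δ s t τ ν k : ℝ}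
    (hδ : 0 < δ) (hδ1 : δ ≤ 1 / 100) (hst : s < t) (ht : t ≤ 1)
    (hdef : ∀ x y, dist_ω t x y = 0 → x = y) (hτ : 0 < τ) (hν : 0 < ν) (hk : 0 < k)
    (hlow : ∀ x ∈ rhoBall β₁ γ t ∩ 𝓡, ∀ v, k * ‖v‖ ^ 2 ≤ ω x v) :
    ∃ h₀ : ℝ, 0 < h₀ ∧ ∀ p ∈ rhoBall β₁ γ s, τ ≤ ‖p.1‖ ^ β₁ → ν ≤ ‖p.2 / p.1 - a₂‖ →
      ν ≤ ‖p.2 / p.1 - a₃‖ → ∀ h : ℝ, 0 < h → h < h₀ →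
      conical t δ p h := by
  have hβ1 := H.pos₁
  have hρ := continuous_rho hβ1.le H.pos.le
  have hne : ∀ p : ℂ², τ ≤ ‖p.1‖ ^ β₁ → p.1 ≠ 0 := fun p hp h0 => by
    rw [h0, norm_zero, zero_rpow hβ1.ne'] at hp; linarith
  set Q : Set ℂ² := {p | rho β₁ γ p ≤ s} ∩ ({p | τ ≤ ‖p.1‖ ^ β₁} ∩
    ({p | ν * ‖p.1‖ ≤ ‖p.2 - a₂ * p.1‖} ∩ {p | ν * ‖p.1‖ ≤ ‖p.2 - a₃ * p.1‖})) with hQ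
  have hQS : Q ⊆ rhoBall β₁ γ t ∩ 𝓡 := by
    rintro p ⟨hp1, hp2, hp3, hp4⟩
    have h0 := hne p hp2
    have h1 : 0 < ν * ‖p.1‖ := mul_pos hν (norm_pos_iff.2 h0)
    exact ⟨lt_of_le_of_lt hp1 hst, h0, norm_sub_pos_iff.1 (h1.trans_le hp3),
      norm_sub_pos_iff.1 (h1.trans_le hp4)⟩
  have hQc : IsCompact Q := by
    refine Metric.isCompact_of_isClosed_isBounded ?_ (isBounded_iff_forall_norm_le.2
      ⟨1, fun p hp => ?_⟩)
    · refine (isClosed_le hρ continuous_const).inter ((isClosed_le continuous_const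
        (continuous_fst.norm.rpow_const fun _ => Or.inr hβ1.le)).inter
        ((isClosed_le ?_ ?_).inter (isClosed_le ?_ ?_))) <;> fun_prop
    · exact max_le_iff.2 (H.norm_le_one ht (hQS hp).1)
  obtain ⟨h₀, hh₀, main⟩ := H.exists_ghEDist_le_of_isCompact hδ hδ1
    (isOpen_lt hρ continuous_const) hQc hQS hdef hk fun x hx => hlow x (hQS hx)
  refine ⟨h₀, hh₀, fun p hp hr h₂ h3 h hh hh0 => ⟨(1, 1), by simp [modelCones],
    main p ⟨LT.lt.le (b := s) hp, hr, ?_, ?_⟩ h hh hh0⟩⟩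
  all_goals
    have := norm_pos_iff.2 (hne p hr)
    rw [mem_ofPred_eq, ← le_div_iff₀ this, ← norm_div, sub_div, mul_div_cancel_right₀ _ (hne p hr)]
    assumption

/-- Away from the lines `{w = a_j z}`, in a sector `|w| ≤ M1 |z|` and close to the origin, balls of
scale small compared with `|z|^γ` are nearly flat. -/
theorem exists_isConical_sector (H : 𝓖) {δ s t ν : ℝ} (hδ : 0 < δ)
    (hδ1 : δ ≤ 1 / 100) (hst : s < t) (ht : t ≤ 1) (hdef : ∀ x y, dist_ω t x y = 0 → x = y)
    (hν : 0 < ν) (M1 : ℝ) : ∃ M τ h₀ : ℝ, 1 ≤ M ∧ 0 < τ ∧ 0 < h₀ ∧ ∀ p ∈ rhoBall β₁ γ s,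
      p.1 ≠ 0 → ‖p.1‖ ^ β₁ < τ → ‖p.2 / p.1‖ ≤ M1 → ν ≤ ‖p.2 / p.1 - a₂‖ → ν ≤ ‖p.2 / p.1 - a₃‖ →
      ∀ h : ℝ, 0 < h → h < h₀ → M * h ≤ ‖p.1‖ ^ γ →
      conical t δ p h := by
  have hβ1 := H.pos₁
  have hγ := H.pos
  obtain ⟨M, h₀, hM, hh₀, reg⟩ := H.exists_isConical_regular hδ hδ1 hst ht hdef M1
  obtain ⟨τ, hτ, hcl⟩ := H.exists_fibre_close (2 * M1 + ‖a₂‖) (δ := δ / 4) (by positivity)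
  obtain ⟨g0, hg, hgd⟩ := H.toIsCentredPair.exists_le_flatDensity M1
  have hg0 := sqrt_pos.2 hg
  refine ⟨max M (M / (√g0 * ν)), τ / 2, h₀, hM.trans (le_max_left _ _), by positivity, hh₀,
    fun p hp hp0 hr hu h₂ h3 h hh hh0 hMh => ?_⟩
  have hp1 := (H.norm_le_one (hst.le.trans ht) hp).1
  have hne : ∀ a : ℂ, ν ≤ ‖p.2 / p.1 - a‖ → p.2 / p.1 ≠ a := fun a ha h0 => by
    rw [h0, sub_self, norm_zero] at ha; linarith
  have hd0 := Real.sqrt_le_sqrt (hgd _ hu (hne _ h₂) (hne _ h3))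
  have key : ∀ a : ℂ, ν ≤ ‖p.2 / p.1 - a‖ →
      M * h ≤ ‖p.1‖ ^ γ * (√(dens (p.2 / p.1)) * ‖p.2 / p.1 - a‖) := fun a ha => by
    have h1 : M / (√g0 * ν) * h ≤ ‖p.1‖ ^ γ :=
      (by gcongr; exact le_max_right _ _ : _ ≤ _ * h).trans hMh
    rw [div_mul_eq_mul_div, div_le_iff₀ (by positivity)] at h1
    exact h1.trans (by gcongr)
  refine reg p hp ⟨hp0, fun h0 => hne _ h₂ ((div_eq_iff hp0).2 h0), fun h0 => hne _ h3
    ((div_eq_iff hp0).2 h0)⟩ hu h 0 hh hh0 ?_ (by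
      rw [IsSubordinate, abs_zero, mul_zero, baseCoeff]; positivity) (key _ h₂) (key _ h3)
    fun x hx hx1 hx2 => hcl x hx.2 ?_ ?_
  · exact ((mul_le_mul_of_nonneg_right (le_max_left _ _) hh.le).trans hMh).trans
      (rpow_le_rpow_of_exponent_ge (norm_pos_iff.2 hp0) hp1 H.lt_γ.le)
  · linarith [rpow_le_two_mul hβ1.le (H.lt_γ.trans H.γ_lt_one).le hx1]
  · have t1 := norm_sub_norm_le (x.2 / x.1) (p.2 / p.1)
    have t2 := norm_sub_le (p.2 / p.1) a₂
    linarith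

/-- The metric is bounded below on a neighbourhood of the origin, in which balls are close to balls
in model cones once their scale is small and separated from the five characteristic scales
`r`, `R`, `|z|^γ` and `|z|^γ |w/z - a_j|^β_j` of their centre. -/
theorem exists_radius (H : 𝓖) : ∃ t0 k : ℝ, 0 < t0 ∧ 0 < k ∧
    (∀ x ∈ rhoBall β₁ γ t0 ∩ 𝓡, ∀ v, k * ‖v‖ ^ 2 ≤ ω x v) ∧
    ∀ t s δ : ℝ, s < t → t ≤ t0 → 0 < δ → δ ≤ 1 / 100 → ∃ M h₀ : ℝ, 1 ≤ M ∧ 0 < h₀ ∧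
      ∀ p ∈ rhoBall β₁ γ s, ∀ h : ℝ, 0 < h → h < h₀ →
      IsSeparated M h (‖p.1‖ ^ β₁) → IsSeparated M h (‖p.2‖ ^ γ) → IsSeparated M h (‖p.1‖ ^ γ) →
      IsSeparated M h (‖p.1‖ ^ γ * ‖p.2 / p.1 - a₂‖ ^ β₂) →
      IsSeparated M h (‖p.1‖ ^ γ * ‖p.2 / p.1 - a₃‖ ^ β₃) →
      conical t δ p h := by
  have hγ := H.pos
  have hβ1 := H.pos₁
  obtain ⟨τ1, k, hτ1, hk, low⟩ := H.exists_mul_sq_norm_le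
  obtain ⟨τ2, hτ2, near2⟩ := H.exists_fibre_close_near
  obtain ⟨τ3, hτ3, near3⟩ := H.symm.exists_fibre_close_near
  obtain ⟨τ4, hτ4, sub2⟩ := H.exists_isSubordinate (φ a₂)
  obtain ⟨τ5, hτ5, sub3⟩ := H.symm.exists_isSubordinate (flatPotential β₃ β₂ γ a₃ a₂ a₃)
  refine ⟨min 1 (min τ1 (min (min τ2 τ3) (min τ4 τ5))), k, by positivity, hk, ?_⟩
  have hsmall : ∀ {t : ℝ}, t ≤ min 1 (min τ1 (min (min τ2 τ3) (min τ4 τ5))) →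
      ∀ x ∈ rhoBall β₁ γ t, ‖x.1‖ ^ β₁ < τ1 ∧ ‖x.2‖ ^ γ ≤ 1 ∧ ‖x.1‖ ^ β₁ < τ2 ∧ ‖x.1‖ ^ β₁ < τ3 ∧
        ‖x.1‖ ^ β₁ < τ4 ∧ ‖x.1‖ ^ β₁ < τ5 := by
    intro t ht x hx
    simp only [le_min_iff] at ht
    have h1 := (fst_rpow_le_rho β₁ γ x).trans_lt hx
    have h2 := (snd_rpow_le_rho β₁ γ x).trans_lt hx
    refine ⟨?_, ?_, ?_, ?_, ?_, ?_⟩ <;> linarith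
  refine ⟨fun x hx => low x hx.2 (hsmall le_rfl x hx.1).1 (hsmall le_rfl x hx.1).2.1, ?_⟩
  intro t s δ hst ht hδ hδ1
  have ht1 : t ≤ 1 := ht.trans (min_le_left _ _)
  have hsm := hsmall ht
  have hlow : ∀ x ∈ rhoBall β₁ γ t ∩ 𝓡, ∀ v, k * ‖v‖ ^ 2 ≤ ω x v := fun x hx =>
    low x hx.2 (hsm x hx.1).1 (hsm x hx.1).2.1
  have hdef : ∀ x y, dist_ω t x y = 0 → x = y := fun x y hxy => by
    have := (enorm_sub_le_lengthDist (sqrt_pos.2 hk) (fun x hx v => by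
      rw [sq_sqrt hk.le]; exact hlow x hx v) x y).trans_eq hxy
    rw [nonpos_iff_eq_zero, mul_eq_zero, enorm_eq_zero, sub_eq_zero, ofReal_eq_zero] at this
    exact (this.resolve_left (not_le.2 (sqrt_pos.2 hk))).symm
  obtain ⟨ν2, M2, h₂, hν2, hM2, hh2, c2⟩ := H.exists_isConical_near hδ hδ1 hst ht1 hdef
    (fun δ hδ => (near2 δ hδ).imp fun ν hν => ⟨hν.1, fun x hx => hν.2 x hx.2 (hsm x hx.1).2.2.1⟩)
    fun p hp hp0 => sub2 p.1 hp0 (hsm p hp).2.2.2.2.1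
  obtain ⟨ν3, M3, h3, hν3, hM3, hh3, c3⟩ := H.symm.exists_isConical_near hδ hδ1 hst ht1
    (by rwa [← approxDist_comm]) (fun δ hδ => (near3 δ hδ).imp fun ν hν =>
      ⟨hν.1, fun x hx => hν.2 x hx.2 (hsm x hx.1).2.2.2.1⟩)
    fun p hp hp0 => sub3 p.1 hp0 (hsm p hp).2.2.2.2.2
  rw [← approxDist_comm, ← modelCones_comm] at c3
  obtain ⟨M4, L, τ, h4, hM4, hL, hτ, hh4, prod⟩ := H.exists_isConical_product hδ hδ1 hst ht1 hdef
  obtain ⟨M5, τ', h5, hM5, hτ', hh5, sector⟩ := H.exists_isConical_sector hδ hδ1 hst ht1 hdef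
    (lt_min hν2 hν3) L
  obtain ⟨h6, hh6, compact⟩ := H.exists_isConical_compact hδ hδ1 hst ht1 hdef
    (lt_min hτ hτ') (lt_min hν2 hν3) hk hlow
  set M := max (max M2 M3) (max M4 M5)
  have hM : M2 ≤ M ∧ M3 ≤ M ∧ M4 ≤ M ∧ M5 ≤ M := by simp [M]
  have hM1 : 1 ≤ M := hM2.trans hM.1
  refine ⟨M, min (min h₂ h3) (min (min h4 h5) (min h6 (min τ τ' ^ (γ / β₁) / M))), hM1,
    by positivity, fun p hp h hh hh0 s1 s2 s3 s4 s5 => ?_⟩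
  simp only [lt_min_iff] at hh0
  obtain ⟨⟨hh2, hh3⟩, ⟨hh4, hh5⟩, hh6, hh7⟩ := hh0
  have mono : ∀ {m y : ℝ}, m ≤ M → M * h ≤ y → m * h ≤ y := fun hm =>
    (mul_le_mul_of_nonneg_right hm hh.le).trans
  -- far from the origin the scale is small compared with `|z|^γ`
  have hbig : min τ τ' ≤ ‖p.1‖ ^ β₁ → M * h < ‖p.1‖ ^ γ := fun hr => by
    rw [lt_div_iff₀' (by positivity)] at hh7
    refine hh7.trans_le ((rpow_le_rpow (by positivity) hr (by positivity)).trans_eq ?_)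
    rw [← rpow_mul (norm_nonneg _), mul_div_cancel₀ _ hβ1.ne']
  have sep1 := s1.mono hM.2.2.1 hh.le (by positivity)
  have sep2 := s2.mono hM.2.2.1 hh.le (by positivity)
  rcases s3 with hs | hs
  · refine prod p hp (lt_of_not_ge fun hr => ?_) h hh hh4 sep1 sep2
      (Or.inl ((mul_le_mul_of_nonneg_right hM.2.2.1 (by positivity)).trans hs))
    linarith [hbig ((min_le_left _ _).trans hr), le_mul_of_one_le_left hh.le hM1,
      le_mul_of_one_le_left (by positivity : 0 ≤ ‖p.1‖ ^ γ) hM1]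
  have hp0 : p.1 ≠ 0 := fun h0 => by rw [h0, norm_zero, zero_rpow hγ.ne'] at hs; nlinarith
  rcases lt_or_ge ‖p.2 / p.1 - a₂‖ ν2 with hu2 | hu2
  · exact c2 p hp hp0 hu2 h hh hh2 (mono hM.1 hs) (s4.mono hM.1 hh.le (by positivity))
  rcases lt_or_ge ‖p.2 / p.1 - a₃‖ ν3 with hu3 | hu3
  · exact c3 p hp hp0 hu3 h hh hh3 (mono hM.2.1 hs) (s5.mono hM.2.1 hh.le (by positivity))
  have hu2' := (min_le_left ν2 ν3).trans hu2
  have hu3' := (min_le_right ν2 ν3).trans hu3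
  rcases lt_or_ge (‖p.1‖ ^ β₁) (min τ τ') with hr | hr
  · rw [lt_min_iff] at hr
    rcases le_or_gt (L * ‖p.1‖) ‖p.2‖ with hw | hw
    · exact prod p hp hr.1 h hh hh4 sep1 sep2 (Or.inr hw)
    · refine sector p hp hp0 hr.2 ?_ hu2' hu3' h hh hh5 (mono hM.2.2.2 hs)
      rw [norm_div, div_le_iff₀ (norm_pos_iff.2 hp0)]
      exact hw.le
  · exact compact p hp hr hu2' hu3' h hh hh6

end GluingData

/-- A geometric sequence of scales is separated from a given number except for boundedly many
members. -/
theorem exists_encard_not_isSeparated_le {lam M : ℝ} (h0 : 0 < lam) (h1 : lam < 1) (hM : 1 ≤ M) :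
    ∃ n : ℕ, ∀ c : ℝ, {k : ℕ | ¬IsSeparated M (lam ^ k) c}.encard ≤ n := by
  obtain ⟨n, hn⟩ := exists_pow_lt_of_lt_one (inv_pos.2 (by positivity : 0 < M ^ 2)) h1
  refine ⟨n, fun c => ?_⟩
  rcases Set.eq_empty_or_nonempty {k : ℕ | ¬IsSeparated M (lam ^ k) c} with he | hne
  · simp [he]
  have hm := Nat.sInf_mem hne
  set m := sInf {k : ℕ | ¬IsSeparated M (lam ^ k) c}
  have hsub : {k : ℕ | ¬IsSeparated M (lam ^ k) c} ⊆ (Finset.Ico m (m + n) : Finset ℕ) := by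
    intro k hk
    rw [Finset.coe_Ico, mem_Ico]
    have hmk := Nat.sInf_le hk
    refine ⟨hmk, lt_of_not_ge fun hcon => ?_⟩
    simp only [IsSeparated, mem_ofPred_eq, not_or, not_le] at hk hm
    have h3 : lam ^ k ≤ lam ^ m * (M ^ 2)⁻¹ := by
      rw [show k = m + n + (k - (m + n)) by omega, pow_add, pow_add]
      refine (mul_le_of_le_one_right (by positivity) (pow_le_one₀ h0.le h1.le)).trans ?_
      gcongr
    rw [← div_eq_mul_inv, le_div_iff₀ (by positivity)] at h3
    nlinarith [hk.2, hm.1]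
  refine (Set.encard_le_encard hsub).trans ?_
  rw [Set.encard_coe_eq_coe_finsetCard, Nat.card_Ico, Nat.add_sub_cancel_left]

end ConicalLines

theorem mainTheorem8
    (β₁ β₂ β₃ γ α₀ : ℝ) (a₂ a₃ : ℂ) (χ₁ : ℝ → ℝ)
    (hβ₁ : 0 < β₁) (hβ₁₂ : β₁ ≤ β₂) (hβ₂₃ : β₂ ≤ β₃) (hβ₃ : β₃ < 1)
    (hangle : (1 - β₂) + (1 - β₃) < 1 - β₁)
    (hγ : 1 - γ = (1 - β₂) + (1 - β₃))
    (ha : a₂ ≠ a₃) (hcentre : ((1 - β₂ : ℝ) : ℂ) * a₂ + ((1 - β₃ : ℝ) : ℂ) * a₃ = 0)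
    (hα₀ : 1 < α₀) (hα₀' : α₀ < γ / β₁)
    (hχ : ContDiff ℝ ∞ χ₁) (hχ01 : ∀ s, χ₁ s ∈ Set.Icc (0 : ℝ) 1)
    (hχ1 : ∀ s, 2 < s → χ₁ s = 1) (hχ0 : ∀ s, s < 1 → χ₁ s = 0) :
    ∃ t₀ : ℝ, 0 < t₀ ∧
      (∀ x ∈ ConicalLines.rhoBall β₁ γ t₀ ∩ ConicalLines.linesCompl a₂ a₃,
        ∀ v : ℂ × ℂ, v ≠ 0 →
          0 < ConicalLines.approxForm β₁ β₂ β₃ γ α₀ a₂ a₃ χ₁ x v) ∧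
      ∀ t s : ℝ, 0 < s → s < t → t ≤ t₀ →
        ∀ ε lam : ℝ, 0 < ε → 0 < lam → lam < 1 →
          ∃ N : ℕ, ∀ p ∈ ConicalLines.rhoBall β₁ γ s,
            {k : ℕ | ¬ ∃ b ∈ ConicalLines.modelCones β₁ β₂ β₃ γ,
              ConicalLines.ghEDist
                (ConicalLines.rescaledBallDist
                  (ConicalLines.approxDist β₁ β₂ β₃ γ α₀ a₂ a₃ χ₁ t) p (lam ^ k))
                (ConicalLines.rescaledBallDist (ConicalLines.coneDist b.1 b.2) 0 1)
                < ENNReal.ofReal ε}.encard ≤ N := by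
  have H : ConicalLines.GluingData β₁ β₂ β₃ γ α₀ a₂ a₃ χ₁ :=
    { pos₂ := by linarith, lt₂ := by linarith, pos₃ := by linarith, lt₃ := hβ₃
      pos := by linarith, lt := by linarith
      angle := hγ, ne := ha, centre := hcentre, pos₁ := hβ₁
      lt_γ := by linarith, one_lt := hα₀, mul_lt := (lt_div_iff₀' hβ₁).1 hα₀'
      smooth := contDiff_infty.1 hχ 2
      nonneg := fun s => (hχ01 s).1, le_one := fun s => (hχ01 s).2, eq_one := hχ1
      eq_zero := hχ0 }
  obtain ⟨t₀, k, ht₀, hk, hlow, main⟩ := H.exists_radius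
  refine ⟨t₀, ht₀, fun x hx v hv => ?_, fun t s _ hst ht ε lam hε h0 h1 => ?_⟩
  · exact lt_of_lt_of_le (by positivity) (hlow x hx v)
  obtain ⟨M, h₀, hM, hh₀, hcone⟩ := main t s (min (1 / 100) (ε / 41)) hst ht (by positivity)
    (min_le_left _ _)
  obtain ⟨n, hn⟩ := ConicalLines.exists_encard_not_isSeparated_le h0 h1 hM
  obtain ⟨m, hm⟩ := exists_pow_lt_of_lt_one hh₀ h1
  refine ⟨m + (n + (n + (n + (n + n)))), fun p hp => ?_⟩
  set S : ℝ → Set ℕ := fun c => {k | ¬ConicalLines.IsSeparated M (lam ^ k) c}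
  refine (Set.encard_le_encard (t := Iio m ∪ (S (‖p.1‖ ^ β₁) ∪ (S (‖p.2‖ ^ γ) ∪ (S (‖p.1‖ ^ γ) ∪
    (S (‖p.1‖ ^ γ * ‖p.2 / p.1 - a₂‖ ^ β₂) ∪ S (‖p.1‖ ^ γ * ‖p.2 / p.1 - a₃‖ ^ β₃))))))
    fun k hk => ?_).trans ?_
  · by_contra hcon
    simp only [mem_union, mem_Iio, S, mem_ofPred_eq, not_or, not_not, not_lt] at hcon
    obtain ⟨c0, c1, c2, c3, c4, c5⟩ := hcon
    obtain ⟨b, hb, hle⟩ := hcone p hp (lam ^ k) (by positivity)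
      ((pow_le_pow_of_le_one h0.le h1.le c0).trans_lt hm) c1 c2 c3 c4 c5
    refine hk ⟨b, hb, hle.trans_lt ((ENNReal.ofReal_lt_ofReal_iff hε).2 ?_)⟩
    linarith [min_le_right (1 / 100) (ε / 41)]
  push_cast
  refine (Set.encard_union_le _ _).trans (add_le_add ?_ ?_)
  · rw [← Finset.coe_Iio, Set.encard_coe_eq_coe_finsetCard, Nat.card_Iio]
  iterate 4 refine (Set.encard_union_le _ _).trans (add_le_add (hn _) ?_)
  exact hn _
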